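/- Let $\pi\colon X\to B$ be a proper holomorphic submersion of relative dimension $n$ between finite-dimensional complex manifolds, and let $K$ be a compact Lie group with Lie algebra $\mathfrak k$, acting smoothly and by biholomorphisms on $X$ and $B$ so that $\pi$ is $K$-equivariant. For $v\in\mathfrak k$ write $v$ also for the vector field $x\mapsto \frac{d}{dt}\big|_{t=0}\exp(tv)x$ on $X$. Let $\omega_X$ be a $K$-invariant relatively Kähler metric, that is, a closed real $K$-invariant $(1,1)$-form on $X$ whose restriction to every fibre of $\pi$ is positive, and let $\mu_X\colon X\to\mathfrak k^*$ be a moment map: a smooth $K$-equivariant map with $d\langle\mu_X,v\rangle=-\iota_v\omega_X$ for all $v\in\mathfrak k$. Let $\mathcal V=\ker(d\pi)\subset TX^{1,0}$ be the vertical holomorphic tangent bundle, $g_{\mathcal V}$ the Hermitian metric on $\mathcal V$ induced by $\omega_X$ (so $\omega_X=i\,g_{\alpha\bar\beta}\,dz^\alpha\wedge d\bar z^\beta$ on fibres), $D_{\mathcal V}$ its Chern connection and $R_{\mathcal V}$ the curvature. For a smooth real function $h$ on $X$ let $g_{\mathcal V}^{-1}\bar\partial_{\mathcal V}\partial_{\mathcal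 V}h$ be the endomorphism of $\mathcal V$ given in fibre coordinates by $g^{\alpha\bar\beta}\partial_{\bar\beta}\partial_\gamma h$, and let $\Delta_{\mathcal V}h$ be its trace. (1) $D_{\mathcal V}$ is $K$-invariant, and $\langle\sigma,v\rangle:=g_{\mathcal V}^{-1}i\bar\partial_{\mathcal V}\partial_{\mathcal V}\langle\mu_X,v\rangle$ defines a moment map for the $K$-action on $\mathcal V$: $\sigma$ is a smooth $K$-equivariant section of $\operatorname{End}\mathcal V\otimes\mathfrak k^*$, and for all $v\in\mathfrak k$ $$\iota_vR_{\mathcal V}=-D_{\operatorname{End}\mathcal V}\langle\sigma,v\rangle .$$ (2) Let $\rho$ be $\frac{i}{2\pi}$ times the curvature of the Hermitian metric induced by $g_{\mathcal V}$ on $-K_{X/B}=\Lambda^n\mathcal V$. Then $$v\mapsto \rho-\tfrac1{2\pi}\Delta_{\mathcal V}\langle\mu_X,v\rangle$$ is an equivariant differential form (a smooth $K$-equivariant polynomial map $\mathfrak k\to\Omega^*(X)$), it is equivariantly closed, i.e. annihilated by $(d_{\mathrm{eq}}\alpha)(v)=d(\alpha(v))+\iota_v(\alpha(v))$, and it represents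 $c_{1,\mathrm{eq}}(-K_{X/B})$. Here $c_{1,\mathrm{eq}}(L)$ of a $K$-equivariant line bundle $L$ is the class, modulo $d_{\mathrm{eq}}$ of equivariant forms, of the equivariant Chern–Weil form $v\mapsto\frac{i}{2\pi}(F_A+\langle\nu,v\rangle)$, where $A$ is a $K$-invariant connection on $L$ and $\nu$ is its moment map determined by the lifted action, $\langle\nu,v\rangle=A_v-L_v$, with $L_v$ the Lie derivative on sections of $L$. -/

import Mathlib

open scoped Manifold ContDiff Topology

noncomputable section

namespace EquivChernWeil

/-! ### Conventions

A complex manifold `X` is a charted space over a finite dimensional complex vector space `E` with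
holomorphic transition maps, `IsManifold 𝓘(ℂ, E) ω X`; the same charts make it a smooth real
manifold. In Mathlib, `TangentSpace I x` unfolds to `E` (through the preferred chart at `x`), for
the real structure `𝓘(ℝ, E)` as well as for the complex structure `𝓘(ℂ, E)`. Tangent vectors at `x`
are therefore written as elements of `E`, the almost complex structure is `u ↦ i • u`, and
`(T_x X, J)` is identified with `T_x X^{1,0}` by `u ↦ u^{1,0} = (u - i J u) / 2`, as usual. -/

/-- The smooth real manifold underlying a complex manifold. -/
instance isManifold_real {E X : Type*} [NormedAddCommGroup E] [NormedSpace ℂ E]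
    [TopologicalSpace X] [ChartedSpace E X] [h : IsManifold 𝓘(ℂ, E) ω X] :
    IsManifold 𝓘(ℝ, E) ∞ X := by
  refine isManifold_of_contDiffOn 𝓘(ℝ, E) ∞ X fun e e' he he' ↦ ?_
  have := (contDiffGroupoid ω 𝓘(ℂ, E)).compatible he he'
  rw [contDiffGroupoid, mem_groupoid_of_pregroupoid] at this
  exact (this.1.restrict_scalars ℝ).of_le le_top

/-! ### Differential forms on a real manifold -/

section Forms

variable {E X : Type*} [NormedAddCommGroup E] [NormedSpace ℂ E]
  [TopologicalSpace X] [ChartedSpace E X]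
  {G : Type*} [NormedAddCommGroup G] [NormedSpace ℝ G]

/-- The coordinate expression `(φ⁻¹)^* α` of a `k`-form `α` in the preferred chart `φ` at `x₀`. -/
def formInChart {k : ℕ} (α : X → E [⋀^Fin k]→L[ℝ] G) (x₀ : X) (y : E) : E [⋀^Fin k]→L[ℝ] G :=
  (α ((extChartAt 𝓘(ℝ, E) x₀).symm y)).compContinuousLinearMap
    (mfderiv 𝓘(ℝ, E) 𝓘(ℝ, E) (extChartAt 𝓘(ℝ, E) x₀).symm y : E →L[ℝ] E)

/-- Smoothness of a differential form: its coordinate expressions are smooth. -/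
def IsSmoothForm {k : ℕ} (α : X → E [⋀^Fin k]→L[ℝ] G) : Prop :=
  ∀ x₀ : X, ContDiffOn ℝ ∞ (formInChart α x₀) (extChartAt 𝓘(ℝ, E) x₀).target

/-- The exterior derivative, computed in the preferred chart at each point. -/
def dForm {k : ℕ} (α : X → E [⋀^Fin k]→L[ℝ] G) (x : X) : E [⋀^Fin (k + 1)]→L[ℝ] G :=
  (extDeriv (formInChart α x) (extChartAt 𝓘(ℝ, E) x x)).compContinuousLinearMap
    (mfderiv 𝓘(ℝ, E) 𝓘(ℝ, E) (extChartAt 𝓘(ℝ, E) x) x : E →L[ℝ] E)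

/-- The differential of a function. -/
def dFun (f : X → G) (x : X) : E →L[ℝ] G := mfderiv 𝓘(ℝ, E) 𝓘(ℝ, G) f x

/-- Smoothness of a real vector field on an open set. -/
def IsSmoothVF [IsManifold 𝓘(ℂ, E) ω X] (U : Set X) (Y : X → E) : Prop :=
  ContMDiffOn 𝓘(ℝ, E) 𝓘(ℝ, E).tangent ∞ (fun x ↦ (⟨x, Y x⟩ : TangentBundle 𝓘(ℝ, E) X)) U

/-- Holomorphy of a vector field (a section of the holomorphic tangent bundle) on an open set. -/
def IsHolomorphicVF [IsManifold 𝓘(ℂ, E) ω X] (U : Set X) (Y : X → E) : Prop :=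
  ContMDiffOn 𝓘(ℂ, E) 𝓘(ℂ, E).tangent ω (fun x ↦ (⟨x, Y x⟩ : TangentBundle 𝓘(ℂ, E) X)) U

/-- The Lie bracket of real vector fields. -/
def bracketVF (Y Z : X → E) (x : X) : E :=
  VectorField.mlieBracket 𝓘(ℝ, E) (M := X) Y Z x

end Forms

/-! ### Group actions, moment maps, equivariant differential forms -/

section Action

variable {E X : Type*} [NormedAddCommGroup E] [NormedSpace ℂ E]
  [TopologicalSpace X] [ChartedSpace E X]

/-- The Lie algebra of the Lie group `K`. -/
abbrev LieAlg (EK K : Type*) [NormedAddCommGroup EK] [NormedSpace ℝ EK]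
    [TopologicalSpace K] [ChartedSpace EK K] [Group K] : Type _ := GroupLieAlgebra 𝓘(ℝ, EK) K

variable {EK K : Type*} [NormedAddCommGroup EK] [NormedSpace ℝ EK]
  [TopologicalSpace K] [ChartedSpace EK K] [Group K]

/-- The adjoint action of `K` on its Lie algebra. -/
def Ad (k : K) (v : LieAlg EK K) : LieAlg EK K :=
  (mfderiv 𝓘(ℝ, EK) 𝓘(ℝ, EK) (fun g : K ↦ k * g * k⁻¹) 1 : EK →L[ℝ] EK) v

variable [MulAction K X]

/-- The differential `T_x X → T_{k x} X` of the action of `k`. -/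
def dAct (k : K) (x : X) : E →L[ℝ] E := mfderiv 𝓘(ℝ, E) 𝓘(ℝ, E) (fun y : X ↦ k • y) x

/-- The vector field on `X` generated by `v ∈ 𝔨`: `x ↦ d/dt (exp (t v) x)` at `t = 0`. -/
def fundVF (v : LieAlg EK K) (x : X) : E :=
  (mfderiv 𝓘(ℝ, EK) 𝓘(ℝ, E) (fun k : K ↦ k • x) 1 : EK →L[ℝ] E) v

/-- `μ : X → 𝔨^*` is a moment map for the action of `K` on `(X, omega)`. -/
structure IsMomentMap (omega : X → E [⋀^Fin 2]→L[ℝ] ℝ) (μ : X → LieAlg EK K →ₗ[ℝ] ℝ) : Prop where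
  smooth : ∀ v, ContMDiff 𝓘(ℝ, E) 𝓘(ℝ, ℝ) ∞ (fun x ↦ μ x v)
  equivariant : ∀ (k : K) (x : X) (v : LieAlg EK K), μ (k • x) (Ad k v) = μ x v
  moment : ∀ (v : LieAlg EK K) (x : X) (u : E),
    dFun (fun y ↦ μ y v) x u = - omega x ![fundVF v x, u]

/-- Differential forms of mixed degree on `X`: the component of degree `k` is a `k`-form. -/
abbrev MixedForm (E X : Type*) [NormedAddCommGroup E] [NormedSpace ℂ E] : Type _ :=
  ∀ k : ℕ, X → E [⋀^Fin k]→L[ℝ] ℂ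

/-- `α : 𝔨 → Ω^*(X)` is an equivariant differential form: a polynomial map into smooth
differential forms with `k^* (α (Ad_k v)) = α v`. -/
structure IsEquivariantForm (α : LieAlg EK K → MixedForm E X) : Prop where
  smooth : ∀ v j, IsSmoothForm (α v j)
  polynomial : ∃ (N : ℕ) (m : ∀ j : ℕ, MultilinearMap ℝ (fun _ : Fin j ↦ LieAlg EK K)
    (MixedForm E X)), ∀ v, α v = ∑ j ∈ Finset.range N, m j (fun _ ↦ v)
  equivariant : ∀ (k : K) (v : LieAlg EK K) (j : ℕ) (x : X),
    (α (Ad k v) j (k • x)).compContinuousLinearMap (dAct k x) = α v j x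

/-- The equivariant differential `(d_eq α)(v) = d (α v) + ι_v (α v)`. -/
def dEq (α : LieAlg EK K → MixedForm E X) (v : LieAlg EK K) : MixedForm E X
  | 0 => fun x ↦ (α v 1 x).curryLeft (fundVF v x)
  | j + 1 => fun x ↦ dForm (α v j) x + (α v (j + 2) x).curryLeft (fundVF v x)

/-- The map `v ↦ η + f_v` for a two-form `η` and functions `f_v`. -/
def twoFormPlus (η : X → E [⋀^Fin 2]→L[ℝ] ℂ) (f : LieAlg EK K → X → ℂ) (v : LieAlg EK K) :
    MixedForm E X
  | 0 => fun x ↦ ContinuousAlternatingMap.constOfIsEmpty ℝ E (Fin 0) (f v x)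
  | 2 => η
  | _ => 0

end Action

/-! ### Equivariant holomorphic vector bundles and connections

`BundleData` records fibres, smooth and holomorphic local sections, and the action of `K` on
sections by pullback. It is only ever used for the two bundles constructed below, the vertical
tangent bundle and its top exterior power. -/

/-- Fibres, smooth and holomorphic sections over open sets, and `pull k x : W_{k x} → W_x`, so that
`(k^* s)(x) = pull k x (s (k x))`. -/
structure BundleData (X K : Type*) [SMul K X] where
  /-- the fibres -/
  Fib : X → Type*
  /-- the fibres are complex vector spaces -/
  [acg : ∀ x, AddCommGroup (Fib x)]
  /-- the fibres are complex vector spaces -/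
  [mod : ∀ x, Module ℂ (Fib x)]
  /-- the section is smooth on the given open set -/
  IsSmooth : Set X → (∀ x, Fib x) → Prop
  /-- the section is holomorphic on the given open set -/
  IsHol : Set X → (∀ x, Fib x) → Prop
  /-- the action of `k⁻¹`, from the fibre at `k x` to the fibre at `x` -/
  pull : ∀ (k : K) (x : X), Fib (k • x) →ₗ[ℂ] Fib x

attribute [instance] BundleData.acg BundleData.mod

section Connections

variable {E X : Type*} [NormedAddCommGroup E] [NormedSpace ℂ E]
  [TopologicalSpace X] [ChartedSpace E X]
  {EK K : Type*} [NormedAddCommGroup EK] [NormedSpace ℝ EK]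
  [TopologicalSpace K] [ChartedSpace EK K] [Group K] [MulAction K X]

/-- Sections of `W`. -/
abbrev BundleData.Sec (W : BundleData X K) : Type _ := ∀ x, W.Fib x

variable (E) in
/-- Operators `D` taking a section `s` and a tangent vector `u` at `x` to `D_u s = D s x u`. -/
abbrev BundleData.Op (W : BundleData X K) : Type _ := W.Sec → ∀ x, E →ₗ[ℝ] W.Fib x

variable (W : BundleData X K)

/-- `D` is a (smooth complex linear) connection on `W`. As in Mathlib's `CovariantDerivative`, `D`
is applied to arbitrary sections, but the laws concern sections that are smooth near the point. -/
structure IsConnection [IsManifold 𝓘(ℂ, E) ω X] (D : W.Op E) : Prop where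
  add : ∀ (U : Set X) (s t : W.Sec), IsOpen U → W.IsSmooth U s → W.IsSmooth U t → ∀ x ∈ U,
    D (fun y ↦ s y + t y) x = D s x + D t x
  leibniz : ∀ (U : Set X) (f : X → ℂ) (s : W.Sec), IsOpen U →
    ContMDiffOn 𝓘(ℝ, E) 𝓘(ℝ, ℂ) ∞ f U → W.IsSmooth U s → ∀ x ∈ U, ∀ u : E,
    D (fun y ↦ f y • s y) x u = f x • D s x u + dFun f x u • s x
  smooth : ∀ (U : Set X) (s : W.Sec) (Y : X → E), IsOpen U → W.IsSmooth U s → IsSmoothVF U Y →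
    W.IsSmooth U (fun x ↦ D s x (Y x))

/-- `D` is the Chern connection of the Hermitian metric `h` on the holomorphic bundle `W`: the
connection with `D^{0,1} e = 0` for local holomorphic sections `e`, that is `D^{0,1} = ∂̄`, and
`d h(s, t) = h(D s, t) + h(s, D t)`. The metric is linear in its first argument. -/
structure IsChernConnection [IsManifold 𝓘(ℂ, E) ω X]
    (h : ∀ x, W.Fib x → W.Fib x → ℂ) (D : W.Op E) : Prop where
  isConnection : IsConnection W D
  holomorphic : ∀ (U : Set X) (e : W.Sec), IsOpen U → W.IsHol U e → ∀ x ∈ U, ∀ u : E,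
    D e x (Complex.I • u) = Complex.I • D e x u
  metric : ∀ (U : Set X) (s t : W.Sec), IsOpen U → W.IsSmooth U s → W.IsSmooth U t →
    ∀ x ∈ U, ∀ u : E,
    dFun (fun y ↦ h y (s y) (t y)) x u = h x (D s x u) (t x) + h x (s x) (D t x u)

open Classical in
/-- The Chern connection of `h`. -/
def chernConnection [IsManifold 𝓘(ℂ, E) ω X] (h : ∀ x, W.Fib x → W.Fib x → ℂ) : W.Op E :=
  if H : ∃ D : W.Op E, IsChernConnection W h D then H.choose else fun _ _ ↦ 0

/-- `D ∘ k^* = k^* ∘ D` for all `k ∈ K`. -/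
def IsInvariantConnection (D : W.Op E) : Prop :=
  ∀ (k : K) (U : Set X) (s : W.Sec), IsOpen U → W.IsSmooth U s → ∀ x, k • x ∈ U → ∀ u : E,
    D (fun y ↦ W.pull k y (s (k • y))) x u = W.pull k x (D s (k • x) (dAct k x u))

/-- The curvature `F_D(Y, Z) s = D_Y D_Z s - D_Z D_Y s - D_{[Y, Z]} s`. -/
def curvature (D : W.Op E) (Y Z : X → E) (s : W.Sec) : W.Sec := fun x ↦
  D (fun y ↦ D s y (Z y)) x (Y x) - D (fun y ↦ D s y (Y y)) x (Z x) - D s x (bracketVF Y Z x)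

/-- `σ`, with `⟨σ, v⟩ = σ v`, is a moment map for the action of `K` on `W` with respect to the
connection `D`: a smooth equivariant section of `End W ⊗ 𝔨^*` such that
`ι_v F_D = - D_{End W} ⟨σ, v⟩`. -/
structure IsBundleMomentMap [IsManifold 𝓘(ℂ, E) ω X] (D : W.Op E)
    (σ : LieAlg EK K → ∀ x, W.Fib x →ₗ[ℂ] W.Fib x) : Prop where
  linear : ∀ x, IsLinearMap ℝ (fun v ↦ σ v x)
  smooth : ∀ v (U : Set X) (s : W.Sec), IsOpen U → W.IsSmooth U s →
    W.IsSmooth U (fun x ↦ σ v x (s x))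
  equivariant : ∀ (k : K) (v : LieAlg EK K) (x : X) (w : W.Fib (k • x)),
    W.pull k x (σ (Ad k v) (k • x) w) = σ v x (W.pull k x w)
  moment : ∀ (v : LieAlg EK K) (U : Set X) (Y : X → E) (s : W.Sec), IsOpen U → IsSmoothVF U Y →
    W.IsSmooth U s → ∀ x ∈ U,
    curvature W D (fundVF v) Y s x
      = - (D (fun y ↦ σ v y (s y)) x (Y x) - σ v x (D s x (Y x)))

/-- For a line bundle `W`: the complex two-form `F` is the curvature of the connection `D`. -/
def IsCurvatureForm [IsManifold 𝓘(ℂ, E) ω X] (D : W.Op E) (F : X → E [⋀^Fin 2]→L[ℝ] ℂ) : Prop :=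
  ∀ (U : Set X) (Y Z : X → E) (s : W.Sec), IsOpen U → IsSmoothVF U Y → IsSmoothVF U Z →
    W.IsSmooth U s → ∀ x ∈ U, curvature W D Y Z s x = F x ![Y x, Z x] • s x

open Classical in
/-- The curvature two-form of a connection on a line bundle. -/
def curvatureForm [IsManifold 𝓘(ℂ, E) ω X] (D : W.Op E) : X → E [⋀^Fin 2]→L[ℝ] ℂ :=
  if H : ∃ F, IsCurvatureForm W D F then H.choose else 0

/-- For a line bundle `W`: the functions `ν v` are the moment `D_v - L_v` of the connection `D`,
where `L_v s = d/dt (exp (t v))^* s` at `t = 0` is the Lie derivative on sections that is defined by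
the lifted action (tested against linear functionals `ℓ` on the fibres). -/
def IsLiftedMoment (D : W.Op E) (ν : LieAlg EK K → X → ℂ) : Prop :=
  ∀ (v : LieAlg EK K) (U : Set X) (s : W.Sec), IsOpen U → W.IsSmooth U s → ∀ x ∈ U,
    ∀ ℓ : W.Fib x →ₗ[ℂ] ℂ,
    ℓ (ν v x • s x) = ℓ (D s x (fundVF v x))
      - (show EK →L[ℝ] ℂ from
          mfderiv 𝓘(ℝ, EK) 𝓘(ℝ, ℂ) (fun k : K ↦ ℓ (W.pull k x (s (k • x)))) 1) v

/-- The equivariantly closed form `α` represents the equivariant first Chern class of the line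
bundle `W`: up to an equivariantly exact form, it is the equivariant Chern-Weil form
`(i / 2π) (F_A + ⟨ν, v⟩)` of a `K`-invariant connection `A` on `W` and its moment map `ν`. -/
def RepresentsC1Eq [IsManifold 𝓘(ℂ, E) ω X] (α : LieAlg EK K → MixedForm E X) : Prop :=
  IsEquivariantForm α ∧ (∀ v, dEq α v = 0) ∧
  ∃ (A : W.Op E) (F : X → E [⋀^Fin 2]→L[ℝ] ℂ) (ν : LieAlg EK K → X → ℂ)
    (β : LieAlg EK K → MixedForm E X),
    IsConnection W A ∧ IsInvariantConnection W A ∧ IsCurvatureForm W A F ∧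
    IsBundleMomentMap W A (fun v x ↦ ν v x • LinearMap.id) ∧ IsLiftedMoment W A ν ∧
    IsEquivariantForm β ∧
    ∀ v, α v - twoFormPlus (fun x ↦ (Complex.I / (2 * Real.pi)) • F x)
      (fun v x ↦ Complex.I / (2 * Real.pi) * ν v x) v = dEq β v

end Connections

/-! ### Equivariant submersions, relatively Kähler metrics, the vertical tangent bundle -/

section Vertical

variable {E F X B : Type*} [NormedAddCommGroup E] [NormedSpace ℂ E]
  [NormedAddCommGroup F] [NormedSpace ℂ F]
  [TopologicalSpace X] [ChartedSpace E X]
  [TopologicalSpace B] [ChartedSpace F B]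

variable (E F) in
/-- The vertical tangent space `V_x = ker (dπ : T_x X → T_{π x} B)`. -/
def vert (π : X → B) (x : X) : Submodule ℂ E :=
  LinearMap.ker (mfderiv 𝓘(ℂ, E) 𝓘(ℂ, F) π x : E →L[ℂ] F).toLinearMap

variable (E F) in
/-- `π : X → B` is a `K`-equivariant proper holomorphic submersion, where `K` acts by
biholomorphisms on `X` and on `B`. -/
structure IsEquivariantSubmersion (K : Type*) [Group K] [MulAction K X] [MulAction K B]
    (π : X → B) : Prop where
  submersion : Manifold.IsSubmersion 𝓘(ℂ, E) 𝓘(ℂ, F) ω π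
  proper : IsProperMap π
  holomorphic_source : ∀ k : K, ContMDiff 𝓘(ℂ, E) 𝓘(ℂ, E) ω (fun x : X ↦ k • x)
  holomorphic_target : ∀ k : K, ContMDiff 𝓘(ℂ, F) 𝓘(ℂ, F) ω (fun b : B ↦ k • b)
  equivariant : ∀ (k : K) (x : X), π (k • x) = k • π x

/-- `omega` is a relatively Kähler metric: a smooth closed real `(1,1)`-form that is positive on
the fibres of `π`. -/
structure IsRelativelyKahler (π : X → B) (omega : X → E [⋀^Fin 2]→L[ℝ] ℝ) : Prop where
  smooth : IsSmoothForm omega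
  closed : dForm omega = 0
  type_one_one : ∀ (x : X) (u w : E), omega x ![Complex.I • u, Complex.I • w] = omega x ![u, w]
  pos : ∀ (x : X), ∀ u ∈ vert E F π x, u ≠ 0 → 0 < omega x ![u, Complex.I • u]

/-- `k^* omega = omega` for all `k ∈ K`. -/
def IsInvariantForm (K : Type*) [Group K] [MulAction K X]
    (omega : X → E [⋀^Fin 2]→L[ℝ] ℝ) : Prop :=
  ∀ (k : K) (x : X), (omega (k • x)).compContinuousLinearMap (dAct k x) = omega x

section Bundles

variable {K : Type*} [Group K] [MulAction K X] [MulAction K B] {π : X → B}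

/-- The differential of the action of `k⁻¹` maps `V_{k x}` to `V_x`. -/
theorem vert_pull_mem (hπ : IsEquivariantSubmersion E F K π) (k : K) (x : X) (w : E)
    (hw : w ∈ vert E F π (k • x)) :
    (mfderiv 𝓘(ℂ, E) 𝓘(ℂ, E) (fun y : X ↦ k⁻¹ • y) (k • x) : E →L[ℂ] E) w ∈ vert E F π x := by
  have hM : (ω : WithTop ℕ∞) ≠ 0 := by simp
  have dπ : MDifferentiable 𝓘(ℂ, E) 𝓘(ℂ, F) π := hπ.submersion.contMDiff.mdifferentiable hM
  have dX : MDifferentiable 𝓘(ℂ, E) 𝓘(ℂ, E) (fun y : X ↦ k⁻¹ • y) :=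
    (hπ.holomorphic_source k⁻¹).mdifferentiable hM
  have dB : MDifferentiable 𝓘(ℂ, F) 𝓘(ℂ, F) (fun b : B ↦ k⁻¹ • b) :=
    (hπ.holomorphic_target k⁻¹).mdifferentiable hM
  have hcomm : π ∘ (fun y : X ↦ k⁻¹ • y) = (fun b : B ↦ k⁻¹ • b) ∘ π :=
    funext fun y ↦ hπ.equivariant k⁻¹ y
  have h1 := mfderiv_comp (k • x) (dπ (k⁻¹ • k • x)) (dX (k • x))
  have h2 := mfderiv_comp (k • x) (dB (π (k • x))) (dπ (k • x))
  rw [hcomm, h2] at h1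
  have h3 := DFunLike.congr_fun h1 w
  have h4 : (mfderiv 𝓘(ℂ, E) 𝓘(ℂ, F) π (k • x) : E →L[ℂ] F) w = 0 := hw
  have key : (mfderiv 𝓘(ℂ, E) 𝓘(ℂ, E) (fun y : X ↦ k⁻¹ • y) (k • x) : E →L[ℂ] E) w
      ∈ vert E F π (k⁻¹ • k • x) := by
    refine h3.symm.trans ?_
    exact (congrArg (mfderiv 𝓘(ℂ, F) 𝓘(ℂ, F) (fun b : B ↦ k⁻¹ • b) (π (k • x))) h4).trans
      (map_zero _)
  rwa [inv_smul_smul] at key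

variable (hπ : IsEquivariantSubmersion E F K π)

/-- The pullback `V_{k x} → V_x`, the differential of the action of `k⁻¹`. -/
def vertPull (k : K) (x : X) : vert E F π (k • x) →ₗ[ℂ] vert E F π x :=
  (mfderiv 𝓘(ℂ, E) 𝓘(ℂ, E) (fun y : X ↦ k⁻¹ • y) (k • x) : E →L[ℂ] E).toLinearMap.restrict
    (vert_pull_mem hπ k x)

variable [IsManifold 𝓘(ℂ, E) ω X]

/-- The vertical holomorphic tangent bundle `V`, as a subbundle of the tangent bundle of `X`. -/
def vertBundle : BundleData X K where
  Fib x := vert E F π x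
  IsSmooth U s := IsSmoothVF U (fun x ↦ (s x : E))
  IsHol U s := IsHolomorphicVF U (fun x ↦ (s x : E))
  pull := vertPull hπ

/-- The relative anticanonical bundle `-K_{X/B} = Λ^n V`: its smooth (holomorphic) sections are
locally `f e₁ ∧ ⋯ ∧ eₙ` with `f` and the frame `e₁, …, eₙ` of `V` smooth (holomorphic). -/
def antiCanonical (n : ℕ) : BundleData X K where
  Fib x := ⋀[ℂ]^n (vert E F π x)
  IsSmooth U s := ∀ x ∈ U, ∃ (U' : Set X) (e : Fin n → ∀ y, vert E F π y) (f : X → ℂ),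
    IsOpen U' ∧ x ∈ U' ∧ (∀ i, (vertBundle hπ).IsSmooth U' (e i)) ∧
    (∀ y ∈ U', LinearIndependent ℂ (fun i ↦ e i y)) ∧
    ContMDiffOn 𝓘(ℝ, E) 𝓘(ℝ, ℂ) ∞ f U' ∧
    ∀ y ∈ U', s y = f y • exteriorPower.ιMulti ℂ n (fun i ↦ e i y)
  IsHol U s := ∀ x ∈ U, ∃ (U' : Set X) (e : Fin n → ∀ y, vert E F π y) (f : X → ℂ),
    IsOpen U' ∧ x ∈ U' ∧ (∀ i, (vertBundle hπ).IsHol U' (e i)) ∧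
    (∀ y ∈ U', LinearIndependent ℂ (fun i ↦ e i y)) ∧
    ContMDiffOn 𝓘(ℂ, E) 𝓘(ℂ, ℂ) ω f U' ∧
    ∀ y ∈ U', s y = f y • exteriorPower.ιMulti ℂ n (fun i ↦ e i y)
  pull k x := exteriorPower.map n (vertPull hπ k x)

end Bundles

/-! ### The Hermitian metrics, the vertical Hessian and Laplacian -/

/-- The value on `(a^{1,0}, b^{0,1})` of the complex bilinear extension of a real bilinear form
`q`, where `a^{1,0} = (a - i J a) / 2` and `b^{0,1} = (b + i J b) / 2`. -/
def oneOnePart (q : E → E → ℝ) (a b : E) : ℂ :=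
  ((q a b + q (Complex.I • a) (Complex.I • b) : ℝ)
    + Complex.I * (q a (Complex.I • b) - q (Complex.I • a) b : ℝ)) / 4

variable (F) in
/-- The Hermitian metric `g_V(a, b) = -i omega(a^{1,0}, b^{0,1})` on `V`. In local coordinates,
`omega = i g_{αβ̄} dz^α ∧ dz̄^β` on the fibres. -/
def vertMetric (π : X → B) (omega : X → E [⋀^Fin 2]→L[ℝ] ℝ) (x : X) (a b : vert E F π x) : ℂ :=
  -Complex.I * oneOnePart (fun u w ↦ omega x ![u, w]) (a : E) (b : E)

/-- The second derivatives `∂_a ∂_{b̄} h` of a real function `h`, in the holomorphic chart at `x`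
(on `V_x`, these are the second derivatives of the restriction of `h` to the fibre). -/
def leviForm (h : X → ℝ) (x : X) (a b : E) : ℂ :=
  oneOnePart (fun u w ↦
    fderiv ℝ (fderiv ℝ (h ∘ (extChartAt 𝓘(ℝ, E) x).symm)) (extChartAt 𝓘(ℝ, E) x x) u w) a b

open Classical in
variable (F) in
/-- The endomorphism `H = g_V⁻¹ ∂̄_V ∂_V h` of `V_x`, obtained from `∂̄_V ∂_V h` by raising the
`(0,1)`-part: `g_V(H a, b) = ∂_a ∂_{b̄} h`, in local coordinates `g^{αβ̄} ∂_{β̄} ∂_γ h`. -/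
def vertHessian (π : X → B) (omega : X → E [⋀^Fin 2]→L[ℝ] ℝ) (h : X → ℝ) (x : X) :
    vert E F π x →ₗ[ℂ] vert E F π x :=
  if H : ∃ T : vert E F π x →ₗ[ℂ] vert E F π x,
    ∀ a b, vertMetric F π omega x (T a) b = leviForm h x (a : E) (b : E) then H.choose else 0

variable (F) in
/-- The vertical Laplacian `Δ_V h`, the trace of `g_V⁻¹ ∂̄_V ∂_V h`. -/
def vertLaplacian (π : X → B) (omega : X → E [⋀^Fin 2]→L[ℝ] ℝ) (h : X → ℝ) (x : X) : ℂ :=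
  LinearMap.trace ℂ (vert E F π x) (vertHessian F π omega h x)

open Classical in
variable (F) in
/-- The Hermitian metric on `Λ^n V` induced by `g_V`: for a basis `b` of `V_x`,
`⟨c b₁ ∧ ⋯ ∧ bₙ, c' b₁ ∧ ⋯ ∧ bₙ⟩ = c c̄' det (g_V(b_i, b_j))`. -/
def detMetric [FiniteDimensional ℂ E] (n : ℕ) (π : X → B) (omega : X → E [⋀^Fin 2]→L[ℝ] ℝ) (x : X)
    (p q : ⋀[ℂ]^n (vert E F π x)) : ℂ :=
  if hn : Module.finrank ℂ (vert E F π x) = n then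
    let b := Module.finBasisOfFinrankEq ℂ (vert E F π x) hn
    let c : ⋀[ℂ]^n (vert E F π x) →ₗ[ℂ] ℂ := exteriorPower.alternatingMapLinearEquiv b.det
    c p * starRingEnd ℂ (c q) * (Matrix.of fun i j ↦ vertMetric F π omega x (b i) (b j)).det
  else 0

section Induced

variable [IsManifold 𝓘(ℂ, E) ω X] {K : Type*} [Group K] [MulAction K X] [MulAction K B] {π : X → B}
  (hπ : IsEquivariantSubmersion E F K π)

/-- The Chern connection `D_V` of the metric `g_V` on the vertical tangent bundle. -/
def vertConnection (omega : X → E [⋀^Fin 2]→L[ℝ] ℝ) : (vertBundle hπ).Op E :=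
  chernConnection (vertBundle hπ) (vertMetric F π omega)

/-- The Chern connection of the metric induced by `g_V` on `-K_{X/B} = Λ^n V`. -/
def antiCanonicalConnection [FiniteDimensional ℂ E] (n : ℕ) (omega : X → E [⋀^Fin 2]→L[ℝ] ℝ) :
    (antiCanonical hπ n).Op E :=
  chernConnection (antiCanonical hπ n) (detMetric F n π omega)

/-- The relative Ricci form `ρ`: `i / 2π` times the curvature of the metric on `-K_{X/B}`. -/
def relativeRicciForm [FiniteDimensional ℂ E] (n : ℕ) (omega : X → E [⋀^Fin 2]→L[ℝ] ℝ) (x : X) :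
    E [⋀^Fin 2]→L[ℝ] ℂ :=
  (Complex.I / (2 * Real.pi)) •
    curvatureForm (antiCanonical hπ n) (antiCanonicalConnection hπ n omega) x

end Induced

end Vertical

end EquivChernWeil

end

set_option linter.unusedSectionVars false

noncomputable section

namespace EquivChernWeil

/-! ### Vector fields and functions in charts -/

section ChartGeneric

variable {𝕜 E M : Type*} [NontriviallyNormedField 𝕜] [NormedAddCommGroup E] [NormedSpace 𝕜 E]
  [TopologicalSpace M] [ChartedSpace E M]

/-! Let h be the sesquilinear form -i omega(a^{1,0}, b^{0,1}) on all of TX (`kpair`). It may be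
degenerate, but it is definite on the vertical bundle V. The Chern connection of V is determined by
h(D_U s, t) = ∂_U h(s, t) + h(∂̄_U s, t) - h(s, ∂̄_U t) for vertical s, t, where ∂̄_U s = ([U, s] +
i [iU, s]) / 2. This right-hand side (`chernPairing`) uses only omega, derivatives of functions and
Lie brackets. Hence it is smooth, it is natural under biholomorphisms preserving omega
(`chernPairing_pullVF`), and it satisfies a Leibniz rule along holomorphic vector fields preserving
omega (`dFun_chernPairing`). In the chart at x it equals h(ds(U), t) + (∂_U g)(s, t)
(`chernPairing_self`), from which the laws of a connection can be read off. The operator so obtained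
is `vertD`; `chernConnection_unique` identifies it, on smooth sections, with the connection picked
by choice.

Moment map on V. Put σ_v s = D_v s - L_v s, where L_v s = [v, s] is the derivative of k ↦ k^* s at 1
(`exists_hasMFDerivAt_pullVF`). The derivative of s along v cancels and h(σ_v s, t) = h(dv(s), t) +
(∂_v g)(s, t) remains. Closedness of omega gives (∂_v g)(s, t) = (∂_s g)(v, t) (`hermDel_comm`), and
differentiating d⟨μ, v⟩ = -ι_v omega once more turns the sum into i ∂_s ∂̄_t ⟨μ, v⟩
(`IsHamiltonian.leviForm_eq`). So σ_v is i times the vertical Hessian (`vertMoment_apply`). Since v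
is holomorphic and preserves omega, L_v(D_Y s) = D_{[v, Y]} s + D_Y(L_v s) (`vertLie_vertD`).
Substituting D_v = L_v + σ_v into the curvature then leaves ι_v R = -Dσ_v
(`vertD_curvature_moment`).

Line bundle. In a frame with connection matrix θ, the formula D(f e₁ ∧ ⋯ ∧ eₙ) = (df + f tr θ) e₁ ∧
⋯ ∧ eₙ is the Chern connection of the determinant metric, by Jacobi's formula
(`isChernConnection_wedgeD`), and its curvature is d tr θ. Taking traces of the identity on V gives
ι_v F = -d tr σ_v (`connCurv_fundVF`). On Λ^n V, D_v - L_v is multiplication by tr σ_v, because the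
derivative of det at the identity is the trace. Finally tr σ_v = i Δ_V⟨μ, v⟩, so the form of the
theorem is exactly (i/2π)(F + tr σ_v): it is the Chern–Weil form of an invariant connection, with no
exact correction. -/

variable (𝕜) in
/-- The differential at `x` of the preferred chart at `x₀`. -/
def chartD (x₀ x : M) : E →L[𝕜] E := mfderiv 𝓘(𝕜, E) 𝓘(𝕜, E) (extChartAt 𝓘(𝕜, E) x₀) x

variable (𝕜) in
/-- The differential at `y` of the inverse of the preferred chart at `x₀`. -/
def symmD (x₀ : M) (y : E) : E →L[𝕜] E :=
  mfderiv 𝓘(𝕜, E) 𝓘(𝕜, E) (extChartAt 𝓘(𝕜, E) x₀).symm y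

variable (𝕜) in
/-- The coordinate expression of a vector field in the preferred chart at `x₀`. -/
def chartVF (x₀ : M) (Y : M → E) (y : E) : E :=
  chartD 𝕜 x₀ ((extChartAt 𝓘(𝕜, E) x₀).symm y) (Y ((extChartAt 𝓘(𝕜, E) x₀).symm y))

/-- Tangent vectors at `x` are by convention written in the preferred chart at `x`. Pointwise
identities are therefore proved in that chart, where no change of coordinates appears. -/
theorem chartD_self [IsManifold 𝓘(𝕜, E) 1 M] (x : M) :
    chartD 𝕜 x x = ContinuousLinearMap.id 𝕜 E :=
  mfderiv_extChartAt_self (I := 𝓘(𝕜, E))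

theorem contMDiffAt_chart_iff {n : ℕ∞ω} [IsManifold 𝓘(𝕜, E) n M] {G : Type*} [NormedAddCommGroup G] [NormedSpace 𝕜 G]
    {f : M → G} {x₀ x : M} (hx : x ∈ (extChartAt 𝓘(𝕜, E) x₀).source) :
    ContMDiffAt 𝓘(𝕜, E) 𝓘(𝕜, G) n f x ↔
      ContDiffAt 𝕜 n (f ∘ (extChartAt 𝓘(𝕜, E) x₀).symm) (extChartAt 𝓘(𝕜, E) x₀ x) := by
  have := contMDiffAt_iff_source_of_mem_source (I := 𝓘(𝕜, E)) (I' := 𝓘(𝕜, G)) (n := n) (f := f)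
    (x := x₀) (x' := x) (by simpa using hx)
  rw [this]
  simp [contMDiffWithinAt_iff_contDiffWithinAt, contDiffWithinAt_univ]

/-- The trivialization of the tangent bundle at `x₀` acts on fibres by the differential of the
chart, so the fibre component of a vector field is its coordinate expression. -/
theorem contMDiffAt_vf_chart_iff {n : ℕ∞ω} [IsManifold 𝓘(𝕜, E) (n + 1) M] [IsManifold 𝓘(𝕜, E) 1 M]
    [IsManifold 𝓘(𝕜, E) n M]
    {Y : M → E} {x₀ x : M} (hx : x ∈ (extChartAt 𝓘(𝕜, E) x₀).source) :
    ContMDiffAt 𝓘(𝕜, E) 𝓘(𝕜, E).tangent n (fun x ↦ (⟨x, Y x⟩ : TangentBundle 𝓘(𝕜, E) M)) x ↔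
      ContDiffAt 𝕜 n (chartVF 𝕜 x₀ Y) (extChartAt 𝓘(𝕜, E) x₀ x) := by
  have hs : x ∈ (chartAt E x₀).source := by simpa using hx
  have : ContMDiffVectorBundle n E (TangentSpace 𝓘(𝕜, E) : M → Type _) 𝓘(𝕜, E) :=
    TangentBundle.contMDiffVectorBundle
  have h1 := Bundle.Trivialization.contMDiffAt_section_iff
    (E := fun x : M ↦ TangentSpace 𝓘(𝕜, E) x)
    (e := trivializationAt E (fun x : M ↦ TangentSpace 𝓘(𝕜, E) x) x₀)
    (IB := 𝓘(𝕜, E)) (n := n) (s := Y) (x₀ := x) (by simpa using hs)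
  have h2 : (fun x ↦ ((trivializationAt E (fun x : M ↦ TangentSpace 𝓘(𝕜, E) x) x₀)
      (⟨x, Y x⟩ : TangentBundle 𝓘(𝕜, E) M)).2) =ᶠ[𝓝 x] (fun x ↦ chartD 𝕜 x₀ x (Y x)) := by
    filter_upwards [(chartAt E x₀).open_source.mem_nhds hs] with z hz
    have := TangentBundle.continuousLinearMapAt_trivializationAt (I := 𝓘(𝕜, E)) hz
    rw [chartD, ← this]
    exact (Bundle.Trivialization.continuousLinearMapAt_apply_of_mem 𝕜 _ (by simpa using hz) _).symm
  refine h1.trans ?_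
  rw [h2.contMDiffAt_iff, contMDiffAt_chart_iff hx]
  rfl

theorem chartD_bijective [IsManifold 𝓘(𝕜, E) 1 M] {x₀ x : M}
    (hx : x ∈ (extChartAt 𝓘(𝕜, E) x₀).source) :
    Function.Bijective (chartD (E := E) 𝕜 x₀ x) :=
  ContinuousLinearMap.IsInvertible.bijective (f := chartD 𝕜 x₀ x)
    (isInvertible_mfderiv_extChartAt (I := 𝓘(𝕜, E)) (H := E) (M := M) hx)

/-- Chain rule for f = (f ∘ φ⁻¹) ∘ φ near `x`. -/
theorem mfderiv_eq_fderiv_comp_chartD [IsManifold 𝓘(𝕜, E) 1 M] {G : Type*} [NormedAddCommGroup G]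
    [NormedSpace 𝕜 G] {f : M → G} {x₀ x : M} (hx : x ∈ (extChartAt 𝓘(𝕜, E) x₀).source)
    (hf : MDifferentiableAt 𝓘(𝕜, E) 𝓘(𝕜, G) f x) :
    (mfderiv 𝓘(𝕜, E) 𝓘(𝕜, G) f x : E →L[𝕜] G) =
      (fderiv 𝕜 (f ∘ (extChartAt 𝓘(𝕜, E) x₀).symm) (extChartAt 𝓘(𝕜, E) x₀ x)).comp
        (chartD 𝕜 x₀ x) := by
  have h1 : MDifferentiableAt 𝓘(𝕜, E) 𝓘(𝕜, E) (extChartAt 𝓘(𝕜, E) x₀) x :=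
    mdifferentiableAt_extChartAt (by simpa using hx)
  have h2 : MDifferentiableAt 𝓘(𝕜, E) 𝓘(𝕜, E) (extChartAt 𝓘(𝕜, E) x₀).symm
      (extChartAt 𝓘(𝕜, E) x₀ x) := by
    have := mdifferentiableWithinAt_extChartAt_symm (I := 𝓘(𝕜, E)) (x := x₀)
      ((extChartAt 𝓘(𝕜, E) x₀).map_source hx)
    rwa [ModelWithCorners.range_eq_univ, mdifferentiableWithinAt_univ] at this
  have h3 : f =ᶠ[𝓝 x] (f ∘ (extChartAt 𝓘(𝕜, E) x₀).symm) ∘ extChartAt 𝓘(𝕜, E) x₀ := by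
    filter_upwards [extChartAt_source_mem_nhds' (I := 𝓘(𝕜, E)) hx] with z hz
    exact (congrArg f ((extChartAt 𝓘(𝕜, E) x₀).left_inv hz)).symm
  have h4 : MDifferentiableAt 𝓘(𝕜, E) 𝓘(𝕜, G) (f ∘ (extChartAt 𝓘(𝕜, E) x₀).symm)
      (extChartAt 𝓘(𝕜, E) x₀ x) :=
    MDifferentiableAt.comp_of_eq (hg := hf) (hf := h2) (hy := (extChartAt 𝓘(𝕜, E) x₀).left_inv hx)
  rw [h3.mfderiv_eq, mfderiv_comp x h4 h1, mfderiv_eq_fderiv]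
  rfl

/-- Pullback of vector fields is defined with `inverse` of a derivative; this identifies pullback by
an inverse chart with the coordinate expression. -/
theorem chartD_eq_inverse [IsManifold 𝓘(𝕜, E) 1 M] {x₀ : M} {y : E}
    (hy : y ∈ (extChartAt 𝓘(𝕜, E) x₀).target) :
    (symmD (E := E) 𝕜 x₀ y).inverse =
      chartD (E := E) 𝕜 x₀ ((extChartAt 𝓘(𝕜, E) x₀).symm y) := by
  have h1 := mfderivWithin_extChartAt_symm_comp_mfderiv_extChartAt (I := 𝓘(𝕜, E)) hy
  have h2 := mfderiv_extChartAt_comp_mfderivWithin_extChartAt_symm (I := 𝓘(𝕜, E)) hy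
  rw [ModelWithCorners.range_eq_univ, mfderivWithin_univ] at h1 h2
  exact ContinuousLinearMap.inverse_eq h1 h2

theorem chartD_symmD [IsManifold 𝓘(𝕜, E) 1 M] {x₀ : M} {y : E}
    (hy : y ∈ (extChartAt 𝓘(𝕜, E) x₀).target) (u : E) :
    chartD (E := E) 𝕜 x₀ ((extChartAt 𝓘(𝕜, E) x₀).symm y)
      (symmD (E := E) 𝕜 x₀ y u) = u := by
  have h2 := mfderiv_extChartAt_comp_mfderivWithin_extChartAt_symm (I := 𝓘(𝕜, E)) hy
  rw [ModelWithCorners.range_eq_univ, mfderivWithin_univ] at h2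
  exact DFunLike.congr_fun h2 u

theorem symmD_chartD [IsManifold 𝓘(𝕜, E) 1 M] {x₀ x : M}
    (hx : x ∈ (extChartAt 𝓘(𝕜, E) x₀).source) (u : E) :
    symmD (E := E) 𝕜 x₀ (extChartAt 𝓘(𝕜, E) x₀ x)
      (chartD (E := E) 𝕜 x₀ x u) = u := by
  have h2 := mfderivWithin_extChartAt_symm_comp_mfderiv_extChartAt' (I := 𝓘(𝕜, E)) hx
  rw [ModelWithCorners.range_eq_univ, mfderivWithin_univ] at h2
  exact DFunLike.congr_fun h2 u

theorem chartVF_chart {x₀ x : M} (hx : x ∈ (extChartAt 𝓘(𝕜, E) x₀).source) (Y : M → E) :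
    chartVF 𝕜 x₀ Y (extChartAt 𝓘(𝕜, E) x₀ x) = chartD 𝕜 x₀ x (Y x) := by
  rw [chartVF, (extChartAt 𝓘(𝕜, E) x₀).left_inv hx]

theorem chartVF_self [IsManifold 𝓘(𝕜, E) 1 M] (x : M) (Y : M → E) :
    chartVF 𝕜 x Y (extChartAt 𝓘(𝕜, E) x x) = Y x := by
  rw [chartVF_chart (mem_extChartAt_source x), chartD_self]; rfl

end ChartGeneric

/-! ### Comparison of complex and real differentials -/

section RestrictScalars

variable {E F X B : Type*} [NormedAddCommGroup E] [NormedSpace ℂ E]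
  [NormedAddCommGroup F] [NormedSpace ℂ F]
  [TopologicalSpace X] [ChartedSpace E X] [TopologicalSpace B] [ChartedSpace F B]

theorem hasMFDerivAt_restrictScalars {f : X → B} {x : X} {f' : E →L[ℂ] F}
    (h : HasMFDerivAt 𝓘(ℂ, E) 𝓘(ℂ, F) f x f') :
    HasMFDerivAt 𝓘(ℝ, E) 𝓘(ℝ, F) f x (f'.restrictScalars ℝ) :=
  ⟨h.1, h.2.restrictScalars ℝ⟩

theorem mfderiv_restrictScalars {f : X → B} {x : X}
    (h : MDifferentiableAt 𝓘(ℂ, E) 𝓘(ℂ, F) f x) :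
    (mfderiv 𝓘(ℝ, E) 𝓘(ℝ, F) f x : E →L[ℝ] F) =
      (mfderiv 𝓘(ℂ, E) 𝓘(ℂ, F) f x : E →L[ℂ] F).restrictScalars ℝ :=
  (hasMFDerivAt_restrictScalars h.hasMFDerivAt).mfderiv

theorem contMDiffAt_restrictScalars {f : X → B} {x : X}
    (h : ContMDiffAt 𝓘(ℂ, E) 𝓘(ℂ, F) ω f x) : ContMDiffAt 𝓘(ℝ, E) 𝓘(ℝ, F) ∞ f x := by
  rw [contMDiffAt_iff] at h ⊢
  exact ⟨h.1, (h.2.restrict_scalars ℝ).of_le le_top⟩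

theorem chartD_restrictScalars [IsManifold 𝓘(ℂ, E) ω X] {x₀ x : X}
    (hx : x ∈ (extChartAt 𝓘(ℝ, E) x₀).source) :
    chartD (E := E) ℝ x₀ x = (chartD (E := E) ℂ x₀ x).restrictScalars ℝ :=
  mfderiv_restrictScalars (f := extChartAt 𝓘(ℂ, E) x₀)
    (mdifferentiableAt_extChartAt (H := E) (M := X) (by simpa using hx))

/-- Transition maps are holomorphic, so multiplication by i in the model space is an almost complex
structure independent of the chart. -/
theorem chartD_I_smul [IsManifold 𝓘(ℂ, E) ω X] {x₀ x : X}
    (hx : x ∈ (extChartAt 𝓘(ℝ, E) x₀).source) (c : ℂ) (u : E) :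
    chartD ℝ x₀ x (c • u) = c • chartD ℝ x₀ x u := by
  simp [chartD_restrictScalars hx]

end RestrictScalars

/-! ### Smooth real vector fields and their brackets -/

section RealVF

variable {E X : Type*} [NormedAddCommGroup E] [NormedSpace ℂ E]
  [TopologicalSpace X] [ChartedSpace E X] [IsManifold 𝓘(ℂ, E) ω X]
  {G : Type*} [NormedAddCommGroup G] [NormedSpace ℝ G]

/-- Smoothness of a real vector field at a point. -/
def VFSmoothAt (Y : X → E) (x : X) : Prop :=
  ContMDiffAt 𝓘(ℝ, E) 𝓘(ℝ, E).tangent ∞ (fun x ↦ (⟨x, Y x⟩ : TangentBundle 𝓘(ℝ, E) X)) x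

theorem isSmoothVF_iff {U : Set X} (hU : IsOpen U) {Y : X → E} :
    IsSmoothVF U Y ↔ ∀ x ∈ U, VFSmoothAt Y x :=
  ⟨fun h x hx ↦ (h x hx).contMDiffAt (hU.mem_nhds hx), fun h x hx ↦ (h x hx).contMDiffWithinAt⟩

theorem vfSmoothAt_iff {Y : X → E} {x₀ x : X} (hx : x ∈ (extChartAt 𝓘(ℝ, E) x₀).source) :
    VFSmoothAt Y x ↔ ContDiffAt ℝ ∞ (chartVF ℝ x₀ Y) (extChartAt 𝓘(ℝ, E) x₀ x) := by
  have : IsManifold 𝓘(ℝ, E) (∞ + 1) X := isManifold_real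
  exact contMDiffAt_vf_chart_iff hx

theorem VFSmoothAt.congr {Y Z : X → E} {x : X} (h : VFSmoothAt Y x) (h' : Z =ᶠ[𝓝 x] Y) :
    VFSmoothAt Z x :=
  ContMDiffAt.congr_of_eventuallyEq h (h'.mono fun y hy ↦ by simp [hy])

-- Moves a statement valid near `x` into coordinates, together with membership in the chart target.
-- It is often used with the trivial predicate, only for that membership.
omit [IsManifold 𝓘(ℂ, E) ω X] in
theorem eventually_chart_symm {x₀ x : X} (hx : x ∈ (extChartAt 𝓘(ℝ, E) x₀).source) {p : X → Prop}
    (h : ∀ᶠ z in 𝓝 x, p z) :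
    ∀ᶠ y in 𝓝 (extChartAt 𝓘(ℝ, E) x₀ x), y ∈ (extChartAt 𝓘(ℝ, E) x₀).target ∧
      p ((extChartAt 𝓘(ℝ, E) x₀).symm y) := by
  have h1 := (continuousAt_extChartAt_symm' (I := 𝓘(ℝ, E)) hx)
  have h2 := h1.eventually (p := p) (by rwa [(extChartAt 𝓘(ℝ, E) x₀).left_inv hx])
  have h3 := (isOpen_extChartAt_target (I := 𝓘(ℝ, E)) x₀).mem_nhds
    ((extChartAt 𝓘(ℝ, E) x₀).map_source hx)
  filter_upwards [h2, h3] with y a b using ⟨b, a⟩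

theorem VFSmoothAt.smul {f : X → ℂ} {Y : X → E} {x : X}
    (hf : ContMDiffAt 𝓘(ℝ, E) 𝓘(ℝ, ℂ) ∞ f x) (hY : VFSmoothAt Y x) :
    VFSmoothAt (fun y ↦ f y • Y y) x := by
  have hx := mem_extChartAt_source (I := 𝓘(ℝ, E)) x
  rw [vfSmoothAt_iff hx] at hY ⊢
  rw [contMDiffAt_chart_iff hx] at hf
  refine (hf.smul hY).congr_of_eventuallyEq ?_
  filter_upwards [eventually_chart_symm hx (p := fun _ ↦ True) (by simp)] with y hy
  exact chartD_I_smul ((extChartAt 𝓘(ℝ, E) x).map_target hy.1) _ _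

theorem VFSmoothAt.const_smul {Y : X → E} {x : X} (c : ℂ) (hY : VFSmoothAt Y x) :
    VFSmoothAt (fun y ↦ c • Y y) x := hY.smul (f := fun _ ↦ c) contMDiffAt_const

theorem VFSmoothAt.add {Y Z : X → E} {x : X} (hY : VFSmoothAt Y x) (hZ : VFSmoothAt Z x) :
    VFSmoothAt (fun y ↦ Y y + Z y) x := by
  have hx := mem_extChartAt_source (I := 𝓘(ℝ, E)) x
  rw [vfSmoothAt_iff hx] at hY hZ ⊢
  refine (hY.add hZ).congr_of_eventuallyEq (Filter.Eventually.of_forall fun y ↦ ?_)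
  simp [chartVF]

theorem VFSmoothAt.sub {Y Z : X → E} {x : X} (hY : VFSmoothAt Y x) (hZ : VFSmoothAt Z x) :
    VFSmoothAt (fun y ↦ Y y - Z y) x := by
  simpa [sub_eq_add_neg] using hY.add (hZ.const_smul (-1))

theorem VFSmoothAt.sum {ι : Type*} (s : Finset ι) {Y : ι → X → E} {x : X}
    (hY : ∀ i ∈ s, VFSmoothAt (Y i) x) : VFSmoothAt (fun y ↦ ∑ i ∈ s, Y i y) x := by
  have hx := mem_extChartAt_source (I := 𝓘(ℝ, E)) x
  simp only [vfSmoothAt_iff hx] at hY ⊢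
  refine (ContDiffAt.sum hY).congr_of_eventuallyEq (Filter.Eventually.of_forall fun y ↦ ?_)
  simp [chartVF]


theorem VFSmoothAt.mdifferentiableAt {Y : X → E} {x : X} (hY : VFSmoothAt Y x) :
    MDifferentiableAt 𝓘(ℝ, E) 𝓘(ℝ, E).tangent
      (fun x ↦ (⟨x, Y x⟩ : TangentBundle 𝓘(ℝ, E) X)) x :=
  ContMDiffAt.mdifferentiableAt hY (by simp)

theorem dFun_eq_fderiv {f : X → G} {x₀ x : X} (hx : x ∈ (extChartAt 𝓘(ℝ, E) x₀).source)
    (hf : ContMDiffAt 𝓘(ℝ, E) 𝓘(ℝ, G) ∞ f x) (u : E) :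
    dFun f x u = fderiv ℝ (f ∘ (extChartAt 𝓘(ℝ, E) x₀).symm) (extChartAt 𝓘(ℝ, E) x₀ x)
      (chartD ℝ x₀ x u) :=
  DFunLike.congr_fun (mfderiv_eq_fderiv_comp_chartD hx (hf.mdifferentiableAt (by simp))) u

variable [CompleteSpace E]

/-- Over ℝ `minSmoothness` is the given order, so the smooth structure provides the regularity
demanded by the bracket lemmas. -/
instance isManifold_minSmoothness_two : IsManifold 𝓘(ℝ, E) (minSmoothness ℝ 2) X :=
  IsManifold.of_le (n := ∞) (by simpa using ENat.LEInfty.out)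

instance isManifold_minSmoothness_three : IsManifold 𝓘(ℝ, E) (minSmoothness ℝ 3) X :=
  IsManifold.of_le (n := ∞) (by simpa using ENat.LEInfty.out)

theorem VFSmoothAt.bracket {Y Z : X → E} {x : X} (hY : VFSmoothAt Y x) (hZ : VFSmoothAt Z x) :
    VFSmoothAt (bracketVF Y Z) x := by
  have : IsManifold 𝓘(ℝ, E) ((⊤ : ℕ∞) + 1) X := isManifold_real
  exact ContMDiffAt.mlieBracket_vectorField (m := ⊤) (n := ⊤) hY hZ (by simp)

/-- Brackets are natural under pullback by the inverse chart, and on the model space the manifold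
bracket is the ordinary one. -/
theorem chartD_bracketVF {Y Z : X → E} {x₀ x : X} (hx : x ∈ (extChartAt 𝓘(ℝ, E) x₀).source)
    (hY : VFSmoothAt Y x) (hZ : VFSmoothAt Z x) :
    chartD ℝ x₀ x (bracketVF Y Z x) =
      VectorField.lieBracket ℝ (chartVF ℝ x₀ Y) (chartVF ℝ x₀ Z) (extChartAt 𝓘(ℝ, E) x₀ x) := by
  have hy := (extChartAt 𝓘(ℝ, E) x₀).map_source hx
  have hl := (extChartAt 𝓘(ℝ, E) x₀).left_inv hx
  have hs : ContMDiffAt 𝓘(ℝ, E) 𝓘(ℝ, E) ∞ (extChartAt 𝓘(ℝ, E) x₀).symm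
      (extChartAt 𝓘(ℝ, E) x₀ x) :=
    (contMDiffOn_extChartAt_symm x₀).contMDiffAt
      ((isOpen_extChartAt_target (I := 𝓘(ℝ, E)) x₀).mem_nhds hy)
  have h := VectorField.mpullback_mlieBracket (I := 𝓘(ℝ, E)) (I' := 𝓘(ℝ, E)) (V := Y) (W := Z)
    (x₀ := extChartAt 𝓘(ℝ, E) x₀ x) (f := (extChartAt 𝓘(ℝ, E) x₀).symm)
    (by rw [hl]; exact hY.mdifferentiableAt) (by rw [hl]; exact hZ.mdifferentiableAt) hs
    (by simpa using ENat.LEInfty.out)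
  have key : ∀ W : X → E, VectorField.mpullback 𝓘(ℝ, E) 𝓘(ℝ, E) (extChartAt 𝓘(ℝ, E) x₀).symm W
      =ᶠ[𝓝 (extChartAt 𝓘(ℝ, E) x₀ x)] chartVF ℝ x₀ W := by
    intro W
    filter_upwards [(isOpen_extChartAt_target (I := 𝓘(ℝ, E)) x₀).mem_nhds hy] with y hy
    exact DFunLike.congr_fun (chartD_eq_inverse hy) _
  have h1 := (key (bracketVF Y Z)).eq_of_nhds
  have h2 := (key Y).mlieBracket_vectorField_eq (key Z)
  have h3 := (VectorField.mlieBracketWithin_univ (I := 𝓘(ℝ, E)) (V := chartVF ℝ x₀ Y)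
    (W := chartVF ℝ x₀ Z)).symm.trans (VectorField.mlieBracketWithin_eq_lieBracketWithin (𝕜 := ℝ))
  rw [VectorField.lieBracketWithin_univ] at h3
  rw [chartVF_chart hx] at h1
  exact h1.symm.trans (h.trans (h2.trans (congrFun h3 _)))

end RealVF

/-! ### Calculus of functions and vector fields -/

section Calculus

variable {E X : Type*} [NormedAddCommGroup E] [NormedSpace ℂ E]
  [TopologicalSpace X] [ChartedSpace E X] [IsManifold 𝓘(ℂ, E) ω X]
  {G : Type*} [NormedAddCommGroup G] [NormedSpace ℝ G]

/-- Order ∞ at a point does not propagate to a neighbourhood, but each finite order does. Order one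
is enough here. For the same reason many later hypotheses ask for smoothness at all nearby points.
-/
theorem eventually_contMDiffAt_one {f : X → G} {x : X} (hf : ContMDiffAt 𝓘(ℝ, E) 𝓘(ℝ, G) ∞ f x) :
    ∀ᶠ z in 𝓝 x, MDifferentiableAt 𝓘(ℝ, E) 𝓘(ℝ, G) f z := by
  have := (contMDiffAt_iff_contMDiffAt_nhds (n := 1) (by simp)).1 (hf.of_le (by simp))
  exact this.mono fun z hz ↦ hz.mdifferentiableAt (by simp)

theorem VFSmoothAt.differentiableAt {Y : X → E} {x₀ x : X}
    (hx : x ∈ (extChartAt 𝓘(ℝ, E) x₀).source) (hY : VFSmoothAt Y x) :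
    DifferentiableAt ℝ (chartVF ℝ x₀ Y) (extChartAt 𝓘(ℝ, E) x₀ x) :=
  ((vfSmoothAt_iff hx).1 hY).differentiableAt (by simp)

theorem differentiableAt_chart {f : X → G} {x₀ x : X} (hx : x ∈ (extChartAt 𝓘(ℝ, E) x₀).source)
    (hf : ContMDiffAt 𝓘(ℝ, E) 𝓘(ℝ, G) ∞ f x) :
    DifferentiableAt ℝ (f ∘ (extChartAt 𝓘(ℝ, E) x₀).symm) (extChartAt 𝓘(ℝ, E) x₀ x) :=
  ((contMDiffAt_chart_iff hx).1 hf).differentiableAt (by simp)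

theorem eventually_dFun_chart {f : X → G} {x₀ x : X} (hx : x ∈ (extChartAt 𝓘(ℝ, E) x₀).source)
    (hf : ContMDiffAt 𝓘(ℝ, E) 𝓘(ℝ, G) ∞ f x) (Y : X → E) :
    (fun z ↦ dFun f z (Y z)) ∘ (extChartAt 𝓘(ℝ, E) x₀).symm
      =ᶠ[𝓝 (extChartAt 𝓘(ℝ, E) x₀ x)]
      fun y ↦ fderiv ℝ (f ∘ (extChartAt 𝓘(ℝ, E) x₀).symm) y (chartVF ℝ x₀ Y y) := by
  filter_upwards [eventually_chart_symm hx (eventually_contMDiffAt_one hf)] with y hy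
  have h := mfderiv_eq_fderiv_comp_chartD ((extChartAt 𝓘(ℝ, E) x₀).map_target hy.1) hy.2
  rw [(extChartAt 𝓘(ℝ, E) x₀).right_inv hy.1] at h
  exact DFunLike.congr_fun h _

theorem contMDiffAt_dFun {f : X → G} {Y : X → E} {x : X}
    (hf : ContMDiffAt 𝓘(ℝ, E) 𝓘(ℝ, G) ∞ f x) (hY : VFSmoothAt Y x) :
    ContMDiffAt 𝓘(ℝ, E) 𝓘(ℝ, G) ∞ (fun z ↦ dFun f z (Y z)) x := by
  have hx := mem_extChartAt_source (I := 𝓘(ℝ, E)) x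
  rw [contMDiffAt_chart_iff hx]
  refine ContDiffAt.congr_of_eventuallyEq ?_ (eventually_dFun_chart hx hf Y)
  rw [vfSmoothAt_iff hx] at hY
  rw [contMDiffAt_chart_iff hx] at hf
  exact (hf.fderiv_right (m := ∞) (by simp)).clm_apply hY

theorem dFun_self {f : X → G} {x : X} (hf : ContMDiffAt 𝓘(ℝ, E) 𝓘(ℝ, G) ∞ f x) (u : E) :
    dFun f x u =
      fderiv ℝ (f ∘ (extChartAt 𝓘(ℝ, E) x).symm) (extChartAt 𝓘(ℝ, E) x x) u := by
  rw [dFun_eq_fderiv (mem_extChartAt_source x) hf, chartD_self]; rfl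

omit [IsManifold 𝓘(ℂ, E) ω X] in
theorem dFun_congr {f g : X → G} {x : X} (h : f =ᶠ[𝓝 x] g) :
    (dFun f x : E →L[ℝ] G) = dFun g x := h.mfderiv_eq

omit [IsManifold 𝓘(ℂ, E) ω X] in
theorem dFun_const (c : G) (x : X) : (dFun (fun _ : X ↦ c) x : E →L[ℝ] G) = 0 :=
  mfderiv_const

theorem dFun_add {f g : X → G} {x : X} (hf : ContMDiffAt 𝓘(ℝ, E) 𝓘(ℝ, G) ∞ f x)
    (hg : ContMDiffAt 𝓘(ℝ, E) 𝓘(ℝ, G) ∞ g x) (u : E) :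
    dFun (fun z ↦ f z + g z) x u = dFun f x u + dFun g x u := by
  have hx := mem_extChartAt_source (I := 𝓘(ℝ, E)) x
  have hfg : ContMDiffAt 𝓘(ℝ, E) 𝓘(ℝ, G) ∞ (fun z ↦ f z + g z) x := hf.add hg
  rw [dFun_self hf, dFun_self hg, dFun_self hfg, ← add_apply,
    ← fderiv_add (differentiableAt_chart hx hf) (differentiableAt_chart hx hg)]
  rfl

theorem dFun_mul {f g : X → ℂ} {x : X} (hf : ContMDiffAt 𝓘(ℝ, E) 𝓘(ℝ, ℂ) ∞ f x)
    (hg : ContMDiffAt 𝓘(ℝ, E) 𝓘(ℝ, ℂ) ∞ g x) (u : E) :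
    dFun (fun z ↦ f z * g z) x u = dFun f x u * g x + f x * dFun g x u := by
  have hx := mem_extChartAt_source (I := 𝓘(ℝ, E)) x
  have hfg : ContMDiffAt 𝓘(ℝ, E) 𝓘(ℝ, ℂ) ∞ (fun z ↦ f z * g z) x := by
    rw [contMDiffAt_chart_iff hx] at hf hg ⊢
    exact hf.mul hg
  have e : (fun z ↦ f z * g z) ∘ (extChartAt 𝓘(ℝ, E) x).symm =
    fun y ↦ (f ∘ (extChartAt 𝓘(ℝ, E) x).symm) y * (g ∘ (extChartAt 𝓘(ℝ, E) x).symm) y := rfl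
  rw [dFun_self hf, dFun_self hg, dFun_self hfg, e,
    fderiv_fun_mul (differentiableAt_chart hx hf) (differentiableAt_chart hx hg)]
  simp
  ring

theorem contMDiffAt_mul {f g : X → ℂ} {x : X} (hf : ContMDiffAt 𝓘(ℝ, E) 𝓘(ℝ, ℂ) ∞ f x)
    (hg : ContMDiffAt 𝓘(ℝ, E) 𝓘(ℝ, ℂ) ∞ g x) :
    ContMDiffAt 𝓘(ℝ, E) 𝓘(ℝ, ℂ) ∞ (fun z ↦ f z * g z) x := by
  have hx := mem_extChartAt_source (I := 𝓘(ℝ, E)) x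
  rw [contMDiffAt_chart_iff hx] at hf hg ⊢
  exact hf.mul hg

theorem dFun_const_mul {f : X → ℂ} {x : X} (c : ℂ) (hf : ContMDiffAt 𝓘(ℝ, E) 𝓘(ℝ, ℂ) ∞ f x)
    (u : E) : dFun (fun z ↦ c * f z) x u = c * dFun f x u := by
  rw [dFun_mul contMDiffAt_const hf, dFun_const]; simp

theorem dFun_sub {f g : X → ℂ} {x : X} (hf : ContMDiffAt 𝓘(ℝ, E) 𝓘(ℝ, ℂ) ∞ f x)
    (hg : ContMDiffAt 𝓘(ℝ, E) 𝓘(ℝ, ℂ) ∞ g x) (u : E) :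
    dFun (fun z ↦ f z - g z) x u = dFun f x u - dFun g x u := by
  have := dFun_add hf (contMDiffAt_mul (contMDiffAt_const (c := (-1 : ℂ))) hg) u
  rw [dFun_const_mul _ hg] at this
  simpa [sub_eq_add_neg] using this

theorem dFun_clm {G' : Type*} [NormedAddCommGroup G'] [NormedSpace ℝ G'] (L : G →L[ℝ] G')
    {f : X → G} {x : X} (hf : ContMDiffAt 𝓘(ℝ, E) 𝓘(ℝ, G) ∞ f x) (u : E) :
    dFun (fun z ↦ L (f z)) x u = L (dFun f x u) := by
  have hx := mem_extChartAt_source (I := 𝓘(ℝ, E)) x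
  have hLf : ContMDiffAt 𝓘(ℝ, E) 𝓘(ℝ, G') ∞ (fun z ↦ L (f z)) x :=
    L.contMDiff.contMDiffAt.comp x hf
  rw [dFun_self hf, dFun_self hLf]
  have e : (fun z ↦ L (f z)) ∘ (extChartAt 𝓘(ℝ, E) x).symm =
    L ∘ (f ∘ (extChartAt 𝓘(ℝ, E) x).symm) := rfl
  rw [e, fderiv_comp _ L.differentiableAt (differentiableAt_chart hx hf)]
  simp

theorem dFun_sum {ι : Type*} (s : Finset ι) {f : ι → X → G} {x : X}
    (hf : ∀ i ∈ s, ContMDiffAt 𝓘(ℝ, E) 𝓘(ℝ, G) ∞ (f i) x) (u : E) :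
    dFun (fun z ↦ ∑ i ∈ s, f i z) x u = ∑ i ∈ s, dFun (f i) x u := by
  classical
  induction s using Finset.induction_on with
  | empty => simp [dFun_const]
  | insert a s ha ih =>
    have h1 := fun i hi ↦ hf i (Finset.mem_insert_of_mem hi)
    simp only [Finset.sum_insert ha]
    rw [dFun_add (hf a (Finset.mem_insert_self a s)) (contMDiffAt_finsetSum h1), ih h1]

/-- The vector field has complex linear derivative at `x`. -/
def IsHolomorphicDerivAt (v : X → E) (x : X) : Prop :=
  ∀ u : E, fderiv ℝ (chartVF ℝ x v) (extChartAt 𝓘(ℝ, E) x x) (Complex.I • u) =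
    Complex.I • fderiv ℝ (chartVF ℝ x v) (extChartAt 𝓘(ℝ, E) x x) u

theorem fderiv_chartVF_smul {Y : X → E} {x : X} (c : ℂ) (hY : VFSmoothAt Y x) (u : E) :
    fderiv ℝ (chartVF ℝ x (fun z ↦ c • Y z)) (extChartAt 𝓘(ℝ, E) x x) u =
      c • fderiv ℝ (chartVF ℝ x Y) (extChartAt 𝓘(ℝ, E) x x) u := by
  have hx := mem_extChartAt_source (I := 𝓘(ℝ, E)) x
  have : chartVF ℝ x (fun z ↦ c • Y z) =ᶠ[𝓝 (extChartAt 𝓘(ℝ, E) x x)]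
      fun y ↦ c • chartVF ℝ x Y y := by
    filter_upwards [eventually_chart_symm hx (p := fun _ ↦ True) (by simp)] with y hy
    exact chartD_I_smul ((extChartAt 𝓘(ℝ, E) x).map_target hy.1) _ _
  rw [this.fderiv_eq, fderiv_fun_const_smul (hY.differentiableAt hx)]
  rfl

theorem fderiv_chartVF_add {Y Z : X → E} {x : X} (hY : VFSmoothAt Y x) (hZ : VFSmoothAt Z x) (u : E) :
    fderiv ℝ (chartVF ℝ x (fun z ↦ Y z + Z z)) (extChartAt 𝓘(ℝ, E) x x) u =
      fderiv ℝ (chartVF ℝ x Y) (extChartAt 𝓘(ℝ, E) x x) u +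
      fderiv ℝ (chartVF ℝ x Z) (extChartAt 𝓘(ℝ, E) x x) u := by
  have hx := mem_extChartAt_source (I := 𝓘(ℝ, E)) x
  have : chartVF ℝ x (fun z ↦ Y z + Z z) = chartVF ℝ x Y + chartVF ℝ x Z := by
    ext y; simp [chartVF]
  rw [this, fderiv_add (hY.differentiableAt hx) (hZ.differentiableAt hx)]
  rfl

omit [IsManifold 𝓘(ℂ, E) ω X] in
theorem fderiv_chartVF_congr {Y Z : X → E} {x : X} (h : Y =ᶠ[𝓝 x] Z) :
    fderiv ℝ (chartVF ℝ x Y) (extChartAt 𝓘(ℝ, E) x x) =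
      fderiv ℝ (chartVF ℝ x Z) (extChartAt 𝓘(ℝ, E) x x) := by
  refine Filter.EventuallyEq.fderiv_eq ?_
  filter_upwards [eventually_chart_symm (mem_extChartAt_source x) h] with y hy
  simp only [chartVF, hy.2]

theorem fderiv_chartVF_fun_smul {f : X → ℂ} {Y : X → E} {x : X}
    (hf : ContMDiffAt 𝓘(ℝ, E) 𝓘(ℝ, ℂ) ∞ f x) (hY : VFSmoothAt Y x) (u : E) :
    fderiv ℝ (chartVF ℝ x (fun z ↦ f z • Y z)) (extChartAt 𝓘(ℝ, E) x x) u =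
      f x • fderiv ℝ (chartVF ℝ x Y) (extChartAt 𝓘(ℝ, E) x x) u + dFun f x u • Y x := by
  have hx := mem_extChartAt_source (I := 𝓘(ℝ, E)) x
  have : chartVF ℝ x (fun z ↦ f z • Y z) =ᶠ[𝓝 (extChartAt 𝓘(ℝ, E) x x)]
      fun y ↦ (f ∘ (extChartAt 𝓘(ℝ, E) x).symm) y • chartVF ℝ x Y y := by
    filter_upwards [eventually_chart_symm hx (p := fun _ ↦ True) (by simp)] with y hy
    exact chartD_I_smul ((extChartAt 𝓘(ℝ, E) x).map_target hy.1) _ _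
  rw [this.fderiv_eq, fderiv_fun_smul (differentiableAt_chart hx hf) (hY.differentiableAt hx),
    dFun_self hf, add_apply, ContinuousLinearMap.smulRight_apply, chartVF_self]
  simp

omit [IsManifold 𝓘(ℂ, E) ω X] in
theorem bracketVF_congr {Y Y' Z Z' : X → E} {x : X} (h : Y =ᶠ[𝓝 x] Y') (h' : Z =ᶠ[𝓝 x] Z') :
    bracketVF Y Z x = bracketVF Y' Z' x :=
  h.mlieBracket_vectorField_eq h'

variable [CompleteSpace E]

theorem bracketVF_self {Y Z : X → E} {x : X} (hY : VFSmoothAt Y x) (hZ : VFSmoothAt Z x) :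
    bracketVF Y Z x = fderiv ℝ (chartVF ℝ x Z) (extChartAt 𝓘(ℝ, E) x x) (Y x) -
      fderiv ℝ (chartVF ℝ x Y) (extChartAt 𝓘(ℝ, E) x x) (Z x) := by
  have h := chartD_bracketVF (mem_extChartAt_source x) hY hZ
  rw [chartD_self, VectorField.lieBracket, chartVF_self, chartVF_self] at h
  exact h

/-- The second derivative of `f` is symmetric, so its two occurrences cancel and only the
derivatives of the vector fields survive. -/
theorem dFun_bracketVF {f : X → G} {Y Z : X → E} {x : X}
    (hf : ContMDiffAt 𝓘(ℝ, E) 𝓘(ℝ, G) ∞ f x) (hY : VFSmoothAt Y x) (hZ : VFSmoothAt Z x) :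
    dFun f x (bracketVF Y Z x) =
      dFun (fun z ↦ dFun f z (Z z)) x (Y x) - dFun (fun z ↦ dFun f z (Y z)) x (Z x) := by
  have hx := mem_extChartAt_source (I := 𝓘(ℝ, E)) x
  have h := chartD_bracketVF hx hY hZ
  rw [chartD_self] at h
  rw [dFun_self hf, dFun_self (contMDiffAt_dFun hf hZ), dFun_self (contMDiffAt_dFun hf hY),
    (eventually_dFun_chart hx hf Y).fderiv_eq, (eventually_dFun_chart hx hf Z).fderiv_eq]
  have hY' := hY.differentiableAt hx
  have hZ' := hZ.differentiableAt hx
  have := VectorField.fderiv_apply_lieBracket ((contMDiffAt_chart_iff hx).1 hf)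
    (by simpa using ENat.LEInfty.out) hZ' hY'
  rw [chartVF_self, chartVF_self, ← h] at this
  exact this

theorem bracketVF_add_right {V Y Z : X → E} {x : X} (hV : VFSmoothAt V x) (hY : VFSmoothAt Y x)
    (hZ : VFSmoothAt Z x) :
    bracketVF V (fun z ↦ Y z + Z z) x = bracketVF V Y x + bracketVF V Z x := by
  rw [bracketVF_self hV (hY.add hZ), bracketVF_self hV hY, bracketVF_self hV hZ,
    fderiv_chartVF_add hY hZ, map_add]
  abel

/-- The bracket is only real bilinear. The scalar is a real number cast to ℂ, which the derivative
of `V` commutes with unconditionally. -/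
theorem bracketVF_const_smul_right {V Y : X → E} {x : X} (r : ℝ) (hV : VFSmoothAt V x)
    (hY : VFSmoothAt Y x) :
    bracketVF V (fun z ↦ (r : ℂ) • Y z) x = (r : ℂ) • bracketVF V Y x := by
  rw [bracketVF_self hV (hY.const_smul _), bracketVF_self hV hY, fderiv_chartVF_smul _ hY,
    smul_sub]
  simp

/-- In a chart [v, iY] = i dY(v) - dv(iY), and the second term is i dv(Y) exactly when the
derivative of `v` is complex linear. -/
theorem bracketVF_I_smul {v Y : X → E} {x : X} (hv : VFSmoothAt v x)
    (hI : IsHolomorphicDerivAt v x) (hY : VFSmoothAt Y x) :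
    bracketVF v (fun z ↦ Complex.I • Y z) x = Complex.I • bracketVF v Y x := by
  rw [bracketVF_self hv (hY.const_smul _), bracketVF_self hv hY, fderiv_chartVF_smul _ hY, hI,
    smul_sub]

theorem bracketVF_jacobi {U V W : X → E} {x : X} (hU : VFSmoothAt U x) (hV : VFSmoothAt V x)
    (hW : VFSmoothAt W x) :
    bracketVF U (bracketVF V W) x =
      bracketVF (bracketVF U V) W x + bracketVF V (bracketVF U W) x :=
  VectorField.leibniz_identity_mlieBracket_apply (hU.of_le (by simpa using ENat.LEInfty.out))
    (hV.of_le (by simpa using ENat.LEInfty.out)) (hW.of_le (by simpa using ENat.LEInfty.out))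

end Calculus

/-! ### Two-forms in charts -/

section TwoForms

variable {E X : Type*} [NormedAddCommGroup E] [NormedSpace ℂ E]
  {G : Type*} [NormedAddCommGroup G] [NormedSpace ℝ G]

variable (E G) in
/-- A two-form as a bilinear map. -/
def twoFormBilin : (E [⋀^Fin 2]→L[ℝ] G) →L[ℝ] E →L[ℝ] E →L[ℝ] G :=
  (ContinuousLinearMap.compL ℝ E (E [⋀^Fin 1]→L[ℝ] G) (E →L[ℝ] G)
    ((ContinuousAlternatingMap.ofSubsingletonLIE (𝕜 := ℝ) (E := E) (F := G) (0 : Fin 1)).symm.toContinuousLinearEquiv :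
      (E [⋀^Fin 1]→L[ℝ] G) →L[ℝ] E →L[ℝ] G)).comp
    ContinuousAlternatingMap.curryLeftLI.toContinuousLinearMap

theorem twoFormBilin_apply (α : E [⋀^Fin 2]→L[ℝ] G) (a b : E) :
    twoFormBilin E G α a b = α ![a, b] := by
  simp only [twoFormBilin, ContinuousLinearMap.comp_apply, ContinuousLinearMap.compL_apply]
  change α (Matrix.vecCons a fun _ ↦ b) = α ![a, b]
  congr 1
  ext i
  fin_cases i <;> rfl

theorem contDiff_twoFormBilin : ContDiff ℝ ∞ (fun α ↦ twoFormBilin E G α) :=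
  ContinuousLinearMap.contDiff _

variable [TopologicalSpace X] [ChartedSpace E X] [IsManifold 𝓘(ℂ, E) ω X]

theorem formInChart_apply {k : ℕ} (α : X → E [⋀^Fin k]→L[ℝ] G) {x₀ x : X}
    (hx : x ∈ (extChartAt 𝓘(ℝ, E) x₀).source) (w : Fin k → E) :
    α x w = formInChart α x₀ (extChartAt 𝓘(ℝ, E) x₀ x) (fun i ↦ chartD ℝ x₀ x (w i)) := by
  simp only [formInChart]
  rw [(extChartAt 𝓘(ℝ, E) x₀).left_inv hx]
  exact congrArg (α x) (funext fun i ↦ (symmD_chartD hx (w i)).symm)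

theorem symmD_smul {x₀ : X} {y : E} (hy : y ∈ (extChartAt 𝓘(ℝ, E) x₀).target) (c : ℂ) (u : E) :
    symmD (E := E) ℝ x₀ y (c • u) =
      c • symmD (E := E) ℝ x₀ y u := by
  have hx := (extChartAt 𝓘(ℝ, E) x₀).map_target hy
  refine (chartD_bijective (𝕜 := ℝ) hx).1 ?_
  rw [chartD_I_smul hx, chartD_symmD hy, chartD_symmD hy]

omit [IsManifold 𝓘(ℂ, E) ω X] in
theorem contDiffAt_twoFormBilin {α : X → E [⋀^Fin 2]→L[ℝ] G} (hα : IsSmoothForm α) {x₀ x : X}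
    (hx : x ∈ (extChartAt 𝓘(ℝ, E) x₀).source) :
    ContDiffAt ℝ ∞ (fun y ↦ twoFormBilin E G (formInChart α x₀ y)) (extChartAt 𝓘(ℝ, E) x₀ x) :=
  contDiff_twoFormBilin.contDiffAt.comp _ ((hα x₀).contDiffAt
    ((isOpen_extChartAt_target (I := 𝓘(ℝ, E)) x₀).mem_nhds ((extChartAt 𝓘(ℝ, E) x₀).map_source hx)))

/-- The derivative at `x` of the coefficients of a two-form, in the preferred chart at `x`. -/
def derivForm (α : X → E [⋀^Fin 2]→L[ℝ] G) (x : X) : E →L[ℝ] E →L[ℝ] E →L[ℝ] G :=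
  fderiv ℝ (fun y ↦ twoFormBilin E G (formInChart α x y)) (extChartAt 𝓘(ℝ, E) x x)

theorem eventually_form_apply (α : X → E [⋀^Fin 2]→L[ℝ] G) {x₀ x : X}
    (hx : x ∈ (extChartAt 𝓘(ℝ, E) x₀).source) (Y Z : X → E) :
    (fun z ↦ α z ![Y z, Z z]) ∘ (extChartAt 𝓘(ℝ, E) x₀).symm =ᶠ[𝓝 (extChartAt 𝓘(ℝ, E) x₀ x)]
      fun y ↦ twoFormBilin E G (formInChart α x₀ y) (chartVF ℝ x₀ Y y) (chartVF ℝ x₀ Z y) := by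
  filter_upwards [eventually_chart_symm hx (p := fun _ ↦ True) (by simp)] with y hy
  have := formInChart_apply α ((extChartAt 𝓘(ℝ, E) x₀).map_target hy.1)
    ![Y ((extChartAt 𝓘(ℝ, E) x₀).symm y), Z ((extChartAt 𝓘(ℝ, E) x₀).symm y)]
  rw [(extChartAt 𝓘(ℝ, E) x₀).right_inv hy.1] at this
  refine this.trans ?_
  rw [twoFormBilin_apply]
  congr 1
  ext i
  fin_cases i <;> rfl

theorem contMDiffAt_form_apply {α : X → E [⋀^Fin 2]→L[ℝ] G} (hα : IsSmoothForm α) {x : X}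
    {Y Z : X → E} (hY : VFSmoothAt Y x) (hZ : VFSmoothAt Z x) :
    ContMDiffAt 𝓘(ℝ, E) 𝓘(ℝ, G) ∞ (fun z ↦ α z ![Y z, Z z]) x := by
  have hx := mem_extChartAt_source (I := 𝓘(ℝ, E)) x
  rw [contMDiffAt_chart_iff hx]
  rw [vfSmoothAt_iff hx] at hY hZ
  exact (((contDiffAt_twoFormBilin hα hx).clm_apply hY).clm_apply hZ).congr_of_eventuallyEq
    (eventually_form_apply α hx Y Z)

theorem formInChart_self (α : X → E [⋀^Fin 2]→L[ℝ] G) (x : X) (a b : E) :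
    twoFormBilin E G (formInChart α x (extChartAt 𝓘(ℝ, E) x x)) a b = α x ![a, b] := by
  rw [twoFormBilin_apply, formInChart_apply α (mem_extChartAt_source x), chartD_self]
  rfl

/-- Product rule in the chart at `x`: one term for the coefficients of the form and one for each
vector field. -/
theorem dFun_form_apply {α : X → E [⋀^Fin 2]→L[ℝ] G} (hα : IsSmoothForm α) {x : X}
    {Y Z : X → E} (hY : VFSmoothAt Y x) (hZ : VFSmoothAt Z x) (u : E) :
    dFun (fun z ↦ α z ![Y z, Z z]) x u = derivForm α x u (Y x) (Z x) +
      α x ![fderiv ℝ (chartVF ℝ x Y) (extChartAt 𝓘(ℝ, E) x x) u, Z x] +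
      α x ![Y x, fderiv ℝ (chartVF ℝ x Z) (extChartAt 𝓘(ℝ, E) x x) u] := by
  have hx := mem_extChartAt_source (I := 𝓘(ℝ, E)) x
  have h0 := (contDiffAt_twoFormBilin hα hx).differentiableAt (by simp)
  rw [dFun_self (contMDiffAt_form_apply hα hY hZ), (eventually_form_apply α hx Y Z).fderiv_eq,
    fderiv_clm_apply (h0.clm_apply (hY.differentiableAt hx)) (hZ.differentiableAt hx),
    fderiv_clm_apply h0 (hY.differentiableAt hx)]
  simp only [add_apply, ContinuousLinearMap.comp_apply,
    ContinuousLinearMap.flip_apply, chartVF_self, formInChart_self, derivForm]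
  abel

omit [IsManifold 𝓘(ℂ, E) ω X] in
theorem derivForm_apply {α : X → E [⋀^Fin 2]→L[ℝ] G} (hα : IsSmoothForm α) (x : X) (u a b : E) :
    derivForm α x u a b =
      fderiv ℝ (fun y ↦ formInChart α x y ![a, b]) (extChartAt 𝓘(ℝ, E) x x) u := by
  have hx := mem_extChartAt_source (I := 𝓘(ℝ, E)) x
  have h0 := (contDiffAt_twoFormBilin hα hx).differentiableAt (by simp)
  have : (fun y ↦ formInChart α x y ![a, b]) =
    fun y ↦ twoFormBilin E G (formInChart α x y) a b := by
    simp only [twoFormBilin_apply]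
  rw [this, fderiv_clm_apply (h0.clm_apply (differentiableAt_const a)) (differentiableAt_const b),
    fderiv_clm_apply h0 (differentiableAt_const a)]
  simp [derivForm]

omit [NormedSpace ℂ E] [IsManifold 𝓘(ℂ, E) ω X] [TopologicalSpace X] [ChartedSpace E X] in
theorem twoForm_swap [NormedSpace ℝ E] (β : E [⋀^Fin 2]→L[ℝ] G) (a b : E) :
    β ![a, b] = - β ![b, a] := by
  have := β.toAlternatingMap.map_swap ![b, a] (i := 0) (j := 1) (by simp)
  refine Eq.trans (congrArg β (funext fun i ↦ ?_)) this
  fin_cases i <;> rfl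

omit [IsManifold 𝓘(ℂ, E) ω X] in
theorem derivForm_swap {α : X → E [⋀^Fin 2]→L[ℝ] G} (hα : IsSmoothForm α) (x : X) (u a b : E) :
    derivForm α x u a b = - derivForm α x u b a := by
  rw [derivForm_apply hα, derivForm_apply hα]
  have : (fun y ↦ formInChart α x y ![a, b]) = - fun y ↦ formInChart α x y ![b, a] := by
    ext y; exact twoForm_swap _ _ _
  rw [this, fderiv_neg]
  rfl

/-- The chart is holomorphic, so the coefficient form is of type (1,1) at every point near the
centre, and its derivative inherits the symmetry. -/
theorem derivForm_I {α : X → E [⋀^Fin 2]→L[ℝ] G} (hα : IsSmoothForm α)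
    (h11 : ∀ (x : X) (u w : E), α x ![Complex.I • u, Complex.I • w] = α x ![u, w])
    (x : X) (u a b : E) :
    derivForm α x u (Complex.I • a) (Complex.I • b) = derivForm α x u a b := by
  rw [derivForm_apply hα, derivForm_apply hα]
  congr 1
  refine Filter.EventuallyEq.fderiv_eq ?_
  filter_upwards [eventually_chart_symm (mem_extChartAt_source x) (p := fun _ ↦ True)
    (by simp)] with y hy
  have key : ∀ c d : E, formInChart α x y ![c, d] = α ((extChartAt 𝓘(ℝ, E) x).symm y)
      ![symmD (E := E) ℝ x y c,
        symmD (E := E) ℝ x y d] := by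
    intro c d
    refine congrArg (α ((extChartAt 𝓘(ℝ, E) x).symm y)) (funext fun i ↦ ?_)
    fin_cases i <;> rfl
  rw [key, key, symmD_smul hy.1, symmD_smul hy.1, h11]

/-- The coordinate formula for dα is an alternating sum over the omitted index; antisymmetry of the
coefficients turns its middle term around and makes the sum cyclic. -/
theorem derivForm_cyclic {α : X → E [⋀^Fin 2]→L[ℝ] G} (hα : IsSmoothForm α)
    (hd : dForm α = 0) (x : X) (a b c : E) :
    derivForm α x a b c + derivForm α x b c a + derivForm α x c a b = 0 := by
  have hx := mem_extChartAt_source (I := 𝓘(ℝ, E)) x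
  have h0 : DifferentiableAt ℝ (formInChart α x) (extChartAt 𝓘(ℝ, E) x x) :=
    ((hα x).contDiffAt ((isOpen_extChartAt_target (I := 𝓘(ℝ, E)) x).mem_nhds
      ((extChartAt 𝓘(ℝ, E) x).map_source hx))).differentiableAt (by simp)
  have h1 := DFunLike.congr_fun (congrFun hd x) ![a, b, c]
  have h2 : dForm α x ![a, b, c] =
      extDeriv (formInChart α x) (extChartAt 𝓘(ℝ, E) x x) ![a, b, c] := by
    have := chartD_self (𝕜 := ℝ) (E := E) x
    rw [chartD] at this
    rw [dForm, this]
    rfl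
  rw [h2, extDeriv_apply h0, Fin.sum_univ_three] at h1
  have e0 : (0 : Fin 3).removeNth ![a, b, c] = ![b, c] := by
    ext i; fin_cases i <;> rfl
  have e1 : (1 : Fin 3).removeNth ![a, b, c] = ![a, c] := by
    ext i; fin_cases i <;> rfl
  have e2 : (2 : Fin 3).removeNth ![a, b, c] = ![a, b] := by
    ext i; fin_cases i <;> rfl
  rw [e0, e1, e2] at h1
  simp only [← derivForm_apply hα] at h1
  rw [derivForm_swap hα x b c a]
  simpa [sub_eq_add_neg] using h1

end TwoForms

/-! ### Hermitian forms attached to real `(1,1)`-forms -/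

section Herm

variable {E : Type*} [NormedAddCommGroup E] [NormedSpace ℂ E]

/-- The sesquilinear form `-i q(a^{1,0}, b^{0,1})` of a real `(1,1)`-form `q`. -/
def herm (q : E →L[ℝ] E →L[ℝ] ℝ) (a b : E) : ℂ :=
  ((q a (Complex.I • b) : ℝ) - Complex.I * (q a b : ℝ)) / 2

/-- `q` is a real `(1,1)`-form. -/
structure IsOneOne (q : E →L[ℝ] E →L[ℝ] ℝ) : Prop where
  swap : ∀ a b, q a b = - q b a
  I_smul : ∀ a b, q (Complex.I • a) (Complex.I • b) = q a b

theorem complex_smul_eq (c : ℂ) (a : E) : c • a = c.re • a + c.im • (Complex.I • a) := by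
  conv_lhs => rw [← Complex.re_add_im c, add_smul, mul_smul]
  simp

variable {q : E →L[ℝ] E →L[ℝ] ℝ}

theorem IsOneOne.I_left (hq : IsOneOne q) (a b : E) :
    q (Complex.I • a) b = - q a (Complex.I • b) := by
  rw [← hq.I_smul (Complex.I • a) b, smul_smul, Complex.I_mul_I]
  simp

theorem herm_add_left (q : E →L[ℝ] E →L[ℝ] ℝ) (a a' b : E) :
    herm q (a + a') b = herm q a b + herm q a' b := by
  simp only [herm, map_add, add_apply, Complex.ofReal_add]; ring

theorem herm_add_right (q : E →L[ℝ] E →L[ℝ] ℝ) (a b b' : E) :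
    herm q a (b + b') = herm q a b + herm q a b' := by
  simp only [herm, map_add, smul_add, Complex.ofReal_add]; ring

theorem herm_real_smul_left (q : E →L[ℝ] E →L[ℝ] ℝ) (r : ℝ) (a b : E) :
    herm q (r • a) b = r * herm q a b := by
  simp only [herm, map_smul, smul_apply, smul_eq_mul, Complex.ofReal_mul]; ring

theorem herm_real_smul_right (q : E →L[ℝ] E →L[ℝ] ℝ) (r : ℝ) (a b : E) :
    herm q a (r • b) = r * herm q a b := by
  simp only [herm, map_smul, smul_eq_mul, Complex.ofReal_mul, smul_comm Complex.I r b]; ring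

theorem herm_I_smul_right (q : E →L[ℝ] E →L[ℝ] ℝ) (a b : E) :
    herm q a (Complex.I • b) = - Complex.I * herm q a b := by
  simp only [herm, smul_smul, Complex.I_mul_I, neg_smul, one_smul, map_neg, Complex.ofReal_neg]
  linear_combination (-(q a b : ℂ) / 2) * Complex.I_mul_I

theorem herm_I_smul_left (hq : IsOneOne q) (a b : E) :
    herm q (Complex.I • a) b = Complex.I * herm q a b := by
  simp only [herm, hq.I_smul, hq.I_left, Complex.ofReal_neg]
  linear_combination ((q a b : ℂ) / 2) * Complex.I_mul_I

theorem herm_smul_left (hq : IsOneOne q) (c : ℂ) (a b : E) :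
    herm q (c • a) b = c * herm q a b := by
  rw [complex_smul_eq, herm_add_left, herm_real_smul_left, herm_real_smul_left,
    herm_I_smul_left hq]
  linear_combination (herm q a b) * (Complex.re_add_im c)

theorem herm_smul_right (q : E →L[ℝ] E →L[ℝ] ℝ) (c : ℂ) (a b : E) :
    herm q a (c • b) = starRingEnd ℂ c * herm q a b := by
  have : starRingEnd ℂ c = c.re - c.im * Complex.I := by
    apply Complex.ext <;> simp
  rw [complex_smul_eq, herm_add_right, herm_real_smul_right, herm_real_smul_right,
    herm_I_smul_right, this]
  ring

theorem herm_conj (hq : IsOneOne q) (a b : E) :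
    starRingEnd ℂ (herm q a b) = herm q b a := by
  have h1 : q a (Complex.I • b) = q b (Complex.I • a) := by
    rw [hq.swap, hq.I_left, neg_neg]
  simp only [herm, map_div₀, map_sub, map_mul, Complex.conj_ofReal, Complex.conj_I, h1,
    hq.swap a b, map_ofNat, Complex.ofReal_neg, map_neg]
  ring

theorem herm_neg_left (q : E →L[ℝ] E →L[ℝ] ℝ) (a b : E) : herm q (-a) b = - herm q a b := by
  simpa using herm_real_smul_left q (-1) a b

theorem herm_neg_right (q : E →L[ℝ] E →L[ℝ] ℝ) (a b : E) : herm q a (-b) = - herm q a b := by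
  simpa using herm_real_smul_right q (-1) a b

theorem herm_sub_left (q : E →L[ℝ] E →L[ℝ] ℝ) (a a' b : E) :
    herm q (a - a') b = herm q a b - herm q a' b := by
  rw [sub_eq_add_neg, herm_add_left, herm_neg_left, sub_eq_add_neg]

/-- The `(1,0)`-part in the first variable of a family of real `(1,1)`-forms. -/
def hermDel (T : E →L[ℝ] E →L[ℝ] E →L[ℝ] ℝ) (u a b : E) : ℂ :=
  (herm (T u) a b - Complex.I * herm (T (Complex.I • u)) a b) / 2

variable {T : E →L[ℝ] E →L[ℝ] E →L[ℝ] ℝ}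

theorem hermDel_add_first (T : E →L[ℝ] E →L[ℝ] E →L[ℝ] ℝ) (u u' a b : E) :
    hermDel T (u + u') a b = hermDel T u a b + hermDel T u' a b := by
  simp only [hermDel, herm, map_add, smul_add, add_apply, Complex.ofReal_add]; ring

theorem hermDel_real_smul_first (T : E →L[ℝ] E →L[ℝ] E →L[ℝ] ℝ) (r : ℝ) (u a b : E) :
    hermDel T (r • u) a b = r * hermDel T u a b := by
  have h : ∀ w : E, herm (T (r • w)) a b = r * herm (T w) a b := by
    intro w
    rw [T.map_smul]
    simp only [herm, smul_apply, smul_eq_mul, Complex.ofReal_mul]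
    ring
  rw [hermDel, hermDel, smul_comm Complex.I r u, h, h]
  ring

theorem hermDel_I_smul_first (T : E →L[ℝ] E →L[ℝ] E →L[ℝ] ℝ) (u a b : E) :
    hermDel T (Complex.I • u) a b = Complex.I * hermDel T u a b := by
  have : herm (T (Complex.I • Complex.I • u)) a b = - herm (T u) a b := by
    rw [smul_smul, Complex.I_mul_I, neg_one_smul, map_neg]
    simp only [herm, neg_apply, Complex.ofReal_neg]; ring
  rw [hermDel, hermDel, this]
  linear_combination (herm (T (Complex.I • u)) a b / 2) * Complex.I_mul_I

/-- This is d = ∂ + ∂̄ on the coefficients: by Hermitian symmetry the (0,1)-derivative is the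
conjugate transpose of the (1,0)-derivative. -/
theorem herm_eq_hermDel (hT : ∀ u, IsOneOne (T u)) (u a b : E) :
    herm (T u) a b = hermDel T u a b + starRingEnd ℂ (hermDel T u b a) := by
  simp only [hermDel, map_div₀, map_sub, map_mul, Complex.conj_I, herm_conj (hT _), map_ofNat]
  ring

/-- The Kähler identity ∂_u g_{a b̄} = ∂_a g_{u b̄}, the (2,1)-component of closedness. The proof
evaluates the cyclic identity on the combinations of `u`, `a`, `b` and their multiples by i that
enter both sides. -/
theorem hermDel_comm (hT : ∀ u, IsOneOne (T u))
    (hc : ∀ a b c, T a b c + T b c a + T c a b = 0) (u a b : E) :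
    hermDel T u a b = hermDel T a u b := by
  have c1 := hc u a b
  have c2 := hc u a (Complex.I • b)
  have c3 := hc (Complex.I • u) a b
  have c4 := hc (Complex.I • u) a (Complex.I • b)
  have c5 := hc u (Complex.I • a) b
  have c6 := hc u (Complex.I • a) (Complex.I • b)
  have s1 := (hT a).swap b u
  have s2 := (hT a).swap (Complex.I • b) u
  have s3 := (hT a).swap b (Complex.I • u)
  have s3' := (hT a).I_left u b
  have s4 := (hT a).swap (Complex.I • b) (Complex.I • u)
  have s4' := (hT a).I_smul u b
  have s5 := (hT (Complex.I • a)).swap b u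
  have s6 := (hT (Complex.I • a)).swap (Complex.I • b) u
  have t5 := (hT u).I_left a b
  have t6 := (hT u).I_smul a b
  have r1 := (hT b).I_left u a
  have r2 := (hT (Complex.I • b)).I_left u a
  -- Splitting into real and imaginary parts leaves two real linear identities.
  have key : ∀ p q r s : ℝ, (((p : ℂ) - Complex.I * q) / 2 - Complex.I * ((r - Complex.I * s) / 2)) / 2
      = (((p - s) / 4 : ℝ) : ℂ) - Complex.I * (((q + r) / 4 : ℝ) : ℂ) := by
    intro p q r s
    push_cast
    linear_combination ((s : ℂ) / 4) * Complex.I_mul_I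
  rw [hermDel, hermDel, herm, herm, herm, herm, key, key]
  congr 2
  · congr 1
    linarith
  · congr 1
    linarith

end Herm

/-! ### The sesquilinear extension of the relative Kähler metric to the tangent bundle -/

section Pairing

variable {E X : Type*} [NormedAddCommGroup E] [NormedSpace ℂ E]

/-- The sesquilinear form of the two-form on the tangent space at `x`. -/
def kpair (omega : X → E [⋀^Fin 2]→L[ℝ] ℝ) (x : X) (a b : E) : ℂ :=
  herm (twoFormBilin E ℝ (omega x)) a b

variable [TopologicalSpace X] [ChartedSpace E X]

/-- `(∂_u g)(a, b)` for the coefficients `g` of the two-form in the preferred chart at `x`. -/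
def kpairDel (omega : X → E [⋀^Fin 2]→L[ℝ] ℝ) (x : X) (u a b : E) : ℂ :=
  hermDel (derivForm omega x) u a b

/-- A closed smooth real `(1,1)`-form. -/
structure IsKahlerForm (omega : X → E [⋀^Fin 2]→L[ℝ] ℝ) : Prop where
  smooth : IsSmoothForm omega
  closed : dForm omega = 0
  type_one_one : ∀ (x : X) (u w : E), omega x ![Complex.I • u, Complex.I • w] = omega x ![u, w]

variable {omega : X → E [⋀^Fin 2]→L[ℝ] ℝ}

omit [TopologicalSpace X] [ChartedSpace E X] in
theorem kpair_eq (omega : X → E [⋀^Fin 2]→L[ℝ] ℝ) (x : X) (a b : E) : kpair omega x a b =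
    ((omega x ![a, Complex.I • b] : ℝ) - Complex.I * (omega x ![a, b] : ℝ)) / 2 := by
  rw [kpair, herm, twoFormBilin_apply, twoFormBilin_apply]

theorem IsKahlerForm.isOneOne (h : IsKahlerForm omega) (x : X) :
    IsOneOne (twoFormBilin E ℝ (omega x)) :=
  ⟨fun a b ↦ by simp only [twoFormBilin_apply]; exact twoForm_swap _ _ _,
    fun a b ↦ by simp only [twoFormBilin_apply]; exact h.type_one_one x a b⟩

variable [IsManifold 𝓘(ℂ, E) ω X]

theorem IsKahlerForm.isOneOne_derivForm (h : IsKahlerForm omega) (x : X) (u : E) :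
    IsOneOne (derivForm omega x u) :=
  ⟨derivForm_swap h.smooth x u, derivForm_I h.smooth h.type_one_one x u⟩

theorem contMDiffAt_kpair (h : IsKahlerForm omega) {x : X} {Y Z : X → E} (hY : VFSmoothAt Y x)
    (hZ : VFSmoothAt Z x) :
    ContMDiffAt 𝓘(ℝ, E) 𝓘(ℝ, ℂ) ∞ (fun z ↦ kpair omega z (Y z) (Z z)) x := by
  have h1 := contMDiffAt_form_apply h.smooth hY (hZ.const_smul Complex.I)
  have h2 := contMDiffAt_form_apply h.smooth hY hZ
  have hx := mem_extChartAt_source (I := 𝓘(ℝ, E)) x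
  simp only [kpair_eq]
  rw [contMDiffAt_chart_iff hx] at h1 h2 ⊢
  exact ((Complex.ofRealCLM.contDiff.contDiffAt.comp _ h1).sub (contDiffAt_const.mul
    (Complex.ofRealCLM.contDiff.contDiffAt.comp _ h2))).div_const 2

theorem dFun_kpair (h : IsKahlerForm omega) {x : X} {Y Z : X → E} (hY : VFSmoothAt Y x)
    (hZ : VFSmoothAt Z x) (u : E) :
    dFun (fun z ↦ kpair omega z (Y z) (Z z)) x u = herm (derivForm omega x u) (Y x) (Z x) +
      kpair omega x (fderiv ℝ (chartVF ℝ x Y) (extChartAt 𝓘(ℝ, E) x x) u) (Z x) +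
      kpair omega x (Y x) (fderiv ℝ (chartVF ℝ x Z) (extChartAt 𝓘(ℝ, E) x x) u) := by
  have h1 := contMDiffAt_form_apply h.smooth hY (hZ.const_smul Complex.I)
  have h2 := contMDiffAt_form_apply h.smooth hY hZ
  have c1 : ContMDiffAt 𝓘(ℝ, E) 𝓘(ℝ, ℂ) ∞
      (fun z ↦ Complex.ofRealCLM (omega z ![Y z, Complex.I • Z z])) x :=
    Complex.ofRealCLM.contMDiff.contMDiffAt.comp x h1
  have c2 : ContMDiffAt 𝓘(ℝ, E) 𝓘(ℝ, ℂ) ∞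
      (fun z ↦ Complex.ofRealCLM (omega z ![Y z, Z z])) x :=
    Complex.ofRealCLM.contMDiff.contMDiffAt.comp x h2
  have e : (fun z ↦ kpair omega z (Y z) (Z z)) = fun z ↦ (1 / 2 : ℂ) *
      (Complex.ofRealCLM (omega z ![Y z, Complex.I • Z z]) -
        Complex.I * Complex.ofRealCLM (omega z ![Y z, Z z])) := by
    ext z
    rw [kpair_eq, Complex.ofRealCLM_apply, Complex.ofRealCLM_apply]
    ring
  have c3 := contMDiffAt_mul (contMDiffAt_const (c := Complex.I)) c2
  have c4 : ContMDiffAt 𝓘(ℝ, E) 𝓘(ℝ, ℂ) ∞ (fun z ↦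
      (Complex.ofRealCLM (omega z ![Y z, Complex.I • Z z]) -
        Complex.I * Complex.ofRealCLM (omega z ![Y z, Z z]))) x := c1.sub c3
  rw [e, dFun_const_mul _ c4, dFun_sub c1 c3, dFun_const_mul _ c2, dFun_clm _ h1, dFun_clm _ h2,
    dFun_form_apply h.smooth hY (hZ.const_smul Complex.I), dFun_form_apply h.smooth hY hZ,
    fderiv_chartVF_smul _ hZ, kpair_eq, kpair_eq, herm]
  simp only [Complex.ofRealCLM_apply, Complex.ofReal_add]
  ring

/-- `∂_U f`, the derivative of `f` along the `(1,0)`-part of `U`. -/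
def delFun (U : X → E) (f : X → ℂ) (x : X) : ℂ :=
  (dFun f x (U x) - Complex.I * dFun f x (Complex.I • U x)) / 2

/-- `∂̄_U s`, written with Lie brackets. -/
def dbarVF (U s : X → E) (x : X) : E :=
  (1 / 2 : ℂ) • (bracketVF U s x + Complex.I • bracketVF (fun z ↦ Complex.I • U z) s x)

/-- `h(D_U s, t)` for the Chern connection of `h`, written with Lie brackets. -/
def chernPairing (omega : X → E [⋀^Fin 2]→L[ℝ] ℝ) (s U t : X → E) (x : X) : ℂ :=
  delFun U (fun z ↦ kpair omega z (s z) (t z)) x + kpair omega x (dbarVF U s x) (t x) -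
    kpair omega x (s x) (dbarVF U t x)

theorem contMDiffAt_delFun {U : X → E} {f : X → ℂ} {x : X} (hU : VFSmoothAt U x)
    (hf : ContMDiffAt 𝓘(ℝ, E) 𝓘(ℝ, ℂ) ∞ f x) : ContMDiffAt 𝓘(ℝ, E) 𝓘(ℝ, ℂ) ∞ (delFun U f) x := by
  have h1 := contMDiffAt_dFun hf hU
  have h2 := contMDiffAt_mul (contMDiffAt_const (c := Complex.I))
    (contMDiffAt_dFun hf (hU.const_smul Complex.I))
  have h3 := contMDiffAt_mul (contMDiffAt_const (c := (1 / 2 : ℂ))) (h1.sub h2)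
  refine h3.congr_of_eventuallyEq (Filter.Eventually.of_forall fun z ↦ ?_)
  simp only [delFun]
  ring

variable [CompleteSpace E]

/-- The derivative of `U` enters the two brackets as -dU(s) and +dU(s) and cancels. What remains is
tensorial in `U`: the conjugate linear part of the derivative of `s`. -/
theorem dbarVF_self {U s : X → E} {x : X} (hU : VFSmoothAt U x) (hs : VFSmoothAt s x) :
    dbarVF U s x = (1 / 2 : ℂ) • (fderiv ℝ (chartVF ℝ x s) (extChartAt 𝓘(ℝ, E) x x) (U x) +
      Complex.I • fderiv ℝ (chartVF ℝ x s) (extChartAt 𝓘(ℝ, E) x x) (Complex.I • U x)) := by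
  rw [dbarVF, bracketVF_self hU hs, bracketVF_self (hU.const_smul _) hs, fderiv_chartVF_smul _ hU,
    smul_sub, smul_smul, Complex.I_mul_I]
  congr 1
  module

theorem VFSmoothAt.dbarVF {U s : X → E} {x : X} (hU : VFSmoothAt U x) (hs : VFSmoothAt s x) :
    VFSmoothAt (dbarVF U s) x :=
  ((hU.bracket hs).add (((hU.const_smul Complex.I).bracket hs).const_smul Complex.I)).const_smul _

/-- In the chart, ∂_U h(s, t) is (∂_U g)(s, t) plus h of the (1,0)-derivative of `s` with `t`, plus
h(s, ∂̄_U t). The last term is subtracted, and h(∂̄_U s, t) completes the full derivative of `s`. -/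
theorem chernPairing_self (h : IsKahlerForm omega) {s U t : X → E} {x : X} (hs : VFSmoothAt s x)
    (hU : VFSmoothAt U x) (ht : VFSmoothAt t x) :
    chernPairing omega s U t x =
      kpair omega x (fderiv ℝ (chartVF ℝ x s) (extChartAt 𝓘(ℝ, E) x x) (U x)) (t x) +
        kpairDel omega x (U x) (s x) (t x) := by
  rw [chernPairing, delFun, dFun_kpair h hs ht, dFun_kpair h hs ht, dbarVF_self hU hs,
    dbarVF_self hU ht, kpairDel, hermDel]
  simp only [kpair, herm_smul_left (h.isOneOne x), herm_smul_right, herm_add_left, herm_add_right,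
    map_div₀, map_one, map_ofNat, Complex.conj_I]
  ring

/-- Smoothness is visible in the bracket form only: `kpairDel` is computed in the preferred chart of
each point, and that chart need not vary continuously with the point. -/
theorem contMDiffAt_chernPairing (h : IsKahlerForm omega) {s U t : X → E} {x : X}
    (hs : VFSmoothAt s x) (hU : VFSmoothAt U x) (ht : VFSmoothAt t x) :
    ContMDiffAt 𝓘(ℝ, E) 𝓘(ℝ, ℂ) ∞ (chernPairing omega s U t) x :=
  ((contMDiffAt_delFun hU (contMDiffAt_kpair h hs ht)).add
    (contMDiffAt_kpair h (hU.dbarVF hs) ht)).sub (contMDiffAt_kpair h hs (hU.dbarVF ht))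

/-- `v` is a holomorphic vector field whose flow preserves `omega`. -/
structure IsHolomorphicIsometric (omega : X → E [⋀^Fin 2]→L[ℝ] ℝ) (v : X → E) : Prop where
  smooth : ∀ x, VFSmoothAt v x
  holomorphic : ∀ x, IsHolomorphicDerivAt v x
  dFun_kpair : ∀ (x : X) (s t : X → E), VFSmoothAt s x → VFSmoothAt t x →
    dFun (fun z ↦ kpair omega z (s z) (t z)) x (v x) =
      kpair omega x (bracketVF v s x) (t x) + kpair omega x (s x) (bracketVF v t x)

/-- The Jacobi identity, applied to `U` and to iU; holomorphy of `v` makes bracketing with `v`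
commute with i. -/
theorem bracketVF_dbarVF {v U s : X → E} {x : X} (hv : ∀ z, VFSmoothAt v z)
    (hv' : ∀ z, IsHolomorphicDerivAt v z) (hU : ∀ᶠ z in 𝓝 x, VFSmoothAt U z)
    (hs : ∀ᶠ z in 𝓝 x, VFSmoothAt s z) :
    bracketVF v (dbarVF U s) x = dbarVF (bracketVF v U) s x + dbarVF U (bracketVF v s) x := by
  have hU0 := hU.self_of_nhds
  have hs0 := hs.self_of_nhds
  have hIU := hU0.const_smul Complex.I
  have e : bracketVF v (fun z ↦ Complex.I • U z) =ᶠ[𝓝 x] fun z ↦ Complex.I • bracketVF v U z :=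
    hU.mono fun z hz ↦ bracketVF_I_smul (hv z) (hv' z) hz
  have b1 := hU0.bracket hs0
  have b2 := hIU.bracket hs0
  -- The factor 1/2 is real, so no holomorphy is needed to move it through the bracket.
  have half : ∀ W : X → E, VFSmoothAt W x →
      bracketVF v (fun z ↦ (1 / 2 : ℂ) • W z) x = (1 / 2 : ℂ) • bracketVF v W x := by
    intro W hW
    simpa using bracketVF_const_smul_right (1 / 2) (hv x) hW
  change bracketVF v (fun z ↦ (1 / 2 : ℂ) • (bracketVF U s z +
    Complex.I • bracketVF (fun z ↦ Complex.I • U z) s z)) x = _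
  rw [half _ (b1.add (b2.const_smul _)), bracketVF_add_right (hv x) b1 (b2.const_smul _),
    bracketVF_I_smul (hv x) (hv' x) b2, bracketVF_jacobi (hv x) hU0 hs0,
    bracketVF_jacobi (hv x) hIU hs0, bracketVF_congr e Filter.EventuallyEq.rfl, dbarVF, dbarVF]
  module

/-- Commute derivatives through `dFun_bracketVF`, once for `U` and once for iU, using [v, iU] = i
[v, U]. -/
theorem dFun_delFun {v U : X → E} {f : X → ℂ} {x : X} (hv : ∀ z, VFSmoothAt v z)
    (hv' : ∀ z, IsHolomorphicDerivAt v z) (hU : VFSmoothAt U x)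
    (hf : ContMDiffAt 𝓘(ℝ, E) 𝓘(ℝ, ℂ) ∞ f x) :
    dFun (delFun U f) x (v x) =
      delFun (bracketVF v U) f x + delFun U (fun z ↦ dFun f z (v z)) x := by
  have hIU := hU.const_smul Complex.I
  have h1 := contMDiffAt_dFun hf hU
  have h2 := contMDiffAt_dFun hf hIU
  have e : delFun U f = fun z ↦ (1 / 2 : ℂ) *
      (dFun f z (U z) - Complex.I * dFun f z (Complex.I • U z)) := by
    ext z; rw [delFun]; ring
  have h3 := contMDiffAt_mul (contMDiffAt_const (c := Complex.I)) h2
  have h4 : ContMDiffAt 𝓘(ℝ, E) 𝓘(ℝ, ℂ) ∞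
    (fun z ↦ (dFun f z (U z) - Complex.I * dFun f z (Complex.I • U z))) x := h1.sub h3
  have b1 := dFun_bracketVF hf (hv x) hU
  have b2 := dFun_bracketVF hf (hv x) hIU
  rw [bracketVF_I_smul (hv x) (hv' x) hU] at b2
  rw [e, dFun_const_mul _ h4, dFun_sub h1 h3, dFun_const_mul _ h2, delFun, delFun, b1, b2]
  ring

/-- Each ingredient (the pairing, ∂ of a function, ∂̄ of a field) satisfies a Leibniz rule along a
holomorphic isometric `v`, hence so does their combination. This is the infinitesimal invariance of
the Chern connection. -/
theorem dFun_chernPairing (h : IsKahlerForm omega) {v : X → E} (hv : IsHolomorphicIsometric omega v)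
    {s U t : X → E} {x : X} (hs : ∀ᶠ z in 𝓝 x, VFSmoothAt s z)
    (hU : ∀ᶠ z in 𝓝 x, VFSmoothAt U z) (ht : ∀ᶠ z in 𝓝 x, VFSmoothAt t z) :
    dFun (chernPairing omega s U t) x (v x) =
      chernPairing omega (bracketVF v s) U t x + chernPairing omega s (bracketVF v U) t x +
        chernPairing omega s U (bracketVF v t) x := by
  have hs0 := hs.self_of_nhds
  have hU0 := hU.self_of_nhds
  have ht0 := ht.self_of_nhds
  have hv0 := hv.smooth x
  have k1 := contMDiffAt_kpair h (hv0.bracket hs0) ht0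
  have k2 := contMDiffAt_kpair h hs0 (hv0.bracket ht0)
  have e : (fun z ↦ dFun (fun z ↦ kpair omega z (s z) (t z)) z (v z)) =ᶠ[𝓝 x]
      fun z ↦ kpair omega z (bracketVF v s z) (t z) + kpair omega z (s z) (bracketVF v t z) := by
    filter_upwards [hs, ht] with z hsz htz using hv.dFun_kpair z s t hsz htz
  have e1 : delFun U (fun z ↦ dFun (fun z ↦ kpair omega z (s z) (t z)) z (v z)) x =
      delFun U (fun z ↦ kpair omega z (bracketVF v s z) (t z)) x +
      delFun U (fun z ↦ kpair omega z (s z) (bracketVF v t z)) x := by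
    rw [delFun, dFun_congr e, dFun_add k1 k2, dFun_add k1 k2, delFun, delFun]
    ring
  have c1 := contMDiffAt_delFun hU0 (contMDiffAt_kpair h hs0 ht0)
  have c2 := contMDiffAt_kpair h (hU0.dbarVF hs0) ht0
  have c3 := contMDiffAt_kpair h hs0 (hU0.dbarVF ht0)
  have c12 : ContMDiffAt 𝓘(ℝ, E) 𝓘(ℝ, ℂ) ∞ (fun x ↦ delFun U (fun z ↦ kpair omega z (s z) (t z)) x +
    kpair omega x (dbarVF U s x) (t x)) x := c1.add c2
  have e2 : chernPairing omega s U t = fun x ↦ (delFun U (fun z ↦ kpair omega z (s z) (t z)) x +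
    kpair omega x (dbarVF U s x) (t x)) - kpair omega x (s x) (dbarVF U t x) := rfl
  rw [e2, dFun_sub c12 c3, dFun_add c1 c2, dFun_delFun hv.smooth hv.holomorphic hU0
    (contMDiffAt_kpair h hs0 ht0), hv.dFun_kpair x _ _ (hU0.dbarVF hs0) ht0,
    hv.dFun_kpair x _ _ hs0 (hU0.dbarVF ht0), e1,
    bracketVF_dbarVF hv.smooth hv.holomorphic hU hs, bracketVF_dbarVF hv.smooth hv.holomorphic hU ht,
    chernPairing, chernPairing, chernPairing]
  simp only [kpair, herm_add_left, herm_add_right]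
  ring

end Pairing

/-! ### Holomorphic vector fields -/

section HolVF

variable {E X : Type*} [NormedAddCommGroup E] [NormedSpace ℂ E]
  [TopologicalSpace X] [ChartedSpace E X] [IsManifold 𝓘(ℂ, E) ω X]

/-- Holomorphy of a vector field near a point. -/
def VFHolAt (Y : X → E) (x : X) : Prop :=
  ContMDiffAt 𝓘(ℂ, E) 𝓘(ℂ, E).tangent ω (fun x ↦ (⟨x, Y x⟩ : TangentBundle 𝓘(ℂ, E) X)) x

theorem isHolomorphicVF_iff {U : Set X} (hU : IsOpen U) {Y : X → E} :
    IsHolomorphicVF U Y ↔ ∀ x ∈ U, VFHolAt Y x :=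
  ⟨fun h x hx ↦ (h x hx).contMDiffAt (hU.mem_nhds hx), fun h x hx ↦ (h x hx).contMDiffWithinAt⟩

theorem vfHolAt_iff {Y : X → E} {x₀ x : X} (hx : x ∈ (extChartAt 𝓘(ℂ, E) x₀).source) :
    VFHolAt Y x ↔ ContDiffAt ℂ ω (chartVF ℂ x₀ Y) (extChartAt 𝓘(ℂ, E) x₀ x) := by
  have : IsManifold 𝓘(ℂ, E) (ω + 1) X := by simpa using ‹IsManifold 𝓘(ℂ, E) ω X›
  exact contMDiffAt_vf_chart_iff hx

theorem chartVF_restrictScalars {Y : X → E} {x₀ x : X} (hx : x ∈ (extChartAt 𝓘(ℝ, E) x₀).source) :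
    chartVF ℝ x₀ Y =ᶠ[𝓝 (extChartAt 𝓘(ℝ, E) x₀ x)] chartVF ℂ x₀ Y := by
  filter_upwards [eventually_chart_symm hx (p := fun _ ↦ True) (by simp)] with y hy
  simp only [chartVF]
  rw [chartD_restrictScalars ((extChartAt 𝓘(ℝ, E) x₀).map_target hy.1)]
  rfl

theorem VFHolAt.vfSmoothAt {Y : X → E} {x : X} (h : VFHolAt Y x) : VFSmoothAt Y x := by
  have hx := mem_extChartAt_source (I := 𝓘(ℝ, E)) x
  rw [vfSmoothAt_iff hx]
  rw [vfHolAt_iff (mem_extChartAt_source x)] at h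
  exact ((h.restrict_scalars ℝ).of_le le_top).congr_of_eventuallyEq (chartVF_restrictScalars hx)

theorem VFHolAt.eventually {Y : X → E} {x : X} (h : VFHolAt Y x) : ∀ᶠ z in 𝓝 x, VFHolAt Y z := by
  have : IsManifold 𝓘(ℂ, E).tangent ω (TangentBundle 𝓘(ℂ, E) X) := by
    infer_instance
  exact (contMDiffAt_iff_contMDiffAt_nhds (by simp)).1 h

theorem VFHolAt.isHolomorphicDerivAt {Y : X → E} {x : X} (h : VFHolAt Y x) :
    IsHolomorphicDerivAt Y x := by
  intro u
  have hx := mem_extChartAt_source (I := 𝓘(ℝ, E)) x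
  rw [vfHolAt_iff (mem_extChartAt_source x)] at h
  have hd : DifferentiableAt ℂ (chartVF ℂ x Y) (extChartAt 𝓘(ℝ, E) x x) :=
    h.differentiableAt (by simp)
  rw [(chartVF_restrictScalars hx).fderiv_eq, hd.fderiv_restrictScalars ℝ]
  simp

end HolVF

/-! ### Vertical tangent spaces of a submersion -/

section Submersion

variable {E F X B : Type*} [NormedAddCommGroup E] [NormedSpace ℂ E]
  [NormedAddCommGroup F] [NormedSpace ℂ F]
  [TopologicalSpace X] [ChartedSpace E X] [IsManifold 𝓘(ℂ, E) ω X]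
  [TopologicalSpace B] [ChartedSpace F B] [IsManifold 𝓘(ℂ, F) ω B] {π : X → B}

-- The normal form of a submersion is a product projection, so it has a holomorphic local section
-- through `x`; differentiating π ∘ τ = id gives a right inverse.
omit [IsManifold 𝓘(ℂ, E) ω X] [IsManifold 𝓘(ℂ, F) ω B] in
theorem mfderiv_surjective_of_isSubmersion (h : Manifold.IsSubmersion 𝓘(ℂ, E) 𝓘(ℂ, F) ω π)
    (x : X) : Function.Surjective (mfderiv 𝓘(ℂ, E) 𝓘(ℂ, F) π x : E →L[ℂ] F) := by
  obtain ⟨F', _, _, hs⟩ := h.isSubmersionAt x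
  set φ := hs.domChart
  set ψ := hs.codChart
  have hx : x ∈ φ.source := hs.mem_domChart_source
  have hπx : π x ∈ ψ.source := hs.mem_codChart_source
  -- The fibre coordinate of `x`, kept constant along the section so that the section passes through
  -- `x`.
  set v₀ := (hs.equiv (φ x)).2 with hv₀
  have key : ∀ z ∈ φ.target, ψ (π (φ.symm z)) = (hs.equiv z).1 := fun z hz ↦
    hs.writtenInCharts (by simpa using hz)
  have e0 : hs.equiv.symm (ψ (π x), v₀) = φ x := by
    rw [ContinuousLinearEquiv.symm_apply_eq]
    refine Prod.ext ?_ rfl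
    have := key (φ x) (φ.map_source hx)
    rw [φ.left_inv hx] at this
    exact this
  let τ : B → X := fun b ↦ φ.symm (hs.equiv.symm (ψ b, v₀))
  have hτx : τ (π x) = x := by simp only [τ]; rw [e0, φ.left_inv hx]
  have hψ : ContMDiffAt 𝓘(ℂ, F) 𝓘(ℂ, F) ω ψ (π x) :=
    (contMDiffOn_of_mem_maximalAtlas hs.codChart_mem_maximalAtlas).contMDiffAt
      (ψ.open_source.mem_nhds hπx)
  have hφ : ContMDiffAt 𝓘(ℂ, E) 𝓘(ℂ, E) ω φ.symm (φ x) :=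
    (contMDiffOn_symm_of_mem_maximalAtlas hs.domChart_mem_maximalAtlas).contMDiffAt
      (φ.open_target.mem_nhds (φ.map_source hx))
  have hlin : ContDiff ℂ ω (fun c : F ↦ hs.equiv.symm (c, v₀)) := by fun_prop
  have hmid : ContMDiffAt 𝓘(ℂ, F) 𝓘(ℂ, E) ω (fun b ↦ hs.equiv.symm (ψ b, v₀)) (π x) :=
    hlin.contMDiff.contMDiffAt.comp (π x) hψ
  have hτ : ContMDiffAt 𝓘(ℂ, F) 𝓘(ℂ, E) ω τ (π x) :=
    ContMDiffAt.comp (π x) (by rw [e0]; exact hφ) hmid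
  have hid : π ∘ τ =ᶠ[𝓝 (π x)] id := by
    have h1 : ∀ᶠ b in 𝓝 (π x), hs.equiv.symm (ψ b, v₀) ∈ φ.target := by
      refine hmid.continuousAt.eventually ?_
      simp only [e0]
      exact φ.open_target.mem_nhds (φ.map_source hx)
    filter_upwards [h1, ψ.open_source.mem_nhds hπx] with b hb hb'
    have h2 := key _ hb
    rw [ContinuousLinearEquiv.apply_symm_apply] at h2
    exact ψ.injOn (hs.mapsto_domChart_source_codChart_source (φ.map_target hb)) hb' h2
  have hπd : MDifferentiableAt 𝓘(ℂ, E) 𝓘(ℂ, F) π (τ (π x)) := by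
    rw [hτx]; exact (h.contMDiff x).mdifferentiableAt (by simp)
  have hc := mfderiv_comp (π x) hπd (hτ.mdifferentiableAt (by simp))
  rw [hid.mfderiv_eq, mfderiv_id] at hc
  have hsurj : Function.Surjective (mfderiv 𝓘(ℂ, E) 𝓘(ℂ, F) π (τ (π x)) : E →L[ℂ] F) :=
    fun c ↦ ⟨(mfderiv 𝓘(ℂ, F) 𝓘(ℂ, E) τ (π x) : F →L[ℂ] E) c, (DFunLike.congr_fun hc c).symm⟩
  rwa [hτx] at hsurj

omit [IsManifold 𝓘(ℂ, E) ω X] [IsManifold 𝓘(ℂ, F) ω B] in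
theorem finrank_vert [FiniteDimensional ℂ E] [FiniteDimensional ℂ F]
    (h : Manifold.IsSubmersion 𝓘(ℂ, E) 𝓘(ℂ, F) ω π) {n : ℕ}
    (hn : Module.finrank ℂ E = Module.finrank ℂ F + n) (x : X) :
    Module.finrank ℂ (vert E F π x) = n := by
  have h0 := mfderiv_surjective_of_isSubmersion h x
  have h1 : ∀ T : E →ₗ[ℂ] F, Function.Surjective T → Module.finrank ℂ (LinearMap.ker T) = n := by
    intro T hT
    have h2 := LinearMap.finrank_range_add_finrank_ker T
    rw [LinearMap.range_eq_top.2 hT, finrank_top] at h2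
    omega
  exact h1 _ h0

/-- The chart differentials on source and target are bijective, so verticality is the kernel
condition for the coordinate expression of π. -/
theorem mem_vert_iff_chart (h : Manifold.IsSubmersion 𝓘(ℂ, E) 𝓘(ℂ, F) ω π) {x₀ x : X}
    (hx : x ∈ (extChartAt 𝓘(ℂ, E) x₀).source)
    (hπx : π x ∈ (extChartAt 𝓘(ℂ, F) (π x₀)).source) (w : E) :
    w ∈ vert E F π x ↔
      fderiv ℂ (extChartAt 𝓘(ℂ, F) (π x₀) ∘ π ∘ (extChartAt 𝓘(ℂ, E) x₀).symm)
        (extChartAt 𝓘(ℂ, E) x₀ x) (chartD ℂ x₀ x w) = 0 := by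
  have d1 : MDifferentiableAt 𝓘(ℂ, F) 𝓘(ℂ, F) (extChartAt 𝓘(ℂ, F) (π x₀)) (π x) :=
    mdifferentiableAt_extChartAt (by simpa using hπx)
  have d2 : MDifferentiableAt 𝓘(ℂ, E) 𝓘(ℂ, F) π x := (h.contMDiff x).mdifferentiableAt (by simp)
  have h1 := mfderiv_eq_fderiv_comp_chartD hx (d1.comp x d2)
  rw [mfderiv_comp x d1 d2] at h1
  have h2 := DFunLike.congr_fun h1 w
  rw [← Function.comp_assoc]
  have h3 : w ∈ vert E F π x ↔ (mfderiv 𝓘(ℂ, E) 𝓘(ℂ, F) π x : E →L[ℂ] F) w = 0 := Iff.rfl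
  have h4 : (chartD (E := F) ℂ (π x₀) (π x))
      ((mfderiv 𝓘(ℂ, E) 𝓘(ℂ, F) π x : E →L[ℂ] F) w) = 0 ↔
      (mfderiv 𝓘(ℂ, E) 𝓘(ℂ, F) π x : E →L[ℂ] F) w = 0 :=
    map_eq_zero_iff _ (chartD_bijective hπx).1
  exact h3.trans (h4.symm.trans (Eq.congr_left h2))

variable (F) in
open Classical in
/-- Extension of a local section of the vertical tangent bundle by zero. -/
def vertSection (π : X → B) (e : X → E) (x : X) : vert E F π x :=
  if h : e x ∈ vert E F π x then ⟨e x, h⟩ else 0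

omit [IsManifold 𝓘(ℂ, E) ω X] [IsManifold 𝓘(ℂ, F) ω B] in
theorem vertSection_coe {e : X → E} {x : X} (h : e x ∈ vert E F π x) :
    (vertSection F π e x : E) = e x := by
  rw [vertSection, dif_pos h]

/-- Let P(y) be the derivative of π in charts and S a right inverse of P at the centre. The map w ↦
w - S (P(y) S)⁻¹ P(y) w takes values in ker P(y) and depends holomorphically on y. Applied to a
basis of the central kernel it yields the frame. -/
theorem exists_holomorphic_frame [FiniteDimensional ℂ E] [FiniteDimensional ℂ F]
    (h : Manifold.IsSubmersion 𝓘(ℂ, E) 𝓘(ℂ, F) ω π) {n : ℕ}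
    (hn : Module.finrank ℂ E = Module.finrank ℂ F + n) (x₀ : X) :
    ∃ e : Fin n → ∀ y, vert E F π y, ∀ᶠ y in 𝓝 x₀,
      (∀ i, VFHolAt (fun z ↦ (e i z : E)) y) ∧ LinearIndependent ℂ (fun i ↦ e i y) := by
  have hc : CompleteSpace E := FiniteDimensional.complete ℂ E
  have hcF : CompleteSpace F := FiniteDimensional.complete ℂ F
  set φ := extChartAt 𝓘(ℂ, E) x₀ with hφ
  have hx₀ : x₀ ∈ φ.source := mem_extChartAt_source x₀
  set Q : E → F := extChartAt 𝓘(ℂ, F) (π x₀) ∘ π ∘ φ.symm with hQ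
  have hQs : ContDiffAt ℂ ω Q (φ x₀) := by
    have h1 : ContMDiffAt 𝓘(ℂ, E) 𝓘(ℂ, F) ω (extChartAt 𝓘(ℂ, F) (π x₀) ∘ π) x₀ :=
      ContMDiffAt.comp x₀ (contMDiffAt_extChartAt (I := 𝓘(ℂ, F))) (h.contMDiff x₀)
    exact (contMDiffAt_chart_iff hx₀).1 h1
  set P : E → E →L[ℂ] F := fderiv ℂ Q with hP
  have hPs : ContDiffAt ℂ ω P (φ x₀) := hQs.fderiv_right (by simp)
  have hsrc : ∀ᶠ x in 𝓝 x₀, x ∈ φ.source ∧ π x ∈ (extChartAt 𝓘(ℂ, F) (π x₀)).source :=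
    Filter.Eventually.and (extChartAt_source_mem_nhds (I := 𝓘(ℂ, E)) x₀)
      ((h.contMDiff x₀).continuousAt (extChartAt_source_mem_nhds (I := 𝓘(ℂ, F)) (π x₀)))
  have hmem : ∀ x, x ∈ φ.source ∧ π x ∈ (extChartAt 𝓘(ℂ, F) (π x₀)).source → ∀ w : E,
      w ∈ vert E F π x ↔ P (φ x) (chartD ℂ x₀ x w) = 0 := fun x hx w ↦
    mem_vert_iff_chart h hx.1 hx.2 w
  have hmem₀ : ∀ w : E, w ∈ vert E F π x₀ ↔ P (φ x₀) w = 0 := by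
    intro w
    rw [hmem x₀ hsrc.self_of_nhds, chartD_self]; rfl
  have hsurj : Function.Surjective (P (φ x₀)) := by
    have : Module.finrank ℂ (LinearMap.ker (P (φ x₀)).toLinearMap) = n := by
      have e : LinearMap.ker (P (φ x₀)).toLinearMap = vert E F π x₀ := by
        ext w; exact (hmem₀ w).symm
      rw [e, finrank_vert h hn]
    have h1 := LinearMap.finrank_range_add_finrank_ker (P (φ x₀)).toLinearMap
    have h2 : Module.finrank ℂ (LinearMap.range (P (φ x₀)).toLinearMap) = Module.finrank ℂ F := by
      omega
    exact LinearMap.range_eq_top.1 (Submodule.eq_top_of_finrank_eq h2)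
  obtain ⟨S₀, hS₀⟩ := (P (φ x₀)).toLinearMap.exists_rightInverse_of_surjective
    (LinearMap.range_eq_top.2 hsurj)
  set S : F →L[ℂ] E := LinearMap.toContinuousLinearMap S₀
  have hS : ∀ c, P (φ x₀) (S c) = c := fun c ↦ LinearMap.congr_fun hS₀ c
  have hPS : (P (φ x₀)).comp S = ContinuousLinearMap.id ℂ F := by ext c; exact hS c
  set J : E → F →L[ℂ] F := fun y ↦ ((P y).comp S).inverse with hJ
  have hcomp : ContDiffAt ℂ ω (fun y ↦ (P y).comp S) (φ x₀) := hPs.clm_comp contDiffAt_const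
  have hJs : ContDiffAt ℂ ω J (φ x₀) := by
    have h1 : ContDiffAt ℂ ω ContinuousLinearMap.inverse ((P (φ x₀)).comp S) := by
      rw [hPS]
      exact contDiffAt_map_inverse (ContinuousLinearEquiv.refl ℂ F)
    exact h1.comp (φ x₀) hcomp
  -- P S is the identity at the centre, and invertibility is an open condition.
  have hinv : ∀ᶠ y in 𝓝 (φ x₀), ((P y).comp S).IsInvertible := by
    have h1 : ∀ᶠ T in 𝓝 ((P (φ x₀)).comp S), T.IsInvertible := by
      rw [hPS]
      exact ContinuousLinearEquiv.nhds (ContinuousLinearEquiv.refl ℂ F)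
    exact hcomp.continuousAt.eventually h1
  let b := Module.finBasisOfFinrankEq ℂ (vert E F π x₀) (finrank_vert h hn x₀)
  let ε : Fin n → E → E := fun i y ↦ (b i : E) - S (J y (P y (b i)))
  have hεs : ∀ i, ContDiffAt ℂ ω (ε i) (φ x₀) := fun i ↦
    contDiffAt_const.sub (S.contDiff.contDiffAt.comp _
      (hJs.clm_apply (hPs.clm_apply contDiffAt_const)))
  have hPε : ∀ i y, ((P y).comp S).IsInvertible → P y (ε i y) = 0 := by
    intro i y hy
    have := DFunLike.congr_fun hy.self_comp_inverse (P y (b i))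
    simp only [ε, map_sub]
    exact sub_eq_zero.2 this.symm
  let Y : Fin n → X → E := fun i x ↦ symmD ℂ x₀ (φ x) (ε i (φ x))
  have hgood : ∀ᶠ x in 𝓝 x₀, (x ∈ φ.source ∧ π x ∈ (extChartAt 𝓘(ℂ, F) (π x₀)).source) ∧
      ((P (φ x)).comp S).IsInvertible :=
    hsrc.and ((continuousAt_extChartAt (I := 𝓘(ℂ, E)) x₀).eventually hinv)
  have hchartY : ∀ i x, x ∈ φ.source → chartD ℂ x₀ x (Y i x) = ε i (φ x) := by
    intro i x hx
    have := chartD_symmD (𝕜 := ℂ) (φ.map_source hx) (ε i (φ x))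
    rwa [φ.left_inv hx] at this
  have hYmem : ∀ᶠ x in 𝓝 x₀, ∀ i, Y i x ∈ vert E F π x := by
    filter_upwards [hgood] with x hx i
    rw [hmem x hx.1, hchartY i x hx.1.1]
    exact hPε i _ hx.2
  -- The fields are vertical near x₀ only; sections must be defined everywhere, so zero is
  -- substituted where verticality fails.
  refine ⟨fun i ↦ vertSection F π (Y i), ?_⟩
  have hcoe : ∀ i, (fun x ↦ (vertSection F π (Y i) x : E)) =ᶠ[𝓝 x₀] Y i := by
    intro i
    filter_upwards [hYmem] with x hx
    exact vertSection_coe (hx i)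
  have hhol : ∀ i, VFHolAt (fun z ↦ (vertSection F π (Y i) z : E)) x₀ := by
    intro i
    rw [vfHolAt_iff hx₀]
    refine (hεs i).congr_of_eventuallyEq ?_
    filter_upwards [eventually_chart_symm (X := X) hx₀ (hcoe i)] with y hy
    have hy2 : (vertSection F π (Y i) (φ.symm y) : E) = Y i (φ.symm y) := hy.2
    rw [chartVF, hy2, hchartY i _ (φ.map_target hy.1)]
    exact congrArg (ε i) (φ.right_inv hy.1)
  filter_upwards [Filter.eventually_all.2 fun i ↦ (hhol i).eventually, hYmem, hgood] with x h1 h2 h3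
  refine ⟨h1, ?_⟩
  rw [Fintype.linearIndependent_iff]
  intro g hg
  have hg1 : ∑ i, g i • Y i x = 0 := by
    have := congrArg (Subtype.val) hg
    rw [AddSubmonoidClass.coe_finsetSum] at this
    refine Eq.trans ?_ this
    refine Finset.sum_congr rfl fun i _ ↦ ?_
    rw [Submodule.coe_smul, vertSection_coe (h2 i)]
  have hg2 : ∑ i, g i • ε i (φ x) = 0 := by
    have := congrArg (chartD (E := E) ℂ x₀ x) hg1
    rw [map_sum, map_zero] at this
    rw [← this]
    refine Finset.sum_congr rfl fun i _ ↦ ?_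
    rw [map_smul, hchartY i x h3.1.1]
  -- A relation among the frame makes Σ gᵢ bᵢ equal to S c for some c. The bᵢ lie in the kernel at
  -- the centre, where P S = id, so c = 0 and the relation descends to the basis.
  have hg3 : ((∑ i, g i • b i : vert E F π x₀) : E) =
      S (J (φ x) (P (φ x) (∑ i, g i • (b i : E)))) := by
    rw [← sub_eq_zero, ← hg2]
    simp [ε, smul_sub, Finset.sum_sub_distrib, map_sum]
  have hg4 : P (φ x₀) ((∑ i, g i • b i : vert E F π x₀) : E) = 0 := (hmem₀ _).1 (Subtype.mem _)
  rw [hg3, hS] at hg4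
  rw [hg4, map_zero] at hg3
  exact Fintype.linearIndependent_iff.1 b.linearIndependent g (Subtype.ext hg3)

end Submersion

/-! ### Hermitian inner products on finite dimensional spaces -/

section HermitianInner

variable {V : Type*} [AddCommGroup V] [Module ℂ V]

/-- A definite Hermitian form, linear in the first argument. -/
structure IsHermitianInner (h : V → V → ℂ) : Prop where
  add_left : ∀ a b c, h (a + b) c = h a c + h b c
  smul_left : ∀ (z : ℂ) a b, h (z • a) b = z * h a b
  conj : ∀ a b, starRingEnd ℂ (h a b) = h b a
  definite : ∀ a, h a a = 0 → a = 0

variable {h : V → V → ℂ}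

namespace IsHermitianInner

theorem smul_right (hh : IsHermitianInner h) (z : ℂ) (a b : V) :
    h a (z • b) = starRingEnd ℂ z * h a b := by
  rw [← hh.conj, hh.smul_left, map_mul, hh.conj]

theorem zero_left (hh : IsHermitianInner h) (a : V) : h 0 a = 0 := by
  simpa using hh.smul_left 0 0 a

theorem neg_left (hh : IsHermitianInner h) (a b : V) : h (-a) b = - h a b := by
  simpa using hh.smul_left (-1) a b

theorem sub_left (hh : IsHermitianInner h) (a b c : V) : h (a - b) c = h a c - h b c := by
  rw [sub_eq_add_neg, hh.add_left, hh.neg_left, sub_eq_add_neg]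

theorem sub_right (hh : IsHermitianInner h) (a b c : V) : h a (b - c) = h a b - h a c := by
  rw [← hh.conj, hh.sub_left, map_sub, hh.conj, hh.conj]

theorem sum_left (hh : IsHermitianInner h) {ι : Type*} (s : Finset ι) (a : ι → V) (b : V) :
    h (∑ i ∈ s, a i) b = ∑ i ∈ s, h (a i) b := by
  classical
  induction s using Finset.induction_on with
  | empty => simp [hh.zero_left]
  | insert i s hi ih => rw [Finset.sum_insert hi, Finset.sum_insert hi, hh.add_left, ih]

theorem sum_right (hh : IsHermitianInner h) {ι : Type*} (s : Finset ι) (a : ι → V) (b : V) :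
    h b (∑ i ∈ s, a i) = ∑ i ∈ s, h b (a i) := by
  rw [← hh.conj, hh.sum_left, map_sum]
  simp only [hh.conj]

theorem ext (hh : IsHermitianInner h) {a b : V} (hab : ∀ t, h a t = h b t) : a = b := by
  refine sub_eq_zero.1 (hh.definite _ ?_)
  rw [hh.sub_left, hab, sub_self]

theorem ext_basis (hh : IsHermitianInner h) {ι : Type*} [Fintype ι] (e : Module.Basis ι ℂ V)
    {a b : V} (hab : ∀ i, h a (e i) = h b (e i)) : a = b := by
  refine hh.ext fun t ↦ ?_
  rw [← e.sum_repr t, hh.sum_right, hh.sum_right]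
  simp only [hh.smul_right, hab]

variable [FiniteDimensional ℂ V]

/-- The identification of vectors with their pairings against a basis. -/
def flat (hh : IsHermitianInner h) : V ≃ₗ[ℂ] (Fin (Module.finrank ℂ V) → ℂ) :=
  LinearEquiv.ofInjectiveOfFinrankEq
    { toFun := fun a i ↦ h a (Module.finBasis ℂ V i)
      map_add' := fun a b ↦ funext fun i ↦ hh.add_left _ _ _
      map_smul' := fun z a ↦ funext fun i ↦ hh.smul_left _ _ _ }
    (fun _ _ hab ↦ hh.ext_basis (Module.finBasis ℂ V) fun i ↦ congrFun hab i) (by simp)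

/-- The vector representing a conjugate linear functional. -/
def sharp (hh : IsHermitianInner h) (g : V → ℂ) : V :=
  hh.flat.symm fun i ↦ g (Module.finBasis ℂ V i)

theorem sharp_apply (hh : IsHermitianInner h) {g : V → ℂ} (hg : ∀ a b, g (a + b) = g a + g b)
    (hg' : ∀ (z : ℂ) a, g (z • a) = starRingEnd ℂ z * g a) (t : V) : h (hh.sharp g) t = g t := by
  have h1 : ∀ i, h (hh.sharp g) (Module.finBasis ℂ V i) = g (Module.finBasis ℂ V i) := fun i ↦
    congrFun (hh.flat.apply_symm_apply fun i ↦ g (Module.finBasis ℂ V i)) i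
  have h0 : g 0 = 0 := by simpa using hg' 0 0
  have hs : ∀ (s : Finset (Fin (Module.finrank ℂ V))) (a : Fin (Module.finrank ℂ V) → V),
      g (∑ i ∈ s, a i) = ∑ i ∈ s, g (a i) := by
    intro s a
    induction s using Finset.induction_on with
    | empty => simp [h0]
    | insert i s hi ih => rw [Finset.sum_insert hi, Finset.sum_insert hi, hg, ih]
  conv_lhs => rw [← (Module.finBasis ℂ V).sum_repr t, hh.sum_right]
  conv_rhs => rw [← (Module.finBasis ℂ V).sum_repr t, hs]
  simp only [hh.smul_right, hg', h1]

theorem sharp_add (hh : IsHermitianInner h) (f g : V → ℂ) :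
    hh.sharp (fun t ↦ f t + g t) = hh.sharp f + hh.sharp g :=
  (hh.flat.symm.map_add _ _)

theorem sharp_smul (hh : IsHermitianInner h) (z : ℂ) (g : V → ℂ) :
    hh.sharp (fun t ↦ z * g t) = z • hh.sharp g :=
  (hh.flat.symm.map_smul _ _)

end IsHermitianInner

end HermitianInner

/-! ### Uniqueness of Chern connections -/

section Uniqueness

variable {E X : Type*} [NormedAddCommGroup E] [NormedSpace ℂ E]
  [TopologicalSpace X] [ChartedSpace E X] [IsManifold 𝓘(ℂ, E) ω X]
  {K : Type*} [Group K] [MulAction K X] {W : BundleData X K}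

/-- The difference A of the two connections satisfies h(A_u s, t) + h(s, A_u t) = 0. On holomorphic
sections A is complex linear in u, so passing from u to iu changes the relative sign and both terms
vanish. A smooth section is then paired with holomorphic ones, which attain every value in the
fibre. -/
theorem chernConnection_unique {h : ∀ x, W.Fib x → W.Fib x → ℂ}
    (hh : ∀ x, IsHermitianInner (h x))
    (mono : ∀ (U U' : Set X) (s : W.Sec), U' ⊆ U → W.IsSmooth U s → W.IsSmooth U' s)
    (ext : ∀ (x : X) (w : W.Fib x), ∃ (U : Set X) (e : W.Sec), IsOpen U ∧ x ∈ U ∧ W.IsHol U e ∧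
      W.IsSmooth U e ∧ e x = w)
    {D D' : W.Op E} (hD : IsChernConnection W h D) (hD' : IsChernConnection W h D')
    {U : Set X} {s : W.Sec} (hU : IsOpen U) (hs : W.IsSmooth U s) {x : X} (hx : x ∈ U) :
    D s x = D' s x := by
  have key : ∀ (U : Set X) (s t : W.Sec), IsOpen U → W.IsSmooth U s → W.IsSmooth U t → x ∈ U →
      ∀ u, h x (D s x u - D' s x u) (t x) + h x (s x) (D t x u - D' t x u) = 0 := by
    intro U s t hU hs ht hx u
    have h1 := hD.metric U s t hU hs ht x hx u
    rw [hD'.metric U s t hU hs ht x hx u] at h1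
    rw [(hh x).sub_left, (hh x).sub_right]
    linear_combination -h1
  have hol : ∀ (U : Set X) (e : W.Sec), IsOpen U → W.IsHol U e → W.IsSmooth U e → x ∈ U →
      ∀ u, D e x u - D' e x u = 0 := by
    intro U e hU he he' hx u
    refine (hh x).ext fun w ↦ ?_
    obtain ⟨U', e', hU', hx', hol', hs', rfl⟩ := ext x w
    have hV := hU.inter hU'
    have k1 := key _ e e' hV (mono _ _ _ Set.inter_subset_left he')
      (mono _ _ _ Set.inter_subset_right hs') ⟨hx, hx'⟩ u
    -- The identity `k1` at iu: the factor is i in the first slot and -i in the second.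
    have k2 := key _ e e' hV (mono _ _ _ Set.inter_subset_left he')
      (mono _ _ _ Set.inter_subset_right hs') ⟨hx, hx'⟩ (Complex.I • u)
    rw [hD.holomorphic U e hU he x hx, hD'.holomorphic U e hU he x hx,
      hD.holomorphic U' e' hU' hol' x hx', hD'.holomorphic U' e' hU' hol' x hx', ← smul_sub,
      ← smul_sub, (hh x).smul_left, (hh x).smul_right, Complex.conj_I] at k2
    rw [(hh x).zero_left]
    linear_combination (1 / 2 : ℂ) * k1 - (Complex.I / 2) * k2 + (-(1 / 2 : ℂ) * h x (D e x u - D' e x u) (e' x) +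
      (1 / 2) * h x (e x) (D e' x u - D' e' x u)) * (-Complex.I_mul_I)
  ext u
  refine sub_eq_zero.1 ((hh x).ext fun w ↦ ?_)
  obtain ⟨U', e', hU', hx', hol', hs', rfl⟩ := ext x w
  have k1 := key _ s e' (hU.inter hU') (mono _ _ _ Set.inter_subset_left hs)
    (mono _ _ _ Set.inter_subset_right hs') ⟨hx, hx'⟩ u
  rw [hol U' e' hU' hol' hs' hx' u] at k1
  rw [(hh x).zero_left, ← k1]
  have : h x (s x) 0 = 0 := by rw [← (hh x).conj, (hh x).zero_left, map_zero]
  rw [this, add_zero]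

theorem isChernConnection_chernConnection {h : ∀ x, W.Fib x → W.Fib x → ℂ} {D : W.Op E}
    (hD : IsChernConnection W h D) : IsChernConnection W h (chernConnection (E := E) W h) := by
  have H : ∃ D : W.Op E, IsChernConnection W h D := ⟨D, hD⟩
  rw [chernConnection, dif_pos H]
  exact H.choose_spec

end Uniqueness

/-! ### Matrices of functions -/

section MatrixCalculus

variable {E : Type*} [NormedAddCommGroup E] [NormedSpace ℝ E] {n : ℕ} {y : E}
  {M : E → Matrix (Fin n) (Fin n) ℂ}

theorem contDiffAt_det (hM : ∀ i j, ContDiffAt ℝ ∞ (fun z ↦ M z i j) y) :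
    ContDiffAt ℝ ∞ (fun z ↦ (M z).det) y := by
  simp only [Matrix.det_apply']
  exact ContDiffAt.sum fun σ _ ↦ contDiffAt_const.mul (contDiffAt_prod fun i _ ↦ hM _ _)

/-- By Cramer's rule each entry of the inverse is a quotient of determinants, which are polynomial
in the entries. -/
theorem contDiffAt_inv_apply (hM : ∀ i j, ContDiffAt ℝ ∞ (fun z ↦ M z i j) y)
    (hy : IsUnit (M y).det) (i j : Fin n) : ContDiffAt ℝ ∞ (fun z ↦ (M z)⁻¹ i j) y := by
  have e : ∀ z, (M z)⁻¹ i j = (M z).det⁻¹ * ((M z).updateRow j (Pi.single i 1)).det := by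
    intro z
    rw [Matrix.inv_def, Matrix.smul_apply, Matrix.adjugate_apply, Ring.inverse_eq_inv', smul_eq_mul]
  simp only [e]
  refine (ContDiffAt.inv (contDiffAt_det hM) hy.ne_zero).mul (contDiffAt_det fun k l ↦ ?_)
  by_cases hk : k = j
  · subst hk
    simp only [Matrix.updateRow_self]
    exact contDiffAt_const
  · simp only [Matrix.updateRow_ne hk]
    exact hM k l

end MatrixCalculus

/-! ### Frames of the vertical tangent bundle -/

section Frames

variable {E F X B : Type*} [NormedAddCommGroup E] [NormedSpace ℂ E]
  [NormedAddCommGroup F] [NormedSpace ℂ F]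
  [TopologicalSpace X] [ChartedSpace E X] [TopologicalSpace B] [ChartedSpace F B]
  {π : X → B} {omega : X → E [⋀^Fin 2]→L[ℝ] ℝ}

theorem IsRelativelyKahler.isKahlerForm (h : IsRelativelyKahler (F := F) π omega) :
    IsKahlerForm omega := ⟨h.smooth, h.closed, h.type_one_one⟩

theorem oneOnePart_eq (q : E →L[ℝ] E →L[ℝ] ℝ) (hq : IsOneOne q) (a b : E) :
    oneOnePart (fun u w ↦ q u w) a b = Complex.I * herm q a b := by
  rw [oneOnePart, herm, hq.I_smul, hq.I_left]
  push_cast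
  linear_combination ((q a b : ℂ) / 2) * Complex.I_mul_I

theorem vertMetric_eq (h : IsRelativelyKahler (F := F) π omega) (x : X) (a b : vert E F π x) :
    vertMetric F π omega x a b = kpair omega x a b := by
  have : (fun u w ↦ omega x ![u, w]) = fun u w ↦ twoFormBilin E ℝ (omega x) u w := by
    ext u w; rw [twoFormBilin_apply]
  rw [vertMetric, this, oneOnePart_eq _ (h.isKahlerForm.isOneOne x), kpair]
  linear_combination (-herm (twoFormBilin E ℝ (omega x)) (a : E) b) * Complex.I_mul_I

/-- Restriction to vertical vectors is essential: positivity is assumed only along the fibres, and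
the form on all of TX may be degenerate. -/
theorem isHermitianInner_kpair (h : IsRelativelyKahler (F := F) π omega) (x : X) :
    IsHermitianInner (fun a b : vert E F π x ↦ kpair omega x a b) where
  add_left a b c := herm_add_left _ _ _ _
  smul_left z a b := herm_smul_left (h.isKahlerForm.isOneOne x) _ _ _
  conj a b := herm_conj (h.isKahlerForm.isOneOne x) _ _
  definite a ha := by
    by_contra hne
    have h1 := h.pos x a a.2 (fun h0 ↦ hne (Subtype.ext h0))
    have h2 := congrArg Complex.re ha
    simp only [kpair_eq] at h2
    have h3 : omega x ![(a : E), a] = 0 := by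
      have := twoForm_swap (omega x) (a : E) a
      linarith
    rw [h3] at h2
    simp at h2
    linarith

theorem isHermitianInner_vertMetric
    (h : IsRelativelyKahler (F := F) π omega) (x : X) :
    IsHermitianInner (vertMetric F π omega x) := by
  have : vertMetric F π omega x = fun a b : vert E F π x ↦ kpair omega x a b := by
    ext a b; exact vertMetric_eq h x a b
  rw [this]
  exact isHermitianInner_kpair h x

variable [IsManifold 𝓘(ℂ, E) ω X]

/-- A smooth frame of the vertical tangent bundle near a point. -/
structure IsVertFrame {n : ℕ} (e : Fin n → ∀ y, vert E F π y) (x : X) : Prop where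
  smooth : ∀ᶠ y in 𝓝 x, ∀ i, VFSmoothAt (fun z ↦ (e i z : E)) y
  linearIndependent : ∀ᶠ y in 𝓝 x, LinearIndependent ℂ (fun i ↦ e i y)

variable {n : ℕ} {e : Fin n → ∀ y, vert E F π y} {x : X}

theorem IsVertFrame.eventually (he : IsVertFrame e x) : ∀ᶠ y in 𝓝 x, IsVertFrame e y := by
  filter_upwards [he.smooth.eventually_nhds, he.linearIndependent.eventually_nhds] with y h1 h2
    using ⟨h1, h2⟩

/-- The basis of a fibre of the vertical tangent bundle given by independent sections. -/
def vertBasis [FiniteDimensional ℂ E] (hr : Module.finrank ℂ (vert E F π x) = n)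
    (he : LinearIndependent ℂ (fun i ↦ e i x)) : Module.Basis (Fin n) ℂ (vert E F π x) :=
  basisOfLinearIndependentOfCardEqFinrank' _ he (by simp [hr])

omit [IsManifold 𝓘(ℂ, E) ω X] in
theorem vertBasis_apply [FiniteDimensional ℂ E] (hr : Module.finrank ℂ (vert E F π x) = n)
    (he : LinearIndependent ℂ (fun i ↦ e i x)) (i : Fin n) : vertBasis hr he i = e i x := by
  simp [vertBasis]

/-- The Gram matrix of sections of the vertical tangent bundle. -/
def gram (omega : X → E [⋀^Fin 2]→L[ℝ] ℝ) (e : Fin n → ∀ y, vert E F π y) (x : X) :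
    Matrix (Fin n) (Fin n) ℂ := Matrix.of fun i j ↦ kpair omega x (e i x) (e j x)

-- A left null vector c of the Gram matrix makes Σ cᵢ eᵢ orthogonal to every eⱼ, hence to itself.
omit [IsManifold 𝓘(ℂ, E) ω X] in
theorem isUnit_det_gram (h : IsRelativelyKahler (F := F) π omega)
    (he : LinearIndependent ℂ (fun i ↦ e i x)) : IsUnit (gram omega e x).det := by
  rw [isUnit_iff_ne_zero]
  intro h0
  obtain ⟨c, hc, hc0⟩ := Matrix.exists_vecMul_eq_zero_iff.2 h0
  have hh := isHermitianInner_kpair h x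
  refine hc (funext fun i ↦ ?_)
  refine Fintype.linearIndependent_iff.1 he c (hh.definite _ ?_) i
  rw [hh.sum_right (b := ∑ i, c i • e i x)]
  refine Finset.sum_eq_zero fun j _ ↦ ?_
  rw [hh.smul_right, hh.sum_left]
  have := congrFun hc0 j
  simp only [Matrix.vecMul, dotProduct, gram, Matrix.of_apply, Pi.zero_apply] at this
  simp only [hh.smul_left, this, mul_zero]

omit [IsManifold 𝓘(ℂ, E) ω X] in
theorem eq_sum_gram_inv [FiniteDimensional ℂ E] (h : IsRelativelyKahler (F := F) π omega)
    (hr : Module.finrank ℂ (vert E F π x) = n) (he : LinearIndependent ℂ (fun i ↦ e i x))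
    (w : vert E F π x) :
    w = ∑ i, (∑ j, kpair omega x w (e j x) * (gram omega e x)⁻¹ j i) • e i x := by
  have hh := isHermitianInner_kpair h x
  refine hh.ext_basis (vertBasis hr he) fun l ↦ ?_
  simp only [vertBasis_apply]
  rw [hh.sum_left]
  simp only [hh.smul_left]
  have h1 := Matrix.nonsing_inv_mul (gram omega e x) (isUnit_det_gram h he)
  have h2 : ∀ j, ∑ i, (gram omega e x)⁻¹ j i * kpair omega x (e i x) (e l x) =
      if j = l then 1 else 0 := by
    intro j
    have := congrFun (congrFun h1 j) l
    rwa [Matrix.mul_apply, Matrix.one_apply] at this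
  simp only [Finset.sum_mul, mul_assoc]
  rw [Finset.sum_comm]
  simp only [← Finset.mul_sum, h2]
  simp

/-- Vertical sections with smooth pairings against a frame have smooth coefficients. -/
theorem IsVertFrame.exists_coeff [FiniteDimensional ℂ E] (h : IsRelativelyKahler (F := F) π omega)
    (hr : ∀ x, Module.finrank ℂ (vert E F π x) = n) (he : IsVertFrame e x)
    (s : ∀ y, vert E F π y) :
    ∃ c : Fin n → X → ℂ, (∀ᶠ y in 𝓝 x, s y = ∑ i, c i y • e i y) ∧
      ∀ᶠ y in 𝓝 x, (∀ j, ContMDiffAt 𝓘(ℝ, E) 𝓘(ℝ, ℂ) ∞ (fun z ↦ kpair omega z (s z) (e j z)) y) →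
        ∀ i, ContMDiffAt 𝓘(ℝ, E) 𝓘(ℝ, ℂ) ∞ (c i) y := by
  refine ⟨fun i y ↦ ∑ j, kpair omega y (s y) (e j y) * (gram omega e y)⁻¹ j i, ?_, ?_⟩
  · filter_upwards [he.linearIndependent] with y hy using eq_sum_gram_inv h (hr y) hy (s y)
  · filter_upwards [he.smooth, he.linearIndependent] with y hy hi hc i
    have hx := mem_extChartAt_source (I := 𝓘(ℝ, E)) y
    have hg : ∀ k l, ContMDiffAt 𝓘(ℝ, E) 𝓘(ℝ, ℂ) ∞ (fun z ↦ gram omega e z k l) y := fun k l ↦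
      contMDiffAt_kpair h.isKahlerForm (hy k) (hy l)
    have hg' : ∀ k l, ContMDiffAt 𝓘(ℝ, E) 𝓘(ℝ, ℂ) ∞ (fun z ↦ (gram omega e z)⁻¹ k l) y := by
      intro k l
      rw [contMDiffAt_chart_iff hx]
      simp only [contMDiffAt_chart_iff hx] at hg
      refine contDiffAt_inv_apply (M := fun z ↦ gram omega e ((extChartAt 𝓘(ℝ, E) y).symm z)) hg ?_ k l
      rw [(extChartAt 𝓘(ℝ, E) y).left_inv hx]
      exact isUnit_det_gram h hi
    simp only [contMDiffAt_chart_iff hx] at hc hg' ⊢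
    exact ContDiffAt.sum fun j _ ↦ (hc j).mul (hg' j i)

/-- Sections defined by duality are known only through their pairings; this converts smooth pairings
with a frame into smoothness of the section. -/
theorem IsVertFrame.vfSmoothAt [FiniteDimensional ℂ E] (h : IsRelativelyKahler (F := F) π omega)
    (hr : ∀ x, Module.finrank ℂ (vert E F π x) = n) (he : IsVertFrame e x)
    {s : ∀ y, vert E F π y}
    (hs : ∀ j, ContMDiffAt 𝓘(ℝ, E) 𝓘(ℝ, ℂ) ∞ (fun z ↦ kpair omega z (s z) (e j z)) x) :
    VFSmoothAt (fun z ↦ (s z : E)) x := by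
  obtain ⟨c, hc, hc'⟩ := he.exists_coeff h hr s
  refine (VFSmoothAt.sum Finset.univ fun i _ ↦
    VFSmoothAt.smul (hc'.self_of_nhds hs i) (he.smooth.self_of_nhds i)).congr ?_
  filter_upwards [hc] with y hy
  rw [hy]
  simp

end Frames

/-! ### The Chern connection of the vertical tangent bundle -/

section VertChern

variable {E F X B : Type*} [NormedAddCommGroup E] [NormedSpace ℂ E]
  [NormedAddCommGroup F] [NormedSpace ℂ F]
  [TopologicalSpace X] [ChartedSpace E X] [TopologicalSpace B] [ChartedSpace F B]
  {π : X → B} {omega : X → E [⋀^Fin 2]→L[ℝ] ℝ}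

theorem kpair_add_left (omega : X → E [⋀^Fin 2]→L[ℝ] ℝ) (x : X) (a b t : E) :
    kpair omega x (a + b) t = kpair omega x a t + kpair omega x b t := herm_add_left _ _ _ _

theorem kpair_add_right (omega : X → E [⋀^Fin 2]→L[ℝ] ℝ) (x : X) (a b t : E) :
    kpair omega x a (b + t) = kpair omega x a b + kpair omega x a t := herm_add_right _ _ _ _

theorem kpair_sub_left (omega : X → E [⋀^Fin 2]→L[ℝ] ℝ) (x : X) (a b t : E) :
    kpair omega x (a - b) t = kpair omega x a t - kpair omega x b t := herm_sub_left _ _ _ _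

theorem kpair_smul_left (h : IsKahlerForm omega) (x : X) (z : ℂ) (a t : E) :
    kpair omega x (z • a) t = z * kpair omega x a t := herm_smul_left (h.isOneOne x) _ _ _

theorem kpair_conj (h : IsKahlerForm omega) (x : X) (a b : E) :
    starRingEnd ℂ (kpair omega x a b) = kpair omega x b a := herm_conj (h.isOneOne x) _ _

theorem kpairDel_add_second (omega : X → E [⋀^Fin 2]→L[ℝ] ℝ) (x : X) (u a b t : E) :
    kpairDel omega x u (a + b) t = kpairDel omega x u a t + kpairDel omega x u b t := by
  simp only [kpairDel, hermDel, herm_add_left]; ring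

theorem kpairDel_add_third (omega : X → E [⋀^Fin 2]→L[ℝ] ℝ) (x : X) (u a b t : E) :
    kpairDel omega x u a (b + t) = kpairDel omega x u a b + kpairDel omega x u a t := by
  simp only [kpairDel, hermDel, herm_add_right]; ring

theorem kpairDel_smul_third (omega : X → E [⋀^Fin 2]→L[ℝ] ℝ) (x : X) (u a : E) (z : ℂ) (t : E) :
    kpairDel omega x u a (z • t) = starRingEnd ℂ z * kpairDel omega x u a t := by
  simp only [kpairDel, hermDel, herm_smul_right]; ring

variable [IsManifold 𝓘(ℂ, E) ω X]

theorem kpairDel_smul_second (h : IsKahlerForm omega) (x : X) (u a : E) (z : ℂ) (t : E) :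
    kpairDel omega x u (z • a) t = z * kpairDel omega x u a t := by
  simp only [kpairDel, hermDel, herm_smul_left (h.isOneOne_derivForm x _)]; ring

variable [FiniteDimensional ℂ E]

/-- The Chern connection of the vertical tangent bundle, in the preferred chart at each point. -/
def vertD (h : IsRelativelyKahler (F := F) π omega) (s : ∀ y, vert E F π y) (x : X) :
    E →ₗ[ℝ] vert E F π x where
  -- The chart derivative of `s` need not be vertical. Only its pairing with vertical `t` is used,
  -- and definiteness on the vertical space then gives a vertical vector.
  toFun u := (isHermitianInner_kpair h x).sharp fun t ↦
    kpair omega x (fderiv ℝ (chartVF ℝ x fun z ↦ (s z : E)) (extChartAt 𝓘(ℝ, E) x x) u) t +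
      kpairDel omega x u (s x) t
  map_add' u u' := by
    rw [← IsHermitianInner.sharp_add]
    congr 1
    ext t
    simp only [map_add, kpairDel, hermDel_add_first, kpair, herm_add_left]
    ring
  map_smul' r u := by
    have : ∀ w : vert E F π x, r • w = (r : ℂ) • w := fun w ↦ rfl
    rw [RingHom.id_apply, this, ← IsHermitianInner.sharp_smul]
    congr 1
    ext t
    simp only [map_smul, kpairDel, hermDel_real_smul_first, kpair, herm_real_smul_left]
    ring

theorem kpair_vertD (h : IsRelativelyKahler (F := F) π omega) (s : ∀ y, vert E F π y) (x : X)
    (u : E) (t : vert E F π x) :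
    kpair omega x (vertD h s x u) t =
      kpair omega x (fderiv ℝ (chartVF ℝ x fun z ↦ (s z : E)) (extChartAt 𝓘(ℝ, E) x x) u) t +
        kpairDel omega x u (s x) t := by
  refine (isHermitianInner_kpair h x).sharp_apply (g := fun t ↦
    kpair omega x (fderiv ℝ (chartVF ℝ x fun z ↦ (s z : E)) (extChartAt 𝓘(ℝ, E) x x) u) t +
      kpairDel omega x u (s x) t) (fun a b ↦ ?_) (fun z a ↦ ?_) t
  · simp only [Submodule.coe_add, kpairDel_add_third, kpair, herm_add_right]
    ring
  · simp only [Submodule.coe_smul, kpairDel_smul_third, kpair, herm_smul_right]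
    ring

theorem vert_ext (h : IsRelativelyKahler (F := F) π omega) {x : X} {a b : vert E F π x}
    (hab : ∀ t : vert E F π x, kpair omega x a t = kpair omega x b t) : a = b :=
  (isHermitianInner_kpair h x).ext hab

theorem kpair_vertD_eq_chernPairing (h : IsRelativelyKahler (F := F) π omega)
    {s t : ∀ y, vert E F π y} {U : X → E} {x : X} (hs : VFSmoothAt (fun z ↦ (s z : E)) x)
    (hU : VFSmoothAt U x) (ht : VFSmoothAt (fun z ↦ (t z : E)) x) :
    kpair omega x (vertD h s x (U x)) (t x) =
      chernPairing omega (fun z ↦ (s z : E)) U (fun z ↦ (t z : E)) x := by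
  have := FiniteDimensional.complete ℂ E
  rw [kpair_vertD, chernPairing_self h.isKahlerForm hs hU ht]

theorem vertD_add (h : IsRelativelyKahler (F := F) π omega) {s t : ∀ y, vert E F π y} {x : X}
    (hs : VFSmoothAt (fun z ↦ (s z : E)) x) (ht : VFSmoothAt (fun z ↦ (t z : E)) x) (u : E) :
    vertD h (fun y ↦ s y + t y) x u = vertD h s x u + vertD h t x u := by
  refine vert_ext h fun w ↦ ?_
  rw [Submodule.coe_add, kpair_add_left, kpair_vertD, kpair_vertD, kpair_vertD]
  simp only [Submodule.coe_add]
  rw [fderiv_chartVF_add hs ht, kpair_add_left, kpairDel_add_second]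
  ring

theorem vertD_smul (h : IsRelativelyKahler (F := F) π omega) {f : X → ℂ} {s : ∀ y, vert E F π y}
    {x : X} (hf : ContMDiffAt 𝓘(ℝ, E) 𝓘(ℝ, ℂ) ∞ f x) (hs : VFSmoothAt (fun z ↦ (s z : E)) x)
    (u : E) : vertD h (fun y ↦ f y • s y) x u = f x • vertD h s x u + dFun f x u • s x := by
  refine vert_ext h fun w ↦ ?_
  have hk := h.isKahlerForm
  rw [Submodule.coe_add, kpair_add_left, Submodule.coe_smul, Submodule.coe_smul,
    kpair_smul_left hk, kpair_smul_left hk, kpair_vertD, kpair_vertD]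
  simp only [Submodule.coe_smul]
  rw [fderiv_chartVF_fun_smul hf hs, kpair_add_left, kpair_smul_left hk, kpair_smul_left hk,
    kpairDel_smul_second hk]
  ring

theorem vertD_congr (h : IsRelativelyKahler (F := F) π omega) {s t : ∀ y, vert E F π y} {x : X}
    (hst : ∀ᶠ y in 𝓝 x, s y = t y) : vertD h s x = vertD h t x := by
  ext1 u
  refine vert_ext h fun w ↦ ?_
  have : (fun z ↦ (s z : E)) =ᶠ[𝓝 x] fun z ↦ (t z : E) := hst.mono fun y hy ↦ congrArg Subtype.val hy
  rw [kpair_vertD, kpair_vertD, fderiv_chartVF_congr this, hst.self_of_nhds]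

/-- The (1,0)-derivative of the metric comes from the first term and, after conjugation, the
(0,1)-derivative from the second; `herm_eq_hermDel` adds them up. -/
theorem vertD_metric (h : IsRelativelyKahler (F := F) π omega) {s t : ∀ y, vert E F π y} {x : X}
    (hs : VFSmoothAt (fun z ↦ (s z : E)) x) (ht : VFSmoothAt (fun z ↦ (t z : E)) x) (u : E) :
    dFun (fun y ↦ kpair omega y (s y) (t y)) x u =
      kpair omega x (vertD h s x u) (t x) + kpair omega x (s x) (vertD h t x u) := by
  have e : kpair omega x (s x) (vertD h t x u) =
      starRingEnd ℂ (kpair omega x (vertD h t x u) (s x)) :=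
    ((isHermitianInner_kpair h x).conj _ _).symm
  rw [e, kpair_vertD, kpair_vertD, dFun_kpair h.isKahlerForm hs ht,
    herm_eq_hermDel (h.isKahlerForm.isOneOne_derivForm x), map_add,
    kpair_conj h.isKahlerForm, kpairDel, kpairDel]
  ring

theorem vertD_vertMetric (h : IsRelativelyKahler (F := F) π omega) {s t : ∀ y, vert E F π y}
    {x : X} (hs : VFSmoothAt (fun z ↦ (s z : E)) x) (ht : VFSmoothAt (fun z ↦ (t z : E)) x) (u : E) :
    dFun (fun y ↦ vertMetric F π omega y (s y) (t y)) x u =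
      vertMetric F π omega x (vertD h s x u) (t x) +
        vertMetric F π omega x (s x) (vertD h t x u) := by
  simp only [vertMetric_eq h]
  exact vertD_metric h hs ht u

/-- Both terms are complex linear in `u`: the derivative of `s` by hypothesis, the metric term
because it contains ∂g only. -/
theorem vertD_holomorphic (h : IsRelativelyKahler (F := F) π omega) {s : ∀ y, vert E F π y} {x : X}
    (hs : IsHolomorphicDerivAt (fun z ↦ (s z : E)) x) (u : E) :
    vertD h s x (Complex.I • u) = Complex.I • vertD h s x u := by
  refine vert_ext h fun w ↦ ?_
  have h11 := h.isKahlerForm.isOneOne x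
  have e : kpair omega x ((Complex.I • vertD h s x u : vert E F π x) : E) w =
      Complex.I * kpair omega x (vertD h s x u) w := herm_smul_left h11 _ _ _
  rw [e, kpair_vertD, kpair_vertD, hs, kpairDel, hermDel_I_smul_first, kpair, herm_smul_left h11,
    kpairDel, kpair]
  ring

variable [FiniteDimensional ℂ F] [IsManifold 𝓘(ℂ, F) ω B]

/-- Pairings with a frame are values of `chernPairing`, whose smoothness does not depend on the
charts used to define `vertD`. -/
theorem vertD_smooth (h : IsRelativelyKahler (F := F) π omega)
    (hs : Manifold.IsSubmersion 𝓘(ℂ, E) 𝓘(ℂ, F) ω π) {n : ℕ}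
    (hn : Module.finrank ℂ E = Module.finrank ℂ F + n) {s : ∀ y, vert E F π y} {Y : X → E} {x : X}
    (hsm : ∀ᶠ y in 𝓝 x, VFSmoothAt (fun z ↦ (s z : E)) y) (hY : ∀ᶠ y in 𝓝 x, VFSmoothAt Y y) :
    VFSmoothAt (fun z ↦ (vertD h s z (Y z) : E)) x := by
  have := FiniteDimensional.complete ℂ E
  obtain ⟨e, he⟩ := exists_holomorphic_frame hs hn x
  have hfr : IsVertFrame e x :=
    ⟨he.mono fun y hy i ↦ (hy.1 i).vfSmoothAt, he.mono fun y hy ↦ hy.2⟩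
  refine hfr.vfSmoothAt h (fun z ↦ finrank_vert hs hn z) (s := fun z ↦ vertD h s z (Y z)) fun j ↦ ?_
  refine (contMDiffAt_chernPairing h.isKahlerForm hsm.self_of_nhds hY.self_of_nhds
    (hfr.smooth.self_of_nhds j)).congr_of_eventuallyEq ?_
  filter_upwards [hsm, hY, hfr.smooth] with y h1 h2 h3
    using kpair_vertD_eq_chernPairing h h1 h2 (h3 j)

variable {K : Type*} [Group K] [MulAction K X] [MulAction K B]

omit [FiniteDimensional ℂ E] [FiniteDimensional ℂ F] [IsManifold 𝓘(ℂ, F) ω B] in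
theorem vertBundle_isSmooth_iff (hπ : IsEquivariantSubmersion E F K π) {U : Set X} (hU : IsOpen U)
    {s : ∀ y, vert E F π y} :
    (vertBundle hπ).IsSmooth U s ↔ ∀ x ∈ U, VFSmoothAt (fun z ↦ (s z : E)) x :=
  isSmoothVF_iff hU

omit [FiniteDimensional ℂ E] [FiniteDimensional ℂ F] [IsManifold 𝓘(ℂ, F) ω B] in
theorem vertBundle_isHol_iff (hπ : IsEquivariantSubmersion E F K π) {U : Set X} (hU : IsOpen U)
    {s : ∀ y, vert E F π y} :
    (vertBundle hπ).IsHol U s ↔ ∀ x ∈ U, VFHolAt (fun z ↦ (s z : E)) x :=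
  isHolomorphicVF_iff hU

theorem isChernConnection_vertD (hπ : IsEquivariantSubmersion E F K π)
    (h : IsRelativelyKahler (F := F) π omega) {n : ℕ}
    (hn : Module.finrank ℂ E = Module.finrank ℂ F + n) :
    IsChernConnection (vertBundle hπ) (vertMetric F π omega) (vertD h) where
  isConnection :=
    { add := fun U s t hU hs ht x hx ↦ by
        replace hs := (vertBundle_isSmooth_iff hπ hU).1 hs
        replace ht := (vertBundle_isSmooth_iff hπ hU).1 ht
        ext1 u
        exact vertD_add h (hs x hx) (ht x hx) u
      leibniz := fun U f s hU hf hs x hx u ↦ by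
        replace hs := (vertBundle_isSmooth_iff hπ hU).1 hs
        exact vertD_smul h (hf.contMDiffAt (hU.mem_nhds hx)) (hs x hx) u
      smooth := fun U s Y hU hs hY ↦ by
        replace hs := (vertBundle_isSmooth_iff hπ hU).1 hs
        refine (vertBundle_isSmooth_iff hπ hU).2 ?_
        rw [isSmoothVF_iff hU] at hY
        intro x hx
        exact vertD_smooth h hπ.submersion hn ((hU.eventually_mem hx).mono hs)
          ((hU.eventually_mem hx).mono hY) }
  holomorphic U e hU he x hx u := by
    replace he := (vertBundle_isHol_iff hπ hU).1 he
    exact vertD_holomorphic h (he x hx).isHolomorphicDerivAt u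
  metric U s t hU hs ht x hx u := by
    replace hs := (vertBundle_isSmooth_iff hπ hU).1 hs
    replace ht := (vertBundle_isSmooth_iff hπ hU).1 ht
    exact vertD_vertMetric h (hs x hx) (ht x hx) u

/-- The Chern connection agrees with its coordinate expression on smooth sections. -/
theorem vertConnection_eq (hπ : IsEquivariantSubmersion E F K π)
    (h : IsRelativelyKahler (F := F) π omega) {n : ℕ}
    (hn : Module.finrank ℂ E = Module.finrank ℂ F + n) {s : ∀ y, vert E F π y} {x : X}
    (hs : ∀ᶠ y in 𝓝 x, VFSmoothAt (fun z ↦ (s z : E)) y) :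
    vertConnection hπ omega s x = vertD h s x := by
  obtain ⟨U, hUs, hU, hx⟩ := eventually_nhds_iff.1 hs
  have hD := isChernConnection_vertD hπ h hn
  refine chernConnection_unique (isHermitianInner_vertMetric h) (W := vertBundle hπ)
    (fun U U' s hUU' hs ↦ ContMDiffOn.mono hs hUU') (fun x w ↦ ?_)
    (isChernConnection_chernConnection hD) hD hU
    ((vertBundle_isSmooth_iff hπ hU).2 hUs) hx
  obtain ⟨e, he⟩ := exists_holomorphic_frame hπ.submersion hn x
  obtain ⟨U, hUe, hU, hx⟩ := eventually_nhds_iff.1 he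
  let b := vertBasis (finrank_vert hπ.submersion hn x) (hUe x hx).2
  -- Combinations of a holomorphic frame with constant coefficients are holomorphic and take any
  -- prescribed value at `x`.
  have hsm : ∀ y ∈ U, VFHolAt (fun z ↦ ((∑ i, b.repr w i • e i z : vert E F π z) : E)) y := by
    intro y hy
    have hx := mem_extChartAt_source (I := 𝓘(ℂ, E)) y
    have h1 := (hUe y hy).1
    simp only [vfHolAt_iff hx] at h1 ⊢
    refine (ContDiffAt.sum (s := Finset.univ) fun i _ ↦
      contDiffAt_const (c := b.repr w i).smul (h1 i)).congr_of_eventuallyEq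
      (Filter.Eventually.of_forall fun z ↦ ?_)
    simp only [chartVF, AddSubmonoidClass.coe_finsetSum, map_sum, Submodule.coe_smul, map_smul]
    rfl
  refine ⟨U, fun z ↦ ∑ i, b.repr w i • e i z, hU, hx, (vertBundle_isHol_iff hπ hU).2 hsm,
    (vertBundle_isSmooth_iff hπ hU).2 fun y hy ↦ (hsm y hy).vfSmoothAt, ?_⟩
  refine Eq.trans ?_ (b.sum_repr w)
  exact Finset.sum_congr rfl fun i _ ↦ by rw [vertBasis_apply]

end VertChern

/-! ### The action in charts -/

section ActChart

variable {E X : Type*} [NormedAddCommGroup E] [NormedSpace ℂ E]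
  [TopologicalSpace X] [ChartedSpace E X] [IsManifold 𝓘(ℂ, E) ω X]
  {EK K : Type*} [NormedAddCommGroup EK] [NormedSpace ℝ EK]
  [TopologicalSpace K] [ChartedSpace EK K] [Group K] [LieGroup 𝓘(ℝ, EK) ∞ K]
  [MulAction K X] [ContMDiffSMul 𝓘(ℝ, EK) 𝓘(ℝ, E) ∞ K X]

variable (EK K) in
/-- The action in the preferred charts at `1` and at `x₀`. -/
def actChart (x₀ : X) (p : EK × E) : E :=
  extChartAt 𝓘(ℝ, E) x₀ ((extChartAt 𝓘(ℝ, EK) (1 : K)).symm p.1 •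
    (extChartAt 𝓘(ℝ, E) x₀).symm p.2)

omit [IsManifold 𝓘(ℂ, E) ω X] [LieGroup 𝓘(ℝ, EK) ∞ K] in
theorem mdifferentiableAt_orbit (z : X) (k : K) :
    MDifferentiableAt 𝓘(ℝ, EK) 𝓘(ℝ, E) (fun k : K ↦ k • z) k := by
  have h : ContMDiff 𝓘(ℝ, EK) 𝓘(ℝ, E) ∞ (fun k : K ↦ k • z) :=
    (contMDiff_smul (I := 𝓘(ℝ, EK)) (I' := 𝓘(ℝ, E))).comp (contMDiff_id.prodMk contMDiff_const)
  exact (h k).mdifferentiableAt (by simp)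

theorem contDiffAt_actChart (x₀ : X) :
    ContDiffAt ℝ ∞ (actChart EK K x₀)
      (extChartAt 𝓘(ℝ, EK) (1 : K) 1, extChartAt 𝓘(ℝ, E) x₀ x₀) := by
  rw [← contMDiffAt_iff_contDiffAt]
  set κ₀ := extChartAt 𝓘(ℝ, EK) (1 : K) 1
  set y₀ := extChartAt 𝓘(ℝ, E) x₀ x₀
  have hK : IsManifold 𝓘(ℝ, EK) ∞ K := inferInstance
  have e1 : (extChartAt 𝓘(ℝ, EK) (1 : K)).symm κ₀ = 1 := extChartAt_to_inv (I := 𝓘(ℝ, EK)) (1 : K)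
  have e2 : (extChartAt 𝓘(ℝ, E) x₀).symm y₀ = x₀ := extChartAt_to_inv (I := 𝓘(ℝ, E)) x₀
  have s1 : ContMDiffAt 𝓘(ℝ, EK) 𝓘(ℝ, EK) ∞ (extChartAt 𝓘(ℝ, EK) (1 : K)).symm κ₀ :=
    (contMDiffOn_extChartAt_symm (1 : K)).contMDiffAt
      (extChartAt_target_mem_nhds (I := 𝓘(ℝ, EK)) (1 : K))
  have s2 : ContMDiffAt 𝓘(ℝ, E) 𝓘(ℝ, E) ∞ (extChartAt 𝓘(ℝ, E) x₀).symm y₀ :=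
    (contMDiffOn_extChartAt_symm x₀).contMDiffAt (extChartAt_target_mem_nhds (I := 𝓘(ℝ, E)) x₀)
  have f1 : ContMDiffAt 𝓘(ℝ, EK × E) 𝓘(ℝ, EK) ∞
      (fun p : EK × E ↦ (extChartAt 𝓘(ℝ, EK) (1 : K)).symm p.1) (κ₀, y₀) :=
    ContMDiffAt.comp (κ₀, y₀) (g := (extChartAt 𝓘(ℝ, EK) (1 : K)).symm) s1
      contDiff_fst.contMDiff.contMDiffAt
  have f2 : ContMDiffAt 𝓘(ℝ, EK × E) 𝓘(ℝ, E) ∞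
      (fun p : EK × E ↦ (extChartAt 𝓘(ℝ, E) x₀).symm p.2) (κ₀, y₀) :=
    ContMDiffAt.comp (κ₀, y₀) (g := (extChartAt 𝓘(ℝ, E) x₀).symm) s2
      contDiff_snd.contMDiff.contMDiffAt
  have f3 : ContMDiffAt 𝓘(ℝ, EK × E) 𝓘(ℝ, E) ∞ (fun p : EK × E ↦
      (extChartAt 𝓘(ℝ, EK) (1 : K)).symm p.1 • (extChartAt 𝓘(ℝ, E) x₀).symm p.2) (κ₀, y₀) :=
    (contMDiff_smul (I := 𝓘(ℝ, EK)) (I' := 𝓘(ℝ, E)) (G := K)).contMDiffAt.comp (κ₀, y₀)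
      (f1.prodMk f2)
  refine ContMDiffAt.comp (κ₀, y₀) (g := extChartAt 𝓘(ℝ, E) x₀) ?_ f3
  simp only [e1, e2, one_smul]
  exact contMDiffAt_extChartAt

theorem chartVF_fundVF (v : LieAlg EK K) {x₀ : X} {y : E}
    (hy : y ∈ (extChartAt 𝓘(ℝ, E) x₀).target) :
    chartVF ℝ x₀ (fundVF v) y =
      fderiv ℝ (fun κ ↦ actChart EK K x₀ (κ, y)) (extChartAt 𝓘(ℝ, EK) (1 : K) 1) v := by
  set z := (extChartAt 𝓘(ℝ, E) x₀).symm y with hz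
  have hzs : z ∈ (extChartAt 𝓘(ℝ, E) x₀).source := (extChartAt 𝓘(ℝ, E) x₀).map_target hy
  have hK : IsManifold 𝓘(ℝ, EK) ∞ K := inferInstance
  have hK1 : IsManifold 𝓘(ℝ, EK) 1 K := IsManifold.of_le (n := ∞) (by simp)
  have d1 := mdifferentiableAt_orbit (EK := EK) (E := E) z (1 : K)
  have d2 : MDifferentiableAt 𝓘(ℝ, E) 𝓘(ℝ, E) (extChartAt 𝓘(ℝ, E) x₀) ((1 : K) • z) := by
    rw [one_smul]
    exact mdifferentiableAt_extChartAt (by simpa using hzs)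
  have h1 := mfderiv_comp (1 : K) d2 d1
  have h2 := mfderiv_eq_fderiv_comp_chartD (mem_extChartAt_source (I := 𝓘(ℝ, EK)) (1 : K))
    (d2.comp (1 : K) d1)
  rw [h1, chartD_self] at h2
  have h3 : ((mfderiv 𝓘(ℝ, E) 𝓘(ℝ, E) (extChartAt 𝓘(ℝ, E) x₀) ((1 : K) • z) : E →L[ℝ] E))
      ((mfderiv 𝓘(ℝ, EK) 𝓘(ℝ, E) (fun k : K ↦ k • z) 1 : EK →L[ℝ] E) v) =
      fderiv ℝ (fun κ ↦ actChart EK K x₀ (κ, y)) (extChartAt 𝓘(ℝ, EK) (1 : K) 1) v :=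
    DFunLike.congr_fun h2 v
  rw [one_smul] at h3
  exact h3

/-- Near x₀ the generating field is the partial derivative of the action in the group variable.
Writing it through the full derivative of one smooth map gives smoothness in the point. -/
theorem eventually_chartVF_fundVF (v : LieAlg EK K) (x₀ : X) :
    chartVF ℝ x₀ (fundVF v) =ᶠ[𝓝 (extChartAt 𝓘(ℝ, E) x₀ x₀)] fun y ↦
      fderiv ℝ (actChart EK K x₀) (extChartAt 𝓘(ℝ, EK) (1 : K) 1, y) ((v : EK), (0 : E)) := by
  have h1 : ∀ᶠ p in 𝓝 (extChartAt 𝓘(ℝ, EK) (1 : K) 1, extChartAt 𝓘(ℝ, E) x₀ x₀),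
      DifferentiableAt ℝ (actChart EK K x₀) p :=
    (((contDiffAt_actChart (EK := EK) (K := K) x₀).of_le (m := 1) (by simp)).eventually
      (by simp)).mono fun p hp ↦ hp.differentiableAt (by simp)
  have h2 : Filter.Tendsto (fun y : E ↦ (extChartAt 𝓘(ℝ, EK) (1 : K) 1, y))
      (𝓝 (extChartAt 𝓘(ℝ, E) x₀ x₀))
      (𝓝 (extChartAt 𝓘(ℝ, EK) (1 : K) 1, extChartAt 𝓘(ℝ, E) x₀ x₀)) :=
    (Continuous.prodMk_right _).continuousAt
  filter_upwards [h2.eventually h1, extChartAt_target_mem_nhds (I := 𝓘(ℝ, E)) x₀] with y hy hy'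
  rw [chartVF_fundVF v hy']
  have h3 := hy.hasFDerivAt.comp (extChartAt 𝓘(ℝ, EK) (1 : K) 1)
    ((hasFDerivAt_id (𝕜 := ℝ) (extChartAt 𝓘(ℝ, EK) (1 : K) 1)).prodMk (hasFDerivAt_const y _))
  exact DFunLike.congr_fun h3.fderiv v

theorem contDiffAt_fderiv_actChart (x₀ : X) :
    ContDiffAt ℝ ∞ (fderiv ℝ (actChart EK K x₀))
      (extChartAt 𝓘(ℝ, EK) (1 : K) 1, extChartAt 𝓘(ℝ, E) x₀ x₀) :=
  (contDiffAt_actChart x₀).fderiv_right (by simp)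

theorem vfSmoothAt_fundVF (v : LieAlg EK K) (x : X) : VFSmoothAt (fundVF (E := E) v) x := by
  rw [vfSmoothAt_iff (mem_extChartAt_source x)]
  refine ContDiffAt.congr_of_eventuallyEq ?_ (eventually_chartVF_fundVF v x)
  have h1 : ContDiffAt ℝ ∞ (fun y : E ↦ (extChartAt 𝓘(ℝ, EK) (1 : K) 1, y))
    (extChartAt 𝓘(ℝ, E) x x) := contDiffAt_const.prodMk contDiffAt_id
  exact ((contDiffAt_fderiv_actChart (E := E) (EK := EK) (K := K) x).comp _ h1).clm_apply contDiffAt_const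

/-- The derivative of the action along `X` in the preferred charts. -/
def actChartD (x₀ : X) (κ : EK) : E →L[ℝ] E :=
  (fderiv ℝ (actChart EK K x₀) (κ, extChartAt 𝓘(ℝ, E) x₀ x₀)).comp (ContinuousLinearMap.inr ℝ EK E)

theorem contDiffAt_actChartD (x₀ : X) :
    ContDiffAt ℝ ∞ (actChartD (E := E) (K := K) x₀) (extChartAt 𝓘(ℝ, EK) (1 : K) 1) := by
  have h1 : ContDiffAt ℝ ∞ (fun κ : EK ↦ (κ, extChartAt 𝓘(ℝ, E) x₀ x₀))
    (extChartAt 𝓘(ℝ, EK) (1 : K) 1) := contDiffAt_id.prodMk contDiffAt_const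
  have h2 : ContDiffAt ℝ ∞ (fun κ ↦ fderiv ℝ (actChart EK K x₀) (κ, extChartAt 𝓘(ℝ, E) x₀ x₀))
      (extChartAt 𝓘(ℝ, EK) (1 : K) 1) :=
    (contDiffAt_fderiv_actChart (EK := EK) (K := K) x₀).comp (extChartAt 𝓘(ℝ, EK) (1 : K) 1) h1
  exact ContDiffAt.clm_comp h2
    (contDiffAt_const (c := ContinuousLinearMap.inr ℝ EK E))

/-- Symmetry of the mixed second derivatives of the action. -/
theorem fderiv_actChartD (v : LieAlg EK K) (x₀ : X) (u : E) :
    fderiv ℝ (actChartD (E := E) (K := K) x₀) (extChartAt 𝓘(ℝ, EK) (1 : K) 1) v u =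
      fderiv ℝ (chartVF ℝ x₀ (fundVF (E := E) v)) (extChartAt 𝓘(ℝ, E) x₀ x₀) u := by
  set κ₀ := extChartAt 𝓘(ℝ, EK) (1 : K) 1
  set y₀ := extChartAt 𝓘(ℝ, E) x₀ x₀
  have hd := ((contDiffAt_fderiv_actChart (E := E) (EK := EK) (K := K) x₀).differentiableAt
    (by simp)).hasFDerivAt
  have h1 : HasFDerivAt (fun κ ↦ fderiv ℝ (actChart EK K x₀) (κ, y₀)) _ κ₀ :=
    hd.comp κ₀ ((hasFDerivAt_id (𝕜 := ℝ) κ₀).prodMk (hasFDerivAt_const y₀ κ₀))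
  have h2 : HasFDerivAt (fun y ↦ fderiv ℝ (actChart EK K x₀) (κ₀, y)) _ y₀ :=
    hd.comp y₀ ((hasFDerivAt_const κ₀ y₀).prodMk (hasFDerivAt_id (𝕜 := ℝ) y₀))
  have h3 := ((ContinuousLinearMap.compL ℝ E (EK × E) E).flip
    (ContinuousLinearMap.inr ℝ EK E)).hasFDerivAt.comp κ₀ h1
  have h4 := (ContinuousLinearMap.apply ℝ E ((v, 0) : EK × E)).hasFDerivAt.comp y₀ h2
  have e1 : fderiv ℝ (actChartD (E := E) (K := K) x₀) κ₀ = _ := h3.fderiv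
  rw [(eventually_chartVF_fundVF v x₀).fderiv_eq, e1]
  refine Eq.trans ?_ (DFunLike.congr_fun h4.fderiv u).symm
  have hsymm : IsSymmSndFDerivAt ℝ (actChart EK K x₀) (κ₀, y₀) :=
    (contDiffAt_actChart x₀).isSymmSndFDerivAt (by simpa using ENat.LEInfty.out)
  exact hsymm.eq ((v : EK), (0 : E)) ((0 : EK), u)

omit [LieGroup 𝓘(ℝ, EK) ∞ K] in
theorem eventually_act_mem_source (x₀ : X) :
    ∀ᶠ κ in 𝓝 (extChartAt 𝓘(ℝ, EK) (1 : K) 1),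
      (extChartAt 𝓘(ℝ, EK) (1 : K)).symm κ • x₀ ∈ (extChartAt 𝓘(ℝ, E) x₀).source := by
  have e1 : (extChartAt 𝓘(ℝ, EK) (1 : K)).symm (extChartAt 𝓘(ℝ, EK) (1 : K) 1) = 1 :=
    extChartAt_to_inv (I := 𝓘(ℝ, EK)) (1 : K)
  have h1 : ContinuousAt (extChartAt 𝓘(ℝ, EK) (1 : K)).symm (extChartAt 𝓘(ℝ, EK) (1 : K) 1) :=
    continuousAt_extChartAt_symm (1 : K)
  have h2 : ContinuousAt (fun k : K ↦ k • x₀) 1 :=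
    (mdifferentiableAt_orbit (EK := EK) (E := E) x₀ (1 : K)).continuousAt
  have h3 : ContinuousAt (fun κ ↦ (extChartAt 𝓘(ℝ, EK) (1 : K)).symm κ • x₀)
      (extChartAt 𝓘(ℝ, EK) (1 : K) 1) :=
    ContinuousAt.comp (g := fun k : K ↦ k • x₀) (by rw [e1]; exact h2) h1
  refine h3.eventually ?_
  simp only [e1, one_smul]
  exact extChartAt_source_mem_nhds x₀

theorem eventually_actChartD (x₀ : X) :
    ∀ᶠ κ in 𝓝 (extChartAt 𝓘(ℝ, EK) (1 : K) 1), ∀ u, actChartD (E := E) (K := K) x₀ κ u =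
      chartD (E := E) ℝ x₀ ((extChartAt 𝓘(ℝ, EK) (1 : K)).symm κ • x₀)
        (dAct ((extChartAt 𝓘(ℝ, EK) (1 : K)).symm κ) x₀ u) := by
  have h1 : ∀ᶠ p in 𝓝 (extChartAt 𝓘(ℝ, EK) (1 : K) 1, extChartAt 𝓘(ℝ, E) x₀ x₀),
      DifferentiableAt ℝ (actChart EK K x₀) p :=
    (((contDiffAt_actChart (EK := EK) (K := K) x₀).of_le (m := 1) (by simp)).eventually
      (by simp)).mono fun p hp ↦ hp.differentiableAt (by simp)
  have h2 : Filter.Tendsto (fun κ : EK ↦ (κ, extChartAt 𝓘(ℝ, E) x₀ x₀))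
      (𝓝 (extChartAt 𝓘(ℝ, EK) (1 : K) 1))
      (𝓝 (extChartAt 𝓘(ℝ, EK) (1 : K) 1, extChartAt 𝓘(ℝ, E) x₀ x₀)) :=
    (Continuous.prodMk_left _).continuousAt
  filter_upwards [h2.eventually h1, eventually_act_mem_source (E := E) (EK := EK) (K := K) x₀]
    with κ hκ hκ' u
  set k := (extChartAt 𝓘(ℝ, EK) (1 : K)).symm κ with hk
  have h3 := hκ.hasFDerivAt.comp (extChartAt 𝓘(ℝ, E) x₀ x₀)
    ((hasFDerivAt_const κ (extChartAt 𝓘(ℝ, E) x₀ x₀)).prodMk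
      (hasFDerivAt_id (𝕜 := ℝ) (extChartAt 𝓘(ℝ, E) x₀ x₀)))
  have d1 : MDifferentiableAt 𝓘(ℝ, E) 𝓘(ℝ, E) (fun z : X ↦ k • z) x₀ :=
    (((contMDiff_smul (I := 𝓘(ℝ, EK)) (I' := 𝓘(ℝ, E)) (n := ∞)).comp
      (contMDiff_const.prodMk contMDiff_id)) x₀).mdifferentiableAt (by simp)
  have d2 : MDifferentiableAt 𝓘(ℝ, E) 𝓘(ℝ, E) (extChartAt 𝓘(ℝ, E) x₀) (k • x₀) :=
    mdifferentiableAt_extChartAt (by simpa using hκ')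
  have h4 := mfderiv_eq_fderiv_comp_chartD (mem_extChartAt_source (I := 𝓘(ℝ, E)) x₀)
    (d2.comp x₀ d1)
  rw [mfderiv_comp x₀ d2 d1, chartD_self] at h4
  refine Eq.trans ?_ (DFunLike.congr_fun h4 u).symm
  exact (DFunLike.congr_fun h3.fderiv u).symm

omit [LieGroup 𝓘(ℝ, EK) ∞ K] [ContMDiffSMul 𝓘(ℝ, EK) 𝓘(ℝ, E) ∞ K X] [TopologicalSpace K]
  [ChartedSpace EK K] [NormedAddCommGroup EK] [NormedSpace ℝ EK] [IsManifold 𝓘(ℂ, E) ω X] in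
theorem dAct_smul (hol : ∀ k : K, ContMDiff 𝓘(ℂ, E) 𝓘(ℂ, E) ω (fun x : X ↦ k • x)) (k : K) (x : X)
    (c : ℂ) (u : E) : dAct k x (c • u) = c • dAct k x u := by
  have h1 : ∀ u : E, (dAct k x u : E) = (mfderiv 𝓘(ℂ, E) 𝓘(ℂ, E) (fun x : X ↦ k • x) x : E →L[ℂ] E) u :=
    fun u ↦ DFunLike.congr_fun
      (mfderiv_restrictScalars ((hol k x).mdifferentiableAt (by simp))) u
  rw [h1, h1]
  exact map_smul (mfderiv 𝓘(ℂ, E) 𝓘(ℂ, E) (fun x : X ↦ k • x) x : E →L[ℂ] E) c u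

/-- For group elements near 1 the derivative of the action along X is complex linear.
Differentiating this in the group variable and exchanging the mixed derivatives gives the statement
for the generating field. -/
theorem isHolomorphicDerivAt_fundVF
    (hol : ∀ k : K, ContMDiff 𝓘(ℂ, E) 𝓘(ℂ, E) ω (fun x : X ↦ k • x)) (v : LieAlg EK K) (x : X) :
    IsHolomorphicDerivAt (fundVF (E := E) v) x := by
  intro u
  rw [← fderiv_actChartD, ← fderiv_actChartD]
  have hd := ((contDiffAt_actChartD (E := E) (EK := EK) (K := K) x).differentiableAt (by simp)).hasFDerivAt
  have hA : ∀ u, HasFDerivAt (fun κ ↦ actChartD (E := E) (K := K) x κ u)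
      ((fderiv ℝ (actChartD (E := E) (K := K) x) (extChartAt 𝓘(ℝ, EK) (1 : K) 1)).flip u)
      (extChartAt 𝓘(ℝ, EK) (1 : K) 1) := by
    intro u
    have := hd.clm_apply (hasFDerivAt_const u _)
    simpa using this
  have e : (fun κ ↦ actChartD (E := E) (K := K) x κ (Complex.I • u))
      =ᶠ[𝓝 (extChartAt 𝓘(ℝ, EK) (1 : K) 1)] fun κ ↦ Complex.I • actChartD (E := E) (K := K) x κ u := by
    filter_upwards [eventually_actChartD (E := E) (EK := EK) (K := K) x,
      eventually_act_mem_source (E := E) (EK := EK) (K := K) x] with κ h1 h2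
    rw [h1, h1, dAct_smul hol, chartD_I_smul h2]
  have h1 := (hA (Complex.I • u)).fderiv
  rw [e.fderiv_eq, ((hA u).fun_const_smul Complex.I).fderiv] at h1
  exact (DFunLike.congr_fun h1 v).symm

end ActChart

/-! ### Hamiltonian holomorphic vector fields -/

section Hamiltonian

variable {E X : Type*} [NormedAddCommGroup E] [NormedSpace ℂ E]
  [TopologicalSpace X] [ChartedSpace E X] [IsManifold 𝓘(ℂ, E) ω X]
  {omega : X → E [⋀^Fin 2]→L[ℝ] ℝ}

/-- `v` is the Hamiltonian vector field of `f`: `df = -ι_v omega`. -/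
structure IsHamiltonian (omega : X → E [⋀^Fin 2]→L[ℝ] ℝ) (f : X → ℝ) (v : X → E) : Prop where
  smooth : ContMDiff 𝓘(ℝ, E) 𝓘(ℝ, ℝ) ∞ f
  smooth_vf : ∀ x, VFSmoothAt v x
  moment : ∀ (x : X) (u : E), dFun f x u = - omega x ![v x, u]

variable {f : X → ℝ} {v : X → E}

/-- Differentiate the coordinate form of df = -ι_v omega by the product rule. -/
theorem IsHamiltonian.hessian (h : IsKahlerForm omega) (hf : IsHamiltonian omega f v) (x : X)
    (a b : E) :
    fderiv ℝ (fderiv ℝ (f ∘ (extChartAt 𝓘(ℝ, E) x).symm)) (extChartAt 𝓘(ℝ, E) x x) a b =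
      -(derivForm omega x a (v x) b + twoFormBilin E ℝ (omega x)
        (fderiv ℝ (chartVF ℝ x v) (extChartAt 𝓘(ℝ, E) x x) a) b) := by
  have hx := mem_extChartAt_source (I := 𝓘(ℝ, E)) x
  have e : fderiv ℝ (f ∘ (extChartAt 𝓘(ℝ, E) x).symm) =ᶠ[𝓝 (extChartAt 𝓘(ℝ, E) x x)]
      fun y ↦ -(twoFormBilin E ℝ (formInChart omega x y) (chartVF ℝ x v y)) := by
    filter_upwards [extChartAt_target_mem_nhds (I := 𝓘(ℝ, E)) x] with y hy
    have hz := (extChartAt 𝓘(ℝ, E) x).map_target hy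
    ext b
    have h1 := dFun_eq_fderiv hz (hf.smooth _) (symmD (E := E) ℝ x y b)
    rw [chartD_symmD hy, (extChartAt 𝓘(ℝ, E) x).right_inv hy, hf.moment] at h1
    have h2 := formInChart_apply omega hz
      ![v ((extChartAt 𝓘(ℝ, E) x).symm y), symmD (E := E) ℝ x y b]
    rw [(extChartAt 𝓘(ℝ, E) x).right_inv hy] at h2
    rw [← h1, neg_apply, twoFormBilin_apply, h2]
    congr 2
    ext i
    fin_cases i
    · rfl
    · exact chartD_symmD hy b
  have h0 := ((contDiffAt_twoFormBilin h.smooth hx).differentiableAt (by simp)).hasFDerivAt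
  have h1 := ((hf.smooth_vf x).differentiableAt hx).hasFDerivAt
  have h2 := (h0.clm_apply h1).neg
  have e' : fderiv ℝ (fun y ↦ -(twoFormBilin E ℝ (formInChart omega x y) (chartVF ℝ x v y)))
    (extChartAt 𝓘(ℝ, E) x x) = _ := h2.fderiv
  rw [e.fderiv_eq, e', chartVF_self]
  have h3 : ∀ c : E, twoFormBilin E ℝ (formInChart omega x (extChartAt 𝓘(ℝ, E) x x)) c b =
      twoFormBilin E ℝ (omega x) c b := fun c ↦
    (formInChart_self omega x c b).trans (twoFormBilin_apply _ _ _).symm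
  simp only [neg_apply, add_apply, ContinuousLinearMap.comp_apply, ContinuousLinearMap.flip_apply,
    h3]
  rw [add_comm]
  rfl

/-- This is L_v omega = 0 in coordinates: symmetry of the second derivative of `f` (that is, d ι_v
omega = 0) combined with closedness of omega. -/
theorem IsHamiltonian.derivForm_add (h : IsKahlerForm omega) (hf : IsHamiltonian omega f v) (x : X)
    (a b : E) :
    derivForm omega x (v x) a b +
      twoFormBilin E ℝ (omega x) (fderiv ℝ (chartVF ℝ x v) (extChartAt 𝓘(ℝ, E) x x) a) b +
      twoFormBilin E ℝ (omega x) a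
        (fderiv ℝ (chartVF ℝ x v) (extChartAt 𝓘(ℝ, E) x x) b) = 0 := by
  have hx := mem_extChartAt_source (I := 𝓘(ℝ, E)) x
  have hs : IsSymmSndFDerivAt ℝ (f ∘ (extChartAt 𝓘(ℝ, E) x).symm) (extChartAt 𝓘(ℝ, E) x x) :=
    ((contMDiffAt_chart_iff hx).1 (hf.smooth x)).isSymmSndFDerivAt (by simpa using ENat.LEInfty.out)
  have h1 := hs.eq a b
  rw [hf.hessian h, hf.hessian h] at h1
  have h2 := derivForm_cyclic h.smooth h.closed x (v x) a b
  have h3 := (h.isOneOne_derivForm x a).swap b (v x)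
  have h4 := (h.isOneOne x).swap a (fderiv ℝ (chartVF ℝ x v) (extChartAt 𝓘(ℝ, E) x x) b)
  linarith

/-- Preservation of omega, evaluated on `s`, `t` and on `s`, it, gives the real and imaginary parts
of the identity for h. Holomorphy lets the derivative of `v` pass i. -/
theorem IsHamiltonian.isHolomorphicIsometric [CompleteSpace E] (h : IsKahlerForm omega)
    (hf : IsHamiltonian omega f v) (hv : ∀ x, IsHolomorphicDerivAt v x) :
    IsHolomorphicIsometric omega v where
  smooth := hf.smooth_vf
  holomorphic := hv
  dFun_kpair x s t hs ht := by
    rw [dFun_kpair h hs ht, bracketVF_self (hf.smooth_vf x) hs, bracketVF_self (hf.smooth_vf x) ht]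
    have h1 := hf.derivForm_add h x (s x) (Complex.I • t x)
    have h2 := hf.derivForm_add h x (s x) (t x)
    rw [hv] at h1
    have key : herm (derivForm omega x (v x)) (s x) (t x) +
        kpair omega x (fderiv ℝ (chartVF ℝ x v) (extChartAt 𝓘(ℝ, E) x x) (s x)) (t x) +
        kpair omega x (s x) (fderiv ℝ (chartVF ℝ x v) (extChartAt 𝓘(ℝ, E) x x) (t x)) = 0 := by
      have c1 := congrArg (fun r : ℝ ↦ (r : ℂ)) h1
      have c2 := congrArg (fun r : ℝ ↦ (r : ℂ)) h2
      simp only [Complex.ofReal_add, Complex.ofReal_zero] at c1 c2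
      simp only [kpair, herm]
      linear_combination (1 / 2 : ℂ) * c1 - (Complex.I / 2) * c2
    rw [kpair_sub_left]
    have e : ∀ a b : E, kpair omega x (s x) (a - b) = kpair omega x (s x) a - kpair omega x (s x) b :=
      fun a b ↦ by rw [sub_eq_add_neg, kpair_add_right, sub_eq_add_neg, kpair, kpair, kpair,
        herm_neg_right]
    rw [e]
    linear_combination key

/-- The left side is the Chern derivative of `v` along `a`, paired with `b`. Taking the (1,1)-part
of the Hessian formula and using complex linearity of dv identifies it with i times the Levi form.
-/
theorem IsHamiltonian.leviForm_eq (h : IsKahlerForm omega) (hf : IsHamiltonian omega f v)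
    (x : X) (hv : IsHolomorphicDerivAt v x) (a b : E) :
    kpair omega x (fderiv ℝ (chartVF ℝ x v) (extChartAt 𝓘(ℝ, E) x x) a) b +
      kpairDel omega x a (v x) b = Complex.I * leviForm f x a b := by
  have q := h.isOneOne x
  simp only [leviForm, oneOnePart, hf.hessian h, hv a, kpair, kpairDel, herm, hermDel, q.I_smul,
    q.I_left]
  push_cast
  generalize (twoFormBilin E ℝ (omega x))
    (fderiv ℝ (chartVF ℝ x v) (extChartAt 𝓘(ℝ, E) x x) a) b = I1
  generalize (twoFormBilin E ℝ (omega x))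
    (fderiv ℝ (chartVF ℝ x v) (extChartAt 𝓘(ℝ, E) x x) a) (Complex.I • b) = I2
  generalize (derivForm omega x a) (v x) (Complex.I • b) = t2
  linear_combination ((I2 : ℂ) / 2 + t2 / 4) * Complex.I_mul_I

end Hamiltonian

/-! ### Pullback of vector fields -/

section Pull

variable {E X : Type*} [NormedAddCommGroup E] [NormedSpace ℂ E]
  [TopologicalSpace X] [ChartedSpace E X]
  {K : Type*} [Group K] [MulAction K X]

/-- The pullback of a vector field by the action of `k`. -/
def pullVF (k : K) (s : X → E) (x : X) : E := dAct (E := E) k⁻¹ (k • x) (s (k • x))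

theorem contMDiff_act (hol : ∀ k : K, ContMDiff 𝓘(ℂ, E) 𝓘(ℂ, E) ω (fun x : X ↦ k • x)) (k : K) :
    ContMDiff 𝓘(ℝ, E) 𝓘(ℝ, E) ∞ (fun x : X ↦ k • x) := fun x ↦
  contMDiffAt_restrictScalars (hol k x)

theorem hasMFDerivAt_act (hol : ∀ k : K, ContMDiff 𝓘(ℂ, E) 𝓘(ℂ, E) ω (fun x : X ↦ k • x)) (k : K)
    (x : X) : HasMFDerivAt 𝓘(ℝ, E) 𝓘(ℝ, E) (fun x : X ↦ k • x) x (dAct (E := E) k x) :=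
  ((contMDiff_act hol k x).mdifferentiableAt (by simp)).hasMFDerivAt

theorem dAct_inv_dAct (hol : ∀ k : K, ContMDiff 𝓘(ℂ, E) 𝓘(ℂ, E) ω (fun x : X ↦ k • x)) (k : K)
    (x : X) (u : E) : dAct (E := E) k⁻¹ (k • x) (dAct (E := E) k x u) = u := by
  have h1 := (hasMFDerivAt_act hol k⁻¹ (k • x)).comp x (hasMFDerivAt_act hol k x)
  have e : (fun x : X ↦ k⁻¹ • x) ∘ (fun x : X ↦ k • x) = id := funext fun x ↦ inv_smul_smul k x
  rw [e] at h1
  exact DFunLike.congr_fun (hasMFDerivAt_unique h1 (hasMFDerivAt_id x)) u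

theorem dAct_dAct_inv (hol : ∀ k : K, ContMDiff 𝓘(ℂ, E) 𝓘(ℂ, E) ω (fun x : X ↦ k • x)) (k : K)
    (x : X) (u : E) : dAct (E := E) k x (dAct (E := E) k⁻¹ (k • x) u) = u := by
  have h1 : HasMFDerivAt 𝓘(ℝ, E) 𝓘(ℝ, E) (fun x : X ↦ k • x) (k⁻¹ • k • x) (dAct (E := E) k x) := by
    rw [inv_smul_smul]
    exact hasMFDerivAt_act hol k x
  have h2 := h1.comp (k • x) (hasMFDerivAt_act hol k⁻¹ (k • x))
  have e : (fun x : X ↦ k • x) ∘ (fun x : X ↦ k⁻¹ • x) = id := funext fun x ↦ smul_inv_smul k x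
  rw [e] at h2
  exact DFunLike.congr_fun (hasMFDerivAt_unique h2 (hasMFDerivAt_id (k • x))) u

theorem pullVF_eq_iff (hol : ∀ k : K, ContMDiff 𝓘(ℂ, E) 𝓘(ℂ, E) ω (fun x : X ↦ k • x)) (k : K)
    (s : X → E) (x : X) : dAct (E := E) k x (pullVF k s x) = s (k • x) := dAct_dAct_inv hol k x _

/-- The differential of k⁻¹ inverts that of k, so the general theorems on pullback and brackets
apply to the action. -/
theorem pullVF_eq_mpullback (hol : ∀ k : K, ContMDiff 𝓘(ℂ, E) 𝓘(ℂ, E) ω (fun x : X ↦ k • x)) (k : K)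
    (s : X → E) (x : X) :
    pullVF k s x = VectorField.mpullback 𝓘(ℝ, E) 𝓘(ℝ, E) (fun x : X ↦ k • x) s x := by
  have h1 : (mfderiv 𝓘(ℝ, E) 𝓘(ℝ, E) (fun x : X ↦ k • x) x : E →L[ℝ] E).inverse =
      dAct (E := E) k⁻¹ (k • x) := by
    refine ContinuousLinearMap.inverse_eq ?_ ?_
    · ext u; exact dAct_dAct_inv hol k x u
    · ext u; exact dAct_inv_dAct hol k x u
  exact (DFunLike.congr_fun h1 (s (k • x))).symm

theorem pullVF_I_smul (hol : ∀ k : K, ContMDiff 𝓘(ℂ, E) 𝓘(ℂ, E) ω (fun x : X ↦ k • x)) (k : K)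
    (s : X → E) (c : ℂ) (x : X) : pullVF k (fun z ↦ c • s z) x = c • pullVF k s x :=
  dAct_smul hol _ _ _ _

theorem tendsto_act (hol : ∀ k : K, ContMDiff 𝓘(ℂ, E) 𝓘(ℂ, E) ω (fun x : X ↦ k • x)) (k : K)
    (x : X) : Filter.Tendsto (fun x : X ↦ k • x) (𝓝 x) (𝓝 (k • x)) :=
  (contMDiff_act hol k).continuous.continuousAt

theorem dFun_act {G : Type*} [NormedAddCommGroup G] [NormedSpace ℝ G]
    (hol : ∀ k : K, ContMDiff 𝓘(ℂ, E) 𝓘(ℂ, E) ω (fun x : X ↦ k • x)) (k : K)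
    {f : X → G} {x : X} (hf : ContMDiffAt 𝓘(ℝ, E) 𝓘(ℝ, G) ∞ f (k • x)) (u : E) :
    dFun (fun z ↦ f (k • z)) x u = dFun f (k • x) (dAct (E := E) k x u) :=
  DFunLike.congr_fun (mfderiv_comp x (hf.mdifferentiableAt (by simp))
    (hasMFDerivAt_act hol k x).mdifferentiableAt) u

theorem contMDiffAt_act {G : Type*} [NormedAddCommGroup G] [NormedSpace ℝ G]
    (hol : ∀ k : K, ContMDiff 𝓘(ℂ, E) 𝓘(ℂ, E) ω (fun x : X ↦ k • x)) (k : K)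
    {f : X → G} {x : X} (hf : ContMDiffAt 𝓘(ℝ, E) 𝓘(ℝ, G) ∞ f (k • x)) :
    ContMDiffAt 𝓘(ℝ, E) 𝓘(ℝ, G) ∞ (fun z ↦ f (k • z)) x :=
  ContMDiffAt.comp x hf (contMDiff_act hol k x)

variable [IsManifold 𝓘(ℂ, E) ω X] [CompleteSpace E]

theorem VFSmoothAt.pullVF (hol : ∀ k : K, ContMDiff 𝓘(ℂ, E) 𝓘(ℂ, E) ω (fun x : X ↦ k • x)) (k : K)
    {s : X → E} {x : X} (hs : VFSmoothAt s (k • x)) : VFSmoothAt (pullVF k s) x := by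
  have e : EquivChernWeil.pullVF k s =
      VectorField.mpullback 𝓘(ℝ, E) 𝓘(ℝ, E) (fun x : X ↦ k • x) s :=
    funext fun x ↦ pullVF_eq_mpullback hol k s x
  rw [e]
  have : IsManifold 𝓘(ℝ, E) (∞ + 1) X := isManifold_real
  have hinv : (mfderiv 𝓘(ℝ, E) 𝓘(ℝ, E) (fun x : X ↦ k • x) x).IsInvertible := by
    refine ⟨ContinuousLinearEquiv.equivOfInverse (dAct (E := E) k x) (dAct (E := E) k⁻¹ (k • x))
      (dAct_inv_dAct hol k x) (dAct_dAct_inv hol k x), rfl⟩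
  exact ContMDiffAt.mpullback_vectorField_preimage (n := ∞) hs (contMDiff_act hol k x) hinv (by simp)

theorem pullVF_bracketVF (hol : ∀ k : K, ContMDiff 𝓘(ℂ, E) 𝓘(ℂ, E) ω (fun x : X ↦ k • x)) (k : K)
    {s t : X → E} {x : X} (hs : VFSmoothAt s (k • x)) (ht : VFSmoothAt t (k • x)) :
    pullVF k (bracketVF s t) x = bracketVF (pullVF k s) (pullVF k t) x := by
  have e : ∀ s : X → E, pullVF k s =
      VectorField.mpullback 𝓘(ℝ, E) 𝓘(ℝ, E) (fun x : X ↦ k • x) s :=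
    fun s ↦ funext fun x ↦ pullVF_eq_mpullback hol k s x
  rw [e, e, e]
  exact VectorField.mpullback_mlieBracket hs.mdifferentiableAt ht.mdifferentiableAt
    (contMDiff_act hol k x) (by simpa using ENat.LEInfty.out)

end Pull

/-! ### Infinitesimal action on vector fields -/

section InfAction

variable {E X : Type*} [NormedAddCommGroup E] [NormedSpace ℂ E]
  [TopologicalSpace X] [ChartedSpace E X] [IsManifold 𝓘(ℂ, E) ω X]
  {EK K : Type*} [NormedAddCommGroup EK] [NormedSpace ℝ EK]
  [TopologicalSpace K] [ChartedSpace EK K] [Group K] [LieGroup 𝓘(ℝ, EK) ∞ K]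
  [MulAction K X] [ContMDiffSMul 𝓘(ℝ, EK) 𝓘(ℝ, E) ∞ K X]

omit [IsManifold 𝓘(ℂ, E) ω X] in
/-- Equivariance of the generating vector fields. -/
theorem dAct_fundVF (hol : ∀ k : K, ContMDiff 𝓘(ℂ, E) 𝓘(ℂ, E) ω (fun x : X ↦ k • x)) (k : K)
    (v : LieAlg EK K) (x : X) :
    dAct (E := E) k x (fundVF v x) = fundVF (Ad k v) (k • x) := by
  have h1 : HasMFDerivAt 𝓘(ℝ, E) 𝓘(ℝ, E) (fun x : X ↦ k • x) ((1 : K) • x)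
      (dAct (E := E) k x) := by
    rw [one_smul]
    exact hasMFDerivAt_act hol k x
  have h2 := h1.comp (1 : K) (mdifferentiableAt_orbit (EK := EK) (E := E) x (1 : K)).hasMFDerivAt
  have d3 : MDifferentiableAt 𝓘(ℝ, EK) 𝓘(ℝ, EK) (fun g : K ↦ k * g * k⁻¹) 1 := by
    have : ContMDiff 𝓘(ℝ, EK) 𝓘(ℝ, EK) ∞ (fun g : K ↦ k * g * k⁻¹) :=
      ((contMDiff_const (c := k)).mul contMDiff_id).mul contMDiff_const
    exact (this 1).mdifferentiableAt (by simp)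
  have h4 : HasMFDerivAt 𝓘(ℝ, EK) 𝓘(ℝ, E) (fun g : K ↦ g • (k • x)) (k * 1 * k⁻¹)
      (mfderiv 𝓘(ℝ, EK) 𝓘(ℝ, E) (fun g : K ↦ g • (k • x)) 1 : EK →L[ℝ] E) := by
    rw [mul_one, mul_inv_cancel]
    exact (mdifferentiableAt_orbit (EK := EK) (E := E) (k • x) (1 : K)).hasMFDerivAt
  have h5 := h4.comp (1 : K) d3.hasMFDerivAt
  -- Both sides are derivatives at g = 1 of the same map, since (k g k⁻¹)(k x) = k (g x).
  have e : (fun g : K ↦ g • (k • x)) ∘ (fun g : K ↦ k * g * k⁻¹) =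
      (fun x : X ↦ k • x) ∘ fun g : K ↦ g • x := by
    ext g
    simp only [Function.comp_apply, mul_smul, inv_smul_smul]
  rw [e] at h5
  exact DFunLike.congr_fun (hasMFDerivAt_unique h2 h5) v

variable [CompleteSpace E]

/-- The infinitesimal action on vector fields is the Lie bracket. -/
theorem exists_hasMFDerivAt_pullVF
    (hol : ∀ k : K, ContMDiff 𝓘(ℂ, E) 𝓘(ℂ, E) ω (fun x : X ↦ k • x)) {s : X → E} {x : X}
    (hs : VFSmoothAt s x) :
    ∃ L : EK →L[ℝ] E, HasMFDerivAt 𝓘(ℝ, EK) 𝓘(ℝ, E) (fun k : K ↦ pullVF k s x) 1 L ∧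
      ∀ v : LieAlg EK K, L v = bracketVF (fundVF v) s x := by
  have hK1 : IsManifold 𝓘(ℝ, EK) 1 K := IsManifold.of_le (n := ∞) (by simp)
  set κ₀ := extChartAt 𝓘(ℝ, EK) (1 : K) 1 with hκ₀
  set y₀ := extChartAt 𝓘(ℝ, E) x x with hy₀
  have e1 : (extChartAt 𝓘(ℝ, EK) (1 : K)).symm κ₀ = 1 := extChartAt_to_inv (I := 𝓘(ℝ, EK)) (1 : K)
  have e2 : (extChartAt 𝓘(ℝ, E) x).symm y₀ = x := extChartAt_to_inv (I := 𝓘(ℝ, E)) x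
  have hx := mem_extChartAt_source (I := 𝓘(ℝ, E)) x
  set A : EK → E →L[ℝ] E := actChartD (K := K) x with hA
  have hA0 : A κ₀ = ContinuousLinearMap.id ℝ E := by
    ext u
    rw [hA, (eventually_actChartD (E := E) (EK := EK) (K := K) x).self_of_nhds u]
    have hid : HasMFDerivAt 𝓘(ℝ, E) 𝓘(ℝ, E) (fun z : X ↦ (1 : K) • z) x
        (ContinuousLinearMap.id ℝ E) := by
      have h0 : (fun z : X ↦ (1 : K) • z) = id := funext (one_smul K)
      rw [h0]
      exact hasMFDerivAt_id x
    have h1 := DFunLike.congr_fun (hasMFDerivAt_unique (hasMFDerivAt_act hol (1 : K) x) hid) u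
    simp only [← hκ₀, e1]
    have h2 : chartD (E := E) ℝ x ((1 : K) • x) = ContinuousLinearMap.id ℝ E := by
      rw [one_smul, chartD_self]
    rw [h2]
    exact h1
  have hAd : HasFDerivAt A (fderiv ℝ A κ₀) κ₀ :=
    ((contDiffAt_actChartD (E := E) (EK := EK) (K := K) x).differentiableAt
      (by simp)).hasFDerivAt
  have hinv : ∀ᶠ κ in 𝓝 κ₀, (A κ).IsInvertible := by
    have h1 : ∀ᶠ T in 𝓝 (A κ₀), T.IsInvertible := by
      rw [hA0]
      exact ContinuousLinearEquiv.nhds (ContinuousLinearEquiv.refl ℝ E)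
    exact hAd.continuousAt.eventually h1
  set S : EK → E := fun κ ↦ chartVF ℝ x s (actChart EK K x (κ, y₀)) with hS
  have ha0 : actChart EK K x (κ₀, y₀) = y₀ := by
    simp only [actChart, e1, e2, one_smul]; rfl
  have hSd : HasFDerivAt S ((fderiv ℝ (chartVF ℝ x s) y₀).comp
      (fderiv ℝ (fun κ ↦ actChart EK K x (κ, y₀)) κ₀)) κ₀ := by
    have h1 : HasFDerivAt (chartVF ℝ x s) (fderiv ℝ (chartVF ℝ x s) y₀)
        (actChart EK K x (κ₀, y₀)) := by
      rw [ha0]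
      exact (hs.differentiableAt hx).hasFDerivAt
    have h2 : DifferentiableAt ℝ (fun κ ↦ actChart EK K x (κ, y₀)) κ₀ :=
      DifferentiableAt.comp (g := actChart EK K x) κ₀ ((contDiffAt_actChart (EK := EK) (K := K) x).differentiableAt
        (by simp)) (differentiableAt_id.prodMk (differentiableAt_const y₀))
    exact h1.comp κ₀ h2.hasFDerivAt
  -- The pullback of `s` to x in coordinates: A is the differential of the action at x, and S is `s`
  -- read at the moved point.
  set g : EK → E := fun κ ↦ (A κ).inverse (S κ) with hg
  have hgd : DifferentiableAt ℝ g κ₀ := by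
    have h1 : DifferentiableAt ℝ ContinuousLinearMap.inverse (A κ₀) := by
      rw [hA0]
      exact (contDiffAt_map_inverse (n := ∞) (𝕜 := ℝ)
        (ContinuousLinearEquiv.refl ℝ E)).differentiableAt (by simp)
    exact (h1.comp κ₀ hAd.differentiableAt).clm_apply hSd.differentiableAt
  have hAg : (fun κ ↦ A κ (g κ)) =ᶠ[𝓝 κ₀] S := by
    filter_upwards [hinv] with κ hκ
    exact DFunLike.congr_fun hκ.self_comp_inverse (S κ)
  have hg0 : g κ₀ = s x := by
    have : A κ₀ (g κ₀) = S κ₀ := hAg.self_of_nhds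
    rw [hA0] at this
    refine this.trans ?_
    simp only [hS, ha0]
    exact chartVF_self x s
  -- Differentiate A g = S at the identity, where A = id and g = s(x). This avoids differentiating
  -- the inverse explicitly.
  have hder : ∀ w : EK, fderiv ℝ g κ₀ w = fderiv ℝ S κ₀ w - fderiv ℝ A κ₀ w (s x) := by
    intro w
    have h1 := (hAd.clm_apply hgd.hasFDerivAt).fderiv
    rw [hAg.fderiv_eq, hA0, hg0] at h1
    rw [h1]
    simp
  have hpull : (fun k : K ↦ pullVF k s x) =ᶠ[𝓝 1] g ∘ extChartAt 𝓘(ℝ, EK) (1 : K) := by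
    have h1 : ContinuousAt (extChartAt 𝓘(ℝ, EK) (1 : K)) 1 := continuousAt_extChartAt (1 : K)
    filter_upwards [h1.eventually (eventually_actChartD (E := E) (EK := EK) (K := K) x),
      h1.eventually (eventually_act_mem_source (E := E) (EK := EK) (K := K) x),
      h1.eventually hinv, extChartAt_source_mem_nhds (I := 𝓘(ℝ, EK)) (1 : K)] with k k1 k2 k3 k4
    rw [(extChartAt 𝓘(ℝ, EK) (1 : K)).left_inv k4] at k1 k2
    have h2 : A (extChartAt 𝓘(ℝ, EK) (1 : K) k) (pullVF k s x) =
        S (extChartAt 𝓘(ℝ, EK) (1 : K) k) := by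
      rw [hA, k1, pullVF_eq_iff hol]
      simp only [hS, actChart, e2, (extChartAt 𝓘(ℝ, EK) (1 : K)).left_inv k4]
      rw [chartVF_chart k2]
    simp only [Function.comp_apply, hg]
    rw [← h2]
    exact (DFunLike.congr_fun k3.inverse_comp_self (pullVF k s x)).symm
  refine ⟨fderiv ℝ g κ₀, ?_, fun v ↦ ?_⟩
  · have h1 : HasMFDerivAt 𝓘(ℝ, EK) 𝓘(ℝ, EK) (extChartAt 𝓘(ℝ, EK) (1 : K)) 1
        (ContinuousLinearMap.id ℝ EK) := by
      have h2 : MDifferentiableAt 𝓘(ℝ, EK) 𝓘(ℝ, EK) (extChartAt 𝓘(ℝ, EK) (1 : K)) 1 :=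
        mdifferentiableAt_extChartAt (by simp)
      have h3 := h2.hasMFDerivAt
      have h4 := chartD_self (𝕜 := ℝ) (E := EK) (1 : K)
      rw [chartD] at h4
      rwa [h4] at h3
    have h5 := HasMFDerivAt.comp (1 : K) (hgd.hasFDerivAt.hasMFDerivAt) h1
    exact (h5.congr_of_eventuallyEq hpull)
  -- S contributes ds(v), and A contributes dv(s) by symmetry of mixed derivatives; the difference
  -- is the bracket.
  · refine (hder v).trans ?_
    rw [hSd.fderiv, bracketVF_self (vfSmoothAt_fundVF v x) hs]
    have h1 := fderiv_actChartD v x (s x)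
    rw [hA, h1]
    congr 1
    have h2 := chartVF_fundVF (EK := EK) (K := K) v (x₀ := x) (y := y₀)
      ((extChartAt 𝓘(ℝ, E) x).map_source hx)
    rw [hy₀, chartVF_self] at h2
    exact (congrArg (fderiv ℝ (chartVF ℝ x s) y₀) h2).symm

end InfAction

/-! ### Naturality of the Chern pairing -/

section Naturality

variable {E X : Type*} [NormedAddCommGroup E] [NormedSpace ℂ E]
  [TopologicalSpace X] [ChartedSpace E X]
  {K : Type*} [Group K] [MulAction K X] {omega : X → E [⋀^Fin 2]→L[ℝ] ℝ}

theorem kpair_dAct (hol : ∀ k : K, ContMDiff 𝓘(ℂ, E) 𝓘(ℂ, E) ω (fun x : X ↦ k • x))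
    (hinv : IsInvariantForm K omega) (k : K) (x : X) (a b : E) :
    kpair omega (k • x) (dAct (E := E) k x a) (dAct (E := E) k x b) = kpair omega x a b := by
  have h : ∀ a b : E, omega (k • x) ![dAct (E := E) k x a, dAct (E := E) k x b] =
      omega x ![a, b] := by
    intro a b
    rw [← hinv k x]
    refine congrArg (omega (k • x)) (funext fun i ↦ ?_)
    fin_cases i <;> rfl
  rw [kpair_eq, kpair_eq, ← dAct_smul hol, h, h]

theorem kpair_pullVF (hol : ∀ k : K, ContMDiff 𝓘(ℂ, E) 𝓘(ℂ, E) ω (fun x : X ↦ k • x))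
    (hinv : IsInvariantForm K omega) (k : K) (s t : X → E) (x : X) :
    kpair omega x (pullVF k s x) (pullVF k t x) = kpair omega (k • x) (s (k • x)) (t (k • x)) := by
  rw [← kpair_dAct hol hinv k, pullVF_eq_iff hol, pullVF_eq_iff hol]

variable [IsManifold 𝓘(ℂ, E) ω X] [CompleteSpace E]

theorem delFun_pullVF (hol : ∀ k : K, ContMDiff 𝓘(ℂ, E) 𝓘(ℂ, E) ω (fun x : X ↦ k • x)) (k : K)
    {f : X → ℂ} {x : X} (hf : ContMDiffAt 𝓘(ℝ, E) 𝓘(ℝ, ℂ) ∞ f (k • x)) (U : X → E) :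
    delFun (pullVF k U) (fun z ↦ f (k • z)) x = delFun U f (k • x) := by
  rw [delFun, dFun_act hol k hf, dFun_act hol k hf, dAct_smul hol, pullVF_eq_iff hol, delFun]

theorem dbarVF_pullVF (hol : ∀ k : K, ContMDiff 𝓘(ℂ, E) 𝓘(ℂ, E) ω (fun x : X ↦ k • x)) (k : K)
    {U s : X → E} {x : X} (hU : VFSmoothAt U (k • x)) (hs : VFSmoothAt s (k • x)) :
    dbarVF (pullVF k U) (pullVF k s) x = pullVF k (dbarVF U s) x := by
  have e : (fun z ↦ Complex.I • pullVF k U z) = pullVF k (fun z ↦ Complex.I • U z) :=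
    funext fun z ↦ (pullVF_I_smul hol k U Complex.I z).symm
  rw [dbarVF, e, ← pullVF_bracketVF hol k hU hs,
    ← pullVF_bracketVF hol k (hU.const_smul Complex.I) hs, pullVF, pullVF, pullVF, dbarVF,
    dAct_smul hol, map_add, dAct_smul hol]

/-- Functions, brackets, multiplication by i and h are all carried along by a biholomorphism
preserving omega. -/
theorem chernPairing_pullVF (hol : ∀ k : K, ContMDiff 𝓘(ℂ, E) 𝓘(ℂ, E) ω (fun x : X ↦ k • x))
    (h : IsKahlerForm omega) (hinv : IsInvariantForm K omega) (k : K) {s U t : X → E} {x : X}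
    (hs : VFSmoothAt s (k • x)) (hU : VFSmoothAt U (k • x)) (ht : VFSmoothAt t (k • x)) :
    chernPairing omega (pullVF k s) (pullVF k U) (pullVF k t) x =
      chernPairing omega s U t (k • x) := by
  have e : (fun z ↦ kpair omega z (pullVF k s z) (pullVF k t z)) =
      fun z ↦ (fun w ↦ kpair omega w (s w) (t w)) (k • z) :=
    funext fun z ↦ kpair_pullVF hol hinv k s t z
  rw [chernPairing, e, delFun_pullVF hol k (contMDiffAt_kpair h hs ht), dbarVF_pullVF hol k hU hs,
    dbarVF_pullVF hol k hU ht, kpair_pullVF hol hinv, kpair_pullVF hol hinv, chernPairing]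

omit [CompleteSpace E] in
/-- A vector field with prescribed value at a point. -/
theorem exists_vfSmoothAt (x : X) (u : E) :
    ∃ Y : X → E, Y x = u ∧ ∀ᶠ z in 𝓝 x, VFSmoothAt Y z := by
  refine ⟨fun z ↦ symmD ℝ x (extChartAt 𝓘(ℝ, E) x z) u, ?_, ?_⟩
  · have := symmD_chartD (𝕜 := ℝ) (E := E) (mem_extChartAt_source x) u
    rwa [chartD_self] at this
  · filter_upwards [extChartAt_source_mem_nhds (I := 𝓘(ℝ, E)) x] with z hz
    rw [vfSmoothAt_iff hz]
    refine (contDiffAt_const (c := u)).congr_of_eventuallyEq ?_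
    filter_upwards [eventually_chart_symm hz (p := fun _ ↦ True) (by simp)] with y hy
    rw [chartVF, (extChartAt 𝓘(ℝ, E) x).right_inv hy.1, chartD_symmD hy.1]

end Naturality

/-! ### Invariance and moment map of the vertical Chern connection -/

section VertMoment

variable {E F X B : Type*} [NormedAddCommGroup E] [NormedSpace ℂ E]
  [NormedAddCommGroup F] [NormedSpace ℂ F]
  [TopologicalSpace X] [ChartedSpace E X] [TopologicalSpace B] [ChartedSpace F B]
  {π : X → B} {omega : X → E [⋀^Fin 2]→L[ℝ] ℝ}
  [IsManifold 𝓘(ℂ, E) ω X]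

/-- Smoothness of a section of the vertical tangent bundle at a point. -/
abbrev SecSmoothAt (s : ∀ y, vert E F π y) (x : X) : Prop := VFSmoothAt (fun z ↦ (s z : E)) x

theorem SecSmoothAt.congr {s t : ∀ y, vert E F π y} {x : X} (hs : SecSmoothAt s x)
    (h : ∀ᶠ y in 𝓝 x, t y = s y) : SecSmoothAt t x :=
  VFSmoothAt.congr hs (h.mono fun _ hy ↦ congrArg Subtype.val hy)

variable [FiniteDimensional ℂ E]

/-- Existence of the vertical Hessian. -/
theorem kpair_vertHessian (h : IsRelativelyKahler (F := F) π omega) (f : X → ℝ) (x : X)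
    (a b : vert E F π x) :
    kpair omega x (vertHessian F π omega f x a) b = leviForm f x (a : E) (b : E) := by
  have hh := isHermitianInner_kpair h x
  set q : E →L[ℝ] E →L[ℝ] ℝ :=
    fderiv ℝ (fderiv ℝ (f ∘ (extChartAt 𝓘(ℝ, E) x).symm)) (extChartAt 𝓘(ℝ, E) x x) with hq
  have I2 : ∀ u : E, Complex.I • Complex.I • u = -u := fun u ↦ by
    rw [smul_smul, Complex.I_mul_I, neg_one_smul]
  have hl : ∀ u w : E, leviForm f x u w = oneOnePart (fun u w ↦ q u w) u w := fun _ _ ↦ rfl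
  have I1 := Complex.I_mul_I
  -- The (1,1)-projection of any real bilinear form is sesquilinear, so the Levi form can be raised
  -- with the metric on the vertical space.
  have Il : ∀ u w : E, leviForm f x (Complex.I • u) w = Complex.I * leviForm f x u w := by
    intro u w
    rw [hl, hl, oneOnePart, oneOnePart, I2]
    simp only [map_neg, neg_apply]
    push_cast
    linear_combination -((q u (Complex.I • w) : ℂ) - q (Complex.I • u) w) / 4 * I1
  have Ir : ∀ u w : E, leviForm f x u (Complex.I • w) = -Complex.I * leviForm f x u w := by
    intro u w
    rw [hl, hl, oneOnePart, oneOnePart, I2]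
    simp only [map_neg]
    push_cast
    linear_combination ((q u (Complex.I • w) : ℂ) - q (Complex.I • u) w) / 4 * I1
  have al : ∀ u u' w : E, leviForm f x (u + u') w = leviForm f x u w + leviForm f x u' w := by
    intro u u' w
    simp only [hl, oneOnePart, smul_add, map_add, add_apply]
    push_cast
    ring
  have ar : ∀ u w w' : E, leviForm f x u (w + w') = leviForm f x u w + leviForm f x u w' := by
    intro u w w'
    simp only [hl, oneOnePart, smul_add, map_add]
    push_cast
    ring
  have rl : ∀ (r : ℝ) (u w : E), leviForm f x (r • u) w = r * leviForm f x u w := by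
    intro r u w
    simp only [hl, oneOnePart, smul_comm Complex.I r, map_smul, smul_apply,
      smul_eq_mul]
    push_cast
    ring
  have rr : ∀ (r : ℝ) (u w : E), leviForm f x u (r • w) = r * leviForm f x u w := by
    intro r u w
    simp only [hl, oneOnePart, smul_comm Complex.I r, map_smul, smul_eq_mul]
    push_cast
    ring
  have cl : ∀ (c : ℂ) (u w : E), leviForm f x (c • u) w = c * leviForm f x u w := by
    intro c u w
    rw [complex_smul_eq, al, rl, rl, Il]
    conv_rhs => rw [← Complex.re_add_im c]
    ring
  have cr : ∀ (c : ℂ) (u w : E),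
      leviForm f x u (c • w) = starRingEnd ℂ c * leviForm f x u w := by
    intro c u w
    have hc : starRingEnd ℂ c = c.re - c.im * Complex.I := by apply Complex.ext <;> simp
    rw [complex_smul_eq, ar, rr, rr, Ir, hc]
    ring
  have hs : ∀ a b : vert E F π x,
      kpair omega x (hh.sharp fun b : vert E F π x ↦ leviForm f x (a : E) (b : E)) b =
        leviForm f x (a : E) (b : E) :=
    fun a b ↦ hh.sharp_apply (g := fun b : vert E F π x ↦ leviForm f x (a : E) (b : E))
      (fun b b' ↦ ar _ _ _) (fun z b ↦ cr _ _ _) b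
  have H : ∃ T : vert E F π x →ₗ[ℂ] vert E F π x,
      ∀ a b, vertMetric F π omega x (T a) b = leviForm f x (a : E) (b : E) := by
    refine ⟨{ toFun := fun a ↦ hh.sharp fun b : vert E F π x ↦ leviForm f x (a : E) (b : E)
              map_add' := fun a a' ↦ ?_
              map_smul' := fun c a ↦ ?_ }, fun a b ↦ ?_⟩
    · rw [← IsHermitianInner.sharp_add]
      exact congrArg hh.sharp (funext fun b ↦ al _ _ _)
    · rw [RingHom.id_apply, ← IsHermitianInner.sharp_smul]
      exact congrArg hh.sharp (funext fun b ↦ cl _ _ _)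
    · rw [vertMetric_eq h]
      exact hs a b
  rw [vertHessian, dif_pos H, ← vertMetric_eq h]
  exact H.choose_spec a b

variable [FiniteDimensional ℂ F] [IsManifold 𝓘(ℂ, F) ω B] {n : ℕ}

/-- A smooth section of the vertical tangent bundle with prescribed value at a point. -/
theorem exists_secSmoothAt (hs : Manifold.IsSubmersion 𝓘(ℂ, E) 𝓘(ℂ, F) ω π)
    (hn : Module.finrank ℂ E = Module.finrank ℂ F + n) (x : X) (w : vert E F π x) :
    ∃ t : ∀ y, vert E F π y, t x = w ∧ ∀ᶠ y in 𝓝 x, SecSmoothAt t y := by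
  obtain ⟨e, he⟩ := exists_holomorphic_frame hs hn x
  let b := vertBasis (finrank_vert hs hn x) he.self_of_nhds.2
  refine ⟨fun z ↦ ∑ i, b.repr w i • e i z, ?_, ?_⟩
  · refine Eq.trans ?_ (b.sum_repr w)
    exact Finset.sum_congr rfl fun i _ ↦ by rw [vertBasis_apply]
  · filter_upwards [he] with y hy
    refine (VFSmoothAt.sum Finset.univ fun i _ ↦
      ((hy.1 i).vfSmoothAt.const_smul (b.repr w i))).congr (Filter.Eventually.of_forall fun z ↦ ?_)
    simp

variable {K : Type*} [Group K] [MulAction K X] [MulAction K B]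

omit [FiniteDimensional ℂ E] [FiniteDimensional ℂ F] [IsManifold 𝓘(ℂ, F) ω B]
  [IsManifold 𝓘(ℂ, E) ω X] in
theorem coe_vertPull (hπ : IsEquivariantSubmersion E F K π) (k : K) (x : X)
    (w : vert E F π (k • x)) :
    (vertPull hπ k x w : E) = dAct (E := E) k⁻¹ (k • x) w := by
  have h := mfderiv_restrictScalars (x := k • x)
    ((hπ.holomorphic_source k⁻¹).mdifferentiable (by simp) (k • x))
  exact (DFunLike.congr_fun h (w : E)).symm

omit [FiniteDimensional ℂ E] [FiniteDimensional ℂ F] [IsManifold 𝓘(ℂ, F) ω B]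
  [IsManifold 𝓘(ℂ, E) ω X] in
theorem vertPull_injective (hπ : IsEquivariantSubmersion E F K π) (k : K) (x : X) :
    Function.Injective (vertPull hπ k x) := by
  intro a b hab
  have h := congrArg (fun w : vert E F π x ↦ dAct (E := E) k x w) hab
  simp only [coe_vertPull] at h
  rw [dAct_dAct_inv hπ.holomorphic_source, dAct_dAct_inv hπ.holomorphic_source] at h
  exact Subtype.ext h

omit [IsManifold 𝓘(ℂ, F) ω B] in
theorem vertPull_bijective (hπ : IsEquivariantSubmersion E F K π)
    (hn : Module.finrank ℂ E = Module.finrank ℂ F + n) (k : K) (x : X) :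
    Function.Bijective (vertPull hπ k x) :=
  ⟨vertPull_injective hπ k x, (LinearMap.injective_iff_surjective_of_finrank_eq_finrank
    ((finrank_vert hπ.submersion hn _).trans (finrank_vert hπ.submersion hn _).symm)).1
    (vertPull_injective hπ k x)⟩

/-- The pullback of a section of the vertical tangent bundle. -/
def pullSec (hπ : IsEquivariantSubmersion E F K π) (k : K) (s : ∀ y, vert E F π y) (x : X) :
    vert E F π x := vertPull hπ k x (s (k • x))

omit [FiniteDimensional ℂ E] [FiniteDimensional ℂ F] [IsManifold 𝓘(ℂ, F) ω B]
  [IsManifold 𝓘(ℂ, E) ω X] in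
theorem coe_pullSec (hπ : IsEquivariantSubmersion E F K π) (k : K) (s : ∀ y, vert E F π y)
    (x : X) : (pullSec hπ k s x : E) = pullVF k (fun z ↦ (s z : E)) x :=
  coe_vertPull hπ k x _

omit [FiniteDimensional ℂ F] [IsManifold 𝓘(ℂ, F) ω B] in
theorem SecSmoothAt.pullSec (hπ : IsEquivariantSubmersion E F K π) (k : K)
    {s : ∀ y, vert E F π y} {x : X} (hs : SecSmoothAt s (k • x)) :
    SecSmoothAt (pullSec hπ k s) x := by
  have := FiniteDimensional.complete ℂ E
  rw [SecSmoothAt, funext fun z ↦ coe_pullSec hπ k s z]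
  exact hs.pullVF hπ.holomorphic_source k

/-- Invariance of the vertical Chern connection. -/
theorem vertD_pullSec (hπ : IsEquivariantSubmersion E F K π)
    (h : IsRelativelyKahler (F := F) π omega) (hinv : IsInvariantForm K omega)
    (hn : Module.finrank ℂ E = Module.finrank ℂ F + n) (k : K) {s : ∀ y, vert E F π y} {x : X}
    (hs : SecSmoothAt s (k • x)) (u : E) :
    vertD h (pullSec hπ k s) x u = vertPull hπ k x (vertD h s (k • x) (dAct k x u)) := by
  have := FiniteDimensional.complete ℂ E
  have hol := hπ.holomorphic_source
  refine vert_ext h fun t ↦ ?_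
  obtain ⟨w, rfl⟩ := (vertPull_bijective hπ hn k x).2 t
  obtain ⟨T, rfl, hT⟩ := exists_secSmoothAt hπ.submersion hn (k • x) w
  -- `chernPairing` takes vector fields, so the single tangent vector is extended before pulling
  -- back.
  obtain ⟨U, hU, hUs⟩ := exists_vfSmoothAt (k • x) (dAct (E := E) k x u)
  have hu : pullVF k U x = u := by rw [pullVF, hU, dAct_inv_dAct hol]
  have h1 := chernPairing_pullVF hol h.isKahlerForm hinv k hs hUs.self_of_nhds hT.self_of_nhds
  rw [← kpair_vertD_eq_chernPairing h hs hUs.self_of_nhds hT.self_of_nhds] at h1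
  have hR : kpair omega x (vertPull hπ k x (vertD h s (k • x) (dAct k x u)))
      (vertPull hπ k x (T (k • x))) =
      kpair omega (k • x) (vertD h s (k • x) (dAct k x u)) (T (k • x)) := by
    rw [coe_vertPull, coe_vertPull, ← kpair_dAct hol hinv k, dAct_dAct_inv hol, dAct_dAct_inv hol]
  have e1 : pullVF k (fun z ↦ (s z : E)) = fun z ↦ (pullSec hπ k s z : E) :=
    funext fun z ↦ (coe_pullSec hπ k s z).symm
  have e2 : pullVF k (fun z ↦ (T z : E)) = fun z ↦ (pullSec hπ k T z : E) :=
    funext fun z ↦ (coe_pullSec hπ k T z).symm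
  rw [hR, ← hU, ← h1, e1, e2, ← kpair_vertD_eq_chernPairing h (SecSmoothAt.pullSec hπ k hs)
    (hUs.self_of_nhds.pullVF hol k) (SecSmoothAt.pullSec hπ k hT.self_of_nhds), hu]
  rfl

variable {EK : Type*} [NormedAddCommGroup EK] [NormedSpace ℝ EK]
  [TopologicalSpace K] [ChartedSpace EK K] [LieGroup 𝓘(ℝ, EK) ∞ K]
  [ContMDiffSMul 𝓘(ℝ, EK) 𝓘(ℝ, E) ∞ K X]

/-- The Lie derivative on sections of the vertical tangent bundle. -/
def vertLie (v : LieAlg EK K) (s : ∀ y, vert E F π y) (x : X) : vert E F π x :=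
  vertSection F π (bracketVF (fundVF v) fun z ↦ (s z : E)) x

/-- The curve k ↦ (k^* s)(x) stays in the fixed subspace V_x, hence so does its derivative; a
projection onto V_x transfers differentiability from E. In particular [v, s] is vertical for every
vertical `s`. -/
theorem exists_hasFDerivAt_pullSec (hπ : IsEquivariantSubmersion E F K π)
    {s : ∀ y, vert E F π y} {x : X} (hs : SecSmoothAt s x) :
    ∃ L : EK →L[ℝ] vert E F π x,
      HasMFDerivAt 𝓘(ℝ, EK) 𝓘(ℝ, vert E F π x) (fun k : K ↦ pullSec hπ k s x) 1 L ∧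
      ∀ v : LieAlg EK K, L v = vertLie v s x ∧
        (L v : E) = bracketVF (fundVF v) (fun z ↦ (s z : E)) x := by
  have := FiniteDimensional.complete ℂ E
  obtain ⟨L, hL, hLv⟩ := exists_hasMFDerivAt_pullVF (EK := EK) hπ.holomorphic_source hs
  obtain ⟨P, hP⟩ := (vert E F π x).exists_isCompl
  let q : E →L[ℝ] vert E F π x :=
    ((((vert E F π x).projectionOnto P hP).toContinuousLinearMap).restrictScalars ℝ)
  have hq : ∀ w : vert E F π x, q w = w := fun w ↦
    Submodule.projectionOnto_apply_left hP w
  have h1 : HasMFDerivAt 𝓘(ℝ, EK) 𝓘(ℝ, vert E F π x) (fun k : K ↦ pullSec hπ k s x) 1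
      (q.comp L) := by
    have h2 := (q.hasMFDerivAt (x := pullVF (1 : K) (fun z ↦ (s z : E)) x)).comp (1 : K) hL
    refine h2.congr_of_eventuallyEq (Filter.Eventually.of_forall fun k ↦ ?_)
    rw [Function.comp_apply, ← coe_pullSec hπ, hq]
  have h3 : L = ((vert E F π x).subtypeL.restrictScalars ℝ).comp (q.comp L) := by
    have h2 := (((vert E F π x).subtypeL.restrictScalars ℝ).hasMFDerivAt
      (x := pullSec hπ (1 : K) s x)).comp (1 : K) h1
    refine hasMFDerivAt_unique hL (h2.congr_of_eventuallyEq (Filter.Eventually.of_forall fun k ↦ ?_))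
    exact (coe_pullSec hπ k s x).symm
  have h4 : ∀ v : LieAlg EK K, ((q.comp L) v : E) = bracketVF (fundVF v) (fun z ↦ (s z : E)) x := by
    intro v
    rw [← hLv v]
    exact (DFunLike.congr_fun h3 v).symm
  refine ⟨q.comp L, h1, fun v ↦ ⟨?_, h4 v⟩⟩
  refine Subtype.ext ((h4 v).trans (vertSection_coe ?_).symm)
  rw [← h4 v]
  exact Subtype.coe_prop _

theorem coe_vertLie (hπ : IsEquivariantSubmersion E F K π) (v : LieAlg EK K)
    {s : ∀ y, vert E F π y} {x : X} (hs : SecSmoothAt s x) :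
    (vertLie v s x : E) = bracketVF (fundVF v) (fun z ↦ (s z : E)) x := by
  obtain ⟨L, -, hL⟩ := exists_hasFDerivAt_pullSec (EK := EK) hπ hs
  rw [← (hL v).1, (hL v).2]

theorem SecSmoothAt.vertLie (hπ : IsEquivariantSubmersion E F K π) (v : LieAlg EK K)
    {s : ∀ y, vert E F π y} {x : X} (hs : ∀ᶠ y in 𝓝 x, SecSmoothAt s y) :
    SecSmoothAt (vertLie v s) x := by
  have := FiniteDimensional.complete ℂ E
  exact ((vfSmoothAt_fundVF v x).bracket hs.self_of_nhds).congr
    (hs.mono fun y hy ↦ coe_vertLie hπ v hy)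

variable {μ : X → LieAlg EK K →ₗ[ℝ] ℝ}

omit [FiniteDimensional ℂ F] [IsManifold 𝓘(ℂ, F) ω B] [FiniteDimensional ℂ E] [MulAction K B] in
theorem IsMomentMap.isHamiltonian (hμ : IsMomentMap omega μ) (v : LieAlg EK K) :
    IsHamiltonian omega (fun y ↦ μ y v) (fundVF v) :=
  ⟨hμ.smooth v, vfSmoothAt_fundVF v, hμ.moment v⟩

theorem IsMomentMap.isHolomorphicIsometric (hπ : IsEquivariantSubmersion E F K π)
    (h : IsRelativelyKahler (F := F) π omega)
    (hμ : IsMomentMap omega μ) (v : LieAlg EK K) :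
    IsHolomorphicIsometric omega (fundVF (E := E) (X := X) v) := by
  have := FiniteDimensional.complete ℂ E
  exact (hμ.isHamiltonian v).isHolomorphicIsometric h.isKahlerForm
    (isHolomorphicDerivAt_fundVF hπ.holomorphic_source v)

/-- The moment endomorphism `⟨σ, v⟩` is `i` times the vertical Hessian. -/
def vertMoment (omega : X → E [⋀^Fin 2]→L[ℝ] ℝ) (μ : X → LieAlg EK K →ₗ[ℝ] ℝ)
    (v : LieAlg EK K) (x : X) : vert E F π x →ₗ[ℂ] vert E F π x :=
  Complex.I • vertHessian F π omega (fun y ↦ μ y v) x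

/-- The moment endomorphism is the difference of covariant and Lie derivative. -/
theorem vertMoment_apply (hπ : IsEquivariantSubmersion E F K π)
    (h : IsRelativelyKahler (F := F) π omega) (hμ : IsMomentMap omega μ) (v : LieAlg EK K)
    {s : ∀ y, vert E F π y} {x : X} (hs : SecSmoothAt s x) :
    vertMoment omega μ v x (s x) = vertD h s x (fundVF v x) - vertLie v s x := by
  have := FiniteDimensional.complete ℂ E
  have hk := h.isKahlerForm
  refine vert_ext h fun t ↦ ?_
  have h1 := (hμ.isHamiltonian v).leviForm_eq hk x
    (isHolomorphicDerivAt_fundVF hπ.holomorphic_source v x) (s x) t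
  -- The derivative of `s` along `v` cancels against the bracket. Then `hermDel_comm` exchanges `v`
  -- and `s` in the metric term, which produces the expression in `h1`.
  rw [AddSubgroupClass.coe_sub, kpair_sub_left, kpair_vertD, coe_vertLie hπ v hs,
    bracketVF_self (vfSmoothAt_fundVF v x) hs, kpair_sub_left, vertMoment, LinearMap.smul_apply,
    Submodule.coe_smul, kpair_smul_left hk, kpair_vertHessian h, ← h1, kpairDel, kpairDel,
    hermDel_comm (hk.isOneOne_derivForm x) (derivForm_cyclic hk.smooth hk.closed x)]
  ring

/-- The vertical Hessian is chosen point by point, so its smoothness is read off from the difference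
of two smooth derivatives. -/
theorem SecSmoothAt.vertMoment (hπ : IsEquivariantSubmersion E F K π)
    (h : IsRelativelyKahler (F := F) π omega) (hμ : IsMomentMap omega μ)
    (hn : Module.finrank ℂ E = Module.finrank ℂ F + n) (v : LieAlg EK K)
    {s : ∀ y, vert E F π y} {x : X} (hs : ∀ᶠ y in 𝓝 x, SecSmoothAt s y) :
    SecSmoothAt (fun y ↦ vertMoment omega μ v y (s y)) x := by
  have h1 := vertD_smooth h hπ.submersion hn hs
    (Filter.Eventually.of_forall fun y ↦ vfSmoothAt_fundVF v y)
  refine (h1.sub (SecSmoothAt.vertLie hπ v hs)).congr (hs.mono fun y hy ↦ ?_)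
  exact congrArg Subtype.val (vertMoment_apply hπ h hμ v hy)

/-- For a fixed section, both D_v s and L_v s at `x` are values at `v` of linear maps on the Lie
algebra. -/
theorem vertMoment_linear (hπ : IsEquivariantSubmersion E F K π)
    (h : IsRelativelyKahler (F := F) π omega) (hμ : IsMomentMap omega μ)
    (hn : Module.finrank ℂ E = Module.finrank ℂ F + n) (x : X) :
    IsLinearMap ℝ (fun v ↦ vertMoment (F := F) (π := π) omega μ v x) := by
  have key : ∀ w : vert E F π x, ∃ M : EK →ₗ[ℝ] vert E F π x,
      ∀ v : LieAlg EK K, vertMoment omega μ v x w = M v := by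
    intro w
    obtain ⟨s, rfl, hs⟩ := exists_secSmoothAt hπ.submersion hn x w
    obtain ⟨L, -, hL⟩ := exists_hasFDerivAt_pullSec (EK := EK) hπ hs.self_of_nhds
    let A : EK →L[ℝ] E := mfderiv 𝓘(ℝ, EK) 𝓘(ℝ, E) (fun k : K ↦ k • x) 1
    refine ⟨(vertD h s x).comp A.toLinearMap - L.toLinearMap, fun v ↦ ?_⟩
    rw [vertMoment_apply hπ h hμ v hs.self_of_nhds, ← (hL v).1]
    rfl
  constructor
  · intro v v'
    ext1 w
    obtain ⟨M, hM⟩ := key w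
    rw [LinearMap.add_apply, hM, hM, hM]
    exact map_add M _ _
  · intro r v
    ext1 w
    obtain ⟨M, hM⟩ := key w
    rw [LinearMap.smul_apply, hM, hM]
    exact map_smul M r _

theorem vertLie_pullSec (hπ : IsEquivariantSubmersion E F K π) (k : K) (v : LieAlg EK K)
    {s : ∀ y, vert E F π y} {x : X} (hs : SecSmoothAt s (k • x)) :
    vertLie v (pullSec hπ k s) x = vertPull hπ k x (vertLie (Ad k v) s (k • x)) := by
  have := FiniteDimensional.complete ℂ E
  have hol := hπ.holomorphic_source
  refine Subtype.ext ?_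
  have e1 : pullVF k (fun z ↦ (s z : E)) = fun z ↦ (pullSec hπ k s z : E) :=
    funext fun z ↦ (coe_pullSec hπ k s z).symm
  have e2 : pullVF k (fundVF (E := E) (X := X) (Ad k v)) = fundVF v := funext fun z ↦ by
    rw [pullVF, ← dAct_fundVF hol, dAct_inv_dAct hol]
  rw [coe_vertLie hπ v (SecSmoothAt.pullSec hπ k hs), coe_vertPull, coe_vertLie hπ _ hs, ← e1, ← e2,
    ← pullVF_bracketVF hol k (vfSmoothAt_fundVF _ _) hs]
  rfl

/-- Covariant derivative, Lie derivative and generating fields are each compatible with pullback by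
`k`, so their combination is too; no transformation law for second derivatives of μ is needed. -/
theorem vertMoment_equivariant (hπ : IsEquivariantSubmersion E F K π)
    (h : IsRelativelyKahler (F := F) π omega) (hinv : IsInvariantForm K omega)
    (hμ : IsMomentMap omega μ) (hn : Module.finrank ℂ E = Module.finrank ℂ F + n) (k : K)
    (v : LieAlg EK K) (x : X) (w : vert E F π (k • x)) :
    vertPull hπ k x (vertMoment omega μ (Ad k v) (k • x) w) =
      vertMoment omega μ v x (vertPull hπ k x w) := by
  obtain ⟨s, rfl, hs⟩ := exists_secSmoothAt hπ.submersion hn (k • x) w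
  rw [vertMoment_apply hπ h hμ _ hs.self_of_nhds, map_sub, ← vertLie_pullSec hπ k v hs.self_of_nhds,
    ← dAct_fundVF hπ.holomorphic_source, ← vertD_pullSec hπ h hinv hn k hs.self_of_nhds,
    ← vertMoment_apply hπ h hμ v (SecSmoothAt.pullSec hπ k hs.self_of_nhds)]
  rfl

/-- Infinitesimal invariance of the vertical Chern connection. -/
theorem vertLie_vertD (hπ : IsEquivariantSubmersion E F K π)
    (h : IsRelativelyKahler (F := F) π omega) (hμ : IsMomentMap omega μ)
    (hn : Module.finrank ℂ E = Module.finrank ℂ F + n) (v : LieAlg EK K)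
    {s : ∀ y, vert E F π y} {Y : X → E} {x : X} (hs : ∀ᶠ y in 𝓝 x, SecSmoothAt s y)
    (hY : ∀ᶠ y in 𝓝 x, VFSmoothAt Y y) :
    vertLie v (fun y ↦ vertD h s y (Y y)) x =
      vertD h s x (bracketVF (fundVF v) Y x) + vertD h (vertLie v s) x (Y x) := by
  have := FiniteDimensional.complete ℂ E
  have hk := h.isKahlerForm
  have hv := hμ.isHolomorphicIsometric hπ h v
  refine vert_ext h fun w ↦ ?_
  obtain ⟨t, rfl, ht⟩ := exists_secSmoothAt hπ.submersion hn x w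
  have hDs := vertD_smooth h hπ.submersion hn hs hY
  have h1 := hv.dFun_kpair x _ _ hDs ht.self_of_nhds
  have h2 : (fun z ↦ kpair omega z (vertD h s z (Y z)) (t z)) =ᶠ[𝓝 x]
      chernPairing omega (fun z ↦ (s z : E)) Y (fun z ↦ (t z : E)) := by
    filter_upwards [hs, hY, ht] with y h1 h2 h3 using kpair_vertD_eq_chernPairing h h1 h2 h3
  have h3 := dFun_chernPairing hk hv hs hY ht
  -- The function h(D_Y s, t) is differentiated along `v` in two ways: by isometry of `v`, and by
  -- the Leibniz rule for `chernPairing`.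
  have h2' : dFun (fun z ↦ kpair omega z (vertD h s z (Y z)) (t z)) x (fundVF v x) = _ :=
    (DFunLike.congr_fun (dFun_congr h2) (fundVF v x)).trans h3
  rw [h1, ← coe_vertLie hπ v hDs, ← coe_vertLie hπ v ht.self_of_nhds,
    ← kpair_vertD_eq_chernPairing h hs.self_of_nhds
      ((vfSmoothAt_fundVF v x).bracket hY.self_of_nhds) ht.self_of_nhds] at h2'
  -- The bracket is known to be vertical only where the section is smooth, so it agrees with
  -- `vertLie` merely near `x`; this is enough for first derivatives at `x`.
  have cs : ∀ {t : ∀ y, vert E F π y}, (∀ᶠ y in 𝓝 x, SecSmoothAt t y) →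
      bracketVF (fundVF v) (fun z ↦ (t z : E)) =ᶠ[𝓝 x] fun z ↦ (vertLie v t z : E) :=
    fun ht ↦ ht.mono fun y hy ↦ (coe_vertLie hπ v hy).symm
  have c1 : chernPairing omega (bracketVF (fundVF v) fun z ↦ (s z : E)) Y (fun z ↦ (t z : E)) x =
      kpair omega x (vertD h (vertLie v s) x (Y x)) (t x) := by
    rw [kpair_vertD_eq_chernPairing h (SecSmoothAt.vertLie hπ v hs) hY.self_of_nhds
      ht.self_of_nhds, chernPairing_self hk (VFSmoothAt.congr (SecSmoothAt.vertLie hπ v hs) (cs hs))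
      hY.self_of_nhds ht.self_of_nhds, chernPairing_self hk (SecSmoothAt.vertLie hπ v hs)
      hY.self_of_nhds ht.self_of_nhds, fderiv_chartVF_congr (cs hs), (cs hs).self_of_nhds]
  have c2 : chernPairing omega (fun z ↦ (s z : E)) Y (bracketVF (fundVF v) fun z ↦ (t z : E)) x =
      kpair omega x (vertD h s x (Y x)) (vertLie v t x) := by
    rw [kpair_vertD_eq_chernPairing h hs.self_of_nhds hY.self_of_nhds
      (SecSmoothAt.vertLie hπ v ht), chernPairing_self hk hs.self_of_nhds
      hY.self_of_nhds (VFSmoothAt.congr (SecSmoothAt.vertLie hπ v ht) (cs ht)),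
      chernPairing_self hk hs.self_of_nhds hY.self_of_nhds (SecSmoothAt.vertLie hπ v ht),
      (cs ht).self_of_nhds]
  rw [c1, c2] at h2'
  rw [Submodule.coe_add, kpair_add_left]
  linear_combination h2'

/-- Replace D_v by L_v + σ_v. The commutation rule for L_v and D removes D_{[v, Y]} s and D_Y(L_v
s), leaving σ_v(D_Y s) - D_Y(σ_v s). -/
theorem vertD_curvature_moment (hπ : IsEquivariantSubmersion E F K π)
    (h : IsRelativelyKahler (F := F) π omega) (hμ : IsMomentMap omega μ)
    (hn : Module.finrank ℂ E = Module.finrank ℂ F + n) (v : LieAlg EK K)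
    {s : ∀ y, vert E F π y} {Y : X → E} {x : X} (hs : ∀ᶠ y in 𝓝 x, SecSmoothAt s y)
    (hY : ∀ᶠ y in 𝓝 x, VFSmoothAt Y y) :
    vertD h (fun y ↦ vertD h s y (Y y)) x (fundVF v x) -
      vertD h (fun y ↦ vertD h s y (fundVF v y)) x (Y x) -
      vertD h s x (bracketVF (fundVF v) Y x) =
    -(vertD h (fun y ↦ vertMoment omega μ v y (s y)) x (Y x) -
      vertMoment omega μ v x (vertD h s x (Y x))) := by
  have h1 := vertMoment_apply hπ h hμ v (vertD_smooth h hπ.submersion hn hs hY)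
  rw [vertLie_vertD hπ h hμ hn v hs hY] at h1
  have h2 : vertD h (fun y ↦ vertD h s y (fundVF v y)) x =
      vertD h (fun y ↦ vertMoment omega μ v y (s y) + vertLie v s y) x := by
    refine vertD_congr h (hs.mono fun y hy ↦ ?_)
    rw [vertMoment_apply hπ h hμ v hy, sub_add_cancel]
  rw [h2, vertD_add h (SecSmoothAt.vertMoment hπ h hμ hn v hs) (SecSmoothAt.vertLie hπ v hs), h1]
  abel

/-- The statement on the vertical tangent bundle. -/
theorem vertBundle_statement (hπ : IsEquivariantSubmersion E F K π)
    (h : IsRelativelyKahler (F := F) π omega) (hinv : IsInvariantForm K omega)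
    (hμ : IsMomentMap omega μ) (hn : Module.finrank ℂ E = Module.finrank ℂ F + n) :
    IsChernConnection (vertBundle hπ) (vertMetric F π omega) (vertConnection hπ omega) ∧
      IsInvariantConnection (vertBundle hπ) (vertConnection hπ omega) ∧
      IsBundleMomentMap (vertBundle hπ) (vertConnection hπ omega) (vertMoment omega μ) := by
  have := FiniteDimensional.complete ℂ E
  have sm : ∀ {U : Set X} {s : ∀ y, vert E F π y}, IsOpen U → (vertBundle hπ).IsSmooth U s →
      ∀ x ∈ U, ∀ᶠ y in 𝓝 x, SecSmoothAt s y := fun hU hs x hx ↦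
    (hU.eventually_mem hx).mono ((vertBundle_isSmooth_iff hπ hU).1 hs)
  refine ⟨isChernConnection_chernConnection (isChernConnection_vertD hπ h hn), ?_, ?_⟩
  · intro k U s hU hs x hx u
    have h1 := sm hU hs _ hx
    have h2 : ∀ᶠ y in 𝓝 x, SecSmoothAt (pullSec hπ k s) y :=
      ((tendsto_act hπ.holomorphic_source k x).eventually h1).mono fun y hy ↦
        SecSmoothAt.pullSec hπ k hy
    have e1 := vertConnection_eq hπ h hn h2
    have e2 := vertConnection_eq hπ h hn h1
    rw [e2]
    exact (DFunLike.congr_fun e1 u).trans (vertD_pullSec hπ h hinv hn k h1.self_of_nhds u)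
  · refine ⟨vertMoment_linear hπ h hμ hn, fun v U s hU hs ↦ ?_,
      vertMoment_equivariant hπ h hinv hμ hn, fun v U Y s hU hY hs x hx ↦ ?_⟩
    · exact (vertBundle_isSmooth_iff hπ hU).2 fun x hx ↦
        SecSmoothAt.vertMoment hπ h hμ hn v (sm hU hs x hx)
    · have h1 := sm hU hs x hx
      have hY' : ∀ᶠ y in 𝓝 x, VFSmoothAt Y y :=
        (hU.eventually_mem hx).mono ((isSmoothVF_iff hU).1 hY)
      -- The chosen connection agrees with `vertD` on smooth sections only, so the inner derivative
      -- must be smooth before the outer one can be replaced.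
      have c : ∀ (Z : X → E), (∀ᶠ y in 𝓝 x, VFSmoothAt Z y) →
          vertConnection hπ omega (fun y ↦ vertConnection hπ omega s y (Z y)) x =
            vertD h (fun y ↦ vertD h s y (Z y)) x := by
        intro Z hZ
        have e : ∀ᶠ y in 𝓝 x, vertConnection hπ omega s y (Z y) = vertD h s y (Z y) := by
          filter_upwards [h1.eventually_nhds] with y hy
          exact DFunLike.congr_fun (vertConnection_eq hπ h hn hy) (Z y)
        have hsm : ∀ᶠ y in 𝓝 x, SecSmoothAt (fun y ↦ vertConnection hπ omega s y (Z y)) y := by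
          filter_upwards [h1.eventually_nhds, hZ.eventually_nhds, e.eventually_nhds] with y k1 k2 k3
          exact SecSmoothAt.congr (vertD_smooth h hπ.submersion hn k1 k2) k3
        rw [vertConnection_eq hπ h hn hsm]
        exact vertD_congr h e
      have h3 : ∀ᶠ y in 𝓝 x, SecSmoothAt (fun y ↦ vertMoment omega μ v y (s y)) y :=
        h1.eventually_nhds.mono fun y hy ↦ SecSmoothAt.vertMoment hπ h hμ hn v hy
      have e3 := vertConnection_eq hπ h hn h3
      have e4 := vertConnection_eq hπ h hn h1
      have e5 := DFunLike.congr_fun (c Y hY') (fundVF v x)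
      have e6 := DFunLike.congr_fun (c _ (Filter.Eventually.of_forall (vfSmoothAt_fundVF v))) (Y x)
      refine (congrArg₂ (· - ·) (congrArg₂ (· - ·) e5 e6) (DFunLike.congr_fun e4 _)).trans
        ((vertD_curvature_moment hπ h hμ hn v h1 hY').trans (congrArg Neg.neg (congrArg₂ (· - ·)
          (DFunLike.congr_fun e3 _).symm (congrArg (vertMoment omega μ v x)
            (DFunLike.congr_fun e4 (Y x)).symm))))

end VertMoment

/-! ### Determinants and top exterior powers -/

section Jacobi

variable {H N : Type*} [NormedAddCommGroup H] [NormedSpace ℝ H] [TopologicalSpace N]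
  [ChartedSpace H N] {n : ℕ}

/-- Replacing one column expands, by Cramer's rule, into the corresponding row of the adjugate. -/
theorem sum_det_updateCol (M M' : Matrix (Fin n) (Fin n) ℂ) :
    ∑ j, (M.updateCol j fun i ↦ M' i j).det = (M.adjugate * M').trace := by
  refine Finset.sum_congr rfl fun j _ ↦ ?_
  rw [← Matrix.cramer_apply, Matrix.cramer_eq_adjugate_mulVec]
  rfl

/-- Jacobi's formula. -/
theorem exists_hasMFDerivAt_det {M : N → Matrix (Fin n) (Fin n) ℂ}
    {M' : Fin n → Fin n → H →L[ℝ] ℂ} {z : N}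
    (hM : ∀ i j, HasMFDerivAt 𝓘(ℝ, H) 𝓘(ℝ, ℂ) (fun y ↦ M y i j) z (M' i j)) :
    ∃ L : H →L[ℝ] ℂ, HasMFDerivAt 𝓘(ℝ, H) 𝓘(ℝ, ℂ) (fun y ↦ (M y).det) z L ∧
      ∀ u, L u = ((M z).adjugate * Matrix.of fun i j ↦ M' i j u).trace := by
  let Q : Equiv.Perm (Fin n) → H →L[ℝ] ℂ := fun σ ↦
    ∑ j, (∏ i ∈ Finset.univ.erase j, M z (σ i) i) • M' (σ j) j
  have h1 : ∀ σ : Equiv.Perm (Fin n),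
      HasMFDerivAt 𝓘(ℝ, H) 𝓘(ℝ, ℂ) (∏ j, fun y ↦ M y (σ j) j) z (Q σ) := fun σ ↦
    HasMFDerivAt.prod fun i _ ↦ hM (σ i) i
  have h2 : HasMFDerivAt 𝓘(ℝ, H) 𝓘(ℝ, ℂ)
      (∑ σ : Equiv.Perm (Fin n), (((Equiv.Perm.sign σ : ℤ) : ℝ) • ∏ j, fun y ↦ M y (σ j) j)) z
      (∑ σ : Equiv.Perm (Fin n), (((Equiv.Perm.sign σ : ℤ) : ℝ) • Q σ)) :=
    HasMFDerivAt.sum fun σ _ ↦ (h1 σ).const_smul _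
  let L : H →L[ℝ] ℂ := ∑ σ : Equiv.Perm (Fin n), (((Equiv.Perm.sign σ : ℤ) : ℝ) • Q σ)
  have hL : ∀ u, L u = ∑ σ : Equiv.Perm (Fin n), (((Equiv.Perm.sign σ : ℤ) : ℝ) •
      ∑ j, (∏ i ∈ Finset.univ.erase j, M z (σ i) i) * M' (σ j) j u) := fun u ↦ by simp [L, Q]
  refine ⟨L, h2.congr_of_eventuallyEq (Filter.Eventually.of_forall fun y ↦ ?_), fun u ↦ ?_⟩
  · simp [Matrix.det_apply']
  · rw [hL, ← sum_det_updateCol]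
    simp only [Matrix.det_apply', Matrix.of_apply]
    rw [Finset.sum_comm]
    refine Finset.sum_congr rfl fun σ _ ↦ ?_
    rw [Finset.smul_sum]
    refine Finset.sum_congr rfl fun j _ ↦ ?_
    rw [← Finset.mul_prod_erase _ _ (Finset.mem_univ j), Matrix.updateCol_self,
      Finset.prod_congr rfl fun i hi ↦ Matrix.updateCol_ne (Finset.ne_of_mem_erase hi)]
    simp
    ring

end Jacobi

/-! ### Coordinates on the top exterior power -/

section Wedge

variable {V : Type*} [AddCommGroup V] [Module ℂ V] {n : ℕ}

/-- The coordinate on the top exterior power with respect to a basis. -/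
def wedgeCoord (b : Module.Basis (Fin n) ℂ V) : ⋀[ℂ]^n V →ₗ[ℂ] ℂ :=
  exteriorPower.alternatingMapLinearEquiv b.det

theorem wedgeCoord_ιMulti (b : Module.Basis (Fin n) ℂ V) (a : Fin n → V) :
    wedgeCoord b (exteriorPower.ιMulti ℂ n a) = b.det a :=
  exteriorPower.alternatingMapLinearEquiv_apply_ιMulti _ _

theorem ιMulti_basis_ne_zero (b : Module.Basis (Fin n) ℂ V) :
    exteriorPower.ιMulti ℂ n b ≠ 0 := by
  intro h
  have h1 := wedgeCoord_ιMulti b b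
  rw [h, map_zero, b.det_self] at h1
  exact zero_ne_one h1

/-- The top exterior power is a line spanned by the wedge of a basis. -/
theorem eq_wedgeCoord_smul (b : Module.Basis (Fin n) ℂ V) (p : ⋀[ℂ]^n V) :
    p = wedgeCoord b p • exteriorPower.ιMulti ℂ n b := by
  have : Module.Finite ℂ V := Module.Finite.of_basis b
  have h1 : Module.finrank ℂ (⋀[ℂ]^n V) = 1 := by
    rw [exteriorPower.finrank_eq, Module.finrank_eq_card_basis b, Fintype.card_fin, Nat.choose_self]
  obtain ⟨c, rfl⟩ := (finrank_eq_one_iff_of_nonzero' _ (ιMulti_basis_ne_zero b)).1 h1 p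
  rw [map_smul, wedgeCoord_ιMulti, b.det_self, smul_eq_mul, mul_one]

theorem ιMulti_eq_det_smul (b : Module.Basis (Fin n) ℂ V) {a : Fin n → V}
    {P : Matrix (Fin n) (Fin n) ℂ} (ha : ∀ j, a j = ∑ i, P i j • b i) :
    exteriorPower.ιMulti ℂ n a = P.det • exteriorPower.ιMulti ℂ n b := by
  rw [eq_wedgeCoord_smul b (exteriorPower.ιMulti ℂ n a), wedgeCoord_ιMulti, b.det_apply]
  congr 2
  ext i j
  rw [Module.Basis.toMatrix_apply, ha, b.repr_sum_self]

end Wedge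

/-! ### Frames, connection matrices and change of frame -/

section FrameCoord

variable {E F X B : Type*} [NormedAddCommGroup E] [NormedSpace ℂ E] [FiniteDimensional ℂ E]
  [NormedAddCommGroup F] [NormedSpace ℂ F]
  [TopologicalSpace X] [ChartedSpace E X] [TopologicalSpace B] [ChartedSpace F B]
  {π : X → B} {omega : X → E [⋀^Fin 2]→L[ℝ] ℝ} [IsManifold 𝓘(ℂ, E) ω X]
  {n : ℕ} {e e' : Fin n → ∀ y, vert E F π y} {x : X}

/-- The coordinates with respect to a frame. -/
def frameCoord (h : IsRelativelyKahler (F := F) π omega) (e : Fin n → ∀ y, vert E F π y) (x : X)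
    (i : Fin n) : vert E F π x →ₗ[ℂ] ℂ where
  -- Written with the inverse Gram matrix instead of a basis, so that it is defined at every point
  -- and its smoothness is visible.
  toFun w := ∑ j, kpair omega x w (e j x) * (gram omega e x)⁻¹ j i
  map_add' w w' := by
    simp only [Submodule.coe_add, kpair_add_left, add_mul, Finset.sum_add_distrib]
  map_smul' c w := by
    simp only [Submodule.coe_smul, kpair_smul_left h.isKahlerForm, mul_assoc, ← Finset.mul_sum]
    rfl

omit [IsManifold 𝓘(ℂ, E) ω X] in
theorem sum_frameCoord (h : IsRelativelyKahler (F := F) π omega)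
    (hr : Module.finrank ℂ (vert E F π x) = n) (he : LinearIndependent ℂ (fun i ↦ e i x))
    (w : vert E F π x) : w = ∑ i, frameCoord h e x i w • e i x := eq_sum_gram_inv h hr he w

omit [IsManifold 𝓘(ℂ, E) ω X] in
theorem frameCoord_eq_repr (h : IsRelativelyKahler (F := F) π omega)
    (hr : Module.finrank ℂ (vert E F π x) = n) (he : LinearIndependent ℂ (fun i ↦ e i x))
    (w : vert E F π x) (i : Fin n) : frameCoord h e x i w = (vertBasis hr he).repr w i := by
  conv_rhs => rw [sum_frameCoord h hr he w]
  have : ∀ i, e i x = vertBasis hr he i := fun i ↦ (vertBasis_apply hr he i).symm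
  simp only [this]
  rw [Module.Basis.repr_sum_self]

omit [IsManifold 𝓘(ℂ, E) ω X] in
theorem frameCoord_sum (h : IsRelativelyKahler (F := F) π omega)
    (hr : Module.finrank ℂ (vert E F π x) = n) (he : LinearIndependent ℂ (fun i ↦ e i x))
    (c : Fin n → ℂ) (i : Fin n) : frameCoord h e x i (∑ j, c j • e j x) = c i := by
  rw [frameCoord_eq_repr h hr he]
  have : ∀ i, e i x = vertBasis hr he i := fun i ↦ (vertBasis_apply hr he i).symm
  simp only [this]
  rw [Module.Basis.repr_sum_self]

theorem contMDiffAt_gram (h : IsRelativelyKahler (F := F) π omega)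
    (he : IsVertFrame e x) (k l : Fin n) :
    ContMDiffAt 𝓘(ℝ, E) 𝓘(ℝ, ℂ) ∞ (fun z ↦ gram omega e z k l) x :=
  contMDiffAt_kpair h.isKahlerForm (he.smooth.self_of_nhds k) (he.smooth.self_of_nhds l)

theorem contMDiffAt_frameCoord (h : IsRelativelyKahler (F := F) π omega)
    (he : IsVertFrame e x) {s : ∀ y, vert E F π y} (hs : SecSmoothAt s x) (i : Fin n) :
    ContMDiffAt 𝓘(ℝ, E) 𝓘(ℝ, ℂ) ∞ (fun z ↦ frameCoord h e z i (s z)) x := by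
  have hx := mem_extChartAt_source (I := 𝓘(ℝ, E)) x
  have hg := contMDiffAt_gram h he
  have hg' : ∀ k l, ContMDiffAt 𝓘(ℝ, E) 𝓘(ℝ, ℂ) ∞ (fun z ↦ (gram omega e z)⁻¹ k l) x := by
    intro k l
    rw [contMDiffAt_chart_iff hx]
    simp only [contMDiffAt_chart_iff hx] at hg
    refine contDiffAt_inv_apply (M := fun z ↦ gram omega e ((extChartAt 𝓘(ℝ, E) x).symm z)) hg ?_ k l
    rw [(extChartAt 𝓘(ℝ, E) x).left_inv hx]
    exact isUnit_det_gram h he.linearIndependent.self_of_nhds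
  have hc : ∀ j, ContMDiffAt 𝓘(ℝ, E) 𝓘(ℝ, ℂ) ∞ (fun z ↦ kpair omega z (s z) (e j z)) x :=
    fun j ↦ contMDiffAt_kpair h.isKahlerForm hs (he.smooth.self_of_nhds j)
  simp only [contMDiffAt_chart_iff hx] at hc hg' ⊢
  exact (ContDiffAt.sum (s := Finset.univ) fun j _ ↦ (hc j).mul (hg' j i)).congr_of_eventuallyEq
    (Filter.Eventually.of_forall fun y ↦ rfl)

/-- The connection matrix of the vertical Chern connection in a frame. -/
def connMatrix (h : IsRelativelyKahler (F := F) π omega) (e : Fin n → ∀ y, vert E F π y) (x : X)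
    (u : E) : Matrix (Fin n) (Fin n) ℂ :=
  Matrix.of fun i j ↦ frameCoord h e x i (vertD h (e j) x u)

/-- The trace of the connection matrix. -/
def connForm (h : IsRelativelyKahler (F := F) π omega) (e : Fin n → ∀ y, vert E F π y) (x : X) :
    E →ₗ[ℝ] ℂ := ∑ i, ((frameCoord h e x i).restrictScalars ℝ).comp (vertD h (e i) x)

theorem connForm_apply (h : IsRelativelyKahler (F := F) π omega) (u : E) :
    connForm h e x u = (connMatrix h e x u).trace := by
  simp [connForm, connMatrix, Matrix.trace]

theorem vertD_frame (h : IsRelativelyKahler (F := F) π omega)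
    (hr : Module.finrank ℂ (vert E F π x) = n) (he : LinearIndependent ℂ (fun i ↦ e i x))
    (j : Fin n) (u : E) : vertD h (e j) x u = ∑ i, connMatrix h e x u i j • e i x :=
  sum_frameCoord h hr he _

theorem dFun_eq_of_hasMFDerivAt {G : Type*} [NormedAddCommGroup G] [NormedSpace ℝ G] {f : X → G}
    {L : E →L[ℝ] G} (hf : HasMFDerivAt 𝓘(ℝ, E) 𝓘(ℝ, G) f x L) (u : E) : dFun f x u = L u :=
  DFunLike.congr_fun hf.mfderiv u

/-- Jacobi's formula on a manifold. -/
theorem dFun_det {M : X → Matrix (Fin n) (Fin n) ℂ}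
    (hM : ∀ i j, ContMDiffAt 𝓘(ℝ, E) 𝓘(ℝ, ℂ) ∞ (fun y ↦ M y i j) x) (u : E) :
    dFun (fun y ↦ (M y).det) x u =
      ((M x).adjugate * Matrix.of fun i j ↦ dFun (fun y ↦ M y i j) x u).trace := by
  obtain ⟨L, hL, hLu⟩ := exists_hasMFDerivAt_det (M := M)
    (M' := fun i j ↦ dFun (fun y ↦ M y i j) x) (z := x)
    fun i j ↦ ((hM i j).mdifferentiableAt (by simp)).hasMFDerivAt
  rw [dFun_eq_of_hasMFDerivAt hL, hLu]

theorem contMDiffAt_det {M : X → Matrix (Fin n) (Fin n) ℂ}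
    (hM : ∀ i j, ContMDiffAt 𝓘(ℝ, E) 𝓘(ℝ, ℂ) ∞ (fun y ↦ M y i j) x) :
    ContMDiffAt 𝓘(ℝ, E) 𝓘(ℝ, ℂ) ∞ (fun y ↦ (M y).det) x := by
  have hx := mem_extChartAt_source (I := 𝓘(ℝ, E)) x
  simp only [contMDiffAt_chart_iff hx] at hM ⊢
  exact contDiffAt_det hM

theorem vertD_sum_smul (h : IsRelativelyKahler (F := F) π omega)
    {c : Fin n → X → ℂ} (hc : ∀ i, ContMDiffAt 𝓘(ℝ, E) 𝓘(ℝ, ℂ) ∞ (c i) x)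
    (he : ∀ i, SecSmoothAt (e i) x) (u : E) (S : Finset (Fin n)) :
    SecSmoothAt (fun y ↦ ∑ i ∈ S, c i y • e i y) x ∧
      vertD h (fun y ↦ ∑ i ∈ S, c i y • e i y) x u =
        ∑ i ∈ S, (c i x • vertD h (e i) x u + dFun (c i) x u • e i x) := by
  have hsm : ∀ i, SecSmoothAt (fun y ↦ c i y • e i y) x := fun i ↦ VFSmoothAt.smul (hc i) (he i)
  induction S using Finset.induction_on with
  | empty =>
    -- The zero section equals 0 times itself, so its derivative vanishes by the Leibniz rule.
    have h0 : (fun y : X ↦ ∑ i ∈ (∅ : Finset (Fin n)), c i y • e i y) =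
        fun y ↦ (0 : ℂ) • ∑ i ∈ (∅ : Finset (Fin n)), c i y • e i y := by simp
    have hz : SecSmoothAt (fun y : X ↦ ∑ i ∈ (∅ : Finset (Fin n)), c i y • e i y) x :=
      VFSmoothAt.congr (VFSmoothAt.sum (∅ : Finset (Fin n)) (Y := fun i z ↦ (e i z : E))
        (by simp)) (Filter.Eventually.of_forall fun y ↦ by simp)
    refine ⟨hz, ?_⟩
    rw [h0, vertD_smul h contMDiffAt_const hz, dFun_const]
    simp
  | insert i S hi IH =>
    simp only [Finset.sum_insert hi]
    refine ⟨VFSmoothAt.add (hsm i) IH.1, ?_⟩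
    rw [vertD_add h (hsm i) IH.1, IH.2, vertD_smul h (hc i) (he i)]

/-- The covariant derivative in a frame. -/
theorem frameCoord_vertD (h : IsRelativelyKahler (F := F) π omega)
    (hr : ∀ x, Module.finrank ℂ (vert E F π x) = n) (he : IsVertFrame e x)
    {t : ∀ y, vert E F π y} (ht : SecSmoothAt t x) (u : E) (i : Fin n) :
    frameCoord h e x i (vertD h t x u) = dFun (fun z ↦ frameCoord h e z i (t z)) x u +
      ∑ l, connMatrix h e x u i l * frameCoord h e x l (t x) := by
  have hli := he.linearIndependent.self_of_nhds
  have h1 : vertD h t x = vertD h (fun y ↦ ∑ i, frameCoord h e y i (t y) • e i y) x := by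
    refine vertD_congr h ?_
    filter_upwards [he.linearIndependent] with y hy using sum_frameCoord h (hr y) hy _
  rw [h1, (vertD_sum_smul h (c := fun i y ↦ frameCoord h e y i (t y))
    (fun i ↦ contMDiffAt_frameCoord h he ht i) he.smooth.self_of_nhds u Finset.univ).2,
    Finset.sum_add_distrib, map_add, frameCoord_sum h (hr x) hli, map_sum, add_comm]
  congr 1
  refine Finset.sum_congr rfl fun l _ ↦ ?_
  rw [map_smul, smul_eq_mul, mul_comm]
  rfl

/-- Transition matrix between frames. -/
def frameChange (h : IsRelativelyKahler (F := F) π omega) (e e' : Fin n → ∀ y, vert E F π y)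
    (x : X) : Matrix (Fin n) (Fin n) ℂ := Matrix.of fun i j ↦ frameCoord h e x i (e' j x)

theorem contMDiffAt_frameChange (h : IsRelativelyKahler (F := F) π omega)
    (he : IsVertFrame e x) (he' : IsVertFrame e' x) (i j : Fin n) :
    ContMDiffAt 𝓘(ℝ, E) 𝓘(ℝ, ℂ) ∞ (fun z ↦ frameChange h e e' z i j) x :=
  contMDiffAt_frameCoord h he (he'.smooth.self_of_nhds j) i

/-- Change of the trace of the connection matrix under a change of frame. -/
theorem dFun_det_frameChange (h : IsRelativelyKahler (F := F) π omega)
    (hr : ∀ x, Module.finrank ℂ (vert E F π x) = n) (he : IsVertFrame e x) (he' : IsVertFrame e' x)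
    (u : E) :
    dFun (fun z ↦ (frameChange h e e' z).det) x u =
      (frameChange h e e' x).det * (connForm h e' x u - connForm h e x u) := by
  set P := frameChange h e e' with hP
  have hPs := contMDiffAt_frameChange h he he'
  -- The gauge law P θ' = dP + θ P, from differentiating the members of `e'` in the frame `e`.
  have hD' : P x * connMatrix h e' x u =
      (Matrix.of fun i j ↦ dFun (fun z ↦ P z i j) x u) + connMatrix h e x u * P x := by
    ext i j
    have h1 := frameCoord_vertD h hr he (he'.smooth.self_of_nhds j) u i
    rw [vertD_frame h (hr x) he'.linearIndependent.self_of_nhds, map_sum] at h1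
    rw [Matrix.add_apply, Matrix.of_apply, Matrix.mul_apply, Matrix.mul_apply]
    refine Eq.trans (Finset.sum_congr rfl fun l _ ↦ ?_) h1
    rw [map_smul, smul_eq_mul, mul_comm]
    rfl
  refine (dFun_det hPs u).trans ?_
  change ((P x).adjugate * Matrix.of fun i j ↦ dFun (fun z ↦ P z i j) x u).trace = _
  -- With dP = P θ' - θ P, Jacobi's formula and adj(P) P = P adj(P) = det P reduce the trace to det
  -- P (tr θ' - tr θ).
  rw [eq_sub_iff_add_eq.2 hD'.symm, Matrix.mul_sub, Matrix.trace_sub,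
    ← Matrix.mul_assoc, Matrix.adjugate_mul, ← Matrix.mul_assoc,
    Matrix.trace_mul_comm ((P x).adjugate * connMatrix h e x u) (P x),
    ← Matrix.mul_assoc, Matrix.mul_adjugate, connForm_apply, connForm_apply]
  simp [Matrix.trace_smul]
  ring

end FrameCoord

/-! ### The Chern connection of the relative anticanonical bundle -/

section AntiCanonical

variable {E F X B : Type*} [NormedAddCommGroup E] [NormedSpace ℂ E] [FiniteDimensional ℂ E]
  [NormedAddCommGroup F] [NormedSpace ℂ F]
  [TopologicalSpace X] [ChartedSpace E X] [TopologicalSpace B] [ChartedSpace F B]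
  {π : X → B} {omega : X → E [⋀^Fin 2]→L[ℝ] ℝ} [IsManifold 𝓘(ℂ, E) ω X]
  {n : ℕ} {e e' : Fin n → ∀ y, vert E F π y} {f f' : X → ℂ}
  {s t : ∀ y, ⋀[ℂ]^n (vert E F π y)} {x : X}

/-- The section `e₁ ∧ ⋯ ∧ eₙ`. -/
def wedge (e : Fin n → ∀ y, vert E F π y) (y : X) : ⋀[ℂ]^n (vert E F π y) :=
  exteriorPower.ιMulti ℂ n fun i ↦ e i y

/-- A smooth representation `s = f e₁ ∧ ⋯ ∧ eₙ` near a point. -/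
structure IsWedgeRep (e : Fin n → ∀ y, vert E F π y) (f : X → ℂ)
    (s : ∀ y, ⋀[ℂ]^n (vert E F π y)) (x : X) : Prop where
  frame : IsVertFrame e x
  smooth : ∀ᶠ y in 𝓝 x, ContMDiffAt 𝓘(ℝ, E) 𝓘(ℝ, ℂ) ∞ f y
  eq : ∀ᶠ y in 𝓝 x, s y = f y • wedge e y

omit [FiniteDimensional ℂ E] in
theorem IsWedgeRep.eventually (hs : IsWedgeRep e f s x) : ∀ᶠ y in 𝓝 x, IsWedgeRep e f s y := by
  filter_upwards [hs.frame.eventually, hs.smooth.eventually_nhds, hs.eq.eventually_nhds]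
    with y h1 h2 h3 using ⟨h1, h2, h3⟩

theorem wedge_ne_zero (hr : Module.finrank ℂ (vert E F π x) = n)
    (he : LinearIndependent ℂ (fun i ↦ e i x)) : wedge e x ≠ 0 := by
  have h := ιMulti_basis_ne_zero (vertBasis hr he)
  rwa [funext (vertBasis_apply hr he)] at h

theorem wedge_frameChange (h : IsRelativelyKahler (F := F) π omega)
    (hr : Module.finrank ℂ (vert E F π x) = n) (he : LinearIndependent ℂ (fun i ↦ e i x)) :
    wedge e' x = (frameChange h e e' x).det • wedge e x := by
  have h1 := ιMulti_eq_det_smul (vertBasis hr he) (a := fun j ↦ e' j x)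
    (P := frameChange h e e' x) fun j ↦ by
      simp only [vertBasis_apply]
      exact sum_frameCoord h hr he _
  rwa [funext (vertBasis_apply hr he)] at h1

/-- A section represented in one frame is represented in any other frame. -/
theorem IsWedgeRep.change (h : IsRelativelyKahler (F := F) π omega)
    (hr : ∀ x, Module.finrank ℂ (vert E F π x) = n) (hs : IsWedgeRep e f s x)
    (he' : IsVertFrame e' x) :
    IsWedgeRep e' (fun y ↦ f y * (frameChange h e' e y).det) s x where
  frame := he'
  smooth := by
    filter_upwards [hs.smooth, hs.frame.eventually, he'.eventually] with y h1 h2 h3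
    exact contMDiffAt_mul h1 (contMDiffAt_det fun i j ↦ contMDiffAt_frameChange h h3 h2 i j)
  eq := by
    filter_upwards [hs.eq, he'.linearIndependent] with y h1 h2
    rw [h1, wedge_frameChange h (hr y) h2, smul_smul]

/-- The covariant derivative of `f e₁ ∧ ⋯ ∧ eₙ`. -/
def wedgeDeriv (h : IsRelativelyKahler (F := F) π omega) (e : Fin n → ∀ y, vert E F π y)
    (f : X → ℂ) (x : X) : E →ₗ[ℝ] ⋀[ℂ]^n (vert E F π x) where
  toFun u := (dFun f x u + f x * connForm h e x u) • wedge e x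
  map_add' u u' := by
    rw [map_add, map_add, ← add_smul]
    congr 1
    ring
  map_smul' r u := by
    have : ∀ w : ⋀[ℂ]^n (vert E F π x), r • w = (r : ℂ) • w := fun w ↦ rfl
    rw [map_smul, map_smul, RingHom.id_apply]
    refine Eq.trans ?_ (this _).symm
    rw [smul_smul, Complex.real_smul, Complex.real_smul]
    congr 1
    ring

theorem wedgeDeriv_apply (h : IsRelativelyKahler (F := F) π omega) (u : E) :
    wedgeDeriv h e f x u = (dFun f x u + f x * connForm h e x u) • wedge e x := rfl

/-- The coefficients are related by f = f' det P. The derivative of det P supplies det P (tr θ' - tr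
θ), which absorbs the change of connection form. -/
theorem wedgeDeriv_congr (h : IsRelativelyKahler (F := F) π omega)
    (hr : ∀ x, Module.finrank ℂ (vert E F π x) = n) (hs : IsWedgeRep e f s x)
    (hs' : IsWedgeRep e' f' s x) : wedgeDeriv h e f x = wedgeDeriv h e' f' x := by
  have hli := hs.frame.linearIndependent
  have h1 : f =ᶠ[𝓝 x] fun y ↦ f' y * (frameChange h e e' y).det := by
    filter_upwards [hs.eq, hs'.eq, hli] with y k1 k2 k3
    rw [k1, wedge_frameChange (e := e) (e' := e') h (hr y) k3, smul_smul] at k2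
    exact smul_left_injective ℂ (wedge_ne_zero (hr y) k3) k2
  ext1 u
  have h2 : dFun f x u = dFun (fun y ↦ f' y * (frameChange h e e' y).det) x u :=
    DFunLike.congr_fun (dFun_congr h1) u
  rw [dFun_mul hs'.smooth.self_of_nhds (contMDiffAt_det fun i j ↦
    contMDiffAt_frameChange h hs.frame hs'.frame i j),
    dFun_det_frameChange h hr hs.frame hs'.frame] at h2
  rw [wedgeDeriv_apply, wedgeDeriv_apply,
    wedge_frameChange (e := e) (e' := e') h (hr x) hli.self_of_nhds, smul_smul,
    h2, h1.self_of_nhds]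
  congr 1
  ring

/-- Smoothness of a section of the relative anticanonical bundle at a point. -/
def WedgeSmoothAt (s : ∀ y, ⋀[ℂ]^n (vert E F π y)) (x : X) : Prop :=
  ∃ (e : Fin n → ∀ y, vert E F π y) (f : X → ℂ), IsWedgeRep e f s x

open Classical in
/-- The connection on the relative anticanonical bundle induced by the vertical Chern
connection. -/
def wedgeD (h : IsRelativelyKahler (F := F) π omega) (s : ∀ y, ⋀[ℂ]^n (vert E F π y)) (x : X) :
    E →ₗ[ℝ] ⋀[ℂ]^n (vert E F π x) :=
  if H : WedgeSmoothAt s x then wedgeDeriv h H.choose H.choose_spec.choose x else 0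

theorem wedgeD_eq (h : IsRelativelyKahler (F := F) π omega)
    (hr : ∀ x, Module.finrank ℂ (vert E F π x) = n) (hs : IsWedgeRep e f s x) :
    wedgeD h s x = wedgeDeriv h e f x := by
  have H : WedgeSmoothAt s x := ⟨e, f, hs⟩
  rw [wedgeD, dif_pos H]
  exact wedgeDeriv_congr h hr H.choose_spec.choose_spec hs

variable {K : Type*} [Group K] [MulAction K X] [MulAction K B]

omit [FiniteDimensional ℂ E] in
theorem antiCanonical_isSmooth_iff (hπ : IsEquivariantSubmersion E F K π) {U : Set X} :
    (antiCanonical hπ n).IsSmooth U s ↔ ∀ x ∈ U, WedgeSmoothAt s x := by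
  constructor
  · intro hs x hx
    obtain ⟨U', e, f, hU', hx', he, hli, hf, heq⟩ := hs x hx
    have hm := hU'.eventually_mem hx'
    refine ⟨e, f, ⟨⟨?_, hm.mono hli⟩, ?_, hm.mono heq⟩⟩
    · exact hm.mono fun y hy i ↦ (vertBundle_isSmooth_iff hπ hU').1 (he i) y hy
    · exact hm.mono fun y hy ↦ hf.contMDiffAt (hU'.mem_nhds hy)
  · intro hs x hx
    obtain ⟨e, f, h1, h2, h3⟩ := hs x hx
    obtain ⟨U', hU'p, hU', hx'⟩ := eventually_nhds_iff.1
      (h1.smooth.and (h1.linearIndependent.and (h2.and h3)))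
    exact ⟨U', e, f, hU', hx', fun i ↦ (vertBundle_isSmooth_iff hπ hU').2
      fun y hy ↦ (hU'p y hy).1 i, fun y hy ↦ (hU'p y hy).2.1,
      fun y hy ↦ (hU'p y hy).2.2.1.contMDiffWithinAt, fun y hy ↦ (hU'p y hy).2.2.2⟩

theorem contMDiffAt_connForm [FiniteDimensional ℂ F] [IsManifold 𝓘(ℂ, F) ω B]
    (hs : Manifold.IsSubmersion 𝓘(ℂ, E) 𝓘(ℂ, F) ω π)
    (h : IsRelativelyKahler (F := F) π omega)
    (hn : Module.finrank ℂ E = Module.finrank ℂ F + n) (he : IsVertFrame e x) {Y : X → E}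
    (hY : ∀ᶠ y in 𝓝 x, VFSmoothAt Y y) :
    ContMDiffAt 𝓘(ℝ, E) 𝓘(ℝ, ℂ) ∞ (fun z ↦ connForm h e z (Y z)) x := by
  have h1 : ∀ i, ContMDiffAt 𝓘(ℝ, E) 𝓘(ℝ, ℂ) ∞
      (fun z ↦ frameCoord h e z i (vertD h (e i) z (Y z))) x := fun i ↦
    contMDiffAt_frameCoord h he (vertD_smooth h hs hn (he.smooth.mono fun y hy ↦ hy i) hY) i
  have hx := mem_extChartAt_source (I := 𝓘(ℝ, E)) x
  simp only [contMDiffAt_chart_iff hx] at h1 ⊢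
  refine (ContDiffAt.sum (s := Finset.univ) fun i _ ↦ h1 i).congr_of_eventuallyEq
    (Filter.Eventually.of_forall fun y ↦ ?_)
  simp [connForm]

theorem connForm_I_smul (h : IsRelativelyKahler (F := F) π omega)
    (he : ∀ i, IsHolomorphicDerivAt (fun z ↦ (e i z : E)) x) (u : E) :
    connForm h e x (Complex.I • u) = Complex.I * connForm h e x u := by
  simp [connForm, vertD_holomorphic h (he _), Finset.mul_sum]

omit [FiniteDimensional ℂ E] in
theorem dFun_I_smul (hf : MDifferentiableAt 𝓘(ℂ, E) 𝓘(ℂ, ℂ) f x) (u : E) :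
    dFun f x (Complex.I • u) = Complex.I * dFun f x u := by
  have h1 := mfderiv_restrictScalars hf
  have h2 : ∀ u : E, dFun f x u = (mfderiv 𝓘(ℂ, E) 𝓘(ℂ, ℂ) f x : E →L[ℂ] ℂ) u := fun u ↦
    DFunLike.congr_fun h1 u
  exact (h2 _).trans ((map_smul _ _ _).trans (congrArg (Complex.I * ·) (h2 u).symm))

-- A change of basis Q turns the Gram matrix G into Qᵀ G Q̄. Its determinant gains |det Q|², the
-- factor that also relates the wedge coordinates, so the metric does not depend on the basis chosen
-- in its definition.
omit [IsManifold 𝓘(ℂ, E) ω X] in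
theorem detMetric_smul_ιMulti (h : IsRelativelyKahler (F := F) π omega)
    (b : Module.Basis (Fin n) ℂ (vert E F π x)) (c c' : ℂ) :
    detMetric F n π omega x (c • exteriorPower.ιMulti ℂ n b) (c' • exteriorPower.ιMulti ℂ n b) =
      c * starRingEnd ℂ c' * (Matrix.of fun i j ↦ kpair omega x (b i) (b j)).det := by
  have hn : Module.finrank ℂ (vert E F π x) = n := by
    rw [Module.finrank_eq_card_basis b, Fintype.card_fin]
  have hh := isHermitianInner_kpair h x
  rw [detMetric, dif_pos hn]
  set b₀ := Module.finBasisOfFinrankEq ℂ (vert E F π x) hn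
  change wedgeCoord b₀ _ * starRingEnd ℂ (wedgeCoord b₀ _) * _ = _
  set Q := b₀.toMatrix b with hQ
  have hb : ∀ j, b j = ∑ i, Q i j • b₀ i := fun j ↦ (b₀.sum_toMatrix_smul_self b j).symm
  have hm : (Matrix.of fun i j ↦ kpair omega x (b i) (b j)) =
      Q.transpose * (Matrix.of fun i j ↦ vertMetric F π omega x (b₀ i) (b₀ j)) *
        Q.map (starRingEnd ℂ) := by
    ext i j
    rw [Matrix.of_apply, hb i, hb j, hh.sum_left, Matrix.mul_assoc, Matrix.mul_apply]
    refine Finset.sum_congr rfl fun k _ ↦ ?_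
    rw [hh.smul_left, hh.sum_right, Matrix.mul_apply, Matrix.transpose_apply]
    congr 1
    refine Finset.sum_congr rfl fun l _ ↦ ?_
    rw [hh.smul_right, Matrix.of_apply, vertMetric_eq h, Matrix.map_apply, mul_comm]
  rw [hm, Matrix.det_mul, Matrix.det_mul, Matrix.det_transpose, map_smul, map_smul,
    wedgeCoord_ιMulti, b₀.det_apply, ← hQ, ← RingHom.mapMatrix_apply, ← RingHom.map_det,
    smul_eq_mul, smul_eq_mul, map_mul]
  ring

omit [IsManifold 𝓘(ℂ, E) ω X] in
theorem detMetric_smul_wedge (h : IsRelativelyKahler (F := F) π omega)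
    (hr : Module.finrank ℂ (vert E F π x) = n) (he : LinearIndependent ℂ (fun i ↦ e i x))
    (c c' : ℂ) : detMetric F n π omega x (c • wedge e x) (c' • wedge e x) =
      c * starRingEnd ℂ c' * (gram omega e x).det := by
  have h1 := detMetric_smul_ιMulti h (vertBasis hr he) c c'
  simp only [vertBasis_apply] at h1
  rwa [funext (vertBasis_apply hr he)] at h1

omit [IsManifold 𝓘(ℂ, E) ω X] in
theorem isHermitianInner_detMetric (h : IsRelativelyKahler (F := F) π omega)
    (hr : Module.finrank ℂ (vert E F π x) = n) :
    IsHermitianInner (detMetric F n π omega x) := by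
  classical
  let b := Module.finBasisOfFinrankEq ℂ (vert E F π x) hr
  set G : Matrix (Fin n) (Fin n) ℂ := Matrix.of fun i j ↦ kpair omega x (b i) (b j) with hG
  have key : ∀ p q, detMetric F n π omega x p q =
      wedgeCoord b p * starRingEnd ℂ (wedgeCoord b q) * G.det := by
    intro p q
    conv_lhs => rw [eq_wedgeCoord_smul b p, eq_wedgeCoord_smul b q]
    exact detMetric_smul_ιMulti h b _ _
  refine ⟨fun p q r ↦ ?_, fun z p q ↦ ?_, fun p q ↦ ?_, fun p hp ↦ ?_⟩
  · rw [key, key, key, map_add]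
    ring
  · rw [key, key, map_smul, smul_eq_mul]
    ring
  · have h1 : starRingEnd ℂ G.det = G.det := by
      rw [RingHom.map_det, ← Matrix.det_transpose]
      congr 1
      ext i j
      exact (isHermitianInner_kpair h x).conj _ _
    rw [key, key, map_mul, map_mul, h1, Complex.conj_conj]
    ring
  · rw [key] at hp
    have hd : G.det ≠ 0 := by
      -- The Gram lemma is about sections; the basis of the single fibre at x is extended by zero
      -- elsewhere.
      have h1 := isUnit_det_gram (e := fun i ↦ Function.update 0 x (b i)) h (x := x)
        (by simpa using b.linearIndependent)
      rw [isUnit_iff_ne_zero] at h1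
      convert h1 using 2
      ext i j
      simp [gram, hG]
    have h2 : wedgeCoord b p = 0 := by simpa [hd] using hp
    rw [eq_wedgeCoord_smul b p, h2, zero_smul]

omit [IsManifold 𝓘(ℂ, E) ω X] in
theorem gram_apply (i j : Fin n) : gram omega e x i j = kpair omega x (e i x) (e j x) := rfl

theorem trace_adjugate_mul_add (A G : Matrix (Fin n) (Fin n) ℂ) :
    (G.adjugate * (A.transpose * G + G * A.map (starRingEnd ℂ))).trace =
      (A.trace + starRingEnd ℂ A.trace) * G.det := by
  have h3 : starRingEnd ℂ A.trace = (A.map (starRingEnd ℂ)).trace := by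
    simp [Matrix.trace, Matrix.map_apply]
  rw [Matrix.mul_add, Matrix.trace_add, ← Matrix.mul_assoc, ← Matrix.mul_assoc,
    Matrix.adjugate_mul, Matrix.trace_mul_comm (G.adjugate * A.transpose),
    ← Matrix.mul_assoc, Matrix.mul_adjugate, h3]
  simp only [Matrix.smul_mul, Matrix.one_mul, Matrix.trace_smul, Matrix.trace_transpose,
    smul_eq_mul]
  ring

theorem dFun_gram (h : IsRelativelyKahler (F := F) π omega)
    (hr : Module.finrank ℂ (vert E F π x) = n) (he : IsVertFrame e x) (u : E) (i j : Fin n) :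
    dFun (fun y ↦ gram omega e y i j) x u =
      ((connMatrix h e x u).transpose * gram omega e x +
        gram omega e x * (connMatrix h e x u).map (starRingEnd ℂ)) i j := by
  have hh := isHermitianInner_kpair h x
  have hli := he.linearIndependent.self_of_nhds
  simp only [gram_apply]
  rw [vertD_metric h (he.smooth.self_of_nhds i) (he.smooth.self_of_nhds j) u,
    vertD_frame h hr hli, vertD_frame h hr hli, hh.sum_left, hh.sum_right,
    Matrix.add_apply, Matrix.mul_apply, Matrix.mul_apply]
  simp only [hh.smul_left, hh.smul_right, Matrix.transpose_apply, Matrix.map_apply, gram_apply]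
  congr 1
  exact Finset.sum_congr rfl fun k _ ↦ mul_comm _ _

/-- The derivative of the Gram determinant. -/
theorem dFun_det_gram (h : IsRelativelyKahler (F := F) π omega)
    (hr : Module.finrank ℂ (vert E F π x) = n) (he : IsVertFrame e x) (u : E) :
    dFun (fun y ↦ (gram omega e y).det) x u =
      (connForm h e x u + starRingEnd ℂ (connForm h e x u)) * (gram omega e x).det := by
  rw [dFun_det (M := gram omega e) (contMDiffAt_gram h he) u, connForm_apply,
    ← trace_adjugate_mul_add]
  congr 2
  ext i j
  exact dFun_gram h hr he u i j

variable [FiniteDimensional ℂ F] [IsManifold 𝓘(ℂ, F) ω B]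

omit [IsManifold 𝓘(ℂ, F) ω B] in
theorem IsWedgeRep.exists_common (h : IsRelativelyKahler (F := F) π omega)
    (hr : ∀ x, Module.finrank ℂ (vert E F π x) = n) (hs : WedgeSmoothAt s x)
    (ht : WedgeSmoothAt t x) :
    ∃ (e : Fin n → ∀ y, vert E F π y) (f f' : X → ℂ), IsWedgeRep e f s x ∧ IsWedgeRep e f' t x := by
  obtain ⟨e, f, hs⟩ := hs
  obtain ⟨e', f', ht⟩ := ht
  exact ⟨e, f, _, hs, ht.change h hr hs.frame⟩

theorem IsWedgeRep.wedgeD (hπ : Manifold.IsSubmersion 𝓘(ℂ, E) 𝓘(ℂ, F) ω π)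
    (h : IsRelativelyKahler (F := F) π omega)
    (hn : Module.finrank ℂ E = Module.finrank ℂ F + n) (hs : IsWedgeRep e f s x) {Y : X → E}
    (hY : ∀ᶠ y in 𝓝 x, VFSmoothAt Y y) :
    IsWedgeRep e (fun y ↦ dFun f y (Y y) + f y * connForm h e y (Y y))
      (fun y ↦ wedgeD h s y (Y y)) x where
  frame := hs.frame
  smooth := by
    filter_upwards [hs.eventually, hY.eventually_nhds] with y h1 h2
    exact (contMDiffAt_dFun h1.smooth.self_of_nhds h2.self_of_nhds).add
      (contMDiffAt_mul h1.smooth.self_of_nhds (contMDiffAt_connForm hπ h hn h1.frame h2))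
  eq := by
    filter_upwards [hs.eventually] with y h1
    rw [wedgeD_eq h (fun x ↦ finrank_vert hπ hn x) h1, wedgeDeriv_apply]

/-- Two smooth sections have representations in a common frame, where the linear laws are the
product rule. In a holomorphic frame df and tr θ are complex linear. Metric compatibility is d det G
= (tr θ + conj(tr θ)) det G. -/
theorem isChernConnection_wedgeD (hπ : IsEquivariantSubmersion E F K π)
    (h : IsRelativelyKahler (F := F) π omega)
    (hn : Module.finrank ℂ E = Module.finrank ℂ F + n) :
    IsChernConnection (antiCanonical hπ n) (detMetric F n π omega) (wedgeD h) := by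
  have hr := fun x ↦ finrank_vert hπ.submersion hn x
  refine ⟨⟨fun U s t hU hs ht x hx ↦ ?_, fun U f s hU hf hs x hx u ↦ ?_,
    fun U s Y hU hs hY ↦ ?_⟩, fun U s hU hs x hx u ↦ ?_, fun U s t hU hs ht x hx u ↦ ?_⟩
  · obtain ⟨e, f, f', hs, ht⟩ := IsWedgeRep.exists_common h hr
      ((antiCanonical_isSmooth_iff hπ).1 hs x hx) ((antiCanonical_isSmooth_iff hπ).1 ht x hx)
    have hst : IsWedgeRep e (fun y ↦ f y + f' y) (fun y ↦ s y + t y) x := by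
      refine ⟨hs.frame, ?_, ?_⟩
      · filter_upwards [hs.smooth, ht.smooth] with y h1 h2 using h1.add h2
      · filter_upwards [hs.eq, ht.eq] with y h1 h2
        exact (congrArg₂ (· + ·) h1 h2).trans (add_smul _ _ _).symm
    refine LinearMap.ext fun u ↦ ?_
    refine (DFunLike.congr_fun (wedgeD_eq h hr hst) u).trans ?_
    refine Eq.trans ?_ (congrArg₂ (· + ·) (DFunLike.congr_fun (wedgeD_eq h hr hs) u)
      (DFunLike.congr_fun (wedgeD_eq h hr ht) u)).symm
    simp only [wedgeDeriv_apply]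
    rw [dFun_add hs.smooth.self_of_nhds ht.smooth.self_of_nhds, ← add_smul]
    congr 1
    ring
  · obtain ⟨e, g, hs⟩ := (antiCanonical_isSmooth_iff hπ).1 hs x hx
    have hf' : ∀ᶠ y in 𝓝 x, ContMDiffAt 𝓘(ℝ, E) 𝓘(ℝ, ℂ) ∞ f y :=
      (hU.eventually_mem hx).mono fun y hy ↦ hf.contMDiffAt (hU.mem_nhds hy)
    have hfs : IsWedgeRep e (fun y ↦ f y * g y) (fun y ↦ f y • s y) x := by
      refine ⟨hs.frame, ?_, ?_⟩
      · filter_upwards [hs.smooth, hf'] with y h1 h2 using contMDiffAt_mul h2 h1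
      · filter_upwards [hs.eq] with y h1
        exact (congrArg (f y • ·) h1).trans (smul_smul _ _ _)
    refine (DFunLike.congr_fun (wedgeD_eq h hr hfs) u).trans ?_
    refine Eq.trans ?_ (congrArg₂ (fun a b ↦ f x • a + dFun f x u • b)
      (DFunLike.congr_fun (wedgeD_eq h hr hs) u) hs.eq.self_of_nhds).symm
    have aux : ∀ (a b c d d' : ℂ) (w : ⋀[ℂ]^n (vert E F π x)), a = b * c + d * d' →
        a • w = b • c • w + d • d' • w := fun a b c d d' w h ↦ by
      rw [h, add_smul, smul_smul, smul_smul]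
    refine aux _ _ _ _ _ _ ?_
    rw [dFun_mul hf'.self_of_nhds hs.smooth.self_of_nhds]
    ring
  · refine (antiCanonical_isSmooth_iff hπ).2 fun x hx ↦ ?_
    obtain ⟨e, g, hs⟩ := (antiCanonical_isSmooth_iff hπ).1 hs x hx
    exact ⟨e, _, hs.wedgeD hπ.submersion h hn
      ((hU.eventually_mem hx).mono ((isSmoothVF_iff hU).1 hY))⟩
  · obtain ⟨U', e, f, hU', hx', he, hli, hf, heq⟩ := hs x hx
    have hm := hU'.eventually_mem hx'
    have he' := fun i ↦ (vertBundle_isHol_iff hπ hU').1 (he i)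
    have hs' : IsWedgeRep e f s x := by
      refine ⟨⟨hm.mono fun y hy i ↦ (he' i y hy).vfSmoothAt, hm.mono hli⟩, ?_, hm.mono heq⟩
      exact hm.mono fun y hy ↦ contMDiffAt_restrictScalars (hf.contMDiffAt (hU'.mem_nhds hy))
    have h1 := wedgeD_eq h hr hs'
    refine (DFunLike.congr_fun h1 _).trans (Eq.trans ?_
      (congrArg (Complex.I • ·) (DFunLike.congr_fun h1 u)).symm)
    simp only [wedgeDeriv_apply]
    rw [dFun_I_smul ((hf.contMDiffAt (hU'.mem_nhds hx')).mdifferentiableAt (by simp)),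
      connForm_I_smul h fun i ↦ (he' i x hx').isHolomorphicDerivAt, smul_smul]
    congr 1
    ring
  · obtain ⟨e, f, f', hs, ht⟩ := IsWedgeRep.exists_common h hr
      ((antiCanonical_isSmooth_iff hπ).1 hs x hx) ((antiCanonical_isSmooth_iff hπ).1 ht x hx)
    have hli := hs.frame.linearIndependent
    have h1 : (fun y ↦ detMetric F n π omega y (s y) (t y)) =ᶠ[𝓝 x]
        fun y ↦ (f y * starRingEnd ℂ (f' y)) * (gram omega e y).det := by
      filter_upwards [hs.eq, ht.eq, hli] with y h1 h2 h3
      rw [h1, h2, detMetric_smul_wedge h (hr y) h3]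
    have hf := hs.smooth.self_of_nhds
    have hf' := ht.smooth.self_of_nhds
    have hc : ContMDiffAt 𝓘(ℝ, E) 𝓘(ℝ, ℂ) ∞ (fun y ↦ starRingEnd ℂ (f' y)) x :=
      (Complex.conjCLE : ℂ →L[ℝ] ℂ).contDiff.contMDiff.contMDiffAt.comp x hf'
    have hc' : dFun (fun y ↦ starRingEnd ℂ (f' y)) x u = starRingEnd ℂ (dFun f' x u) :=
      dFun_clm (Complex.conjCLE : ℂ →L[ℝ] ℂ) hf' u
    refine (DFunLike.congr_fun (dFun_congr h1) u).trans ?_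
    rw [dFun_mul (contMDiffAt_mul hf hc) (contMDiffAt_det (contMDiffAt_gram h hs.frame)),
      dFun_mul hf hc, hc', dFun_det_gram h (hr x) hs.frame]
    have e1 : detMetric F n π omega x (wedgeD h s x u) (t x) =
        (dFun f x u + f x * connForm h e x u) * starRingEnd ℂ (f' x) * (gram omega e x).det := by
      rw [wedgeD_eq h hr hs, wedgeDeriv_apply, ht.eq.self_of_nhds,
        detMetric_smul_wedge h (hr x) hli.self_of_nhds]
    have e2 : detMetric F n π omega x (s x) (wedgeD h t x u) =
        f x * starRingEnd ℂ (dFun f' x u + f' x * connForm h e x u) * (gram omega e x).det := by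
      rw [wedgeD_eq h hr ht, wedgeDeriv_apply, hs.eq.self_of_nhds,
        detMetric_smul_wedge h (hr x) hli.self_of_nhds]
    refine Eq.trans ?_ (congrArg₂ (· + ·) e1 e2).symm
    simp only [map_add, map_mul]
    ring

/-- The Chern connection of the relative anticanonical bundle agrees with the induced connection on
smooth sections. -/
theorem antiCanonicalConnection_eq (hπ : IsEquivariantSubmersion E F K π)
    (h : IsRelativelyKahler (F := F) π omega)
    (hn : Module.finrank ℂ E = Module.finrank ℂ F + n) (hs : WedgeSmoothAt s x) :
    antiCanonicalConnection hπ n omega s x = wedgeD h s x := by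
  have hr := fun x ↦ finrank_vert hπ.submersion hn x
  obtain ⟨e, f, hs⟩ := hs
  obtain ⟨U, hUs, hU, hx⟩ := eventually_nhds_iff.1 hs.eventually
  have hD := isChernConnection_wedgeD hπ h hn
  refine chernConnection_unique (fun x ↦ isHermitianInner_detMetric h (hr x))
    (W := antiCanonical hπ n) (fun U U' s hUU' hs x hx ↦ hs x (hUU' hx)) (fun x w ↦ ?_)
    (isChernConnection_chernConnection hD) hD hU
    ((antiCanonical_isSmooth_iff hπ).2 fun y hy ↦ ⟨e, f, hUs y hy⟩) hx
  obtain ⟨e, he⟩ := exists_holomorphic_frame hπ.submersion hn x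
  obtain ⟨U, hUe, hU, hx⟩ := eventually_nhds_iff.1 he
  let b := vertBasis (hr x) (hUe x hx).2
  refine ⟨U, fun y ↦ wedgeCoord b w • wedge e y, hU, hx, fun y hy ↦ ?_, fun y hy ↦ ?_, ?_⟩
  · exact ⟨U, e, fun _ ↦ wedgeCoord b w, hU, hy, fun i ↦ (vertBundle_isHol_iff hπ hU).2
      fun y hy ↦ (hUe y hy).1 i, fun y hy ↦ (hUe y hy).2, contMDiffOn_const, fun y hy ↦ rfl⟩
  · exact ⟨U, e, fun _ ↦ wedgeCoord b w, hU, hy, fun i ↦ (vertBundle_isSmooth_iff hπ hU).2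
      fun y hy ↦ ((hUe y hy).1 i).vfSmoothAt, fun y hy ↦ (hUe y hy).2, contMDiffOn_const,
      fun y hy ↦ rfl⟩
  · have h1 := eq_wedgeCoord_smul b w
    rw [funext (vertBasis_apply (hr x) (hUe x hx).2)] at h1
    exact h1.symm

end AntiCanonical

/-! ### One-forms and their exterior derivatives -/

section OneForms

variable {E X : Type*} [NormedAddCommGroup E] [NormedSpace ℂ E] [FiniteDimensional ℂ E]
  [TopologicalSpace X] [ChartedSpace E X] [IsManifold 𝓘(ℂ, E) ω X]
  {θ : X → E →L[ℝ] ℂ} {x₀ x : X}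

/-- The coordinate expression of a one-form. -/
def oneFormChart (θ : X → E →L[ℝ] ℂ) (x₀ : X) (y : E) : E →L[ℝ] ℂ :=
  (θ ((extChartAt 𝓘(ℝ, E) x₀).symm y)).comp (symmD ℝ x₀ y)

/-- Smoothness of a one-form at a point, tested on vector fields. -/
def SmoothOneFormAt (θ : X → E →L[ℝ] ℂ) (x : X) : Prop :=
  ∀ Y : X → E, (∀ᶠ y in 𝓝 x, VFSmoothAt Y y) →
    ContMDiffAt 𝓘(ℝ, E) 𝓘(ℝ, ℂ) ∞ (fun z ↦ θ z (Y z)) x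

/-- A coordinate vector field. -/
def coordVF (x₀ : X) (a : E) (x : X) : E := symmD ℝ x₀ (extChartAt 𝓘(ℝ, E) x₀ x) a

omit [FiniteDimensional ℂ E] in
theorem chartVF_coordVF (a : E) {y : E} (hy : y ∈ (extChartAt 𝓘(ℝ, E) x₀).target) :
    chartVF ℝ x₀ (coordVF x₀ a) y = a := by
  rw [chartVF, coordVF, (extChartAt 𝓘(ℝ, E) x₀).right_inv hy, chartD_symmD hy]

omit [FiniteDimensional ℂ E] in
theorem vfSmoothAt_coordVF (a : E) (hx : x ∈ (extChartAt 𝓘(ℝ, E) x₀).source) :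
    VFSmoothAt (coordVF x₀ a) x := by
  rw [vfSmoothAt_iff hx]
  refine (contDiffAt_const (c := a)).congr_of_eventuallyEq ?_
  filter_upwards [eventually_chart_symm hx (p := fun _ ↦ True) (by simp)] with y hy
  exact chartVF_coordVF a hy.1

omit [FiniteDimensional ℂ E] in
theorem eventually_vfSmoothAt_coordVF (a : E) (hx : x ∈ (extChartAt 𝓘(ℝ, E) x₀).source) :
    ∀ᶠ z in 𝓝 x, VFSmoothAt (coordVF x₀ a) z := by
  filter_upwards [(isOpen_extChartAt_source (I := 𝓘(ℝ, E)) x₀).mem_nhds hx] with z hz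
    using vfSmoothAt_coordVF a hz

/-- A vector of one-forms is smooth in coordinates. -/
theorem contDiffAt_oneFormChart (hx : x ∈ (extChartAt 𝓘(ℝ, E) x₀).source)
    (hθ : ∀ᶠ z in 𝓝 x, SmoothOneFormAt θ z) :
    ContDiffAt ℝ ∞ (oneFormChart θ x₀) (extChartAt 𝓘(ℝ, E) x₀ x) := by
  have hev := eventually_chart_symm hx (hθ.and
    ((isOpen_extChartAt_source (I := 𝓘(ℝ, E)) x₀).eventually_mem hx))
  obtain ⟨V, hV, hVo, hxV⟩ := eventually_nhds_iff.1 hev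
  -- A map into continuous linear functionals on a finite dimensional space is smooth as soon as its
  -- values on fixed vectors are; coordinate fields realise these vectors.
  refine ContDiffOn.contDiffAt (s := V) (contDiffOn_clm_apply.2 fun a ↦ ?_) (hVo.mem_nhds hxV)
  intro y hy
  obtain ⟨h1, h2, h3⟩ := hV y hy
  have h4 := h2 (coordVF x₀ a) (eventually_vfSmoothAt_coordVF a h3)
  rw [contMDiffAt_chart_iff h3, (extChartAt 𝓘(ℝ, E) x₀).right_inv h1] at h4
  refine (h4.congr_of_eventuallyEq ?_).contDiffWithinAt
  filter_upwards [hVo.mem_nhds hy] with y hy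
  simp only [Function.comp_apply, coordVF, (extChartAt 𝓘(ℝ, E) x₀).right_inv (hV y hy).1]
  rfl

/-- Cartan's formula for the exterior derivative of a one-form, in coordinates. -/
theorem dFun_oneForm (hx : x ∈ (extChartAt 𝓘(ℝ, E) x₀).source)
    (hθ : ∀ᶠ z in 𝓝 x, SmoothOneFormAt θ z) {Y Z : X → E} (hY : ∀ᶠ z in 𝓝 x, VFSmoothAt Y z)
    (hZ : ∀ᶠ z in 𝓝 x, VFSmoothAt Z z) :
    dFun (fun z ↦ θ z (Z z)) x (Y x) - dFun (fun z ↦ θ z (Y z)) x (Z x) -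
        θ x (bracketVF Y Z x) =
      fderiv ℝ (oneFormChart θ x₀) (extChartAt 𝓘(ℝ, E) x₀ x) (chartD ℝ x₀ x (Y x))
          (chartD ℝ x₀ x (Z x)) -
        fderiv ℝ (oneFormChart θ x₀) (extChartAt 𝓘(ℝ, E) x₀ x) (chartD ℝ x₀ x (Z x))
          (chartD ℝ x₀ x (Y x)) := by
  have := FiniteDimensional.complete ℂ E
  have hd := ((contDiffAt_oneFormChart hx hθ).differentiableAt (by simp)).hasFDerivAt
  have key : ∀ {Z : X → E}, (∀ᶠ z in 𝓝 x, VFSmoothAt Z z) → ∀ u : E,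
      dFun (fun z ↦ θ z (Z z)) x u =
        fderiv ℝ (oneFormChart θ x₀) (extChartAt 𝓘(ℝ, E) x₀ x) (chartD ℝ x₀ x u)
          (chartD ℝ x₀ x (Z x)) +
        oneFormChart θ x₀ (extChartAt 𝓘(ℝ, E) x₀ x)
          (fderiv ℝ (chartVF ℝ x₀ Z) (extChartAt 𝓘(ℝ, E) x₀ x) (chartD ℝ x₀ x u)) := by
    intro Z hZ u
    have h1 : (fun z ↦ θ z (Z z)) ∘ (extChartAt 𝓘(ℝ, E) x₀).symm =ᶠ[𝓝 (extChartAt 𝓘(ℝ, E) x₀ x)]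
        fun y ↦ oneFormChart θ x₀ y (chartVF ℝ x₀ Z y) := by
      filter_upwards [eventually_chart_symm hx
        ((isOpen_extChartAt_source (I := 𝓘(ℝ, E)) x₀).eventually_mem hx)] with y hy
      have h2 := symmD_chartD (𝕜 := ℝ) hy.2 (Z ((extChartAt 𝓘(ℝ, E) x₀).symm y))
      rw [(extChartAt 𝓘(ℝ, E) x₀).right_inv hy.1] at h2
      rw [oneFormChart, chartVF, ContinuousLinearMap.comp_apply, h2]
      rfl
    rw [dFun_eq_fderiv hx (hθ.self_of_nhds Z hZ), h1.fderiv_eq,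
      (hd.clm_apply (hZ.self_of_nhds.differentiableAt hx).hasFDerivAt).fderiv]
    simp only [add_apply, ContinuousLinearMap.comp_apply, ContinuousLinearMap.flip_apply]
    rw [chartVF_chart hx, add_comm]
  have hb : θ x (bracketVF Y Z x) = oneFormChart θ x₀ (extChartAt 𝓘(ℝ, E) x₀ x)
      (chartD ℝ x₀ x (bracketVF Y Z x)) := by
    rw [oneFormChart, ContinuousLinearMap.comp_apply, symmD_chartD hx,
      (extChartAt 𝓘(ℝ, E) x₀).left_inv hx]
  rw [key hZ, key hY, hb, chartD_bracketVF hx hY.self_of_nhds hZ.self_of_nhds,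
    VectorField.lieBracket, map_sub, chartVF_chart hx, chartVF_chart hx]
  ring

/-- A family of linear functionals as a differential form of degree one. -/
def asOneForm (θ : X → E →L[ℝ] ℂ) (x : X) : E [⋀^Fin 1]→L[ℝ] ℂ :=
  ContinuousAlternatingMap.ofSubsingletonLIE (𝕜 := ℝ) (E := E) (F := ℂ) (0 : Fin 1) (θ x)

omit [FiniteDimensional ℂ E] [IsManifold 𝓘(ℂ, E) ω X] in
theorem formInChart_asOneForm (θ : X → E →L[ℝ] ℂ) (x₀ : X) :
    formInChart (asOneForm θ) x₀ = fun y ↦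
      ContinuousAlternatingMap.ofSubsingletonLIE (𝕜 := ℝ) (E := E) (F := ℂ) (0 : Fin 1)
        (oneFormChart θ x₀ y) := by
  ext y w
  rfl

theorem contDiffAt_formInChart_asOneForm (hx : x ∈ (extChartAt 𝓘(ℝ, E) x₀).source)
    (hθ : ∀ᶠ z in 𝓝 x, SmoothOneFormAt θ z) :
    ContDiffAt ℝ ∞ (formInChart (asOneForm θ) x₀) (extChartAt 𝓘(ℝ, E) x₀ x) := by
  rw [formInChart_asOneForm]
  exact (ContinuousAlternatingMap.ofSubsingletonLIE (𝕜 := ℝ) (E := E) (F := ℂ)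
    (0 : Fin 1)).toContinuousLinearEquiv.contDiff.contDiffAt.comp _ (contDiffAt_oneFormChart hx hθ)

theorem extDeriv_asOneForm (hx : x ∈ (extChartAt 𝓘(ℝ, E) x₀).source)
    (hθ : ∀ᶠ z in 𝓝 x, SmoothOneFormAt θ z) (w : Fin 2 → E) :
    extDeriv (formInChart (asOneForm θ) x₀) (extChartAt 𝓘(ℝ, E) x₀ x) w =
      fderiv ℝ (oneFormChart θ x₀) (extChartAt 𝓘(ℝ, E) x₀ x) (w 0) (w 1) -
        fderiv ℝ (oneFormChart θ x₀) (extChartAt 𝓘(ℝ, E) x₀ x) (w 1) (w 0) := by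
  have hd := (contDiffAt_oneFormChart hx hθ).differentiableAt (by simp)
  have key : ∀ a b : E, fderiv ℝ (fun y ↦ oneFormChart θ x₀ y a) (extChartAt 𝓘(ℝ, E) x₀ x) b =
      fderiv ℝ (oneFormChart θ x₀) (extChartAt 𝓘(ℝ, E) x₀ x) b a := by
    intro a b
    rw [fderiv_clm_apply hd (differentiableAt_const a)]
    simp
  rw [extDeriv_apply ((contDiffAt_formInChart_asOneForm hx hθ).differentiableAt (by simp)),
    Fin.sum_univ_two, ← key, ← key, formInChart_asOneForm]
  simp only [Fin.val_zero, pow_zero, one_smul, Fin.val_one, pow_one, neg_smul, ← sub_eq_add_neg]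
  rfl

omit [FiniteDimensional ℂ E] [IsManifold 𝓘(ℂ, E) ω X] in
theorem ContDiffAt.extDeriv {k : ℕ} {α : E → E [⋀^Fin k]→L[ℝ] ℂ} {y : E}
    (h : ContDiffAt ℝ ∞ α y) : ContDiffAt ℝ ∞ (extDeriv α) y := by
  have h1 : ContDiffAt ℝ ∞ (fderiv ℝ α) y := h.fderiv_right (m := ∞) (by simp)
  exact (ContinuousAlternatingMap.alternatizeUncurryFinCLM ℝ E ℂ).contDiff.contDiffAt.comp y h1

omit [FiniteDimensional ℂ E] in
theorem dForm_eq_extDeriv {k : ℕ} (α : X → E [⋀^Fin k]→L[ℝ] ℂ) (x : X) :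
    dForm α x = extDeriv (formInChart α x) (extChartAt 𝓘(ℝ, E) x x) := by
  have := chartD_self (𝕜 := ℝ) (E := E) x
  rw [chartD] at this
  rw [dForm, this]
  rfl

/-- A two-form which is locally exact is smooth and closed. -/
theorem smooth_and_closed_of_locally_exact {η : X → E [⋀^Fin 2]→L[ℝ] ℂ}
    (H : ∀ x, ∃ θ : X → E →L[ℝ] ℂ, (∀ᶠ z in 𝓝 x, SmoothOneFormAt θ z) ∧
      ∀ᶠ z in 𝓝 x, ∀ Y Z : X → E, (∀ᶠ y in 𝓝 z, VFSmoothAt Y y) →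
        (∀ᶠ y in 𝓝 z, VFSmoothAt Z y) → η z ![Y z, Z z] =
          dFun (fun y ↦ θ y (Z y)) z (Y z) - dFun (fun y ↦ θ y (Y y)) z (Z z) -
            θ z (bracketVF Y Z z)) :
    IsSmoothForm η ∧ dForm η = 0 := by
  have key : ∀ {x₀ x : X}, x ∈ (extChartAt 𝓘(ℝ, E) x₀).source → ∃ θ : X → E →L[ℝ] ℂ,
      (∀ᶠ z in 𝓝 x, SmoothOneFormAt θ z) ∧
      formInChart η x₀ =ᶠ[𝓝 (extChartAt 𝓘(ℝ, E) x₀ x)]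
        extDeriv (formInChart (asOneForm θ) x₀) := by
    intro x₀ x hx
    obtain ⟨θ, hθ, hη⟩ := H x
    refine ⟨θ, hθ, ?_⟩
    filter_upwards [eventually_chart_symm hx (hθ.eventually_nhds.and (hη.and
      ((isOpen_extChartAt_source (I := 𝓘(ℝ, E)) x₀).eventually_mem hx)))] with y hy
    obtain ⟨h1, h2, h3, h4⟩ := hy
    set z := (extChartAt 𝓘(ℝ, E) x₀).symm y with hz
    have hyz : extChartAt 𝓘(ℝ, E) x₀ z = y := (extChartAt 𝓘(ℝ, E) x₀).right_inv h1
    ext w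
    -- The hypothesis is free of coordinates, so testing it on the coordinate fields at x₀ gives η =
    -- dθ in that chart.
    have h5 := h3 (coordVF x₀ (w 0)) (coordVF x₀ (w 1)) (eventually_vfSmoothAt_coordVF _ h4)
      (eventually_vfSmoothAt_coordVF _ h4)
    rw [dFun_oneForm h4 h2 (eventually_vfSmoothAt_coordVF _ h4)
      (eventually_vfSmoothAt_coordVF _ h4)] at h5
    have h6 := extDeriv_asOneForm h4 h2 w
    have h7 : ∀ a : E, chartD ℝ x₀ z (coordVF x₀ a z) = a := fun a ↦ by
      rw [coordVF, hyz, hz, chartD_symmD h1]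
    rw [h7, h7, ← h6, hyz] at h5
    rw [← h5]
    refine congrArg (η z) (funext fun i ↦ ?_)
    fin_cases i
    · change _ = coordVF x₀ (w 0) z
      rw [coordVF, hyz]
      rfl
    · change _ = coordVF x₀ (w 1) z
      rw [coordVF, hyz]
      rfl
  constructor
  · intro x₀ y hy
    obtain ⟨θ, hθ, h1⟩ := key ((extChartAt 𝓘(ℝ, E) x₀).map_target hy)
    have h2 := (contDiffAt_formInChart_asOneForm ((extChartAt 𝓘(ℝ, E) x₀).map_target hy) hθ)
    rw [(extChartAt 𝓘(ℝ, E) x₀).right_inv hy] at h1 h2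
    exact ((ContDiffAt.extDeriv h2).congr_of_eventuallyEq h1).contDiffWithinAt
  · ext1 x
    have hx := mem_extChartAt_source (I := 𝓘(ℝ, E)) x
    obtain ⟨θ, hθ, h1⟩ := key hx
    rw [dForm_eq_extDeriv, h1.extDeriv_eq,
      extDeriv_extDeriv_apply (contDiffAt_formInChart_asOneForm hx hθ)
        (by simpa using ENat.LEInfty.out)]
    rfl

end OneForms

/-! ### Curvature and moment map of the relative anticanonical bundle -/

section AntiCanonicalCurvature

variable {E F X B : Type*} [NormedAddCommGroup E] [NormedSpace ℂ E] [FiniteDimensional ℂ E]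
  [NormedAddCommGroup F] [NormedSpace ℂ F] [FiniteDimensional ℂ F]
  [TopologicalSpace X] [ChartedSpace E X] [TopologicalSpace B] [ChartedSpace F B]
  {π : X → B} {omega : X → E [⋀^Fin 2]→L[ℝ] ℝ}
  [IsManifold 𝓘(ℂ, E) ω X] [IsManifold 𝓘(ℂ, F) ω B]
  {n : ℕ} {e : Fin n → ∀ y, vert E F π y} {f : X → ℂ}
  {s : ∀ y, ⋀[ℂ]^n (vert E F π y)} {x : X}

/-- The trace of the connection matrix as a one-form. -/
def connOneForm (h : IsRelativelyKahler (F := F) π omega) (e : Fin n → ∀ y, vert E F π y) (x : X) :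
    E →L[ℝ] ℂ := LinearMap.toContinuousLinearMap (connForm h e x)

theorem smoothOneFormAt_connOneForm (hs : Manifold.IsSubmersion 𝓘(ℂ, E) 𝓘(ℂ, F) ω π)
    (h : IsRelativelyKahler (F := F) π omega)
    (hn : Module.finrank ℂ E = Module.finrank ℂ F + n) (he : IsVertFrame e x) :
    ∀ᶠ z in 𝓝 x, SmoothOneFormAt (connOneForm h e) z :=
  he.eventually.mono fun _ hz _ hY ↦ contMDiffAt_connForm hs h hn hz hY

/-- The exterior derivative of the trace of the connection matrix, on vector fields. -/
def connCurv (h : IsRelativelyKahler (F := F) π omega) (e : Fin n → ∀ y, vert E F π y)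
    (Y Z : X → E) (x : X) : ℂ :=
  dFun (fun z ↦ connForm h e z (Z z)) x (Y x) - dFun (fun z ↦ connForm h e z (Y z)) x (Z x) -
    connForm h e x (bracketVF Y Z x)

variable {K : Type*} [Group K] [MulAction K X] [MulAction K B]

theorem antiCanonicalConnection_apply (hπ : IsEquivariantSubmersion E F K π)
    (h : IsRelativelyKahler (F := F) π omega)
    (hn : Module.finrank ℂ E = Module.finrank ℂ F + n) (hs : IsWedgeRep e f s x) (u : E) :
    antiCanonicalConnection hπ n omega s x u =
      (dFun f x u + f x * connForm h e x u) • wedge e x := by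
  have h1 := antiCanonicalConnection_eq hπ h hn ⟨e, f, hs⟩
  rw [wedgeD_eq h (fun x ↦ finrank_vert hπ.submersion hn x) hs] at h1
  exact DFunLike.congr_fun h1 u

theorem IsWedgeRep.antiCanonicalConnection (hπ : IsEquivariantSubmersion E F K π)
    (h : IsRelativelyKahler (F := F) π omega)
    (hn : Module.finrank ℂ E = Module.finrank ℂ F + n) (hs : IsWedgeRep e f s x) {Y : X → E}
    (hY : ∀ᶠ y in 𝓝 x, VFSmoothAt Y y) :
    IsWedgeRep e (fun y ↦ dFun f y (Y y) + f y * connForm h e y (Y y))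
      (fun y ↦ antiCanonicalConnection hπ n omega s y (Y y)) x :=
  ⟨hs.frame, (hs.wedgeD hπ.submersion h hn hY).smooth,
    hs.eventually.mono fun _ hy ↦ antiCanonicalConnection_apply hπ h hn hy _⟩

/-- The second derivatives of `f` cancel against [Y, Z] f, and the mixed and quadratic terms cancel
because the fibre is one-dimensional; only d tr θ remains. -/
theorem curvature_antiCanonicalConnection (hπ : IsEquivariantSubmersion E F K π)
    (h : IsRelativelyKahler (F := F) π omega)
    (hn : Module.finrank ℂ E = Module.finrank ℂ F + n) (hs : IsWedgeRep e f s x) {Y Z : X → E}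
    (hY : ∀ᶠ y in 𝓝 x, VFSmoothAt Y y) (hZ : ∀ᶠ y in 𝓝 x, VFSmoothAt Z y) :
    curvature (antiCanonical hπ n) (antiCanonicalConnection hπ n omega) Y Z s x =
      connCurv h e Y Z x • s x := by
  have := FiniteDimensional.complete ℂ E
  have hf := hs.smooth.self_of_nhds
  have key : ∀ {Z : X → E}, (∀ᶠ y in 𝓝 x, VFSmoothAt Z y) → ∀ u : E,
      dFun (fun y ↦ dFun f y (Z y) + f y * connForm h e y (Z y)) x u =
        dFun (fun y ↦ dFun f y (Z y)) x u + (dFun f x u * connForm h e x (Z x) +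
          f x * dFun (fun y ↦ connForm h e y (Z y)) x u) := by
    intro Z hZ u
    have h1 := contMDiffAt_dFun hf hZ.self_of_nhds
    have h2 := contMDiffAt_connForm hπ.submersion h hn hs.frame hZ
    rw [dFun_add h1 (contMDiffAt_mul hf h2), dFun_mul hf h2]
  have h1 := antiCanonicalConnection_apply hπ h hn (hs.antiCanonicalConnection hπ h hn hZ) (Y x)
  have h2 := antiCanonicalConnection_apply hπ h hn (hs.antiCanonicalConnection hπ h hn hY) (Z x)
  have h3 := antiCanonicalConnection_apply hπ h hn hs (bracketVF Y Z x)
  have h4 := dFun_bracketVF hf hY.self_of_nhds hZ.self_of_nhds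
  have alg : ∀ (a b c d g : ℂ) (w : ⋀[ℂ]^n (vert E F π x)), a - b - c = d * g →
      a • w - b • w - c • w = d • g • w := fun a b c d g w h ↦ by
    rw [smul_smul, ← h, sub_smul, sub_smul]
  refine (congrArg₂ (· - ·) (congrArg₂ (· - ·) h1 h2) h3).trans
    ((alg _ _ _ (connCurv h e Y Z x) (f x) (wedge e x) ?_).trans
      (congrArg (connCurv h e Y Z x • ·) hs.eq.self_of_nhds.symm))
  rw [key hZ, key hY, h4, connCurv]
  ring

theorem exists_isVertFrame (hs : Manifold.IsSubmersion 𝓘(ℂ, E) 𝓘(ℂ, F) ω π)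
    (hn : Module.finrank ℂ E = Module.finrank ℂ F + n) (x : X) :
    ∃ e : Fin n → ∀ y, vert E F π y, IsVertFrame e x := by
  obtain ⟨e, he⟩ := exists_holomorphic_frame hs hn x
  exact ⟨e, he.mono fun y hy i ↦ (hy.1 i).vfSmoothAt, he.mono fun y hy ↦ hy.2⟩

omit [FiniteDimensional ℂ E] [FiniteDimensional ℂ F] [IsManifold 𝓘(ℂ, F) ω B] in
theorem IsVertFrame.isWedgeRep (he : IsVertFrame e x) :
    IsWedgeRep e (fun _ ↦ 1) (wedge e) x :=
  ⟨he, Filter.Eventually.of_forall fun _ ↦ contMDiffAt_const,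
    Filter.Eventually.of_forall fun _ ↦ (one_smul _ _).symm⟩

/-- The curvature form of the relative anticanonical bundle. -/
theorem isCurvatureForm_curvatureForm (hπ : IsEquivariantSubmersion E F K π)
    (h : IsRelativelyKahler (F := F) π omega)
    (hn : Module.finrank ℂ E = Module.finrank ℂ F + n) :
    IsCurvatureForm (antiCanonical hπ n) (antiCanonicalConnection hπ n omega)
      (curvatureForm (antiCanonical hπ n) (antiCanonicalConnection hπ n omega)) := by
  have H : ∃ η, IsCurvatureForm (antiCanonical hπ n) (antiCanonicalConnection hπ n omega) η := by
    -- A different frame at each point is harmless: the defining property of a curvature form is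
    -- pointwise, and any section can be rewritten in the frame at hand.
    choose e he using exists_isVertFrame (n := n) hπ.submersion hn
    refine ⟨fun x ↦ dForm (asOneForm (connOneForm h (e x))) x, fun U Y Z s hU hY hZ hs x hx ↦ ?_⟩
    obtain ⟨e', f', hs⟩ := (antiCanonical_isSmooth_iff hπ).1 hs x hx
    have hs := hs.change h (fun x ↦ finrank_vert hπ.submersion hn x) (he x)
    have hY' := (hU.eventually_mem hx).mono ((isSmoothVF_iff hU).1 hY)
    have hZ' := (hU.eventually_mem hx).mono ((isSmoothVF_iff hU).1 hZ)
    have hθ := smoothOneFormAt_connOneForm hπ.submersion h hn (he x)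
    have hx' := mem_extChartAt_source (I := 𝓘(ℝ, E)) x
    refine (curvature_antiCanonicalConnection hπ h hn hs hY' hZ').trans ?_
    congr 1
    have h1 := dFun_oneForm hx' hθ hY' hZ'
    rw [chartD_self] at h1
    change _ = dForm (asOneForm (connOneForm h (e x))) x ![Y x, Z x]
    rw [dForm_eq_extDeriv, extDeriv_asOneForm hx' hθ]
    exact h1
  rw [curvatureForm, dif_pos H]
  exact H.choose_spec

/-- The curvature form is known by its action on sections; the nonvanishing section e₁ ∧ ⋯ ∧ eₙ
determines its values. -/
theorem IsCurvatureForm.apply_eq (hπ : IsEquivariantSubmersion E F K π)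
    (h : IsRelativelyKahler (F := F) π omega)
    (hn : Module.finrank ℂ E = Module.finrank ℂ F + n) {η : X → E [⋀^Fin 2]→L[ℝ] ℂ}
    (hη : IsCurvatureForm (antiCanonical hπ n) (antiCanonicalConnection hπ n omega) η)
    (he : IsVertFrame e x) {Y Z : X → E} (hY : ∀ᶠ y in 𝓝 x, VFSmoothAt Y y)
    (hZ : ∀ᶠ y in 𝓝 x, VFSmoothAt Z y) : η x ![Y x, Z x] = connCurv h e Y Z x := by
  obtain ⟨U, hUp, hU, hx⟩ := eventually_nhds_iff.1 (he.eventually.and (hY.and hZ))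
  have h1 := hη U Y Z (wedge e) hU ((isSmoothVF_iff hU).2 fun y hy ↦ (hUp y hy).2.1)
    ((isSmoothVF_iff hU).2 fun y hy ↦ (hUp y hy).2.2)
    ((antiCanonical_isSmooth_iff hπ).2 fun y hy ↦ ⟨e, _, (hUp y hy).1.isWedgeRep⟩) x hx
  have h2 : connCurv h e Y Z x • wedge e x = η x ![Y x, Z x] • wedge e x :=
    (curvature_antiCanonicalConnection hπ h hn he.isWedgeRep hY hZ).symm.trans h1
  exact (smul_left_injective ℂ (wedge_ne_zero (finrank_vert hπ.submersion hn x)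
    he.linearIndependent.self_of_nhds) h2).symm

/-- Multiples of the curvature form are smooth and closed. -/
theorem IsCurvatureForm.smooth_and_closed (hπ : IsEquivariantSubmersion E F K π)
    (h : IsRelativelyKahler (F := F) π omega)
    (hn : Module.finrank ℂ E = Module.finrank ℂ F + n) {η : X → E [⋀^Fin 2]→L[ℝ] ℂ}
    (hη : IsCurvatureForm (antiCanonical hπ n) (antiCanonicalConnection hπ n omega) η) (c : ℂ) :
    IsSmoothForm (fun x ↦ c • η x) ∧ dForm (fun x ↦ c • η x) = 0 := by
  refine smooth_and_closed_of_locally_exact fun x ↦ ?_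
  obtain ⟨e, he⟩ := exists_isVertFrame (n := n) hπ.submersion hn x
  have hθ := smoothOneFormAt_connOneForm hπ.submersion h hn he
  refine ⟨fun z ↦ c • connOneForm h e z, hθ.mono fun z hz Y hY ↦
    contMDiffAt_mul contMDiffAt_const (hz Y hY), ?_⟩
  filter_upwards [he.eventually, hθ] with z hz hz' Y Z hY hZ
  have h1 : ∀ {Z : X → E}, (∀ᶠ y in 𝓝 z, VFSmoothAt Z y) → ∀ u : E,
      dFun (fun y ↦ (c • connOneForm h e y) (Z y)) z u =
        c * dFun (fun y ↦ connForm h e y (Z y)) z u := fun hZ u ↦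
    dFun_const_mul c (hz' _ hZ) u
  rw [h1 hY, h1 hZ]
  refine (congrArg (c * ·) (hη.apply_eq hπ h hn hz hY hZ)).trans ?_
  change c * connCurv h e Y Z z = _ - c * connForm h e z (bracketVF Y Z z)
  rw [connCurv]
  ring

/-! Naturality. -/

omit [IsManifold 𝓘(ℂ, F) ω B] in
theorem IsVertFrame.pullSec (hπ : IsEquivariantSubmersion E F K π) (k : K)
    (he : IsVertFrame e (k • x)) : IsVertFrame (fun i ↦ pullSec hπ k (e i)) x where
  smooth := ((tendsto_act hπ.holomorphic_source k x).eventually he.smooth).mono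
    fun y hy i ↦ SecSmoothAt.pullSec hπ k (hy i)
  linearIndependent := ((tendsto_act hπ.holomorphic_source k x).eventually
    he.linearIndependent).mono fun y hy ↦ by
      exact hy.map' (vertPull hπ k y) (LinearMap.ker_eq_bot.2 (vertPull_injective hπ k y))

omit [IsManifold 𝓘(ℂ, F) ω B] in
theorem frameCoord_pullSec (hπ : IsEquivariantSubmersion E F K π)
    (h : IsRelativelyKahler (F := F) π omega)
    (hn : Module.finrank ℂ E = Module.finrank ℂ F + n) (k : K)
    (he : LinearIndependent ℂ (fun i ↦ e i (k • x))) (i : Fin n) (w : vert E F π (k • x)) :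
    frameCoord h (fun i ↦ pullSec hπ k (e i)) x i (vertPull hπ k x w) =
      frameCoord h e (k • x) i w := by
  conv_lhs => rw [sum_frameCoord h (finrank_vert hπ.submersion hn _) he w, map_sum]
  simp only [map_smul]
  exact frameCoord_sum (e := fun i ↦ pullSec hπ k (e i)) h (finrank_vert hπ.submersion hn _)
    (he.map' (vertPull hπ k x) (LinearMap.ker_eq_bot.2 (vertPull_injective hπ k x))) _ i

theorem connForm_pullSec (hπ : IsEquivariantSubmersion E F K π)
    (h : IsRelativelyKahler (F := F) π omega) (hinv : IsInvariantForm K omega)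
    (hn : Module.finrank ℂ E = Module.finrank ℂ F + n) (k : K)
    (he : IsVertFrame e (k • x)) (u : E) :
    connForm h (fun i ↦ pullSec hπ k (e i)) x u = connForm h e (k • x) (dAct k x u) := by
  simp only [connForm, LinearMap.sum_apply, LinearMap.comp_apply, LinearMap.restrictScalars_apply]
  refine Finset.sum_congr rfl fun i _ ↦ ?_
  rw [vertD_pullSec hπ h hinv hn k (he.smooth.self_of_nhds i),
    frameCoord_pullSec hπ h hn k he.linearIndependent.self_of_nhds]

omit [FiniteDimensional ℂ E] [FiniteDimensional ℂ F] [IsManifold 𝓘(ℂ, F) ω B] in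
theorem pull_wedge (hπ : IsEquivariantSubmersion E F K π) (k : K) :
    (antiCanonical hπ n).pull k x (wedge e (k • x)) = wedge (fun i ↦ pullSec hπ k (e i)) x :=
  exteriorPower.map_apply_ιMulti _ _

theorem IsWedgeRep.pull (hπ : IsEquivariantSubmersion E F K π) (k : K)
    (hs : IsWedgeRep e f s (k • x)) :
    IsWedgeRep (fun i ↦ pullSec hπ k (e i)) (fun y ↦ f (k • y))
      (fun y ↦ (antiCanonical hπ n).pull k y (s (k • y))) x where
  frame := hs.frame.pullSec hπ k
  smooth := ((tendsto_act hπ.holomorphic_source k x).eventually hs.smooth).mono fun _ hy ↦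
    contMDiffAt_act hπ.holomorphic_source k hy
  eq := ((tendsto_act hπ.holomorphic_source k x).eventually hs.eq).mono fun y hy ↦
    (congrArg ((antiCanonical hπ n).pull k y) hy).trans
      ((map_smul _ _ _).trans (congrArg (f (k • y) • ·) (pull_wedge hπ k)))

theorem isInvariantConnection_antiCanonicalConnection (hπ : IsEquivariantSubmersion E F K π)
    (h : IsRelativelyKahler (F := F) π omega) (hinv : IsInvariantForm K omega)
    (hn : Module.finrank ℂ E = Module.finrank ℂ F + n) :
    IsInvariantConnection (antiCanonical hπ n) (antiCanonicalConnection hπ n omega) := by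
  intro k U s hU hs x hx u
  obtain ⟨e, f, hs⟩ := (antiCanonical_isSmooth_iff hπ).1 hs _ hx
  refine (antiCanonicalConnection_apply hπ h hn (hs.pull hπ k) u).trans ?_
  refine Eq.trans ?_ (congrArg ((antiCanonical hπ n).pull k x)
    (antiCanonicalConnection_apply hπ h hn hs (dAct k x u))).symm
  refine Eq.trans ?_ (map_smul ((antiCanonical hπ n).pull k x) _ _).symm
  rw [connForm_pullSec hπ h hinv hn k hs.frame, dFun_act hπ.holomorphic_source k
    hs.smooth.self_of_nhds]
  exact congrArg (_ • ·) (pull_wedge hπ k).symm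

/-- The connection form of the pulled back frame is the pullback of the connection form, and
naturality of derivatives and brackets passes this to the curvature. -/
theorem IsCurvatureForm.invariant (hπ : IsEquivariantSubmersion E F K π)
    (h : IsRelativelyKahler (F := F) π omega) (hinv : IsInvariantForm K omega)
    (hn : Module.finrank ℂ E = Module.finrank ℂ F + n) {η : X → E [⋀^Fin 2]→L[ℝ] ℂ}
    (hη : IsCurvatureForm (antiCanonical hπ n) (antiCanonicalConnection hπ n omega) η) (k : K)
    (x : X) : (η (k • x)).compContinuousLinearMap (dAct k x) = η x := by
  have := FiniteDimensional.complete ℂ E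
  have hol := hπ.holomorphic_source
  ext w
  obtain ⟨Y, hY0, hY⟩ := exists_vfSmoothAt (k • x) (dAct (E := E) k x (w 0))
  obtain ⟨Z, hZ0, hZ⟩ := exists_vfSmoothAt (k • x) (dAct (E := E) k x (w 1))
  obtain ⟨e, he⟩ := exists_isVertFrame (n := n) hπ.submersion hn (k • x)
  have pl : ∀ {Y : X → E}, (∀ᶠ z in 𝓝 (k • x), VFSmoothAt Y z) →
      ∀ᶠ z in 𝓝 x, VFSmoothAt (pullVF k Y) z := fun hY ↦
    ((tendsto_act hol k x).eventually hY).mono fun z hz ↦ hz.pullVF hol k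
  have h1 := hη.apply_eq hπ h hn he hY hZ
  have h2 := hη.apply_eq hπ h hn (he.pullSec hπ k) (pl hY) (pl hZ)
  have h3 : ∀ {Y : X → E}, (∀ᶠ z in 𝓝 (k • x), VFSmoothAt Y z) → ∀ u : E,
      dFun (fun z ↦ connForm h (fun i ↦ pullSec hπ k (e i)) z (pullVF k Y z)) x u =
        dFun (fun z ↦ connForm h e z (Y z)) (k • x) (dAct k x u) := by
    intro Y hY u
    have h4 : (fun z ↦ connForm h (fun i ↦ pullSec hπ k (e i)) z (pullVF k Y z)) =ᶠ[𝓝 x]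
        fun z ↦ (fun z ↦ connForm h e z (Y z)) (k • z) := by
      filter_upwards [(tendsto_act hol k x).eventually he.eventually] with z hz
      rw [connForm_pullSec hπ h hinv hn k hz, pullVF_eq_iff hol]
    have h5 := dFun_act hol k (contMDiffAt_connForm hπ.submersion h hn he hY) u
    exact (DFunLike.congr_fun (dFun_congr h4) u).trans h5
  have h6 : connCurv h (fun i ↦ pullSec hπ k (e i)) (pullVF k Y) (pullVF k Z) x =
      connCurv h e Y Z (k • x) := by
    rw [connCurv, connCurv, h3 hY, h3 hZ, pullVF_eq_iff hol, pullVF_eq_iff hol,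
      connForm_pullSec hπ h hinv hn k he, ← pullVF_bracketVF hol k hY.self_of_nhds hZ.self_of_nhds,
      pullVF_eq_iff hol]
  have h7 : ∀ {Y : X → E} {u : E}, Y (k • x) = dAct k x u → pullVF k Y x = u := fun hY ↦ by
    rw [pullVF, hY, dAct_inv_dAct hol]
  rw [h6, ← h1, h7 hY0, h7 hZ0, hY0, hZ0] at h2
  have e1 : w = ![w 0, w 1] := by ext i; fin_cases i <;> rfl
  rw [e1, h2]
  refine congrArg (η (k • x)) (funext fun i ↦ ?_)
  fin_cases i <;> rfl

end AntiCanonicalCurvature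

/-! ### The moment map on the relative anticanonical bundle -/

section TraceMoment

variable {E F X B : Type*} [NormedAddCommGroup E] [NormedSpace ℂ E] [FiniteDimensional ℂ E]
  [NormedAddCommGroup F] [NormedSpace ℂ F]
  [TopologicalSpace X] [ChartedSpace E X] [TopologicalSpace B] [ChartedSpace F B]
  {π : X → B} {omega : X → E [⋀^Fin 2]→L[ℝ] ℝ}
  [IsManifold 𝓘(ℂ, E) ω X]
  {n : ℕ} {e : Fin n → ∀ y, vert E F π y} {f : X → ℂ}
  {s : ∀ y, ⋀[ℂ]^n (vert E F π y)} {x : X}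

omit [IsManifold 𝓘(ℂ, E) ω X] in
theorem trace_eq_sum_frameCoord (h : IsRelativelyKahler (F := F) π omega)
    (hr : Module.finrank ℂ (vert E F π x) = n) (he : LinearIndependent ℂ (fun i ↦ e i x))
    (T : vert E F π x →ₗ[ℂ] vert E F π x) :
    LinearMap.trace ℂ (vert E F π x) T = ∑ i, frameCoord h e x i (T (e i x)) := by
  rw [LinearMap.trace_eq_matrix_trace ℂ (vertBasis hr he), Matrix.trace]
  refine Finset.sum_congr rfl fun i _ ↦ ?_
  rw [Matrix.diag_apply, LinearMap.toMatrix_apply, vertBasis_apply, frameCoord_eq_repr h hr he]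

/-- Contraction of covariant derivatives in a frame. -/
theorem sum_frameCoord_vertD (h : IsRelativelyKahler (F := F) π omega)
    (hr : ∀ x, Module.finrank ℂ (vert E F π x) = n) (he : IsVertFrame e x)
    {t : Fin n → ∀ y, vert E F π y} (ht : ∀ j, SecSmoothAt (t j) x) (u : E) :
    ∑ j, frameCoord h e x j (vertD h (t j) x u) =
      dFun (fun z ↦ ∑ j, frameCoord h e z j (t j z)) x u +
        (connMatrix h e x u * Matrix.of fun i j ↦ frameCoord h e x i (t j x)).trace := by
  rw [dFun_sum _ fun j _ ↦ contMDiffAt_frameCoord h he (ht j) j]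
  simp only [frameCoord_vertD h hr he (ht _) u, Finset.sum_add_distrib]
  rfl

variable {K : Type*} [Group K] [MulAction K X] [MulAction K B]

theorem pullSec_one (hπ : IsEquivariantSubmersion E F K π) (t : ∀ y, vert E F π y) (x : X) :
    pullSec hπ 1 t x = t x := by
  refine Subtype.ext ?_
  have h1 : dAct (E := E) (1 : K) x = ContinuousLinearMap.id ℝ E := by
    have h0 : (fun z : X ↦ (1 : K) • z) = id := funext (one_smul K)
    rw [dAct, h0]
    exact mfderiv_id
  rw [coe_pullSec, pullVF, inv_one, one_smul, h1]
  rfl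

variable {EK : Type*} [NormedAddCommGroup EK] [NormedSpace ℝ EK]
  [TopologicalSpace K] [ChartedSpace EK K] [LieGroup 𝓘(ℝ, EK) ∞ K]
  [ContMDiffSMul 𝓘(ℝ, EK) 𝓘(ℝ, E) ∞ K X] {μ : X → LieAlg EK K →ₗ[ℝ] ℝ}

/-- The trace of the moment endomorphism. -/
def traceMoment (F : Type*) [NormedAddCommGroup F] [NormedSpace ℂ F] [ChartedSpace F B] (π : X → B)
    (omega : X → E [⋀^Fin 2]→L[ℝ] ℝ) (μ : X → LieAlg EK K →ₗ[ℝ] ℝ)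
    (v : LieAlg EK K) (x : X) : ℂ :=
  LinearMap.trace ℂ (vert E F π x) (vertMoment omega μ v x)

theorem traceMoment_eq (v : LieAlg EK K) (x : X) : traceMoment F π omega μ v x =
    Complex.I * vertLaplacian F π omega (fun y ↦ μ y v) x :=
  map_smul (LinearMap.trace ℂ (vert E F π x)) _ _

variable [FiniteDimensional ℂ F] [IsManifold 𝓘(ℂ, F) ω B]

theorem eventually_traceMoment (hs : Manifold.IsSubmersion 𝓘(ℂ, E) 𝓘(ℂ, F) ω π)
    (h : IsRelativelyKahler (F := F) π omega)
    (hn : Module.finrank ℂ E = Module.finrank ℂ F + n) (he : IsVertFrame e x) (v : LieAlg EK K) :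
    ∀ᶠ z in 𝓝 x, traceMoment F π omega μ v z =
      ∑ j, frameCoord h e z j (vertMoment omega μ v z (e j z)) :=
  he.linearIndependent.mono fun z hz ↦ trace_eq_sum_frameCoord h (finrank_vert hs hn z) hz _

theorem contMDiff_traceMoment (hπ : IsEquivariantSubmersion E F K π)
    (h : IsRelativelyKahler (F := F) π omega) (hμ : IsMomentMap omega μ)
    (hn : Module.finrank ℂ E = Module.finrank ℂ F + n) (v : LieAlg EK K) :
    ContMDiff 𝓘(ℝ, E) 𝓘(ℝ, ℂ) ∞ (traceMoment F π omega μ v) := by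
  intro x
  obtain ⟨e, he⟩ := exists_isVertFrame (n := n) hπ.submersion hn x
  have h1 : ∀ j, ContMDiffAt 𝓘(ℝ, E) 𝓘(ℝ, ℂ) ∞
      (fun z ↦ frameCoord h e z j (vertMoment omega μ v z (e j z))) x := fun j ↦
    contMDiffAt_frameCoord h he (SecSmoothAt.vertMoment hπ h hμ hn v
      (he.smooth.mono fun y hy ↦ hy j)) j
  have hx := mem_extChartAt_source (I := 𝓘(ℝ, E)) x
  refine ContMDiffAt.congr_of_eventuallyEq ?_ (eventually_traceMoment hπ.submersion h hn he v)
  simp only [contMDiffAt_chart_iff hx] at h1 ⊢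
  exact (ContDiffAt.sum (s := Finset.univ) fun j _ ↦ h1 j).congr_of_eventuallyEq
    (Filter.Eventually.of_forall fun y ↦ rfl)

theorem traceMoment_linear (hπ : IsEquivariantSubmersion E F K π)
    (h : IsRelativelyKahler (F := F) π omega) (hμ : IsMomentMap omega μ)
    (hn : Module.finrank ℂ E = Module.finrank ℂ F + n) (x : X) :
    IsLinearMap ℝ (fun v ↦ traceMoment F π omega μ v x) := by
  have h1 := vertMoment_linear hπ h hμ hn x
  constructor
  · intro v w
    exact (congrArg (LinearMap.trace ℂ (vert E F π x)) (h1.map_add v w)).trans (map_add _ _ _)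
  · intro r v
    exact (congrArg (LinearMap.trace ℂ (vert E F π x)) (h1.map_smul r v)).trans
      (map_smul (LinearMap.trace ℂ (vert E F π x)) (r : ℂ) _)

/-- The two endomorphisms are conjugate by the pullback isomorphism, and the trace is invariant
under conjugation. -/
theorem traceMoment_equivariant (hπ : IsEquivariantSubmersion E F K π)
    (h : IsRelativelyKahler (F := F) π omega) (hinv : IsInvariantForm K omega)
    (hμ : IsMomentMap omega μ) (hn : Module.finrank ℂ E = Module.finrank ℂ F + n) (k : K)
    (v : LieAlg EK K) (x : X) :
    traceMoment F π omega μ (Ad k v) (k • x) = traceMoment F π omega μ v x := by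
  let P := LinearEquiv.ofBijective (vertPull hπ k x) (vertPull_bijective hπ hn k x)
  have h1 : vertMoment omega μ v x = P.conj (vertMoment omega μ (Ad k v) (k • x)) := by
    ext1 w
    obtain ⟨w, rfl⟩ := P.surjective w
    rw [LinearEquiv.conj_apply_apply, P.symm_apply_apply]
    exact (vertMoment_equivariant hπ h hinv hμ hn k v x w).symm
  rw [traceMoment, traceMoment, h1, LinearMap.trace_conj']

/-- The trace of the curvature contracted with a fundamental vector field. -/
theorem connCurv_fundVF (hπ : IsEquivariantSubmersion E F K π)
    (h : IsRelativelyKahler (F := F) π omega) (hμ : IsMomentMap omega μ)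
    (hn : Module.finrank ℂ E = Module.finrank ℂ F + n) (he : IsVertFrame e x) (v : LieAlg EK K)
    {Y : X → E} (hY : ∀ᶠ y in 𝓝 x, VFSmoothAt Y y) :
    connCurv h e (fundVF v) Y x = -dFun (traceMoment F π omega μ v) x (Y x) := by
  have := FiniteDimensional.complete ℂ E
  have hr := finrank_vert (n := n) hπ.submersion hn
  have hj : ∀ j, ∀ᶠ y in 𝓝 x, SecSmoothAt (e j) y := fun j ↦ he.smooth.mono fun y hy ↦ hy j
  have hV : ∀ᶠ y in 𝓝 x, VFSmoothAt (fundVF (E := E) v) y :=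
    Filter.Eventually.of_forall fun y ↦ vfSmoothAt_fundVF v y
  -- Tracing a second covariant derivative yields the derivative of tr θ(Z) plus the quadratic term
  -- tr(θ(u) θ(Z)).
  have key : ∀ {Z : X → E}, (∀ᶠ y in 𝓝 x, VFSmoothAt Z y) → ∀ u : E,
      ∑ j, frameCoord h e x j (vertD h (fun y ↦ vertD h (e j) y (Z y)) x u) =
        dFun (fun z ↦ connForm h e z (Z z)) x u +
          (connMatrix h e x u * connMatrix h e x (Z x)).trace := by
    intro Z hZ u
    have h1 := sum_frameCoord_vertD h hr he (t := fun j y ↦ vertD h (e j) y (Z y))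
      (fun j ↦ vertD_smooth h hπ.submersion hn (hj j) hZ) u
    have h2 : (fun z ↦ connForm h e z (Z z)) =
        fun z ↦ ∑ j, frameCoord h e z j (vertD h (e j) z (Z z)) := funext fun z ↦ by
      simp [connForm]
    rw [h2]
    exact h1
  have h1 : ∑ j, frameCoord h e x j (vertD h (fun y ↦ vertD h (e j) y (Y y)) x (fundVF v x) -
      vertD h (fun y ↦ vertD h (e j) y (fundVF v y)) x (Y x) -
      vertD h (e j) x (bracketVF (fundVF v) Y x)) =
      ∑ j, frameCoord h e x j (-(vertD h (fun y ↦ vertMoment omega μ v y (e j y)) x (Y x) -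
      vertMoment omega μ v x (vertD h (e j) x (Y x)))) :=
    Finset.sum_congr rfl fun j _ ↦ by rw [vertD_curvature_moment hπ h hμ hn v (hj j) hY]
  simp only [map_sub, map_neg, Finset.sum_sub_distrib, Finset.sum_neg_distrib] at h1
  have h3 := sum_frameCoord_vertD h hr he (t := fun j y ↦ vertMoment omega μ v y (e j y))
      (fun j ↦ SecSmoothAt.vertMoment hπ h hμ hn v (hj j)) (Y x)
  have h4 : dFun (fun z ↦ ∑ j, frameCoord h e z j (vertMoment omega μ v z (e j z))) x (Y x) =
      dFun (traceMoment F π omega μ v) x (Y x) :=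
    (DFunLike.congr_fun (dFun_congr (eventually_traceMoment hπ.submersion h hn he v)) (Y x)).symm
  have h5 : ∑ j, frameCoord h e x j (vertMoment omega μ v x (vertD h (e j) x (Y x))) =
      ((Matrix.of fun i j ↦ frameCoord h e x i (vertMoment omega μ v x (e j x))) *
        connMatrix h e x (Y x)).trace := by
    refine Finset.sum_congr rfl fun j _ ↦ ?_
    rw [vertD_frame h (hr x) he.linearIndependent.self_of_nhds, map_sum, map_sum, Matrix.diag_apply,
      Matrix.mul_apply]
    refine Finset.sum_congr rfl fun i _ ↦ ?_
    rw [map_smul, map_smul, smul_eq_mul, mul_comm]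
    rfl
  have h6 : ∑ j, frameCoord h e x j (vertD h (e j) x (bracketVF (fundVF v) Y x)) =
      connForm h e x (bracketVF (fundVF v) Y x) := by simp [connForm]
  -- By cyclicity of the trace the quadratic terms in θ cancel, and so do tr(θ σ) and tr(σ θ).
  rw [key hY, key hV, h3, h4, h5, h6, Matrix.trace_mul_comm (connMatrix h e x (fundVF v x)),
    Matrix.trace_mul_comm (connMatrix h e x (Y x)) (Matrix.of _)] at h1
  rw [connCurv]
  linear_combination h1

theorem isBundleMomentMap_traceMoment (hπ : IsEquivariantSubmersion E F K π)
    (h : IsRelativelyKahler (F := F) π omega) (hinv : IsInvariantForm K omega)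
    (hμ : IsMomentMap omega μ) (hn : Module.finrank ℂ E = Module.finrank ℂ F + n) :
    IsBundleMomentMap (antiCanonical hπ n) (antiCanonicalConnection hπ n omega)
      (fun v x ↦ traceMoment F π omega μ v x • LinearMap.id) where
  linear x := by
    have h1 := traceMoment_linear hπ h hμ hn x
    constructor
    · intro v w
      rw [h1.map_add, add_smul]
    · intro r v
      rw [h1.map_smul]
      exact smul_assoc r (traceMoment F π omega μ v x) _
  smooth v U s hU hs := by
    refine (antiCanonical_isSmooth_iff hπ).2 fun x hx ↦ ?_
    obtain ⟨e, f, hs⟩ := (antiCanonical_isSmooth_iff hπ).1 hs x hx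
    refine ⟨e, fun y ↦ traceMoment F π omega μ v y * f y, hs.frame, hs.smooth.mono fun y hy ↦
      contMDiffAt_mul (contMDiff_traceMoment hπ h hμ hn v y) hy, hs.eq.mono fun y hy ↦ ?_⟩
    exact (congrArg (traceMoment F π omega μ v y • ·) hy).trans (smul_smul _ _ _)
  equivariant k v x w := by
    rw [traceMoment_equivariant hπ h hinv hμ hn]
    exact map_smul ((antiCanonical hπ n).pull k x) _ w
  moment v U Y s hU hY hs x hx := by
    obtain ⟨e, f, hs⟩ := (antiCanonical_isSmooth_iff hπ).1 hs x hx
    have hY' := (hU.eventually_mem hx).mono ((isSmoothVF_iff hU).1 hY)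
    have hV : ∀ᶠ y in 𝓝 x, VFSmoothAt (fundVF (E := E) v) y :=
      Filter.Eventually.of_forall fun y ↦ vfSmoothAt_fundVF v y
    have hT := contMDiff_traceMoment hπ h hμ hn v
    have h1 : IsWedgeRep e (fun y ↦ traceMoment F π omega μ v y * f y)
        (fun y ↦ traceMoment F π omega μ v y • s y) x :=
      ⟨hs.frame, hs.smooth.mono fun y hy ↦ contMDiffAt_mul (hT y) hy, hs.eq.mono fun y hy ↦
        (congrArg (traceMoment F π omega μ v y • ·) hy).trans (smul_smul _ _ _)⟩
    have h2 := antiCanonicalConnection_apply hπ h hn h1 (Y x)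
    have h3 := antiCanonicalConnection_apply hπ h hn hs (Y x)
    rw [dFun_mul (hT x) hs.smooth.self_of_nhds] at h2
    have h4 := hs.eq.self_of_nhds
    have alg : ∀ (c d g t p : ℂ) (w : ⋀[ℂ]^n (vert E F π x)),
        -c • g • w = -((c * g + t * d + t * g * p) • w - t • (d + g * p) • w) := by
      intro c d g t p w
      module
    refine (curvature_antiCanonicalConnection hπ h hn hs hV hY').trans ?_
    rw [connCurv_fundVF hπ h hμ hn hs.frame v hY']
    refine Eq.trans ?_ (congrArg Neg.neg (congrArg₂ (· - ·) h2
      (congrArg (traceMoment F π omega μ v x • ·) h3))).symm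
    refine Eq.trans ?_ (alg _ _ _ _ _ _)
    exact congrArg (_ • ·) h4

/-- The infinitesimal action on `e₁ ∧ ⋯ ∧ eₙ`. -/
theorem exists_hasMFDerivAt_det_pullSec (hπ : IsEquivariantSubmersion E F K π)
    (h : IsRelativelyKahler (F := F) π omega)
    (hμ : IsMomentMap omega μ) (hn : Module.finrank ℂ E = Module.finrank ℂ F + n)
    (he : IsVertFrame e x) :
    ∃ D : EK →L[ℝ] ℂ, HasMFDerivAt 𝓘(ℝ, EK) 𝓘(ℝ, ℂ)
      (fun k : K ↦ (frameChange h e (fun i ↦ pullSec hπ k (e i)) x).det) 1 D ∧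
      ∀ v : LieAlg EK K, D v = connForm h e x (fundVF v x) - traceMoment F π omega μ v x := by
  have hr := finrank_vert (n := n) hπ.submersion hn
  have hli := he.linearIndependent.self_of_nhds
  have hej := he.smooth.self_of_nhds
  choose L hL hLv using fun j ↦ exists_hasFDerivAt_pullSec (EK := EK) hπ (hej j)
  let q : Fin n → vert E F π x →L[ℝ] ℂ := fun i ↦
    (frameCoord h e x i).toContinuousLinearMap.restrictScalars ℝ
  have hM : ∀ i j, HasMFDerivAt 𝓘(ℝ, EK) 𝓘(ℝ, ℂ)
      (fun k : K ↦ frameChange h e (fun i ↦ pullSec hπ k (e i)) x i j) 1 ((q i).comp (L j)) := by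
    intro i j
    have h1 : HasMFDerivAt 𝓘(ℝ, vert E F π x) 𝓘(ℝ, ℂ) (q i) (pullSec hπ (1 : K) (e j) x) (q i) :=
      (q i).hasMFDerivAt
    exact HasMFDerivAt.comp (g := q i) (1 : K) h1 (hL j)
  have hM1 : frameChange h e (fun i ↦ pullSec hπ (1 : K) (e i)) x = 1 := by
    ext i j
    have h1 := frameCoord_sum h (hr x) hli (Pi.single j 1) i
    simp only [Pi.single_apply, ite_smul, one_smul, zero_smul, Finset.sum_ite_eq',
      Finset.mem_univ, if_true] at h1
    rw [frameChange, Matrix.of_apply, pullSec_one, h1, Matrix.one_apply]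
  obtain ⟨D, hD, hDv⟩ := exists_hasMFDerivAt_det hM
  refine ⟨D, hD, fun v ↦ (hDv v).trans ?_⟩
  -- At k = 1 the transition matrix is the identity, so Jacobi's formula gives the trace of L_v,
  -- which is tr θ(v) - tr σ_v.
  rw [hM1, Matrix.adjugate_one, one_mul, traceMoment, trace_eq_sum_frameCoord h (hr x) hli,
    connForm_apply, Matrix.trace, Matrix.trace, ← Finset.sum_sub_distrib]
  refine Finset.sum_congr rfl fun i _ ↦ ?_
  rw [vertMoment_apply hπ h hμ v (hej i), map_sub, ← (hLv i v).1]
  exact (sub_sub_cancel _ _).symm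

/-- The pullback of f e₁ ∧ ⋯ ∧ eₙ by k has coefficient f(k x) det P(k), with P(k) the matrix of the
pulled back frame; the product rule at k = 1 gives L_v. -/
theorem exists_hasMFDerivAt_pull (hπ : IsEquivariantSubmersion E F K π)
    (h : IsRelativelyKahler (F := F) π omega)
    (hμ : IsMomentMap omega μ) (hn : Module.finrank ℂ E = Module.finrank ℂ F + n)
    (hs : IsWedgeRep e f s x) (ℓ : ⋀[ℂ]^n (vert E F π x) →ₗ[ℂ] ℂ) :
    ∃ L : EK →L[ℝ] ℂ, HasMFDerivAt 𝓘(ℝ, EK) 𝓘(ℝ, ℂ)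
      (fun k : K ↦ ℓ ((antiCanonical hπ n).pull k x (s (k • x)))) 1 L ∧
      ∀ v : LieAlg EK K, L v = (f x * (connForm h e x (fundVF v x) - traceMoment F π omega μ v x) +
        dFun (E := E) f x (fundVF v x)) * ℓ (wedge e x) := by
  have hr := finrank_vert (n := n) hπ.submersion hn
  have hli := hs.frame.linearIndependent.self_of_nhds
  obtain ⟨D, hD, hDv⟩ := exists_hasMFDerivAt_det_pullSec hπ h hμ hn hs.frame
  let T : E →L[ℝ] ℂ := dFun f x
  let A : EK →L[ℝ] E := mfderiv 𝓘(ℝ, EK) 𝓘(ℝ, E) (fun k : K ↦ k • x) 1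
  have horb : HasMFDerivAt 𝓘(ℝ, EK) 𝓘(ℝ, E) (fun k : K ↦ k • x) 1 A :=
    (mdifferentiableAt_orbit (E := E) (EK := EK) x (1 : K)).hasMFDerivAt
  have hf : ∀ y, y = x → HasMFDerivAt 𝓘(ℝ, E) 𝓘(ℝ, ℂ) f y T := by
    rintro y rfl
    exact (hs.smooth.self_of_nhds.mdifferentiableAt (by simp)).hasMFDerivAt
  have hfo : HasMFDerivAt 𝓘(ℝ, EK) 𝓘(ℝ, ℂ) (fun k : K ↦ f (k • x)) 1 (T.comp A) :=
    (hf _ (one_smul K x)).comp (1 : K) horb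
  let C : ℂ →L[ℝ] ℂ := (ContinuousLinearMap.mul ℝ ℂ).flip (ℓ (wedge e x))
  have hG := hfo.mul hD
  have hC : ∀ c, HasMFDerivAt 𝓘(ℝ, ℂ) 𝓘(ℝ, ℂ) C c C := fun c ↦ C.hasMFDerivAt
  have hc := (hC _).comp (1 : K) hG
  have ht : Filter.Tendsto (fun k : K ↦ k • x) (𝓝 1) (𝓝 x) := by
    have h1 := horb.continuousAt.tendsto
    rwa [one_smul] at h1
  refine ⟨_, hc.congr_of_eventuallyEq ?_, fun v ↦ ?_⟩
  · filter_upwards [ht.eventually hs.eq] with k hk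
    have h1 : (antiCanonical hπ n).pull k x (s (k • x)) =
        (f (k • x) * (frameChange h e (fun i ↦ pullSec hπ k (e i)) x).det) • wedge e x := by
      refine (congrArg ((antiCanonical hπ n).pull k x) hk).trans ((map_smul _ _ _).trans ?_)
      rw [mul_smul]
      exact congrArg (f (k • x) • ·) ((pull_wedge hπ k).trans
        (wedge_frameChange (e' := fun i ↦ pullSec hπ k (e i)) h (hr x) hli))
    exact (congrArg ℓ h1).trans (map_smul ℓ _ _)
  · have h1 : (frameChange h e (fun i ↦ pullSec hπ (1 : K) (e i)) x).det = 1 := by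
      have h2 := wedge_frameChange (e' := fun i ↦ pullSec hπ (1 : K) (e i)) h (hr x) hli
      have h3 : wedge (fun i ↦ pullSec hπ (1 : K) (e i)) x = (1 : ℂ) • wedge e x := by
        rw [wedge, one_smul, wedge]
        simp only [pullSec_one]
      exact smul_left_injective ℂ (wedge_ne_zero (hr x) hli) (h2.symm.trans h3)
    change (f ((1 : K) • x) * D v +
      (frameChange h e (fun i ↦ pullSec hπ (1 : K) (e i)) x).det * T (A v)) * ℓ (wedge e x) = _
    rw [h1, one_smul, one_mul, ← hDv v]
    rfl

/-- The covariant derivative contributes df(v) + f tr θ(v) and the Lie derivative df(v) + f (tr θ(v)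
- tr σ_v); the difference is f tr σ_v. -/
theorem isLiftedMoment_traceMoment (hπ : IsEquivariantSubmersion E F K π)
    (h : IsRelativelyKahler (F := F) π omega)
    (hμ : IsMomentMap omega μ) (hn : Module.finrank ℂ E = Module.finrank ℂ F + n) :
    IsLiftedMoment (antiCanonical hπ n) (antiCanonicalConnection hπ n omega)
      (traceMoment F π omega μ) := by
  intro v U s hU hs x hx ℓ
  obtain ⟨e, f, hs⟩ := (antiCanonical_isSmooth_iff hπ).1 hs x hx
  obtain ⟨L, hL, hLv⟩ := exists_hasMFDerivAt_pull hπ h hμ hn hs ℓ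
  have h0 : (show EK →L[ℝ] ℂ from mfderiv 𝓘(ℝ, EK) 𝓘(ℝ, ℂ)
      (fun k : K ↦ ℓ ((antiCanonical hπ n).pull k x (s (k • x)))) 1) v = L v :=
    DFunLike.congr_fun hL.mfderiv v
  have h1 := antiCanonicalConnection_apply hπ h hn hs (fundVF v x)
  have h2 := hs.eq.self_of_nhds
  have e1 : ℓ (traceMoment F π omega μ v x • s x) =
      traceMoment F π omega μ v x * (f x * ℓ (wedge e x)) :=
    (congrArg (fun p ↦ ℓ (traceMoment F π omega μ v x • p)) h2).trans
      ((map_smul ℓ _ _).trans (congrArg (_ * ·) (map_smul ℓ _ _)))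
  have e2 := (congrArg ℓ h1).trans (map_smul ℓ _ _)
  have alg : ∀ c a d p w : ℂ, c * (a * w) = (d + a * p) * w - (a * (p - c) + d) * w := by
    intro c a d p w
    ring
  exact e1.trans ((alg _ _ _ _ _).trans (congrArg₂ (· - ·) e2 (h0.trans (hLv v))).symm)

end TraceMoment

/-! ### Equivariant forms of the shape `η + f` -/

section TwoFormPlus

variable {E X : Type*} [NormedAddCommGroup E] [NormedSpace ℂ E]
  [TopologicalSpace X] [ChartedSpace E X]

theorem formInChart_zero {k : ℕ} (x : X) :
    formInChart (0 : X → E [⋀^Fin k]→L[ℝ] ℂ) x = 0 := rfl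

theorem isSmoothForm_zero {k : ℕ} : IsSmoothForm (0 : X → E [⋀^Fin k]→L[ℝ] ℂ) := fun x ↦ by
  rw [formInChart_zero]
  exact contDiffOn_const

theorem dForm_zero {k : ℕ} : dForm (0 : X → E [⋀^Fin k]→L[ℝ] ℂ) = 0 := by
  funext x
  have h : extDeriv (0 : E → E [⋀^Fin k]→L[ℝ] ℂ) (extChartAt 𝓘(ℝ, E) x x) = 0 := by
    have h1 := extDeriv_smul (x := extChartAt 𝓘(ℝ, E) x x) (0 : ℝ) (0 : E → E [⋀^Fin k]→L[ℝ] ℂ)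
    rwa [zero_smul, zero_smul] at h1
  rw [dForm, formInChart_zero, h]
  rfl

variable [IsManifold 𝓘(ℂ, E) ω X]

theorem isSmoothForm_constOfIsEmpty {f : X → ℂ} (hf : ContMDiff 𝓘(ℝ, E) 𝓘(ℝ, ℂ) ∞ f) :
    IsSmoothForm fun x ↦ ContinuousAlternatingMap.constOfIsEmpty ℝ E (Fin 0) (f x) := by
  intro x₀ y hy
  have h1 := hf ((extChartAt 𝓘(ℝ, E) x₀).symm y)
  rw [contMDiffAt_chart_iff ((extChartAt 𝓘(ℝ, E) x₀).map_target hy),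
    (extChartAt 𝓘(ℝ, E) x₀).right_inv hy] at h1
  exact ((ContinuousAlternatingMap.constOfIsEmptyLIE ℝ E ℂ
    (Fin 0)).toContinuousLinearEquiv.contDiff.contDiffAt.comp y h1).contDiffWithinAt

theorem dForm_constOfIsEmpty {f : X → ℂ} (hf : ContMDiff 𝓘(ℝ, E) 𝓘(ℝ, ℂ) ∞ f) (x : X)
    (w : Fin 1 → E) :
    dForm (fun x ↦ ContinuousAlternatingMap.constOfIsEmpty ℝ E (Fin 0) (f x)) x w =
      dFun f x (w 0) := by
  rw [dForm_eq_extDeriv, dFun_self (hf x)]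
  exact DFunLike.congr_fun (extDeriv_constOfIsEmpty (𝕜 := ℝ)
    (f ∘ (extChartAt 𝓘(ℝ, E) x).symm) (extChartAt 𝓘(ℝ, E) x x)) w

variable {EK K : Type*} [NormedAddCommGroup EK] [NormedSpace ℝ EK]
  [TopologicalSpace K] [ChartedSpace EK K] [Group K] [MulAction K X]
  {η : X → E [⋀^Fin 2]→L[ℝ] ℂ} {f : LieAlg EK K → X → ℂ}

omit [IsManifold 𝓘(ℂ, E) ω X] in
theorem isEquivariantForm_zero :
    IsEquivariantForm (fun _ : LieAlg EK K ↦ (0 : MixedForm E X)) where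
  smooth _ _ := isSmoothForm_zero
  polynomial := ⟨0, fun _ ↦ 0, fun _ ↦ by simp⟩
  equivariant _ _ _ _ := rfl

/-- The map is polynomial of degree at most one in the Lie algebra variable: η is its constant part
and `f` its linear part. -/
theorem isEquivariantForm_twoFormPlus (hη : IsSmoothForm η)
    (hηK : ∀ (k : K) (x : X), (η (k • x)).compContinuousLinearMap (dAct k x) = η x)
    (hf : ∀ v, ContMDiff 𝓘(ℝ, E) 𝓘(ℝ, ℂ) ∞ (f v)) (hlin : ∀ x, IsLinearMap ℝ (fun v ↦ f v x))
    (hfK : ∀ (k : K) (v : LieAlg EK K) (x : X), f (Ad k v) (k • x) = f v x) :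
    IsEquivariantForm (twoFormPlus η f) where
  smooth v
    | 0 => isSmoothForm_constOfIsEmpty (hf v)
    | 1 => isSmoothForm_zero
    | 2 => hη
    | _ + 3 => isSmoothForm_zero
  polynomial := by
    let A : LieAlg EK K →ₗ[ℝ] MixedForm E X :=
      { toFun := twoFormPlus 0 f
        map_add' := fun v w ↦ by
          funext j x
          match j with
          | 0 =>
            ext u
            exact (hlin x).map_add v w
          | 1 => exact (add_zero _).symm
          | 2 => exact (add_zero _).symm
          | _ + 3 => exact (add_zero _).symm
        map_smul' := fun r v ↦ by
          funext j x
          match j with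
          | 0 =>
            ext u
            exact (hlin x).map_smul r v
          | 1 => exact (smul_zero (A := E [⋀^Fin (1)]→L[ℝ] ℂ) r).symm
          | 2 => exact (smul_zero (A := E [⋀^Fin (2)]→L[ℝ] ℂ) r).symm
          | j + 3 => exact (smul_zero (A := E [⋀^Fin (j + 3)]→L[ℝ] ℂ) r).symm }
    let m : ∀ j : ℕ, MultilinearMap ℝ (fun _ : Fin j ↦ LieAlg EK K) (MixedForm E X)
      | 0 => MultilinearMap.constOfIsEmpty ℝ _ (twoFormPlus η (0 : LieAlg EK K → X → ℂ) 0)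
      | 1 => MultilinearMap.ofSubsingleton ℝ _ _ 0 A
      | _ => 0
    -- The bound is 2 because the range counts the homogeneous degrees 0 and 1.
    refine ⟨2, m, fun v ↦ ?_⟩
    rw [Finset.sum_range_succ, Finset.sum_range_one]
    change _ = twoFormPlus η (0 : LieAlg EK K → X → ℂ) 0 + twoFormPlus 0 f v
    funext j x
    match j with
    | 0 => exact (zero_add _).symm
    | 1 => exact (add_zero _).symm
    | 2 => exact (add_zero _).symm
    | _ + 3 => exact (add_zero _).symm
  equivariant k v
    | 0, x => by
      ext u
      exact hfK k v x
    | 1, x => rfl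
    | 2, x => hηK k x
    | _ + 3, x => rfl

/-- Only two components are not trivially zero: df + ι_v η in degree one and dη in degree three. -/
theorem dEq_twoFormPlus (hη : dForm η = 0) {v : LieAlg EK K}
    (hf : ContMDiff 𝓘(ℝ, E) 𝓘(ℝ, ℂ) ∞ (f v))
    (hηf : ∀ (x : X) (u : E), η x ![fundVF v x, u] = -dFun (f v) x u) :
    dEq (twoFormPlus η f) v = 0 := by
  funext j x
  match j with
  | 0 => rfl
  | 1 =>
    ext w
    have h1 := dForm_constOfIsEmpty hf x w
    have h2 := hηf x (w 0)
    have h3 : (η x).curryLeft (fundVF v x) w = η x ![fundVF v x, w 0] := by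
      refine congrArg (η x) (funext fun i ↦ ?_)
      fin_cases i <;> rfl
    exact (congrArg₂ (· + ·) h1 (h3.trans h2)).trans (add_neg_cancel _)
  | 2 => exact (congrArg₂ (· + ·) (congrFun dForm_zero x) rfl).trans (add_zero _)
  | 3 => exact (congrArg₂ (· + ·) (congrFun hη x) rfl).trans (add_zero _)
  | _ + 4 => exact (congrArg₂ (· + ·) (congrFun dForm_zero x) rfl).trans (add_zero _)

end TwoFormPlus

/-! ### The equivariant first Chern class of the relative anticanonical bundle -/

section FirstChern

variable {E F X B : Type*} [NormedAddCommGroup E] [NormedSpace ℂ E] [FiniteDimensional ℂ E]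
  [NormedAddCommGroup F] [NormedSpace ℂ F] [FiniteDimensional ℂ F]
  [TopologicalSpace X] [ChartedSpace E X] [TopologicalSpace B] [ChartedSpace F B]
  {π : X → B} {omega : X → E [⋀^Fin 2]→L[ℝ] ℝ}
  [IsManifold 𝓘(ℂ, E) ω X] [IsManifold 𝓘(ℂ, F) ω B] {n : ℕ}
  {EK K : Type*} [NormedAddCommGroup EK] [NormedSpace ℝ EK]
  [TopologicalSpace K] [ChartedSpace EK K] [Group K] [LieGroup 𝓘(ℝ, EK) ∞ K]
  [MulAction K X] [ContMDiffSMul 𝓘(ℝ, EK) 𝓘(ℝ, E) ∞ K X] [MulAction K B]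
  {μ : X → LieAlg EK K →ₗ[ℝ] ℝ}

/-- The curvature contracted with a fundamental vector field. -/
theorem IsCurvatureForm.apply_fundVF (hπ : IsEquivariantSubmersion E F K π)
    (h : IsRelativelyKahler (F := F) π omega) (hμ : IsMomentMap omega μ)
    (hn : Module.finrank ℂ E = Module.finrank ℂ F + n) {η : X → E [⋀^Fin 2]→L[ℝ] ℂ}
    (hη : IsCurvatureForm (antiCanonical hπ n) (antiCanonicalConnection hπ n omega) η)
    (v : LieAlg EK K) (x : X) (u : E) :
    η x ![fundVF v x, u] = -dFun (traceMoment F π omega μ v) x u := by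
  have := FiniteDimensional.complete ℂ E
  obtain ⟨Y, rfl, hY⟩ := exists_vfSmoothAt x u
  obtain ⟨e, he⟩ := exists_isVertFrame (n := n) hπ.submersion hn x
  rw [hη.apply_eq hπ h hn he (Filter.Eventually.of_forall fun y ↦ vfSmoothAt_fundVF v y) hY,
    connCurv_fundVF hπ h hμ hn he v hY]

theorem isChernConnection_antiCanonicalConnection (hπ : IsEquivariantSubmersion E F K π)
    (h : IsRelativelyKahler (F := F) π omega)
    (hn : Module.finrank ℂ E = Module.finrank ℂ F + n) :
    IsChernConnection (antiCanonical hπ n) (detMetric F n π omega)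
      (antiCanonicalConnection hπ n omega) :=
  isChernConnection_chernConnection (isChernConnection_wedgeD hπ h hn)

/-- Since tr σ_v is i times the Laplacian, multiplying it by i/2π gives -1/2π times the Laplacian.
The form is thus the Chern–Weil form of the Chern connection itself, and the exact correction can be
taken to be zero. -/
theorem representsC1Eq_relativeRicciForm (hπ : IsEquivariantSubmersion E F K π)
    (h : IsRelativelyKahler (F := F) π omega) (hinv : IsInvariantForm K omega)
    (hμ : IsMomentMap omega μ) (hn : Module.finrank ℂ E = Module.finrank ℂ F + n) :
    RepresentsC1Eq (antiCanonical hπ n) (twoFormPlus (relativeRicciForm hπ n omega)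
      (fun (v : LieAlg EK K) x ↦
        -(1 / (2 * Real.pi)) * vertLaplacian F π omega (fun y ↦ μ y v) x)) := by
  have e1 : (fun (v : LieAlg EK K) x ↦
      -(1 / (2 * Real.pi)) * vertLaplacian F π omega (fun y ↦ μ y v) x) =
      fun v x ↦ Complex.I / (2 * Real.pi) * traceMoment F π omega μ v x := by
    funext v x
    rw [traceMoment_eq]
    linear_combination -(vertLaplacian F π omega (fun y ↦ μ y v) x / (2 * Real.pi)) * Complex.I_mul_I
  have hη := isCurvatureForm_curvatureForm hπ h hn
  have hT := contMDiff_traceMoment hπ h hμ hn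
  have hs := hη.smooth_and_closed hπ h hn (Complex.I / (2 * Real.pi))
  have hsm : ∀ v : LieAlg EK K, ContMDiff 𝓘(ℝ, E) 𝓘(ℝ, ℂ) ∞
      (fun x ↦ Complex.I / (2 * Real.pi) * traceMoment F π omega μ v x) := fun v x ↦
    contMDiffAt_mul contMDiffAt_const (hT v x)
  rw [e1]
  refine ⟨isEquivariantForm_twoFormPlus hs.1 (fun k x ↦ ?_) hsm (fun x ↦ ?_) (fun k v x ↦ ?_),
    fun v ↦ dEq_twoFormPlus hs.2 (hsm v) fun x u ↦ ?_, antiCanonicalConnection hπ n omega,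
    curvatureForm (antiCanonical hπ n) (antiCanonicalConnection hπ n omega),
    traceMoment F π omega μ, fun _ ↦ 0,
    (isChernConnection_antiCanonicalConnection hπ h hn).isConnection,
    isInvariantConnection_antiCanonicalConnection hπ h hinv hn, hη,
    isBundleMomentMap_traceMoment hπ h hinv hμ hn, isLiftedMoment_traceMoment hπ h hμ hn,
    isEquivariantForm_zero, fun v ↦ ?_⟩
  · exact congrArg ((Complex.I / (2 * (Real.pi : ℂ))) • ·) (hη.invariant hπ h hinv hn k x)
  · have h1 := traceMoment_linear hπ h hμ hn x
    constructor
    · intro v w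
      rw [h1.map_add, mul_add]
    · intro r v
      rw [h1.map_smul, mul_smul_comm]
  · rw [traceMoment_equivariant hπ h hinv hμ hn]
  · rw [dFun_const_mul _ (hT v x), ← mul_neg, ← hη.apply_fundVF hπ h hμ hn]
    rfl
  · refine (sub_self _).trans ?_
    funext j x
    match j with
    | 0 => rfl
    | j + 1 => exact ((congrArg₂ (· + ·) (congrFun dForm_zero x) rfl).trans (add_zero _)).symm

end FirstChern

end EquivChernWeil

end

theorem mainTheorem5
    {E F EK X B K : Type*}
    [NormedAddCommGroup E] [NormedSpace ℂ E] [FiniteDimensional ℂ E]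
    [NormedAddCommGroup F] [NormedSpace ℂ F] [FiniteDimensional ℂ F]
    [NormedAddCommGroup EK] [NormedSpace ℝ EK] [FiniteDimensional ℝ EK]
    [TopologicalSpace X] [T2Space X] [SecondCountableTopology X]
    [ChartedSpace E X] [IsManifold 𝓘(ℂ, E) ω X]
    [TopologicalSpace B] [T2Space B] [SecondCountableTopology B]
    [ChartedSpace F B] [IsManifold 𝓘(ℂ, F) ω B]
    [TopologicalSpace K] [T2Space K] [CompactSpace K] [ChartedSpace EK K] [Group K]
    [LieGroup 𝓘(ℝ, EK) ∞ K]
    [MulAction K X] [ContMDiffSMul 𝓘(ℝ, EK) 𝓘(ℝ, E) ∞ K X]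
    [MulAction K B] [ContMDiffSMul 𝓘(ℝ, EK) 𝓘(ℝ, F) ∞ K B]
    (n : ℕ) (hn : Module.finrank ℂ E = Module.finrank ℂ F + n)
    (π : X → B) (hπ : EquivChernWeil.IsEquivariantSubmersion E F K π)
    (omega : X → E [⋀^Fin 2]→L[ℝ] ℝ)
    (homega : EquivChernWeil.IsRelativelyKahler (F := F) π omega)
    (hinv : EquivChernWeil.IsInvariantForm K omega)
    (μ : X → EquivChernWeil.LieAlg EK K →ₗ[ℝ] ℝ)
    (hμ : EquivChernWeil.IsMomentMap omega μ) :
    (EquivChernWeil.IsChernConnection (EquivChernWeil.vertBundle hπ)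
        (EquivChernWeil.vertMetric F π omega) (EquivChernWeil.vertConnection hπ omega) ∧
      EquivChernWeil.IsInvariantConnection (EquivChernWeil.vertBundle hπ)
        (EquivChernWeil.vertConnection hπ omega) ∧
      EquivChernWeil.IsBundleMomentMap (EquivChernWeil.vertBundle hπ)
        (EquivChernWeil.vertConnection hπ omega)
        (fun (v : EquivChernWeil.LieAlg EK K) x ↦
          Complex.I • EquivChernWeil.vertHessian F π omega (fun y ↦ μ y v) x)) ∧
    (EquivChernWeil.IsChernConnection (EquivChernWeil.antiCanonical hπ n)
        (EquivChernWeil.detMetric F n π omega)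
        (EquivChernWeil.antiCanonicalConnection hπ n omega) ∧
      EquivChernWeil.IsCurvatureForm (EquivChernWeil.antiCanonical hπ n)
        (EquivChernWeil.antiCanonicalConnection hπ n omega)
        (EquivChernWeil.curvatureForm (EquivChernWeil.antiCanonical hπ n)
          (EquivChernWeil.antiCanonicalConnection hπ n omega)) ∧
      EquivChernWeil.RepresentsC1Eq (EquivChernWeil.antiCanonical hπ n)
        (EquivChernWeil.twoFormPlus (EquivChernWeil.relativeRicciForm hπ n omega)
          (fun (v : EquivChernWeil.LieAlg EK K) x ↦
            -(1 / (2 * Real.pi)) * EquivChernWeil.vertLaplacian F π omega (fun y ↦ μ y v) x))) :=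
  ⟨EquivChernWeil.vertBundle_statement hπ homega hinv hμ hn,
    EquivChernWeil.isChernConnection_antiCanonicalConnection hπ homega hn,
    EquivChernWeil.isCurvatureForm_curvatureForm hπ homega hn,
    EquivChernWeil.representsC1Eq_relativeRicciForm hπ homega hinv hμ hn⟩
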